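/- Let $T\subset\mathbb{R}^2$ be a finite set of terminals, no two of which lie on a common horizontal or vertical line. The grid $\Gamma(T)$ has as vertices the intersection points of the vertical lines through terminals with the horizontal lines through terminals, and as edges the segments joining consecutive vertices on each of these lines. A bidirected Manhattan network on $T$ is a set $N$ of edges of $\Gamma(T)$, each given exactly one of its two orientations, such that for every ordered pair $(s,t)$ of terminals $N$ contains a directed path from $s$ to $t$ of length $\|s-t\|_1$ (a directed Manhattan path). The length $l(N)$ is the sum of the lengths of the edges of $N$; a bidirected Manhattan network on $T$ is optimal if it has minimum length among all bidirected Manhattan networks on $T$. Theorem. There is a deterministic algorithm (a program for a unit-cost real RAM whose only operations on real numbers are copying, addition, subtraction and comparison, and whose only arithmetic operations on non-negative integers are addition, truncated subtraction and comparison) with worst-case running time $O(n^3)$ such that, for every $n\ge 0$ and every set $T$ of $n$ terminals as above, given the coordinates of the terminals in any order, the algorithm halts and returns a bidirected Manhattan network $N(T)$ on $T$; moreover an optimal bidirected Manhattan network $N^*(T)$ on $T$ exists, and $$l(N(T))\le 2\,l(N^*(T)).$$ That is, the bidirected minimum Manhattan network problem has a factor $2$ approximation algorithm with running time $O(n^3)$.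 -/

import Mathlib

open Filter Asymptotics

/-! ## Bidirected Manhattan networks -/

namespace BDMMN

/-- Points of the plane, as pairs of coordinates. -/
abbrev Point := ℝ × ℝ

/-- A directed segment (arc): its tail and its head. -/
abbrev Arc := Point × Point

/-- The `l₁` (Manhattan) distance. -/
noncomputable def l1 (p q : Point) : ℝ := |p.1 - q.1| + |p.2 - q.2|

/-- Vertices of the grid `Γ(T)`: the intersection points of a vertical line through a terminal
and a horizontal line through a terminal. -/
def IsGridVertex (T : Set Point) (p : Point) : Prop :=
  (∃ s ∈ T, s.1 = p.1) ∧ (∃ s ∈ T, s.2 = p.2)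

/-- Edges of the grid `Γ(T)`: the segments between two grid vertices that are consecutive on a
vertical or on a horizontal grid line. -/
def IsGridEdge (T : Set Point) (p q : Point) : Prop :=
  IsGridVertex T p ∧ IsGridVertex T q ∧ p ≠ q ∧
    ((p.1 = q.1 ∧ ∀ s ∈ T, ¬ (min p.2 q.2 < s.2 ∧ s.2 < max p.2 q.2)) ∨
     (p.2 = q.2 ∧ ∀ s ∈ T, ¬ (min p.1 q.1 < s.1 ∧ s.1 < max p.1 q.1)))

/-- A subset of the edges of `Γ(T)`, each taken with exactly one of its two orientations. -/
def IsOrientedSubnetwork (T : Set Point) (N : Finset Arc) : Prop :=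
  (∀ e ∈ N, IsGridEdge T e.1 e.2) ∧ ∀ p q : Point, (p, q) ∈ N → (q, p) ∉ N

/-- `HasPath N p q ℓ`: some directed path of `N` from `p` to `q` has length `ℓ`. -/
inductive HasPath (N : Finset Arc) : Point → Point → ℝ → Prop
  | nil (p : Point) : HasPath N p p 0
  | cons {p q r : Point} {ℓ : ℝ} (h : (p, q) ∈ N) (hp : HasPath N q r ℓ) :
      HasPath N p r (l1 p q + ℓ)

/-- A directed Manhattan path is a directed path whose length is the `l₁`-distance between its
ends. -/
def HasManhattanPath (N : Finset Arc) (p q : Point) : Prop := HasPath N p q (l1 p q)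

/-- Bidirected Manhattan networks on `T`: every ordered pair of terminals is joined by a directed
Manhattan path. -/
def IsBidirectedManhattan (T : Set Point) (N : Finset Arc) : Prop :=
  IsOrientedSubnetwork T N ∧ ∀ s ∈ T, ∀ t ∈ T, HasManhattanPath N s t

/-- The total length of a network. -/
noncomputable def length (N : Finset Arc) : ℝ := ∑ e ∈ N, l1 e.1 e.2

/-- Optimal (minimum length) bidirected Manhattan networks on `T`. -/
def IsOptimal (T : Set Point) (N : Finset Arc) : Prop :=
  IsBidirectedManhattan T N ∧ ∀ M, IsBidirectedManhattan T M → length N ≤ length M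

/-! ## A real RAM

The machine has integer and real registers, which are addressed directly, and an integer and a
real memory, which are addressed through integer registers. Its operations on real numbers are
addition, subtraction and comparison only; reals cannot be rounded or converted to integers. -/

structure State where
  nreg : ℕ → ℕ
  nmem : ℕ → ℕ
  rreg : ℕ → ℝ
  rmem : ℕ → ℝ

/-- Elementary instructions. -/
inductive Instr
  | nconst (d c : ℕ)
  | nmove (d a : ℕ)
  | nadd (d a b : ℕ)
  | nsub (d a b : ℕ)
  | nload (d a : ℕ)
  | nstore (a b : ℕ)
  | rmove (d a : ℕ)
  | radd (d a b : ℕ)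
  | rsub (d a b : ℕ)
  | rload (d a : ℕ)
  | rstore (a b : ℕ)

/-- The effect of an elementary instruction (subtraction of integers is truncated at `0`). -/
noncomputable def Instr.run : Instr → State → State
  | .nconst d c, s => { s with nreg := Function.update s.nreg d c }
  | .nmove d a, s => { s with nreg := Function.update s.nreg d (s.nreg a) }
  | .nadd d a b, s => { s with nreg := Function.update s.nreg d (s.nreg a + s.nreg b) }
  | .nsub d a b, s => { s with nreg := Function.update s.nreg d (s.nreg a - s.nreg b) }
  | .nload d a, s => { s with nreg := Function.update s.nreg d (s.nmem (s.nreg a)) }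
  | .nstore a b, s => { s with nmem := Function.update s.nmem (s.nreg a) (s.nreg b) }
  | .rmove d a, s => { s with rreg := Function.update s.rreg d (s.rreg a) }
  | .radd d a b, s => { s with rreg := Function.update s.rreg d (s.rreg a + s.rreg b) }
  | .rsub d a b, s => { s with rreg := Function.update s.rreg d (s.rreg a - s.rreg b) }
  | .rload d a, s => { s with rreg := Function.update s.rreg d (s.rmem (s.nreg a)) }
  | .rstore a b, s => { s with rmem := Function.update s.rmem (s.nreg a) (s.rreg b) }

/-- Programs. The tests compare two integer registers or two real registers. -/
inductive Prog
  | skip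
  | instr (i : Instr)
  | seq (P Q : Prog)
  | ifN (a b : ℕ) (P Q : Prog)
  | ifR (a b : ℕ) (P Q : Prog)
  | whileN (a b : ℕ) (P : Prog)

/-- `Exec P s s' k`: started in state `s`, the program `P` halts in state `s'` after `k` steps,
where each elementary instruction and each evaluation of a test is one step. -/
inductive Exec : Prog → State → State → ℕ → Prop
  | skip (s : State) : Exec .skip s s 0
  | instr (i : Instr) (s : State) : Exec (.instr i) s (i.run s) 1
  | seq {P Q : Prog} {s s' s'' : State} {k l : ℕ} (hP : Exec P s s' k) (hQ : Exec Q s' s'' l) :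
      Exec (.seq P Q) s s'' (k + l)
  | ifN_true {a b : ℕ} {P Q : Prog} {s s' : State} {k : ℕ} (h : s.nreg a < s.nreg b)
      (hP : Exec P s s' k) : Exec (.ifN a b P Q) s s' (k + 1)
  | ifN_false {a b : ℕ} {P Q : Prog} {s s' : State} {k : ℕ} (h : ¬ s.nreg a < s.nreg b)
      (hQ : Exec Q s s' k) : Exec (.ifN a b P Q) s s' (k + 1)
  | ifR_true {a b : ℕ} {P Q : Prog} {s s' : State} {k : ℕ} (h : s.rreg a < s.rreg b)
      (hP : Exec P s s' k) : Exec (.ifR a b P Q) s s' (k + 1)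
  | ifR_false {a b : ℕ} {P Q : Prog} {s s' : State} {k : ℕ} (h : ¬ s.rreg a < s.rreg b)
      (hQ : Exec Q s s' k) : Exec (.ifR a b P Q) s s' (k + 1)
  | while_true {a b : ℕ} {P : Prog} {s s' s'' : State} {k l : ℕ} (h : s.nreg a < s.nreg b)
      (hP : Exec P s s' k) (hW : Exec (.whileN a b P) s' s'' l) :
      Exec (.whileN a b P) s s'' (k + l + 1)
  | while_false {a b : ℕ} {P : Prog} {s : State} (h : ¬ s.nreg a < s.nreg b) :
      Exec (.whileN a b P) s s 1

/-- The machine is deterministic: the final state and the number of steps are functions of the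
program and the initial state. -/
theorem Exec.deterministic {P : Prog} {s s₁ s₂ : State} {k₁ k₂ : ℕ}
    (h₁ : Exec P s s₁ k₁) (h₂ : Exec P s s₂ k₂) : s₁ = s₂ ∧ k₁ = k₂ := by
  induction h₁ generalizing s₂ k₂ with
  | skip | instr => cases h₂; exact ⟨rfl, rfl⟩
  | seq _ _ ih₁ ih₂ =>
    cases h₂ with
    | seq hP hQ =>
      obtain ⟨rfl, rfl⟩ := ih₁ hP
      obtain ⟨rfl, rfl⟩ := ih₂ hQ
      exact ⟨rfl, rfl⟩
  | ifN_true h _ ih | ifN_false h _ ih | ifR_true h _ ih | ifR_false h _ ih =>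
    cases h₂ <;> first
      | contradiction
      | (rename_i hX; obtain ⟨rfl, rfl⟩ := ih hX; exact ⟨rfl, rfl⟩)
  | while_true h _ _ ih₁ ih₂ =>
    cases h₂ with
    | while_true _ hP hW =>
      obtain ⟨rfl, rfl⟩ := ih₁ hP
      obtain ⟨rfl, rfl⟩ := ih₂ hW
      exact ⟨rfl, rfl⟩
    | while_false h' => contradiction
  | while_false h =>
    cases h₂ with
    | while_true h' => contradiction
    | while_false => exact ⟨rfl, rfl⟩

/-- The initial state: integer register `0` holds the number `n` of terminals, cells `2 i` and
`2 i + 1` of the real memory hold the coordinates of the `i`-th terminal, all else is `0`. -/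
noncomputable def input {n : ℕ} (t : Fin n → Point) : State where
  nreg := fun a => if a = 0 then n else 0
  nmem := fun _ => 0
  rreg := fun _ => 0
  rmem := fun a =>
    if h : a / 2 < n then (if a % 2 = 0 then (t ⟨a / 2, h⟩).1 else (t ⟨a / 2, h⟩).2) else 0

/-- The network a final state represents: integer register `0` holds the number of listed arcs,
and cells `4 k, …, 4 k + 3` of the real memory hold the coordinates of the tail and of the head
of the `k`-th arc. -/
noncomputable def output (s : State) : Finset Arc :=
  (Finset.range (s.nreg 0)).image fun k =>
    ((s.rmem (4 * k), s.rmem (4 * k + 1)), (s.rmem (4 * k + 2), s.rmem (4 * k + 3)))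

end BDMMN

/-! ### Permutation grids, their symmetries and the staircases of terminals -/

namespace BDMMN

/-! After sorting both coordinates the grid is an `n × n` array with one terminal in every row and
column (`Frame`). Transposition and the two reflections act on such arrays. It therefore suffices to
study paths that enter a terminal from its lower left; paths that leave it, and the other three
directions, follow by symmetry.

Forced edges. Two terminals in consecutive columns are joined by monotone paths in both directions,
and no edge carries both orientations. So the sides of their rectangle form a directed cycle
(`IsNet.cycUp`, `IsNet.cycDown`), and the same holds for consecutive rows. The set F of all these
sides (`InF`) lies in every network. So do the rungs that cross the strips next to rectangles of
width or height one (`IsNet.rung`).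

Regions. All terminals to the lower left of a terminal `b` lie left of column `lc b` and below row
`ld b`. The terminals with a common corner `(lc b, ld b)` form a descending staircase, and their
rectangles form its region. Regions of different staircases, and of different directions, share no
edges (`Sreg_disjoint_fl`). The algorithm takes F, the rungs and, in every region, two shortest
forests that join the staircase to the boundary, one for entering and one for leaving paths. An
interval dynamic program computes such a forest. By `dp_le` its value is at most the length of any
edge set that joins all nodes to the boundary: groups of nodes are pushed along their paths, merged
when they meet, and every edge passed is paid once.

Accounting. The forests end not at the terminals but at nodes one row below, so that their
horizontal edges avoid F. The right and up edges of a network in a region outside F, together with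
their projections to the lines of the nodes and shifted copies of edges of F, join all nodes to the
boundary (`toCol_EAll`). A forest thus costs at most twice these edges plus some edges of F. Right
and up edges serve the entering forest, left and down edges the leaving one, and no edge is both. So
both forests of a region together cost at most twice the edges of the network outside F plus once
the edges of F (`chain_bound`). Since F itself has been bought once, the total is at most twice the
length of the network (`W_AlgE_le`).

Orientations. Rows are directed away from their terminals and columns towards them, except that
horizontal forest edges are turned around. A horizontal edge wanted by both forests of a region
would need two orientations. To exclude this, staircase terminals in adjacent rows or columns are
grouped into singles, pairs and triples that share nodes (`Blocks`, `DE.no_conflict`). A triple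
costs more than F can pay. The excess is twice the gaps at its two ends, and it is covered by edges
outside F that every network must contain next to a triple (`IsNet.alpha`, `exists_spare`). In the
result each terminal is joined in both directions to the corner of its region (`Good.hub`), the
corners are joined along F (`Hub.link`), and splitting at intermediate terminals gives all paths
(`Hub.paths`).

Running time. A compiler for a small expression language fills `n × n` tables whose entries are
computed with no nested loops, hence in linear time each. Sorting, blocks, dynamic programs,
recovery of the forests and orientations are a fixed number of such tables, which gives cubic time
(`approxP_cost`). -/

/-- A permutation grid: `n` columns and rows, one terminal in each, with coordinates. -/
structure Frame where
  n : ℕ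
  π : ℕ → ℕ
  σ : ℕ → ℕ
  xs : ℕ → ℝ
  ys : ℕ → ℝ
  π_lt : ∀ i, i < n → π i < n
  σ_lt : ∀ i, i < n → σ i < n
  σπ : ∀ i, i < n → σ (π i) = i
  πσ : ∀ i, i < n → π (σ i) = i
  xs_lt : ∀ i j, i < j → j < n → xs i < xs j
  ys_lt : ∀ i j, i < j → j < n → ys i < ys j

namespace Frame

/-- Transposition. -/
def T (G : Frame) : Frame :=
  ⟨G.n, G.σ, G.π, G.ys, G.xs, G.σ_lt, G.π_lt, G.πσ, G.σπ, G.ys_lt, G.xs_lt⟩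

/-- Reflection of the columns. -/
def flipX (G : Frame) : Frame where
  n := G.n
  π := fun i => G.π (G.n - 1 - i)
  σ := fun j => G.n - 1 - G.σ j
  xs := fun i => - G.xs (G.n - 1 - i)
  ys := G.ys
  π_lt := fun i h => G.π_lt _ (by omega)
  σ_lt := fun i h => by omega
  σπ := fun i h => by rw [G.σπ _ (by omega)]; omega
  πσ := fun i h => by
    have := G.σ_lt i h
    rw [show G.n - 1 - (G.n - 1 - G.σ i) = G.σ i by omega, G.πσ i h]
  xs_lt := fun i j h h' => neg_lt_neg (G.xs_lt _ _ (by omega) (by omega))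
  ys_lt := G.ys_lt

/-- Reflection of the rows. -/
def flipY (G : Frame) : Frame := G.T.flipX.T

theorem π_inj (G : Frame) {i j : ℕ} (hi : i < G.n) (hj : j < G.n) (h : G.π i = G.π j) : i = j := by
  rw [← G.σπ i hi, ← G.σπ j hj, h]

/-- The least `v` such that `f` is at least `r` on `[v, b)`. -/
def low (f : ℕ → ℕ) (r : ℕ) : ℕ → ℕ
  | 0 => 0
  | b + 1 => if f b < r then b + 1 else low f r b

theorem low_le (f : ℕ → ℕ) (r b : ℕ) : low f r b ≤ b := by
  induction b with
  | zero => simp [low]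
  | succ b ih => simp only [low]; split_ifs <;> omega

theorem le_of_low_le {f : ℕ → ℕ} {r b u : ℕ} (h : low f r b ≤ u) (hu : u < b) : r ≤ f u := by
  induction b with
  | zero => omega
  | succ b ih =>
    simp only [low] at h
    split_ifs at h with h1
    · omega
    · rcases Nat.lt_succ_iff_lt_or_eq.1 hu with h2 | rfl
      · exact ih h h2
      · omega

theorem low_pred {f : ℕ → ℕ} {r b : ℕ} (h : 1 ≤ low f r b) : f (low f r b - 1) < r := by
  induction b with
  | zero => simp [low] at h
  | succ b ih =>
    simp only [low] at h ⊢
    split_ifs at h ⊢ with h1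
    · simpa using h1
    · exact ih h

theorem low_eq {f : ℕ → ℕ} {r b v : ℕ} (hv : v ≤ b) (h : ∀ u, v ≤ u → u < b → r ≤ f u)
    (h' : 1 ≤ v → f (v - 1) < r) : low f r b = v := by
  rcases lt_trichotomy (low f r b) v with h1 | h1 | h1
  · have := le_of_low_le (f := f) (r := r) (b := b) (u := v - 1) (by omega) (by omega)
    have := h' (by omega)
    omega
  · exact h1
  · have := low_pred (f := f) (r := r) (b := b) (by omega)
    have := h (low f r b - 1) (by omega) (by have := low_le f r b; omega)
    omega

/-- One plus the nearest column to the left of `b` with a lower terminal (`0` if there is none). -/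
def lc (G : Frame) (b : ℕ) : ℕ := low G.π (G.π b) b

/-- One plus the nearest row below the terminal of column `b` with a terminal further left. -/
def ld (G : Frame) (b : ℕ) : ℕ := low G.σ b (G.π b)

theorem lc_T (G : Frame) {b : ℕ} (hb : b < G.n) : G.T.lc (G.π b) = G.ld b := by
  simp only [lc, ld, T, G.σπ b hb]

theorem ld_T (G : Frame) {b : ℕ} (hb : b < G.n) : G.T.ld (G.π b) = G.lc b := by
  simp only [lc, ld, T, G.σπ b hb]

variable (G : Frame) {b u l : ℕ}

theorem lc_le : G.lc b ≤ b := low_le _ _ _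
theorem ld_le : G.ld b ≤ G.π b := low_le _ _ _

/-- Strict because two columns never share a row. Consequently the rectangle from `(lc b, ld b)` to
the terminal of column `b` contains no other terminal. -/
theorem lt_π (hb : b < G.n) (h : G.lc b ≤ u) (hu : u < b) : G.π b < G.π u := by
  have h1 : G.π b ≤ G.π u := le_of_low_le h hu
  rcases h1.lt_or_eq with h2 | h2
  · exact h2
  · have := G.π_inj hb (by omega) h2; omega

theorem lt_σ (hb : b < G.n) (h : G.ld b ≤ l) (hl : l < G.π b) : b < G.σ l := by
  have := G.T.lt_π (b := G.π b) (u := l) (G.π_lt b hb) (by rwa [lc_T G hb]) hl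
  simpa only [T, G.σπ b hb] using this

theorem π_lc_lt (h : 1 ≤ G.lc b) : G.π (G.lc b - 1) < G.π b := low_pred h

theorem σ_ld_lt (h : 1 ≤ G.ld b) : G.σ (G.ld b - 1) < b := low_pred h

/-- A terminal to the lower left is visible both from the columns and from the rows: with `ld b = 0`
every lower row would have its terminal to the right of `b`. -/
theorem one_le_ld (hb : b < G.n) (h : 1 ≤ G.lc b) : 1 ≤ G.ld b := by
  by_contra h0
  have h1 := G.π_lc_lt h
  have h2 := G.lc_le (b := b)
  have h3 := G.lt_σ hb (l := G.π (G.lc b - 1)) (by omega) h1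
  rw [G.σπ _ (by omega)] at h3
  omega

theorem one_le_lc_iff (hb : b < G.n) : 1 ≤ G.lc b ↔ 1 ≤ G.ld b :=
  ⟨G.one_le_ld hb, fun h => by
    have := G.T.one_le_ld (G.π_lt b hb) (by rwa [lc_T G hb])
    rwa [ld_T G hb] at this⟩

/-- The lower left terminals of `b` are left of column `lc b` and below row `ld b`. -/
theorem π_lt_ld {a : ℕ} (hb : b < G.n) (ha : a < b) (h : G.π a < G.π b) : G.π a < G.ld b := by
  by_contra h0
  have := G.lt_σ hb (l := G.π a) (by omega) h
  rw [G.σπ a (by omega)] at this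
  omega

theorem lt_lc {a : ℕ} (hb : b < G.n) (ha : a < b) (h : G.π a < G.π b) : a < G.lc b := by
  by_contra h0
  have := G.lt_π hb (u := a) (by omega) ha
  omega

theorem π_lc_lt_ld (hb : b < G.n) (h : 1 ≤ G.lc b) : G.π (G.lc b - 1) < G.ld b := by
  have h2 := G.lc_le (b := b)
  exact G.π_lt_ld hb (by omega) (G.π_lc_lt h)

theorem σ_ld_lt_lc (hb : b < G.n) (h : 1 ≤ G.lc b) : G.σ (G.ld b - 1) < G.lc b := by
  have h1 := G.one_le_ld hb h
  have h2 := G.ld_le (b := b)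
  have h3 := G.π_lt b hb
  have h4 := G.σ_ld_lt h1
  exact G.lt_lc hb h4 (by rw [G.πσ _ (by omega)]; omega)

/-- Terminals whose lower left staircase region is not degenerate. -/
def ND (b : ℕ) : Prop := b < G.n ∧ 1 ≤ G.lc b ∧ G.lc b + 1 ≤ b ∧ G.ld b + 1 ≤ G.π b

/-- Terminals that take part in the staircase trees. -/
def Reg (b : ℕ) : Prop := b < G.n ∧ 1 ≤ G.lc b ∧ G.lc b + 2 ≤ b ∧ G.ld b + 2 ≤ G.π b

/-- The regular terminals of the staircase with corner `(c, d)`. -/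
def Mem (c d b : ℕ) : Prop := G.Reg b ∧ G.lc b = c ∧ G.ld b = d

/-- `s` is the next regular terminal after `b` in the staircase of `b`. -/
def Nx (b s : ℕ) : Prop := G.Reg b ∧ G.Mem (G.lc b) (G.ld b) s ∧ b < s ∧
  ∀ t, G.Mem (G.lc b) (G.ld b) t → b < t → s ≤ t

variable {G}

theorem Reg.nd (h : G.Reg b) : G.ND b := ⟨h.1, h.2.1, by have := h.2.2; omega, by have := h.2.2; omega⟩

theorem ND_T (h : b < G.n) : G.T.ND (G.π b) ↔ G.ND b := by
  unfold ND
  rw [lc_T G h, ld_T G h]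
  simp only [T, G.σπ b h]
  have := G.one_le_lc_iff h
  have := G.π_lt b h
  tauto

theorem Reg_T (h : b < G.n) : G.T.Reg (G.π b) ↔ G.Reg b := by
  unfold Reg
  rw [lc_T G h, ld_T G h]
  simp only [T, G.σπ b h]
  have := G.one_le_lc_iff h
  have := G.π_lt b h
  tauto

theorem Mem_T {c d : ℕ} (h : b < G.n) : G.T.Mem d c (G.π b) ↔ G.Mem c d b := by
  unfold Mem
  rw [lc_T G h, ld_T G h, Reg_T h]
  tauto

/-- Terminals of a staircase descend to the right. -/
theorem chain_anti {a b : ℕ} (ha : G.ND a) (hb : G.ND b) (hc : G.lc a = G.lc b)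
    (h : a < b) : G.π b < G.π a :=
  G.lt_π hb.1 (by have := ha.2.2; omega) h

theorem chain_mono {a b : ℕ} (ha : G.ND a) (hb : G.ND b) (hc : G.lc a = G.lc b)
    (h : G.π b < G.π a) : a < b := by
  rcases lt_trichotomy a b with h1 | h1 | h1
  · exact h1
  · subst h1; omega
  · have := chain_anti hb ha hc.symm h1; omega

theorem Nx.reg (h : G.Nx b u) : G.Reg b := h.1
theorem Nx.reg' (h : G.Nx b u) : G.Reg u := h.2.1.1
theorem Nx.lc (h : G.Nx b u) : G.lc u = G.lc b := h.2.1.2.1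
theorem Nx.ld (h : G.Nx b u) : G.ld u = G.ld b := h.2.1.2.2
theorem Nx.lt (h : G.Nx b u) : b < u := h.2.2.1
theorem Nx.π_lt (h : G.Nx b u) : G.π u < G.π b := chain_anti h.reg.nd h.reg'.nd h.lc.symm h.lt

/-- A staircase descends to the right, so transposition reverses its order and successors become
predecessors. -/
theorem Nx.T (h : G.Nx b u) : G.T.Nx (G.π u) (G.π b) := by
  have hb := h.reg.1
  have hu := h.reg'.1
  refine ⟨(Reg_T hu).2 h.reg', ?_, h.π_lt, ?_⟩
  · rw [lc_T G hu, ld_T G hu, Mem_T hb]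
    exact ⟨h.reg, h.lc.symm, h.ld.symm⟩
  · rw [lc_T G hu, ld_T G hu]
    intro t ht htu
    have htn : t < G.n := ht.1.1
    obtain ⟨t, rfl, htn'⟩ : ∃ t', t = G.π t' ∧ t' < G.n := ⟨G.σ t, (G.πσ t htn).symm, G.σ_lt t htn⟩
    rw [Mem_T htn'] at ht
    rw [h.lc, h.ld] at ht
    have htr := ht.1
    by_contra hlt
    have h1 : b < t := chain_mono h.reg.nd htr.nd ht.2.1.symm (by omega)
    have h2 := h.2.2.2 t ht h1
    have h3 : t < u := chain_mono htr.nd h.reg'.nd (by rw [h.lc, ht.2.1]) htu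
    omega

theorem Nx_T_iff (hb : b < G.n) (hu : u < G.n) : G.T.Nx (G.π u) (G.π b) ↔ G.Nx b u := by
  refine ⟨fun h => ?_, Nx.T⟩
  have := h.T
  change G.Nx (G.σ (G.π b)) (G.σ (G.π u)) at this
  rwa [G.σπ _ hb, G.σπ _ hu] at this

theorem Nx.unique {s s' : ℕ} (h : G.Nx b s) (h' : G.Nx b s') : s = s' :=
  le_antisymm (h.2.2.2 _ h'.2.1 h'.lt) (h'.2.2.2 _ h.2.1 h.lt)

theorem Nx.unique_left {s p p' : ℕ} (h : G.Nx p s) (h' : G.Nx p' s) : p = p' := by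
  have := h.T.unique h'.T
  exact G.π_inj h.reg.1 h'.reg.1 this

/-- Between two consecutive terminals of a staircase all columns belong to higher terminals. -/
theorem Nx.le_or_le {s t : ℕ} (h : G.Nx b s) (ht : G.Mem (G.lc b) (G.ld b) t) : t ≤ b ∨ s ≤ t := by
  by_contra hh
  have := h.2.2.2 t ht (by omega)
  omega

end Frame

/-! ### Edge sets, their lengths, and paths to the left and down -/

/-- Edges of a grid: `(true, u, l)` joins `(u, l)` to `(u + 1, l)`, `(false, u, l)` joins `(u, l)`
to `(u, l + 1)`. -/
abbrev Edge := Bool × ℕ × ℕ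

namespace Frame

/-- The length of an edge. -/
noncomputable def wt (G : Frame) (e : Edge) : ℝ :=
  if e.1 then |G.xs (e.2.1 + 1) - G.xs e.2.1| else |G.ys (e.2.2 + 1) - G.ys e.2.2|

/-- The length of a set of edges. -/
noncomputable def W (G : Frame) (E : Finset Edge) : ℝ := ∑ e ∈ E, G.wt e

theorem wt_nonneg (G : Frame) (e : Edge) : 0 ≤ G.wt e := by
  unfold wt; split_ifs <;> exact abs_nonneg _

theorem W_nonneg (G : Frame) (E : Finset Edge) : 0 ≤ G.W E := Finset.sum_nonneg fun e _ => G.wt_nonneg e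

theorem W_mono (G : Frame) {E E' : Finset Edge} (h : E ⊆ E') : G.W E ≤ G.W E' :=
  Finset.sum_le_sum_of_subset_of_nonneg h fun e _ _ => G.wt_nonneg e

theorem W_union_le (G : Frame) (E E' : Finset Edge) : G.W (E ∪ E') ≤ G.W E + G.W E' := by
  unfold W
  rw [← Finset.sum_union_inter]
  have := G.W_nonneg (E ∩ E')
  unfold W at this
  linarith

theorem W_union (G : Frame) {E E' : Finset Edge} (h : Disjoint E E') :
    G.W (E ∪ E') = G.W E + G.W E' := Finset.sum_union h

/-- The horizontal segment of row `l` between columns `a` and `b`. -/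
def hseg (a b l : ℕ) : Finset Edge := (Finset.Ico a b).image fun u => (true, u, l)

/-- The vertical segment of column `u` between rows `a` and `b`. -/
def vseg (u a b : ℕ) : Finset Edge := (Finset.Ico a b).image fun l => (false, u, l)

@[simp] theorem mem_hseg {a b l : ℕ} {e : Edge} :
    e ∈ hseg a b l ↔ e.1 = true ∧ a ≤ e.2.1 ∧ e.2.1 < b ∧ e.2.2 = l := by
  obtain ⟨k, u, m⟩ := e
  simp [hseg]
  grind

@[simp] theorem mem_vseg {a b u : ℕ} {e : Edge} :
    e ∈ vseg u a b ↔ e.1 = false ∧ a ≤ e.2.2 ∧ e.2.2 < b ∧ e.2.1 = u := by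
  obtain ⟨k, v, m⟩ := e
  simp [vseg]
  grind

theorem xs_le (G : Frame) {a b : ℕ} (h : a ≤ b) (hb : b < G.n) : G.xs a ≤ G.xs b := by
  rcases h.lt_or_eq with h | rfl
  · exact (G.xs_lt a b h hb).le
  · exact le_rfl

theorem ys_le (G : Frame) {a b : ℕ} (h : a ≤ b) (hb : b < G.n) : G.ys a ≤ G.ys b := G.T.xs_le h hb

theorem sum_gap {f : ℕ → ℝ} {n a b : ℕ} (hf : ∀ i j, i < j → j < n → f i < f j) (h : a ≤ b)
    (hb : b < n) : ∑ u ∈ Finset.Ico a b, |f (u + 1) - f u| = f b - f a := by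
  induction b, h using Nat.le_induction with
  | base => simp
  | succ m hm ih =>
    rw [Finset.sum_Ico_succ_top hm, ih (by omega), abs_of_pos (by have := hf m (m + 1) (by omega) hb; linarith)]
    ring

theorem W_hseg (G : Frame) {a b l : ℕ} (h : a ≤ b) (hb : b < G.n) :
    G.W (hseg a b l) = G.xs b - G.xs a := by
  rw [W, hseg, Finset.sum_image (by intro x _ y _ h; simpa using h)]
  simpa [wt] using sum_gap G.xs_lt h hb

theorem W_vseg (G : Frame) {a b u : ℕ} (h : a ≤ b) (hb : b < G.n) :
    G.W (vseg u a b) = G.ys b - G.ys a := by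
  rw [W, vseg, Finset.sum_image (by intro x _ y _ h; simpa using h)]
  simpa [wt] using sum_gap G.ys_lt h hb

/-- One unit step to the left or down along an edge of `E`. -/
def LDStep (E : Finset Edge) (p q : ℕ × ℕ) : Prop :=
  (p.1 = q.1 + 1 ∧ p.2 = q.2 ∧ (true, q.1, q.2) ∈ E) ∨
    (p.1 = q.1 ∧ p.2 = q.2 + 1 ∧ (false, q.1, q.2) ∈ E)

/-- `E` contains a path to the left and down from `p` to column `c`. -/
def ToCol (E : Finset Edge) (c : ℕ) (p : ℕ × ℕ) : Prop :=
  ∃ r, Relation.ReflTransGen (LDStep E) p (c, r)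

theorem ToCol.head {E : Finset Edge} {c : ℕ} {p q : ℕ × ℕ} (h : LDStep E p q) (hq : ToCol E c q) :
    ToCol E c p := by
  obtain ⟨r, hr⟩ := hq
  exact ⟨r, Relation.ReflTransGen.head h hr⟩

/-- A path that starts at another point, not above the diagonal of `v`, avoids the edge that leaves
`v`. -/
theorem ToCol.erase {E : Finset Edge} {c : ℕ} {p v w : ℕ × ℕ} {e : Edge}
    (he : (v.1 = w.1 + 1 ∧ v.2 = w.2 ∧ e = (true, w.1, w.2)) ∨
      (v.1 = w.1 ∧ v.2 = w.2 + 1 ∧ e = (false, w.1, w.2)))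
    (hp : p ≠ v) (hs : p.1 + p.2 ≤ v.1 + v.2) (h : ToCol E c p) : ToCol (E.erase e) c p := by
  obtain ⟨r, hr⟩ := h
  induction hr using Relation.ReflTransGen.head_induction_on with
  | refl => exact ⟨r, .refl⟩
  | @head p q hpq _ ih =>
    -- Each step lowers the coordinate sum, so the rest of the path stays strictly below the
    -- diagonal of `v`.
    have hq := ih (by rintro rfl; rcases hpq with h | h <;> omega)
      (by rcases hpq with h | h <;> omega)
    refine ToCol.head ?_ hq
    have hne : ∀ k : Bool, (k, q.1, q.2) = e → (k = true → p.1 = q.1 + 1 ∧ p.2 = q.2) →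
        (k = false → p.1 = q.1 ∧ p.2 = q.2 + 1) → False := by
      intro k hk h1 h2
      apply hp
      rcases he with ⟨h3, h4, rfl⟩ | ⟨h3, h4, rfl⟩
      · simp only [Prod.mk.injEq] at hk
        have := h1 hk.1
        ext <;> omega
      · simp only [Prod.mk.injEq] at hk
        have := h2 hk.1
        ext <;> omega
    rcases hpq with ⟨h1, h2, h3⟩ | ⟨h1, h2, h3⟩
    · exact Or.inl ⟨h1, h2, Finset.mem_erase.2 ⟨fun h => hne true h (by simp [h1, h2]) (by simp), h3⟩⟩
    · exact Or.inr ⟨h1, h2, Finset.mem_erase.2 ⟨fun h => hne false h (by simp) (by simp [h1, h2]), h3⟩⟩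

/-! ### The interval dynamic program and its lower bound -/

/-- An interval dynamic program for trees that join the nodes `(X j, ρ j)` to column `c`. `I a b`
says that `[a, b]` is an interval of indices, `N` is the successor relation, `L` marks the last
index. -/
structure DP (G : Frame) (c : ℕ) (I N : ℕ → ℕ → Prop) (L : ℕ → Prop) (X ρ : ℕ → ℕ)
    (M : ℕ → ℕ → ℝ) (f : ℕ → ℝ) : Prop where
  merge : ∀ a m m' b, I a m → N m m' → I m' b → I a b ∧
    M a b ≤ M a m + M m' b + (G.ys (ρ m) - G.ys (ρ b)) + (G.xs (X m') - G.xs (X a))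
  last : ∀ a b, I a b → L b → f a ≤ M a b + (G.xs (X a) - G.xs c)
  next : ∀ a b a', I a b → N b a' → f a ≤ M a b + (G.xs (X a) - G.xs c) + f a'
  lt : ∀ a b, I a b → X a < G.n ∧ ρ b < G.n

/-- A group: an interval of indices and the point at which its paths are. -/
structure Grp where
  a : ℕ
  b : ℕ
  p : ℕ × ℕ

/-- Consecutive groups that exhaust the indices from `a` on. -/
inductive Grps (I N : ℕ → ℕ → Prop) (L : ℕ → Prop) (X ρ : ℕ → ℕ) : ℕ → List Grp → Prop
  | last {g : Grp} (h : I g.a g.b) (hL : L g.b) (hx : g.p.1 ≤ X g.a) (hy : g.p.2 ≤ ρ g.b) :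
      Grps I N L X ρ g.a [g]
  | cons {g : Grp} {a' : ℕ} {gs : List Grp} (h : I g.a g.b) (hN : N g.b a') (hx : g.p.1 ≤ X g.a)
      (hy : g.p.2 ≤ ρ g.b) (hgs : Grps I N L X ρ a' gs) : Grps I N L X ρ g.a (g :: gs)

section

variable {G : Frame} {c : ℕ} {I N : ℕ → ℕ → Prop} {L : ℕ → Prop} {X ρ : ℕ → ℕ} {M : ℕ → ℕ → ℝ}
  {f : ℕ → ℝ}

/-- The cost of completing a group. -/
noncomputable def Grp.cost (G : Frame) (X ρ : ℕ → ℕ) (M : ℕ → ℕ → ℝ) (g : Grp) : ℝ :=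
  M g.a g.b + (G.xs (X g.a) - G.xs g.p.1) + (G.ys (ρ g.b) - G.ys g.p.2)

/-- Groups move only to the left and down, which preserves the bounds on their position by the first
column and the last row. -/
theorem Grps.move {l₁ l₂ : List Grp} {g : Grp} {a : ℕ} {q : ℕ × ℕ} (h1 : q.1 ≤ g.p.1)
    (h2 : q.2 ≤ g.p.2) (h : Grps I N L X ρ a (l₁ ++ g :: l₂)) :
    Grps I N L X ρ a (l₁ ++ ⟨g.a, g.b, q⟩ :: l₂) := by
  induction l₁ generalizing a with
  | nil =>
    cases h with
    | last h hL hx hy => exact Grps.last (g := ⟨g.a, g.b, q⟩) h hL (h1.trans hx) (h2.trans hy)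
    | cons h hN hx hy hgs => exact Grps.cons (g := ⟨g.a, g.b, q⟩) h hN (h1.trans hx) (h2.trans hy) hgs
  | cons g' l ih =>
    generalize hl : l ++ g :: l₂ = l' at *
    simp only [List.cons_append, hl] at h
    cases h with
    | last => simp at hl
    | cons h hN hx hy hgs => exact Grps.cons h hN hx hy (ih hgs)

/-- The amounts `ys (ρ g.b) - ys g.p.2` and `xs (X g'.a) - xs g.p.1`, contained in the two old
costs, pay for the connection that the merge rule charges; what is left over is non-negative since
both groups are at the same point. -/
theorem Grps.merge (hD : DP G c I N L X ρ M f) {l₁ l₂ : List Grp} {g g' : Grp} {a : ℕ}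
    (hp : g.p = g'.p) (h : Grps I N L X ρ a (l₁ ++ g :: g' :: l₂)) :
    Grps I N L X ρ a (l₁ ++ ⟨g.a, g'.b, g.p⟩ :: l₂) ∧
      Grp.cost G X ρ M ⟨g.a, g'.b, g.p⟩ ≤ g.cost G X ρ M + g'.cost G X ρ M := by
  induction l₁ generalizing a with
  | nil =>
    cases h with
    | cons h hN hx hy hgs =>
      have key : I g'.a g'.b → N g.b g'.a → g'.p.2 ≤ ρ g'.b →
          I g.a g'.b ∧ Grp.cost G X ρ M ⟨g.a, g'.b, g.p⟩ ≤ g.cost G X ρ M + g'.cost G X ρ M := by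
        intro h1 h2 h3
        obtain ⟨h4, h5⟩ := hD.merge _ _ _ _ h h2 h1
        refine ⟨h4, ?_⟩
        have h6 := hD.lt _ _ h4
        have h7 := G.xs_le hx h6.1
        have h8 := G.ys_le h3 h6.2
        simp only [Grp.cost, hp] at *
        linarith
      cases hgs with
      | last h' hL' hx' hy' =>
        obtain ⟨h4, h5⟩ := key h' hN hy'
        exact ⟨Grps.last (g := ⟨g.a, g'.b, g.p⟩) h4 hL' hx (by simpa [hp] using hy'), h5⟩
      | cons h' hN' hx' hy' hgs' =>
        obtain ⟨h4, h5⟩ := key h' hN hy'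
        exact ⟨Grps.cons (g := ⟨g.a, g'.b, g.p⟩) h4 hN' hx (by simpa [hp] using hy') hgs', h5⟩
  | cons g₀ l ih =>
    generalize hl : l ++ g :: g' :: l₂ = l' at *
    simp only [List.cons_append, hl] at h
    cases h with
    | last => simp at hl
    | cons h hN hx hy hgs =>
      obtain ⟨h1, h2⟩ := ih hgs
      exact ⟨Grps.cons h hN hx hy h1, h2⟩

/-- Once all groups have arrived at column `c`, completing each of them separately is one of the
solutions among which the program minimizes. -/
theorem Grps.bound (hD : DP G c I N L X ρ M f) {gs : List Grp} {a : ℕ} (h : Grps I N L X ρ a gs)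
    (hc : ∀ g ∈ gs, g.p.1 = c) : f a ≤ (gs.map (Grp.cost G X ρ M)).sum := by
  induction h with
  | @last g h hL hx hy =>
    have h1 := hD.last _ _ h hL
    have h2 := G.ys_le hy (hD.lt _ _ h).2
    have h3 := hc g (by simp)
    simp only [List.map_cons, List.map_nil, List.sum_cons, List.sum_nil, Grp.cost, h3]
    linarith
  | @cons g a' gs h hN hx hy _ ih =>
    have h1 := hD.next _ _ _ h hN
    have h2 := G.ys_le hy (hD.lt _ _ h).2
    have h3 := hc g (by simp)
    have h4 := ih fun g hg => hc g (by simp [hg])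
    simp only [List.map_cons, List.sum_cons]
    rw [Grp.cost, h3]
    linarith

/-- The order of the groups: to the right and down. -/
def Desc (p q : ℕ × ℕ) : Prop := p.1 ≤ q.1 ∧ q.2 ≤ p.2

/-- In the order to the right and down equal points are consecutive, so a coincidence already shows
between neighbours. -/
theorem exists_adjacent (l : List Grp) (h : l.Pairwise fun g g' => Desc g.p g'.p) :
    (l.Pairwise fun g g' => Desc g.p g'.p ∧ g.p ≠ g'.p) ∨
      ∃ l₁ g g' l₂, l = l₁ ++ g :: g' :: l₂ ∧ g.p = g'.p := by
  induction l with
  | nil => left; simp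
  | cons g l ih =>
    rw [List.pairwise_cons] at h
    rcases ih h.2 with h1 | ⟨l₁, g1, g2, l₂, rfl, h2⟩
    · cases l with
      | nil => left; simp
      | cons g' l =>
        by_cases hg : g.p = g'.p
        · exact Or.inr ⟨[], g, g', l, rfl, hg⟩
        · left
          rw [List.pairwise_cons]
          refine ⟨fun x hx => ⟨h.1 x hx, fun hx' => ?_⟩, h1⟩
          rcases List.mem_cons.1 hx with rfl | hx2
          · exact hg hx'
          · have h3 := h.1 g' (by simp)
            have h4 := ((List.pairwise_cons.1 h.2).1 x hx2)
            unfold Desc at h3 h4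
            rw [← hx'] at h4
            exact hg (Prod.ext (by omega) (by omega))
    · exact Or.inr ⟨g :: l₁, g1, g2, l₂, rfl, h2⟩

theorem exists_max_sum (l : List Grp) (c : ℕ) (h : ¬ ∀ g ∈ l, g.p.1 = c) :
    ∃ g ∈ l, g.p.1 ≠ c ∧ ∀ g' ∈ l, g'.p.1 ≠ c → g'.p.1 + g'.p.2 ≤ g.p.1 + g.p.2 := by
  classical
  have hne : (l.toFinset.filter (fun g => g.p.1 ≠ c)).Nonempty := by
    push Not at h
    obtain ⟨g, h0, h1⟩ := h
    exact ⟨g, by simp [h0, h1]⟩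
  obtain ⟨g, hg, hmax⟩ := Finset.exists_max_image _ (fun g : Grp => g.p.1 + g.p.2) hne
  simp only [Finset.mem_filter, List.mem_toFinset] at hg hmax
  exact ⟨g, hg.1, hg.2, fun g' h1 h2 => hmax g' ⟨h1, h2⟩⟩

/-- A charging argument with the measure `E.card + gs.length`. Neighbouring groups at the same point
are merged, at no cost. Otherwise, among the groups outside column `c`, one with the largest
coordinate sum makes a step of its path, and the edge of this step is deleted from `E`. The cost of
the group grows by at most the length of that edge, and the other groups keep their paths: they are
at different points not above the diagonal, so their paths avoid the edge. -/
theorem dp_le (hD : DP G c I N L X ρ M f) (k : ℕ) : ∀ (E : Finset Edge) (gs : List Grp) (a : ℕ),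
    E.card + gs.length ≤ k → Grps I N L X ρ a gs → (gs.Pairwise fun g g' => Desc g.p g'.p) →
    (∀ g ∈ gs, ToCol E c g.p) → f a ≤ G.W E + (gs.map (Grp.cost G X ρ M)).sum := by
  induction k with
  | zero =>
    intro E gs a hk h _ _
    have : gs = [] := List.eq_nil_of_length_eq_zero (by omega)
    subst this
    cases h
  | succ k ih =>
    intro E gs a hk h hp ht
    rcases exists_adjacent gs hp with hs | ⟨l₁, g, g', l₂, rfl, hg⟩
    · by_cases hc : ∀ g ∈ gs, g.p.1 = c
      · have := h.bound hD hc
        have := G.W_nonneg E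
        linarith
      · obtain ⟨g, hg, hgc, hmax⟩ := exists_max_sum gs c hc
        obtain ⟨l₁, l₂, rfl⟩ := List.append_of_mem hg
        obtain ⟨r, hr⟩ := ht g hg
        rcases Relation.ReflTransGen.cases_head hr with h0 | ⟨q, hq, hqr⟩
        · exact absurd (by rw [h0]) hgc
        obtain ⟨e, heE, he, hq1, hq2, hw, hq3, hq4⟩ : ∃ e ∈ E, ((g.p.1 = q.1 + 1 ∧ g.p.2 = q.2 ∧ e = (true, q.1, q.2)) ∨
            (g.p.1 = q.1 ∧ g.p.2 = q.2 + 1 ∧ e = (false, q.1, q.2))) ∧ q.1 ≤ g.p.1 ∧ q.2 ≤ g.p.2 ∧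
            (G.xs g.p.1 - G.xs q.1) + (G.ys g.p.2 - G.ys q.2) ≤ G.wt e ∧ q.1 + q.2 + 1 = g.p.1 + g.p.2 ∧ q ≠ g.p := by
          rcases hq with ⟨h1, h2, h3⟩ | ⟨h1, h2, h3⟩
          · refine ⟨_, h3, Or.inl ⟨h1, h2, rfl⟩, by omega, by omega, ?_, by omega, by rintro rfl; omega⟩
            have := le_abs_self (G.xs (q.1 + 1) - G.xs q.1)
            simp only [wt, h1, h2, if_true]
            linarith
          · refine ⟨_, h3, Or.inr ⟨h1, h2, rfl⟩, by omega, by omega, ?_, by omega, by rintro rfl; omega⟩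
            have := le_abs_self (G.ys (q.2 + 1) - G.ys q.2)
            simp only [wt, h1, h2, Bool.false_eq_true, if_false]
            linarith
        have hmv := h.move hq1 hq2
        have hcard := Finset.card_erase_lt_of_mem heE
        rw [List.pairwise_append, List.pairwise_cons] at hs
        obtain ⟨hs1, ⟨hs2, hs3⟩, hs4⟩ := hs
        -- Groups already in column `c` need no path; the remaining ones satisfy the hypotheses of
        -- `ToCol.erase` by the choice of `g`.
        have hother : ∀ g' ∈ l₁ ++ g :: l₂, g'.p ≠ g.p → ToCol (E.erase e) c g'.p := by
          intro g' hg' hne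
          by_cases hc' : g'.p.1 = c
          · exact ⟨g'.p.2, by rw [← hc']⟩
          · exact (ht g' hg').erase he hne (hmax g' hg' hc')
        have hqt : ToCol (E.erase e) c q := ToCol.erase he hq4 (by omega) ⟨r, hqr⟩
        have := ih (E.erase e) _ a (by simp at hk ⊢; omega) hmv ?_ ?_
        · have hW : G.W (E.erase e) = G.W E - G.wt e := by
            have := Finset.sum_erase_add E G.wt heE
            unfold W; linarith
          simp only [List.map_append, List.map_cons, List.sum_append, List.sum_cons] at this ⊢
          have hcost : Grp.cost G X ρ M ⟨g.a, g.b, q⟩ ≤ g.cost G X ρ M + G.wt e := by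
            simp only [Grp.cost]; linarith
          linarith
        · rw [List.pairwise_append, List.pairwise_cons]
          refine ⟨hs1.imp fun h => h.1, ⟨?_, hs3.imp fun h => h.1⟩, ?_⟩
          · intro g' hg'
            obtain ⟨h1, h2⟩ := hs2 g' hg'
            -- A single step of an extreme point cannot overtake: a different point to the right and
            -- down that is not above its diagonal is strictly lower. The same reasoning applies to
            -- the points on the other side.
            have h3 : g'.p.1 + g'.p.2 ≤ g.p.1 + g.p.2 ∨ g'.p.1 = c := by
              by_cases hc' : g'.p.1 = c
              · exact Or.inr hc'
              · exact Or.inl (hmax g' (by simp [hg']) hc')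
            have h5 : ¬ (g.p.1 = g'.p.1 ∧ g.p.2 = g'.p.2) := fun h => h2 (Prod.ext h.1 h.2)
            have h6 : c ≤ q.1 := by
              obtain ⟨r', hr'⟩ := hqt
              have : ∀ p, Relation.ReflTransGen (LDStep (E.erase e)) p (c, r') → c ≤ p.1 := by
                intro p hp
                induction hp using Relation.ReflTransGen.head_induction_on with
                | refl => exact le_rfl
                | head h _ ih => rcases h with h | h <;> omega
              exact this _ hr'
            unfold Desc at h1 ⊢
            show q.1 ≤ g'.p.1 ∧ g'.p.2 ≤ q.2
            rcases hq with h | h <;> omega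
          · intro x hx g' hg'
            rcases List.mem_cons.1 hg' with rfl | hg'
            · obtain ⟨h1, h2⟩ := hs4 x hx g (by simp)
              have h3 : x.p.1 + x.p.2 ≤ g.p.1 + g.p.2 ∨ x.p.1 = c := by
                by_cases hc' : x.p.1 = c
                · exact Or.inr hc'
                · exact Or.inl (hmax x (by simp [hx]) hc')
              have h5 : ¬ (x.p.1 = g.p.1 ∧ x.p.2 = g.p.2) := fun h => h2 (Prod.ext h.1 h.2)
              have h6 : c ≤ q.1 := by
                obtain ⟨r', hr'⟩ := hqt
                have : ∀ p, Relation.ReflTransGen (LDStep (E.erase e)) p (c, r') → c ≤ p.1 := by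
                  intro p hp
                  induction hp using Relation.ReflTransGen.head_induction_on with
                  | refl => exact le_rfl
                  | head h _ ih => rcases h with h | h <;> omega
                exact this _ hr'
              unfold Desc at h1 ⊢
              show x.p.1 ≤ q.1 ∧ q.2 ≤ x.p.2
              rcases hq with h | h <;> omega
            · exact (hs4 x hx g' (by simp [hg'])).1
        · intro g' hg'
          simp only [List.mem_append, List.mem_cons] at hg'
          rcases hg' with hg' | rfl | hg'
          · exact hother g' (by simp [hg']) (hs4 g' hg' g (by simp)).2
          · exact hqt
          · exact hother g' (by simp [hg']) (hs2 g' hg').2.symm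
    · obtain ⟨h1, h2⟩ := h.merge hD hg
      have := ih E _ a (by simp at hk ⊢; omega) h1 ?_ ?_
      · simp only [List.map_append, List.map_cons, List.sum_append, List.sum_cons] at this ⊢
        linarith
      · have hp' : (l₁ ++ g :: l₂).Pairwise fun g g' => Desc g.p g'.p :=
          hp.sublist (by simp)
        rw [List.pairwise_append, List.pairwise_cons] at hp' ⊢
        refine ⟨hp'.1, ⟨hp'.2.1.1, hp'.2.1.2⟩, ?_⟩
        intro x hx y hy
        rcases List.mem_cons.1 hy with rfl | hy
        · exact hp'.2.2 x hx g (by simp)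
        · exact hp'.2.2 x hx y (by simp [hy])
      · intro x hx
        simp only [List.mem_append, List.mem_cons] at hx
        rcases hx with hx | rfl | hx
        · exact ht x (by simp [hx])
        · exact ht g (by simp)
        · exact ht x (by simp [hx])

/-- The dynamic program is at most the length of every set of edges that joins all nodes to
column `c`. -/
theorem DP.le_W (hD : DP G c I N L X ρ M f) {P : ℕ → Prop} {n : ℕ}
    (hP : ∀ a, P a → a < n ∧ I a a ∧ M a a = 0)
    (hN : ∀ a, P a → L a ∨ ∃ s, N a s ∧ P s ∧ a < s)
    (hX : ∀ a b, P a → P b → a ≤ b → X a ≤ X b ∧ ρ b ≤ ρ a)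
    {E : Finset Edge} (hE : ∀ a, P a → ToCol E c (X a, ρ a)) {a : ℕ} (ha : P a) :
    f a ≤ G.W E := by
  -- At the start every node is a group of its own, placed at the node itself, so completing it
  -- costs nothing.
  have key : ∀ k a, P a → n ≤ a + k → ∃ gs, Grps I N L X ρ a gs ∧
      (gs.Pairwise fun g g' => Desc g.p g'.p) ∧
      ∀ g ∈ gs, ∃ b, a ≤ b ∧ P b ∧ g = ⟨b, b, X b, ρ b⟩ := by
    intro k
    induction k with
    | zero => intro a ha h; have := (hP a ha).1; omega
    | succ k ih =>
      intro a ha h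
      rcases hN a ha with hL | ⟨s, hs, hPs, has⟩
      · exact ⟨[⟨a, a, X a, ρ a⟩], Grps.last (g := ⟨a, a, X a, ρ a⟩) (hP a ha).2.1 hL le_rfl le_rfl,
          by simp, by intro g hg; exact ⟨a, le_rfl, ha, by simpa using hg⟩⟩
      · obtain ⟨gs, h1, h2, h3⟩ := ih s hPs (by omega)
        refine ⟨⟨a, a, X a, ρ a⟩ :: gs,
          Grps.cons (g := ⟨a, a, X a, ρ a⟩) (hP a ha).2.1 hs le_rfl le_rfl h1, ?_, ?_⟩
        · rw [List.pairwise_cons]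
          refine ⟨?_, h2⟩
          intro g hg
          obtain ⟨b, hb, hPb, rfl⟩ := h3 g hg
          exact hX a b ha hPb (by omega)
        · intro g hg
          rcases List.mem_cons.1 hg with rfl | hg
          · exact ⟨a, le_rfl, ha, rfl⟩
          · obtain ⟨b, hb, hPb, rfl⟩ := h3 g hg
            exact ⟨b, by omega, hPb, rfl⟩
  obtain ⟨gs, h1, h2, h3⟩ := key n a ha (by omega)
  have := dp_le hD _ E gs a le_rfl h1 h2 (by
    intro g hg
    obtain ⟨b, _, hb, rfl⟩ := h3 g hg
    exact hE b hb)
  have h0 : (gs.map (Grp.cost G X ρ M)).sum = 0 := by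
    apply List.sum_eq_zero
    intro x hx
    obtain ⟨g, hg, rfl⟩ := List.mem_map.1 hx
    obtain ⟨b, _, hb, rfl⟩ := h3 g hg
    simp [Grp.cost, (hP b hb).2.2]
  linarith

end

/-! ### Networks in terms of indices, and their symmetries -/

/-- The `l₁` distance of grid vertices, counted in edges. -/
def nd (p q : ℕ × ℕ) : ℕ := (p.1 - q.1) + (q.1 - p.1) + ((p.2 - q.2) + (q.2 - p.2))

/-- A step of a monotone path from `p` to `q`. -/
def BStep (A : ℕ × ℕ → ℕ × ℕ → Prop) (p q a b : ℕ × ℕ) : Prop :=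
  A a b ∧ nd p b = nd p a + 1 ∧ nd a q = nd b q + 1

/-- Bidirected Manhattan networks, in terms of the indices of columns and rows. -/
structure IsNet (G : Frame) (A : ℕ × ℕ → ℕ × ℕ → Prop) : Prop where
  lt : ∀ p q, A p q → (p.1 < G.n ∧ p.2 < G.n) ∧ q.1 < G.n ∧ q.2 < G.n
  unit : ∀ p q, A p q → nd p q = 1
  anti : ∀ p q, A p q → ¬ A q p
  path : ∀ i j, i < G.n → j < G.n →
    Relation.ReflTransGen (BStep A (i, G.π i) (j, G.π j)) (i, G.π i) (j, G.π j)

/-- The reversed arcs. -/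
def rA (A : ℕ × ℕ → ℕ × ℕ → Prop) : ℕ × ℕ → ℕ × ℕ → Prop := fun p q => A q p

/-- The transposed and reversed arcs. -/
def tA (A : ℕ × ℕ → ℕ × ℕ → Prop) : ℕ × ℕ → ℕ × ℕ → Prop := fun p q => A q.swap p.swap

/-- The arcs after a reflection of the `n` columns. -/
def xA (n : ℕ) (A : ℕ × ℕ → ℕ × ℕ → Prop) : ℕ × ℕ → ℕ × ℕ → Prop :=
  fun p q => (p.1 < n ∧ q.1 < n) ∧ A (n - 1 - p.1, p.2) (n - 1 - q.1, q.2)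

/-- The arcs after a reflection of the `n` rows. -/
def yA (n : ℕ) (A : ℕ × ℕ → ℕ × ℕ → Prop) : ℕ × ℕ → ℕ × ℕ → Prop := tA (xA n (tA A))

theorem nd_comm (p q : ℕ × ℕ) : nd p q = nd q p := by unfold nd; omega

theorem nd_swap (p q : ℕ × ℕ) : nd p.swap q.swap = nd p q := by simp only [nd, Prod.fst_swap, Prod.snd_swap]; omega

theorem path_rev {A : ℕ × ℕ → ℕ × ℕ → Prop} {p q a b : ℕ × ℕ}
    (h : Relation.ReflTransGen (BStep A p q) a b) : Relation.ReflTransGen (BStep (rA A) q p) b a := by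
  induction h with
  | refl => exact .refl
  | tail _ hs ih =>
    refine .head ?_ ih
    obtain ⟨h1, h2, h3⟩ := hs
    exact ⟨h1, by rw [nd_comm q, nd_comm q, h3], by rw [nd_comm _ p, nd_comm _ p, h2]⟩

variable {G : Frame} {A : ℕ × ℕ → ℕ × ℕ → Prop}

theorem IsNet.rev (h : IsNet G A) : IsNet G (rA A) where
  lt p q hpq := (h.lt _ _ hpq).symm
  unit p q hpq := by rw [nd_comm]; exact h.unit _ _ hpq
  anti p q hpq := h.anti _ _ hpq
  path i j hi hj := path_rev (h.path j i hj hi)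

/-- Transposition alone keeps paths to the right and up. The reversal contained in `tA` turns paths
that leave a terminal to the lower left into paths that enter it, so every result on entering paths
also yields one on leaving paths. -/
theorem IsNet.T (h : IsNet G A) : IsNet G.T (tA A) where
  lt p q hpq := by have := h.lt _ _ hpq; simp only [Prod.fst_swap, Prod.snd_swap] at this; simp only [Frame.T]; tauto
  unit p q hpq := by rw [nd_comm, ← nd_swap]; exact h.unit _ _ hpq
  anti p q hpq := h.anti _ _ hpq
  path i j hi hj := by
    have := path_rev (h.path (G.σ j) (G.σ i) (G.σ_lt j hj) (G.σ_lt i hi))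
    rw [G.πσ i hi, G.πσ j hj] at this
    refine this.lift Prod.swap ?_
    rintro a b ⟨h1, h2, h3⟩
    refine ⟨h1, ?_, ?_⟩
    · simp only [nd, Prod.fst_swap, Prod.snd_swap, Frame.T] at h2 ⊢; omega
    · simp only [nd, Prod.fst_swap, Prod.snd_swap, Frame.T] at h3 ⊢; omega

theorem nd_flip {n : ℕ} {a b c d : ℕ} (ha : a < n) (hc : c < n) :
    nd (n - 1 - a, b) (n - 1 - c, d) = nd (a, b) (c, d) := by
  simp only [nd]
  congr 1
  omega

theorem IsNet.flipX (h : IsNet G A) : IsNet G.flipX (xA G.n A) where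
  lt p q hpq := by have := h.lt _ _ hpq.2; have := hpq.1; simp only [Frame.flipX]; tauto
  unit p q hpq := by
    rw [← h.unit _ _ hpq.2, nd_flip hpq.1.1 hpq.1.2]
  anti p q hpq hqp := h.anti _ _ hpq.2 hqp.2
  path i j hi hj := by
    change i < G.n at hi
    change j < G.n at hj
    have h0 := h.path (G.n - 1 - i) (G.n - 1 - j) (by omega) (by omega)
    have := h0.lift (p := BStep (xA G.n A) (i, G.flipX.π i) (j, G.flipX.π j))
      (fun p : ℕ × ℕ => (G.n - 1 - p.1, p.2)) ?_
    · simp only [Function.onFun] at this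
      rwa [show G.n - 1 - (G.n - 1 - i) = i by omega, show G.n - 1 - (G.n - 1 - j) = j by omega] at this
    · rintro ⟨a, a'⟩ ⟨b, b'⟩ ⟨h1, h2, h3⟩
      obtain ⟨⟨h4, -⟩, h5, -⟩ := h.lt _ _ h1
      simp only at h4 h5
      refine ⟨⟨⟨by show G.n - 1 - a < G.n; omega, by show G.n - 1 - b < G.n; omega⟩, ?_⟩, ?_, ?_⟩
      · simp only
        rwa [show G.n - 1 - (G.n - 1 - a) = a by omega, show G.n - 1 - (G.n - 1 - b) = b by omega]
      · rw [← nd_flip (by omega) h4, ← nd_flip (by omega) h5] at h2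
        rwa [show G.n - 1 - (G.n - 1 - i) = i by omega] at h2
      · rw [← nd_flip h4 (by omega), ← nd_flip h5 (by omega)] at h3
        rwa [show G.n - 1 - (G.n - 1 - j) = j by omega] at h3

theorem IsNet.flipY (h : IsNet G A) : IsNet G.flipY (yA G.n A) := h.T.flipX.T

/-- A path to the right and up. -/
def RU (A : ℕ × ℕ → ℕ × ℕ → Prop) : ℕ × ℕ → ℕ × ℕ → Prop :=
  Relation.ReflTransGen fun a b => A a b ∧ (b = (a.1 + 1, a.2) ∨ b = (a.1, a.2 + 1))

theorem RU.le {p q : ℕ × ℕ} (h : RU A p q) : p.1 ≤ q.1 ∧ p.2 ≤ q.2 := by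
  induction h with
  | refl => exact ⟨le_rfl, le_rfl⟩
  | tail _ hs ih => rcases hs.2 with rfl | rfl <;> simp only <;> omega

/-- Every step moves away from the start and towards the end, hence stays in the rectangle of the
two terminals and goes to the right or up. -/
theorem IsNet.ru (h : IsNet G A) {i j : ℕ} (hi : i < G.n) (hj : j < G.n) (hij : i ≤ j)
    (hp : G.π i ≤ G.π j) : RU A (i, G.π i) (j, G.π j) := by
  have key : ∀ a, Relation.ReflTransGen (BStep A (i, G.π i) (j, G.π j)) (i, G.π i) a →
      RU A (i, G.π i) a ∧ i ≤ a.1 ∧ a.1 ≤ j ∧ G.π i ≤ a.2 ∧ a.2 ≤ G.π j := by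
    intro a ha
    induction ha with
    | refl => exact ⟨.refl, le_rfl, hij, le_rfl, hp⟩
    | @tail a b _ hs ih =>
      obtain ⟨h1, h2, h3⟩ := hs
      obtain ⟨h4, h5⟩ := ih
      have h6 := h.unit _ _ h1
      simp only [nd] at h2 h3 h6
      have h7 : b = (a.1 + 1, a.2) ∨ b = (a.1, a.2 + 1) := by
        simp only [Prod.ext_iff]
        omega
      refine ⟨h4.tail ⟨h1, h7⟩, ?_⟩
      omega
  exact (key _ (h.path i j hi hj)).1

theorem RU.col {p q : ℕ × ℕ} (h : RU A p q) (hpq : p.1 = q.1) :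
    ∀ l, p.2 ≤ l → l < q.2 → A (p.1, l) (p.1, l + 1) := by
  induction h with
  | refl => intro l h1 h2; omega
  | @tail a b hpa hs ih =>
    intro l h1 h2
    have hle := RU.le hpa
    rcases hs.2 with rfl | rfl
    · simp only at hpq; omega
    · simp only at hpq h2
      rcases Nat.lt_succ_iff_lt_or_eq.1 h2 with h3 | rfl
      · exact ih hpq l h1 h3
      · have := hs.1
        rw [hpq]
        exact this

theorem RU.row {p q : ℕ × ℕ} (h : RU A p q) (hpq : p.2 = q.2) :
    ∀ u, p.1 ≤ u → u < q.1 → A (u, p.2) (u + 1, p.2) := by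
  induction h with
  | refl => intro l h1 h2; omega
  | @tail a b hpa hs ih =>
    intro l h1 h2
    have hle := RU.le hpa
    rcases hs.2 with rfl | rfl
    · simp only at hpq h2
      rcases Nat.lt_succ_iff_lt_or_eq.1 h2 with h3 | rfl
      · exact ih hpq l h1 h3
      · have := hs.1
        rw [hpq]
        exact this
    · simp only at hpq; omega

theorem RU.cross_col {p q : ℕ × ℕ} (h : RU A p q) {u : ℕ} (hu : p.1 ≤ u) (hu' : u < q.1) :
    ∃ r, RU A p (u, r) ∧ A (u, r) (u + 1, r) ∧ RU A (u + 1, r) q := by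
  induction h with
  | refl => omega
  | @tail a b hpa hs ih =>
    rcases Nat.lt_or_ge u a.1 with h1 | h1
    · obtain ⟨r, h2, h3, h4⟩ := ih h1
      exact ⟨r, h2, h3, h4.tail hs⟩
    · rcases hs.2 with rfl | rfl
      · simp only at hu'
        obtain rfl : u = a.1 := by omega
        exact ⟨a.2, hpa, hs.1, .refl⟩
      · simp only at hu'; omega

/-! ### Forced edges: rectangles of consecutive terminals -/

/-- The four sides of the rectangle of two terminals in consecutive columns form a directed
cycle; the case in which the right terminal is higher. -/
def CycUp (G : Frame) (B : ℕ × ℕ → ℕ × ℕ → Prop) (u : ℕ) : Prop :=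
  (∀ l, G.π u ≤ l → l < G.π (u + 1) → B (u, l) (u, l + 1) ∧ B (u + 1, l + 1) (u + 1, l)) ∧
    B (u, G.π (u + 1)) (u + 1, G.π (u + 1)) ∧ B (u + 1, G.π u) (u, G.π u)

/-- The two opposite paths cross between the columns in rows `r` and `r'` and otherwise run along
the columns. If neither crosses in the bottom row, both use the lowest edge of column `u`, in
different orientations; the top row is treated alike. Hence one path crosses at the bottom, the
other at the top, and together they run around the rectangle. -/
theorem IsNet.cycUp (h : IsNet G A) {u : ℕ} (hu : u + 1 < G.n) (hp : G.π u < G.π (u + 1)) :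
    CycUp G A u ∨ CycUp G (rA A) u := by
  have h1 := h.ru (by omega : u < G.n) hu (by omega) hp.le
  have h2 := h.rev.ru (by omega : u < G.n) hu (by omega) hp.le
  obtain ⟨r, a1, a2, a3⟩ := h1.cross_col (u := u) le_rfl (by simp)
  obtain ⟨r', b1, b2, b3⟩ := h2.cross_col (u := u) le_rfl (by simp)
  have a4 := a1.col rfl
  have a5 := a3.col rfl
  have b4 := b1.col rfl
  have b5 := b3.col rfl
  have a6 := a1.le
  have a7 := a3.le
  have b6 := b1.le
  have b7 := b3.le
  simp only at a4 a5 b4 b5 a6 a7 b6 b7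
  have e1 : r = G.π u ∨ r' = G.π u := by
    by_contra hc
    exact h.anti _ _ (a4 (G.π u) le_rfl (by omega)) (b4 (G.π u) le_rfl (by omega))
  have e2 : r = G.π (u + 1) ∨ r' = G.π (u + 1) := by
    by_contra hc
    have h3 := a5 (G.π (u + 1) - 1) (by omega) (by omega)
    have h4 := b5 (G.π (u + 1) - 1) (by omega) (by omega)
    exact h.anti _ _ h3 h4
  rcases e1 with e1 | e1
  · have e3 : r' = G.π (u + 1) := by omega
    subst e1; subst e3
    exact Or.inr ⟨fun l h1 h2 => ⟨b4 l h1 h2, a5 l h1 h2⟩, b2, a2⟩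
  · have e3 : r = G.π (u + 1) := by omega
    subst e1; subst e3
    exact Or.inl ⟨fun l h1 h2 => ⟨a4 l h1 h2, b5 l h1 h2⟩, a2, b2⟩

/-- The case in which the left terminal is higher. -/
def CycDown (G : Frame) (B : ℕ × ℕ → ℕ × ℕ → Prop) (u : ℕ) : Prop :=
  (∀ l, G.π (u + 1) ≤ l → l < G.π u → B (u, l) (u, l + 1) ∧ B (u + 1, l + 1) (u + 1, l)) ∧
    B (u, G.π u) (u + 1, G.π u) ∧ B (u + 1, G.π (u + 1)) (u, G.π (u + 1))

theorem yA_iff {n : ℕ} {a b c d : ℕ} : yA n A (a, b) (c, d) ↔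
    (b < n ∧ d < n) ∧ A (a, n - 1 - b) (c, n - 1 - d) := by
  simp only [yA, tA, xA, Prod.swap]
  tauto

theorem CycUp.down (hu : u + 1 < G.n) (h : CycUp G.flipY (yA G.n A) u) :
    CycDown G (rA A) u := by
  have e1 := G.π_lt u (by omega)
  have e2 := G.π_lt (u + 1) hu
  obtain ⟨h1, h2, h3⟩ := h
  simp only [yA_iff, Frame.flipY, Frame.T, Frame.flipX] at h1 h2 h3
  rw [show G.n - 1 - (G.n - 1 - G.π (u + 1)) = G.π (u + 1) by omega] at h2
  rw [show G.n - 1 - (G.n - 1 - G.π u) = G.π u by omega] at h3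
  refine ⟨fun l hl hl' => ?_, h3.2, h2.2⟩
  have := h1 (G.n - 1 - (l + 1)) (by omega) (by omega)
  rw [show G.n - 1 - (G.n - 1 - (l + 1)) = l + 1 by omega,
    show G.n - 1 - (G.n - 1 - (l + 1) + 1) = l by omega] at this
  exact ⟨this.1.2, this.2.2⟩

theorem IsNet.cycDown (h : IsNet G A) {u : ℕ} (hu : u + 1 < G.n) (hp : G.π (u + 1) < G.π u) :
    CycDown G A u ∨ CycDown G (rA A) u := by
  have e1 := G.π_lt u (by omega)
  have := h.flipY.cycUp (u := u) hu (by simp only [Frame.flipY, Frame.T, Frame.flipX]; omega)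
  rcases this with h1 | h1
  · exact Or.inr (CycUp.down hu h1)
  · left
    have e : rA (yA G.n A) = yA G.n (rA A) := by
      funext p q
      simp only [rA, yA, tA, xA, and_comm]
    rw [e] at h1
    exact CycUp.down hu h1

/-- `l` is in the half open range of two numbers. -/
def Btw (a b l : ℕ) : Prop := min a b ≤ l ∧ l < max a b

/-- The vertical edges on the boundaries of the rectangles of consecutive terminals. -/
def FV (G : Frame) (u l : ℕ) : Prop := u < G.n ∧ l + 1 < G.n ∧
  ((u + 1 < G.n ∧ Btw (G.π u) (G.π (u + 1)) l) ∨ (1 ≤ u ∧ Btw (G.π (u - 1)) (G.π u) l) ∨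
    G.π u = l ∨ G.π u = l + 1)

/-- The horizontal ones. -/
def FH (G : Frame) (u l : ℕ) : Prop := FV G.T l u

/-- `A` contains the edge in one of its orientations. -/
def HasE (A : ℕ × ℕ → ℕ × ℕ → Prop) (e : Edge) : Prop :=
  if e.1 then A (e.2.1, e.2.2) (e.2.1 + 1, e.2.2) ∨ A (e.2.1 + 1, e.2.2) (e.2.1, e.2.2)
  else A (e.2.1, e.2.2) (e.2.1, e.2.2 + 1) ∨ A (e.2.1, e.2.2 + 1) (e.2.1, e.2.2)

theorem hasE_rA {e : Edge} : HasE (rA A) e ↔ HasE A e := by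
  unfold HasE rA; split_ifs <;> exact Or.comm

theorem hasE_tA {k : Bool} {u l : ℕ} : HasE (tA A) (k, u, l) ↔ HasE A (!k, l, u) := by
  cases k <;> simp [HasE, tA, or_comm]

/-- The two senses of the cycle differ in orientation only, so all sides are present in either case.
-/
theorem IsNet.strip (h : IsNet G A) {u : ℕ} (hu : u + 1 < G.n) :
    (∀ l, Btw (G.π u) (G.π (u + 1)) l → HasE A (false, u, l) ∧ HasE A (false, u + 1, l)) ∧
      HasE A (true, u, G.π u) ∧ HasE A (true, u, G.π (u + 1)) := by
  have hne : G.π u ≠ G.π (u + 1) := fun h => by have := G.π_inj (by omega) hu h; omega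
  have key : ∀ B, (B = A ∨ B = rA A) → ((∀ l, Btw (G.π u) (G.π (u + 1)) l → HasE B (false, u, l) ∧ HasE B (false, u + 1, l)) ∧
      HasE B (true, u, G.π u) ∧ HasE B (true, u, G.π (u + 1))) → ((∀ l, Btw (G.π u) (G.π (u + 1)) l → HasE A (false, u, l) ∧ HasE A (false, u + 1, l)) ∧
      HasE A (true, u, G.π u) ∧ HasE A (true, u, G.π (u + 1))) := by
    rintro B (rfl | rfl) hB
    · exact hB
    · simpa only [hasE_rA] using hB
  have up : ∀ B, G.π u < G.π (u + 1) → CycUp G B u → ((∀ l, Btw (G.π u) (G.π (u + 1)) l → HasE B (false, u, l) ∧ HasE B (false, u + 1, l)) ∧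
      HasE B (true, u, G.π u) ∧ HasE B (true, u, G.π (u + 1))) := by
    rintro B hp ⟨h1, h2, h3⟩
    refine ⟨fun l hl => ?_, Or.inr h3, Or.inl h2⟩
    have := h1 l (by have := hl.1; omega) (by have := hl.2; omega)
    exact ⟨Or.inl this.1, Or.inr this.2⟩
  have down : ∀ B, G.π (u + 1) < G.π u → CycDown G B u → ((∀ l, Btw (G.π u) (G.π (u + 1)) l → HasE B (false, u, l) ∧ HasE B (false, u + 1, l)) ∧
      HasE B (true, u, G.π u) ∧ HasE B (true, u, G.π (u + 1))) := by
    rintro B hp ⟨h1, h2, h3⟩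
    refine ⟨fun l hl => ?_, Or.inl h2, Or.inr h3⟩
    have := h1 l (by have := hl.1; omega) (by have := hl.2; omega)
    exact ⟨Or.inl this.1, Or.inr this.2⟩
  rcases lt_or_gt_of_ne hne with hp | hp
  · rcases h.cycUp hu hp with h1 | h1
    · exact up A hp h1
    · exact key _ (Or.inr rfl) (up _ hp h1)
  · rcases h.cycDown hu hp with h1 | h1
    · exact down A hp h1
    · exact key _ (Or.inr rfl) (down _ hp h1)

/-- The last two cases, the edges directly above and below a terminal, are sides of rectangles of
terminals in consecutive rows. -/
theorem IsNet.fv (h : IsNet G A) {u l : ℕ} (hf : FV G u l) : HasE A (false, u, l) := by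
  obtain ⟨hu, hl, ⟨h1, h2⟩ | ⟨h1, h2⟩ | h2 | h2⟩ := hf
  · exact ((h.strip h1).1 l h2).1
  · have := ((h.strip (u := u - 1) (by omega)).1 l (by rwa [show u - 1 + 1 = u by omega])).2
    rwa [show u - 1 + 1 = u by omega] at this
  · have := (h.T.strip (u := l) hl).2.1
    simp only [hasE_tA, Frame.T] at this
    rwa [← h2, G.σπ u hu, h2] at this
  · have := (h.T.strip (u := l) hl).2.2
    simp only [hasE_tA, Frame.T] at this
    rwa [← h2, G.σπ u hu] at this

theorem IsNet.fh (h : IsNet G A) {u l : ℕ} (hf : FH G u l) : HasE A (true, u, l) := by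
  have := h.T.fv hf
  rwa [hasE_tA] at this


/-! ### Blocks of a staircase and the nodes at which the trees end -/

/-- A partition of the staircases into singles (type `1`), pairs (types `2`, `3`) and triples
(types `4`, `5`, `6`). -/
structure Blocks (G : Frame) (τ : ℕ → ℕ) : Prop where
  ty : ∀ b, G.Reg b → 1 ≤ τ b ∧ τ b ≤ 6
  p1 : ∀ b, G.Reg b → τ b = 2 → ∃ s, G.Nx b s ∧ (G.π s + 1 = G.π b ∨ s = b + 1) ∧ τ s = 3
  p2 : ∀ b, G.Reg b → τ b = 3 → ∃ p, G.Nx p b ∧ (G.π b + 1 = G.π p ∨ b = p + 1) ∧ τ p = 2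
  t1 : ∀ b, G.Reg b → τ b = 4 → ∃ s, G.Nx b s ∧ s = b + 1 ∧ τ s = 5
  t2 : ∀ b, G.Reg b → τ b = 5 → ∃ p, G.Nx p b ∧ b = p + 1 ∧ τ p = 4
  t2' : ∀ b, G.Reg b → τ b = 5 → ∃ t, G.Nx b t ∧ G.π t + 1 = G.π b ∧ τ t = 6
  t3 : ∀ b, G.Reg b → τ b = 6 → ∃ s, G.Nx s b ∧ G.π b + 1 = G.π s ∧ τ s = 5
  single : ∀ b, G.Reg b → τ b = 1 → ∀ s, G.Nx b s → s ≠ b + 1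
  single' : ∀ b, G.Reg b → τ b = 1 → ∀ p, G.Nx p b → G.π b + 1 ≠ G.π p

/-- Reversal of the order in a block. -/
def swapTy (k : ℕ) : ℕ :=
  if k = 2 then 3 else if k = 3 then 2 else if k = 4 then 6 else if k = 6 then 4 else k

/-- Transposition reverses a staircase and exchanges adjacency of rows with adjacency of columns. A
triple has adjacent columns first and adjacent rows second, so its shape is preserved. -/
theorem Blocks.T {G : Frame} {τ : ℕ → ℕ} (h : Blocks G τ) : Blocks G.T (fun r => swapTy (τ (G.σ r))) := by
  have ex : ∀ r, G.T.Reg r → ∃ b, b < G.n ∧ r = G.π b ∧ G.Reg b := by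
    intro r hr
    have h1 : r < G.n := hr.1
    refine ⟨G.σ r, G.σ_lt r h1, (G.πσ r h1).symm, ?_⟩
    rw [← Reg_T (G.σ_lt r h1), G.πσ r h1]
    exact hr
  have exN : ∀ r s, G.T.Nx r s → ∃ a b, r = G.π b ∧ s = G.π a ∧ G.Nx a b := by
    intro r s hrs
    obtain ⟨b, hb, rfl, -⟩ := ex r hrs.reg
    obtain ⟨a, ha, rfl, -⟩ := ex s hrs.reg'
    exact ⟨a, b, rfl, rfl, (Nx_T_iff ha hb).1 hrs⟩
  refine ⟨?_, ?_, ?_, ?_, ?_, ?_, ?_, ?_, ?_⟩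
  · intro r hr
    obtain ⟨b, hb, rfl, hrb⟩ := ex r hr
    have := h.ty b hrb
    simp only [G.σπ b hb, swapTy]
    split_ifs <;> omega
  all_goals
    intro r hr hτ
    obtain ⟨b, hb, rfl, hrb⟩ := ex r hr
    simp only [G.σπ b hb] at hτ
    have hty := h.ty b hrb
  · obtain ⟨p, h1, h2, h3⟩ := h.p2 b hrb (by unfold swapTy at hτ; split_ifs at hτ <;> omega)
    refine ⟨G.π p, h1.T, ?_, by simp [G.σπ p h1.reg.1, h3, swapTy]⟩
    simp only [Frame.T, G.σπ p h1.reg.1, G.σπ b hb]; omega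
  · obtain ⟨p, h1, h2, h3⟩ := h.p1 b hrb (by unfold swapTy at hτ; split_ifs at hτ <;> omega)
    refine ⟨G.π p, h1.T, ?_, by simp [G.σπ p h1.reg'.1, h3, swapTy]⟩
    simp only [Frame.T, G.σπ p h1.reg'.1, G.σπ b hb]; omega
  · obtain ⟨p, h1, h2, h3⟩ := h.t3 b hrb (by unfold swapTy at hτ; split_ifs at hτ <;> omega)
    exact ⟨G.π p, h1.T, by omega, by simp [G.σπ p h1.reg.1, h3, swapTy]⟩
  · obtain ⟨p, h1, h2, h3⟩ := h.t2' b hrb (by unfold swapTy at hτ; split_ifs at hτ <;> omega)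
    exact ⟨G.π p, h1.T, by omega, by simp [G.σπ p h1.reg'.1, h3, swapTy]⟩
  · obtain ⟨p, h1, h2, h3⟩ := h.t2 b hrb (by unfold swapTy at hτ; split_ifs at hτ <;> omega)
    refine ⟨G.π p, h1.T, ?_, by simp [G.σπ p h1.reg.1, h3, swapTy]⟩
    simp only [Frame.T, G.σπ p h1.reg.1, G.σπ b hb]; omega
  · obtain ⟨p, h1, h2, h3⟩ := h.t1 b hrb (by unfold swapTy at hτ; split_ifs at hτ <;> omega)
    refine ⟨G.π p, h1.T, ?_, by simp [G.σπ p h1.reg'.1, h3, swapTy]⟩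
    simp only [Frame.T, G.σπ p h1.reg'.1, G.σπ b hb]; omega
  · intro s hs
    obtain ⟨a, b', e1, rfl, h1⟩ := exN _ _ hs
    obtain rfl : b = b' := G.π_inj hb h1.reg'.1 e1
    have := h.single' b hrb (by unfold swapTy at hτ; split_ifs at hτ <;> omega) a h1
    omega
  · intro s hs
    obtain ⟨a, b', rfl, e1, h1⟩ := exN _ _ hs
    obtain rfl : b = a := G.π_inj hb h1.reg.1 e1
    have := h.single b hrb (by unfold swapTy at hτ; split_ifs at hτ <;> omega) b' h1
    simp only [Frame.T, G.σπ b' h1.reg'.1, G.σπ b hb]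
    omega

/-- The nodes of the trees: terminal `b` is joined to `(X b, ρ b)`. -/
structure Nodes (G : Frame) (τ X ρ : ℕ → ℕ) : Prop where
  own : ∀ b, G.Reg b → τ b ≠ 3 → τ b ≠ 6 → X b = b
  pred : ∀ p b, G.Nx p b → τ b = 3 ∨ τ b = 6 → X b = p
  last : ∀ b, G.Reg b → τ b = 1 ∨ τ b = 3 ∨ τ b = 6 → ρ b + 1 = G.π b
  next : ∀ b s, G.Nx b s → τ b = 2 ∨ τ b = 5 → ρ b + 1 = G.π s
  next' : ∀ b s t, G.Nx b s → G.Nx s t → τ b = 4 → ρ b + 1 = G.π t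

section

variable {G : Frame} {τ X ρ : ℕ → ℕ} (hB : Blocks G τ) (hX : Nodes G τ X ρ)

theorem Mem.nx_ex {c d a b : ℕ} (ha : G.Mem c d a) (hb : G.Mem c d b) (h : a < b) :
    ∃ s, G.Nx a s := by
  classical
  have hex : ∃ s, G.Mem c d s ∧ a < s := ⟨b, hb, h⟩
  refine ⟨Nat.find hex, ha.1, ?_, (Nat.find_spec hex).2, ?_⟩
  · rw [ha.2.1, ha.2.2]; exact (Nat.find_spec hex).1
  · rw [ha.2.1, ha.2.2]; intro t h1 h2; exact Nat.find_min' hex ⟨h1, h2⟩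

theorem Mem.T' {c d b : ℕ} (h : G.Mem c d b) : G.T.Mem d c (G.π b) := (Mem_T h.1.1).2 h

theorem Mem.nx_ex' {c d a b : ℕ} (ha : G.Mem c d a) (hb : G.Mem c d b) (h : a < b) :
    ∃ p, G.Nx p b := by
  have := chain_anti ha.1.nd hb.1.nd (ha.2.1.trans hb.2.1.symm) h
  obtain ⟨s, hs⟩ := hb.T'.nx_ex ha.T' this
  have hsn : s < G.n := hs.reg'.1
  refine ⟨G.σ s, ?_⟩
  rw [← Nx_T_iff (G.σ_lt s hsn) hb.1.1, G.πσ s hsn]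
  exact hs

theorem Nx.le_left {c d a b s : ℕ} (h : G.Nx b s) (hb : G.Mem c d b) (ha : G.Mem c d a) (has : a < s) :
    a ≤ b := by
  rcases h.le_or_le (t := a) (by rwa [hb.2.1, hb.2.2]) with h1 | h1 <;> omega

theorem Nx.le_right {c d a b s : ℕ} (h : G.Nx b s) (hb : G.Mem c d b) (ha : G.Mem c d a) (has : b < a) :
    s ≤ a := by
  rcases h.le_or_le (t := a) (by rwa [hb.2.1, hb.2.2]) with h1 | h1 <;> omega

theorem Nx.mem {c d b s : ℕ} (h : G.Nx b s) (hb : G.Mem c d b) : G.Mem c d s :=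
  ⟨h.reg', h.lc.trans hb.2.1, h.ld.trans hb.2.2⟩

theorem Nx.mem' {c d b s : ℕ} (h : G.Nx b s) (hs : G.Mem c d s) : G.Mem c d b :=
  ⟨h.reg, h.lc.symm.trans hs.2.1, h.ld.symm.trans hs.2.2⟩

theorem Mem.anti {c d a b : ℕ} (ha : G.Mem c d a) (hb : G.Mem c d b) (h : a < b) : G.π b < G.π a :=
  chain_anti ha.1.nd hb.1.nd (ha.2.1.trans hb.2.1.symm) h

include hB hX

theorem Nodes.X_cases {c d b : ℕ} (hb : G.Mem c d b) :
    (X b = b ∧ τ b ≠ 3 ∧ τ b ≠ 6) ∨ (∃ p, G.Nx p b ∧ X b = p ∧ (τ b = 3 ∨ τ b = 6)) := by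
  by_cases h3 : τ b = 3
  · obtain ⟨p, h1, -⟩ := hB.p2 b hb.1 h3
    exact Or.inr ⟨p, h1, hX.pred p b h1 (Or.inl h3), Or.inl h3⟩
  · by_cases h6 : τ b = 6
    · obtain ⟨p, h1, -⟩ := hB.t3 b hb.1 h6
      exact Or.inr ⟨p, h1, hX.pred p b h1 (Or.inr h6), Or.inr h6⟩
    · exact Or.inl ⟨hX.own b hb.1 h3 h6, h3, h6⟩

theorem Nodes.ρ_cases {c d b : ℕ} (hb : G.Mem c d b) :
    ((τ b = 1 ∨ τ b = 3 ∨ τ b = 6) ∧ ρ b + 1 = G.π b) ∨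
      (∃ s, G.Nx b s ∧ (τ b = 2 ∨ τ b = 5) ∧ (τ s = 3 ∨ τ s = 6) ∧ ρ b + 1 = G.π s) ∨
      ∃ s t, G.Nx b s ∧ G.Nx s t ∧ τ b = 4 ∧ τ s = 5 ∧ τ t = 6 ∧ ρ b + 1 = G.π t := by
  have hty := hB.ty b hb.1
  by_cases h1 : τ b = 2
  · obtain ⟨s, h2, -, h3⟩ := hB.p1 b hb.1 h1
    exact Or.inr (Or.inl ⟨s, h2, Or.inl h1, Or.inl h3, hX.next b s h2 (Or.inl h1)⟩)
  by_cases h2 : τ b = 5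
  · obtain ⟨s, h3, -, h4⟩ := hB.t2' b hb.1 h2
    exact Or.inr (Or.inl ⟨s, h3, Or.inr h2, Or.inr h4, hX.next b s h3 (Or.inr h2)⟩)
  by_cases h3 : τ b = 4
  · obtain ⟨s, h4, -, h5⟩ := hB.t1 b hb.1 h3
    obtain ⟨t, h6, -, h7⟩ := hB.t2' s h4.reg' h5
    exact Or.inr (Or.inr ⟨s, t, h4, h6, h3, h5, h7, hX.next' b s t h4 h6 h3⟩)
  have h4 : τ b = 1 ∨ τ b = 3 ∨ τ b = 6 := by omega
  exact Or.inl ⟨h4, hX.last b hb.1 h4⟩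

theorem Nodes.X_le {c d b : ℕ} (hb : G.Mem c d b) : X b ≤ b ∧ c + 2 ≤ X b ∧ X b < G.n := by
  have hbn := hb.1.1
  have hb2 := hb.1.2.2.1
  have := hb.2.1
  rcases hX.X_cases hB hb with ⟨h, -⟩ | ⟨p, h1, h, -⟩
  · omega
  · have h2 := (h1.mem' hb)
    have h3 := h2.1.2.2.1
    have := h2.2.1
    have := h1.lt
    omega

theorem Nodes.ρ_lt {c d b : ℕ} (hb : G.Mem c d b) : ρ b < G.π b ∧ d + 1 ≤ ρ b ∧ ρ b < G.n := by
  have hbn := G.π_lt b hb.1.1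
  have key : ∀ e, G.Mem c d e → ρ b + 1 = G.π e → G.π e ≤ G.π b → ρ b < G.π b ∧ d + 1 ≤ ρ b ∧ ρ b < G.n := by
    intro e he h1 h2
    have := he.1.2.2.2
    have := he.2.2
    omega
  rcases hX.ρ_cases hB hb with ⟨-, h⟩ | ⟨s, h1, -, -, h⟩ | ⟨s, t, h1, h2, -, -, -, h⟩
  · exact key b hb h le_rfl
  · exact key s (h1.mem hb) h h1.π_lt.le
  · exact key t (h2.mem (h1.mem hb)) h (h2.π_lt.le.trans h1.π_lt.le)

theorem Nodes.le_X {c d a b : ℕ} (ha : G.Mem c d a) (hb : G.Mem c d b) (h : a < b) : a ≤ X b := by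
  rcases hX.X_cases hB hb with ⟨h1, -⟩ | ⟨p, h1, h2, -⟩
  · omega
  · rw [h2]; exact h1.le_left (h1.mem' hb) ha h

/-- All members of a block share the row just below the last terminal of the block. If that terminal
comes before `b`, this row is not below the row of `b`; otherwise `a` and `b` are in one block.
Hence the rows of nodes interleave with those of the terminals, which makes the projection `snap`
well behaved. -/
theorem Nodes.ρ_eq_or {c d a b : ℕ} (ha : G.Mem c d a) (hb : G.Mem c d b) (h : a < b) :
    ρ a = ρ b ∨ G.π b ≤ ρ a := by
  have hm : ∀ e, G.Mem c d e → e < b → G.π b + 1 ≤ G.π e := fun e he h => he.anti hb h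
  rcases hX.ρ_cases hB ha with ⟨-, h1⟩ | ⟨s, h1, h2, h3, h4⟩ | ⟨s, t, h1, h2, h3, h4, h5, h6⟩
  · have := hm a ha h; omega
  · have := h1.le_right ha hb h
    rcases this.lt_or_eq with h5 | rfl
    · have := hm s (h1.mem ha) h5; omega
    · have := hX.last s h1.reg' (by omega); omega
  · have := h1.le_right ha hb h
    rcases this.lt_or_eq with h7 | rfl
    · have := h2.le_right (h1.mem ha) hb h7
      rcases this.lt_or_eq with h8 | rfl
      · have := hm t (h2.mem (h1.mem ha)) h8; omega
      · have := hX.last t h2.reg' (by omega); omega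
    · have := hX.next s t h2 (by omega); omega

theorem Nodes.mono {c d a b : ℕ} (ha : G.Mem c d a) (hb : G.Mem c d b) (h : a ≤ b) :
    X a ≤ X b ∧ ρ b ≤ ρ a := by
  rcases h.lt_or_eq with h | rfl
  · have h1 := hX.le_X hB ha hb h
    have h2 := hX.X_le hB ha
    have h3 := hX.ρ_eq_or hB ha hb h
    have h4 := hX.ρ_lt hB hb
    omega
  · exact ⟨le_rfl, le_rfl⟩

end

/-- Optimal trees for the nodes of all staircases. -/
structure Sol (G : Frame) (τ : ℕ → ℕ) where
  X : ℕ → ℕ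
  ρ : ℕ → ℕ
  sc : ℕ → ℕ
  pr : ℕ → ℕ
  M : ℕ → ℕ → ℝ
  sp : ℕ → ℕ → ℕ
  f : ℕ → ℝ
  ar : ℕ → ℕ
  sc_eq : ∀ a b, G.Nx a b → sc a = b
  pr_eq : ∀ a b, G.Nx a b → pr b = a
  nodes : Nodes G τ X ρ
  M_self : ∀ a, G.Reg a → M a a = 0
  sp_mem : ∀ a b, G.Reg a → G.Mem (G.lc a) (G.ld a) b → a < b →
    G.Mem (G.lc a) (G.ld a) (sp a b) ∧ a ≤ sp a b ∧ sp a b < b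
  M_eq : ∀ a b, G.Reg a → G.Mem (G.lc a) (G.ld a) b → a < b →
    M a b = M a (sp a b) + M (sc (sp a b)) b + (G.ys (ρ (sp a b)) - G.ys (ρ b)) +
      (G.xs (X (sc (sp a b))) - G.xs (X a))
  M_le : ∀ a m b, G.Reg a → G.Mem (G.lc a) (G.ld a) m → G.Mem (G.lc a) (G.ld a) b → a ≤ m → m < b →
    M a b ≤ M a m + M (sc m) b + (G.ys (ρ m) - G.ys (ρ b)) + (G.xs (X (sc m)) - G.xs (X a))
  ar_mem : ∀ a, G.Reg a → G.Mem (G.lc a) (G.ld a) (ar a) ∧ a ≤ ar a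
  f_eq_last : ∀ a, G.Reg a → (∀ s, ¬ G.Nx (ar a) s) → f a = M a (ar a) + (G.xs (X a) - G.xs (G.lc a))
  f_eq_next : ∀ a s, G.Reg a → G.Nx (ar a) s → f a = M a (ar a) + (G.xs (X a) - G.xs (G.lc a)) + f s
  f_le_last : ∀ a b, G.Reg a → G.Mem (G.lc a) (G.ld a) b → a ≤ b → (∀ s, ¬ G.Nx b s) →
    f a ≤ M a b + (G.xs (X a) - G.xs (G.lc a))
  f_le_next : ∀ a b s, G.Reg a → G.Mem (G.lc a) (G.ld a) b → a ≤ b → G.Nx b s →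
    f a ≤ M a b + (G.xs (X a) - G.xs (G.lc a)) + f s

theorem Sol.dp {G : Frame} {τ : ℕ → ℕ} (hB : Blocks G τ) (S : Sol G τ) (c d : ℕ) :
    DP G c (fun a b => G.Mem c d a ∧ G.Mem c d b ∧ a ≤ b) (fun a b => G.Nx a b)
      (fun b => ∀ s, ¬ G.Nx b s) S.X S.ρ S.M S.f where
  merge := by
    rintro a m m' b ⟨h1, h2, h3⟩ h4 ⟨h5, h6, h7⟩
    have h8 := h4.lt
    refine ⟨⟨h1, h6, by omega⟩, ?_⟩
    have := S.M_le a m b h1.1 (by rwa [h1.2.1, h1.2.2]) (by rwa [h1.2.1, h1.2.2]) h3 (by omega)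
    rwa [S.sc_eq _ _ h4] at this
  last := by
    rintro a b ⟨h1, h2, h3⟩ h4
    have := S.f_le_last a b h1.1 (by rwa [h1.2.1, h1.2.2]) h3 h4
    rwa [h1.2.1] at this
  next := by
    rintro a b s ⟨h1, h2, h3⟩ h4
    have := S.f_le_next a b s h1.1 (by rwa [h1.2.1, h1.2.2]) h3 h4
    rwa [h1.2.1] at this
  lt := by
    rintro a b ⟨h1, h2, h3⟩
    exact ⟨(S.nodes.X_le hB h1).2.2, (S.nodes.ρ_lt hB h2).2.2⟩

/-- If all nodes of a staircase are joined to its left boundary by `E`, the dynamic program gives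
at most the length of `E`. -/
theorem Sol.f_le_W {G : Frame} {τ : ℕ → ℕ} (hB : Blocks G τ) (S : Sol G τ) {c d a : ℕ} {E : Finset Edge}
    (ha : G.Mem c d a) (hE : ∀ b, G.Mem c d b → ToCol E c (S.X b, S.ρ b)) : S.f a ≤ G.W E := by
  refine (S.dp hB c d).le_W (P := G.Mem c d) (n := G.n) ?_ ?_ ?_ hE ha
  · intro a ha
    exact ⟨ha.1.1, ⟨ha, ha, le_rfl⟩, S.M_self a ha.1⟩
  · intro a ha
    by_cases h : ∃ s, G.Nx a s
    · obtain ⟨s, hs⟩ := h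
      exact Or.inr ⟨s, hs, hs.mem ha, hs.lt⟩
    · push Not at h; exact Or.inl h
  · intro a b ha hb h
    exact S.nodes.mono hB ha hb h


/-! ### Regions, and how the edges of a network join the nodes to the boundary -/

/-- The edges on the boundaries of the rectangles of consecutive terminals. -/
def InF (G : Frame) (e : Edge) : Prop := if e.1 then FH G e.2.1 e.2.2 else FV G e.2.1 e.2.2

/-- The edges of the rectangle between `(lc b, ld b)` and the terminal of column `b`. -/
def InRect (G : Frame) (b : ℕ) (e : Edge) : Prop :=
  if e.1 then G.lc b ≤ e.2.1 ∧ e.2.1 + 1 ≤ b ∧ G.ld b ≤ e.2.2 ∧ e.2.2 ≤ G.π b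
  else G.lc b ≤ e.2.1 ∧ e.2.1 ≤ b ∧ G.ld b ≤ e.2.2 ∧ e.2.2 + 1 ≤ G.π b

/-- All edges of the grid. -/
def gridE (n : ℕ) : Finset Edge :=
  (Finset.univ ×ˢ Finset.range n ×ˢ Finset.range n).filter fun e =>
    if e.1 then e.2.1 + 1 < n else e.2.2 + 1 < n

theorem mem_gridE {n : ℕ} {e : Edge} : e ∈ gridE n ↔
    e.2.1 < n ∧ e.2.2 < n ∧ (if e.1 then e.2.1 + 1 < n else e.2.2 + 1 < n) := by
  simp [gridE, and_assoc]

open Classical in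
/-- The region of a staircase. -/
noncomputable def Sreg (G : Frame) (c d : ℕ) : Finset Edge :=
  (gridE G.n).filter fun e => ∃ b, G.ND b ∧ G.lc b = c ∧ G.ld b = d ∧ InRect G b e

theorem mem_Sreg_h {G : Frame} {c d b u l : ℕ} (hb : G.ND b) (hc : G.lc b = c) (hd : G.ld b = d)
    (h1 : c ≤ u) (h2 : u + 1 ≤ b) (h3 : d ≤ l) (h4 : l ≤ G.π b) : (true, u, l) ∈ Sreg G c d := by
  have := hb.1
  have := G.π_lt b hb.1
  classical
  refine Finset.mem_filter.2 ⟨mem_gridE.2 ⟨by simp only; omega, by simp only; omega, by simp only [if_true]; omega⟩, b, hb, hc, hd, ?_⟩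
  simp only [InRect, if_true]
  omega

theorem mem_Sreg_v {G : Frame} {c d b u l : ℕ} (hb : G.ND b) (hc : G.lc b = c) (hd : G.ld b = d)
    (h1 : c ≤ u) (h2 : u ≤ b) (h3 : d ≤ l) (h4 : l + 1 ≤ G.π b) : (false, u, l) ∈ Sreg G c d := by
  have := hb.1
  have := G.π_lt b hb.1
  classical
  refine Finset.mem_filter.2 ⟨mem_gridE.2 ⟨by simp only; omega, by simp only; omega, by simp only [Bool.false_eq_true, if_false]; omega⟩, b, hb, hc, hd, ?_⟩
  simp only [InRect, Bool.false_eq_true, if_false]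
  omega

variable {G : Frame} {A : ℕ × ℕ → ℕ × ℕ → Prop} {τ : ℕ → ℕ}

/-- The columns from `u - 1` to `u + 1` all have their terminals in row `π b` or above, so
rectangles of consecutive columns and edges next to terminals appear in column `u` from row `π b` on
only. -/
theorem not_FV {b u l : ℕ} (hb : b < G.n) (h1 : G.lc b < u) (h2 : u < b) (h3 : l < G.π b) :
    ¬ FV G u l := by
  rintro ⟨-, -, ⟨h4, h5, h6⟩ | ⟨h4, h5, h6⟩ | h4 | h4⟩
  · have h7 := G.lt_π hb (u := u) h1.le h2
    have h8 : G.π b ≤ G.π (u + 1) := by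
      rcases Nat.lt_or_ge (u + 1) b with h | h
      · exact (G.lt_π hb (u := u + 1) (by omega) h).le
      · rw [show u + 1 = b by omega]
    omega
  · have h7 := G.lt_π hb (u := u) h1.le h2
    have h8 := G.lt_π hb (u := u - 1) (by omega) (by omega)
    omega
  · have h7 := G.lt_π hb (u := u) h1.le h2
    omega
  · have h7 := G.lt_π hb (u := u) h1.le h2
    omega

theorem not_FH {b u l : ℕ} (hb : b < G.n) (h1 : G.ld b < l) (h2 : l < G.π b) (h3 : u < b) :
    ¬ FH G u l := by
  refine not_FV (G := G.T) (b := G.π b) (G.π_lt b hb) (by rwa [lc_T G hb]) h2 ?_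
  simpa only [Frame.T, G.σπ b hb] using h3

/-- The right or upward orientation of an edge is an arc. -/
def Arrow (A : ℕ × ℕ → ℕ × ℕ → Prop) (e : Edge) : Prop :=
  if e.1 then A (e.2.1, e.2.2) (e.2.1 + 1, e.2.2) else A (e.2.1, e.2.2) (e.2.1, e.2.2 + 1)

/-- The last arc of the path from the lower left to terminal `b` is horizontal. -/
def InL (G : Frame) (A : ℕ × ℕ → ℕ × ℕ → Prop) (b : ℕ) : Prop := A (b - 1, G.π b) (b, G.π b)

theorem RU.last {p q : ℕ × ℕ} (h : RU A p q) : p = q ∨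
    (1 ≤ q.1 ∧ A (q.1 - 1, q.2) q ∧ RU A p (q.1 - 1, q.2)) ∨
    (1 ≤ q.2 ∧ A (q.1, q.2 - 1) q ∧ RU A p (q.1, q.2 - 1)) := by
  rcases Relation.ReflTransGen.cases_tail h with h | ⟨a, h1, h2, rfl | rfl⟩
  · exact Or.inl h.symm
  · exact Or.inr (Or.inl ⟨by simp, h2, h1⟩)
  · exact Or.inr (Or.inr ⟨by simp, h2, h1⟩)

theorem IsNet.in_ru (h : IsNet G A) {b : ℕ} (hb : b < G.n) (hc : 1 ≤ G.lc b) :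
    RU A (G.lc b - 1, G.π (G.lc b - 1)) (b, G.π b) := by
  have := G.lc_le (b := b)
  exact h.ru (by omega) hb (by omega) (G.π_lc_lt hc).le

/-- Only two edges at the terminal lead to the left or down. The entering path ends with one of them
and the leaving path begins with the other, as an edge has a single orientation. -/
theorem IsNet.inL_iff (h : IsNet G A) {b : ℕ} (hb : b < G.n) (hc : 1 ≤ G.lc b) :
    InL G A b ↔ ¬ A (b, G.π b - 1) (b, G.π b) := by
  have h1 := (h.in_ru hb hc).last
  have h2 := (h.rev.in_ru hb hc).last
  have h3 := G.lc_le (b := b)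
  have hne : ¬ ((G.lc b - 1, G.π (G.lc b - 1)) = (b, G.π b)) := by
    intro h; have := congrArg Prod.fst h; simp only at this; omega
  simp only [hne, false_or] at h1 h2
  unfold InL
  constructor
  · intro h4 h5
    rcases h2 with h2 | h2
    · exact h.anti _ _ h4 h2.2.1
    · exact h.anti _ _ h5 h2.2.1
  · intro h4
    rcases h1 with h1 | h1
    · exact h1.2.1
    · exact absurd h1.2.1 h4

/-- A terminal entered horizontally is left vertically; after transposition and reversal this is
again a horizontal entry. Thus one alternative governs the charges in both frames. -/
theorem IsNet.inL_T (h : IsNet G A) {b : ℕ} (hb : b < G.n) (hc : 1 ≤ G.lc b) :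
    InL G.T (tA A) (G.π b) ↔ InL G A b := by
  have h1 := h.inL_iff hb hc
  have h2 := h.rev.inL_iff hb hc
  have h3 : InL G.T (tA A) (G.π b) ↔ A (b, G.π b) (b, G.π b - 1) := by
    simp only [InL, tA, Frame.T, G.σπ b hb, Prod.swap]
  have h4 : InL G (rA A) b → ¬ InL G A b := fun h5 h6 => h.anti _ _ h5 h6
  have h5 : rA A (b, G.π b - 1) (b, G.π b) → ¬ A (b, G.π b - 1) (b, G.π b) := fun h5 h6 => h.anti _ _ h5 h6
  rw [h3]
  change A (b, G.π b) (b, G.π b - 1) ↔ _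
  have h6 : rA A (b, G.π b - 1) (b, G.π b) ↔ A (b, G.π b) (b, G.π b - 1) := Iff.rfl
  tauto

open Classical in
/-- The edges of the region that do not lie in every network and are oriented to the right or up. -/
noncomputable def EIn (G : Frame) (A : ℕ × ℕ → ℕ × ℕ → Prop) (c d : ℕ) : Finset Edge :=
  (Sreg G c d).filter fun e => ¬ InF G e ∧ Arrow A e

open Classical in
/-- The bottom row of the region. -/
noncomputable def bottom (G : Frame) (c d : ℕ) : Finset Edge :=
  (Sreg G c d).filter fun e => e.1 = true ∧ e.2.2 = d

/-- Edges that are reserved for triples. -/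
def Spare (G : Frame) (τ : ℕ → ℕ) (c d : ℕ) (e : Edge) : Prop :=
  (e.1 = true ∧ ∃ i s, G.Mem c d i ∧ G.Nx i s ∧ τ i = 4 ∧ e.2.1 + 1 = i ∧ G.π s ≤ e.2.2 ∧ e.2.2 < G.π i) ∨
    (e.1 = false ∧ ∃ s t, G.Mem c d s ∧ G.Nx s t ∧ τ t = 6 ∧ e.2.2 + 1 = G.π t ∧ s ≤ e.2.1 ∧ e.2.1 < t)

open Classical in
/-- The edges of the rectangles of consecutive terminals on the row of `j`, moved to row `r`. -/
noncomputable def rowF (G : Frame) (j x r : ℕ) : Finset Edge :=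
  ((Finset.Ico (G.lc j) x).filter fun u => FH G u (G.π j)).image fun u => (true, u, r)

open Classical in
/-- The edges of the rectangles of consecutive terminals on column `j`, moved to column `x`. -/
noncomputable def colF (G : Frame) (j y x : ℕ) : Finset Edge :=
  ((Finset.Ico (G.ld j) y).filter fun l => FV G j l).image fun l => (false, x, l)

open Classical in
/-- Edges that replace the first edges of the path to `j`. -/
noncomputable def Off (S : Sol G τ) (A : ℕ × ℕ → ℕ × ℕ → Prop) (j : ℕ) : Finset Edge :=
  if τ j = 2 ∨ τ j = 5 then ∅
  else if InL G A j then rowF G j (S.X j) (S.ρ j)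
  else colF G j (S.ρ j) (S.X j) ∪ if τ j = 4 then {(true, j - 1, S.ρ j)} else ∅

open Classical in
/-- The members of a staircase. -/
noncomputable def memF (G : Frame) (c d : ℕ) : Finset ℕ := (Finset.range G.n).filter (G.Mem c d)

theorem mem_memF {c d b : ℕ} : b ∈ memF G c d ↔ G.Mem c d b := by
  simp only [memF, Finset.mem_filter, Finset.mem_range, and_iff_right_iff_imp]
  exact fun h => h.1.1

open Classical in
/-- The projection of the edges to the lines of the nodes. -/
noncomputable def snap (S : Sol G τ) (c d : ℕ) (e : Edge) : Edge :=
  if e.1 then (true, e.2.1, ((memF G c d).filter fun i => S.ρ i < e.2.2).sup S.ρ)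
  else (false, ((memF G c d).filter fun i => S.X i < e.2.1).sup S.X, e.2.2)

theorem wt_snap (S : Sol G τ) (c d : ℕ) (e : Edge) : G.wt (snap S c d e) = G.wt e := by
  obtain ⟨k, u, l⟩ := e
  cases k <;> simp [snap, wt]

theorem sup_eq_of {s : Finset ℕ} {f : ℕ → ℕ} {j : ℕ} (hj : j ∈ s) (h : ∀ i ∈ s, f i ≤ f j) :
    s.sup f = f j := le_antisymm (Finset.sup_le h) (Finset.le_sup hj)

/-- The projection is defined from the edge alone and must not depend on the path in which the edge
is used. It gives the row of the node of `j` because no row of a node lies strictly between `ρ j`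
and `π j`. -/
theorem snap_h (hB : Blocks G τ) (S : Sol G τ) {c d j u l : ℕ} (hj : G.Mem c d j)
    (h1 : S.ρ j < l) (h2 : l ≤ G.π j) : snap S c d (true, u, l) = (true, u, S.ρ j) := by
  classical
  simp only [snap, if_true, Prod.mk.injEq, true_and]
  refine sup_eq_of (by simp [mem_memF, hj, h1]) ?_
  intro i hi
  simp only [Finset.mem_filter, mem_memF] at hi
  rcases lt_trichotomy i j with h | rfl | h
  · have := S.nodes.ρ_eq_or hB hi.1 hj h; omega
  · exact le_rfl
  · exact (S.nodes.mono hB hj hi.1 h.le).2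

theorem snap_v (hB : Blocks G τ) (S : Sol G τ) {c d j u l : ℕ} (hj : G.Mem c d j)
    (h1 : S.X j < u) (h2 : u ≤ j) : snap S c d (false, u, l) = (false, S.X j, l) := by
  classical
  simp only [snap, Bool.false_eq_true, if_false, Prod.mk.injEq, true_and, and_true]
  refine sup_eq_of (by simp [mem_memF, hj, h1]) ?_
  intro i hi
  simp only [Finset.mem_filter, mem_memF] at hi
  rcases lt_trichotomy i j with h | rfl | h
  · exact (S.nodes.mono hB hi.1 hj h.le).1
  · exact le_rfl
  · have := S.nodes.le_X hB hj hi.1 h; omega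

open Classical in
/-- The edges that join the nodes to the left boundary. -/
noncomputable def EAll (S : Sol G τ) (A : ℕ × ℕ → ℕ × ℕ → Prop) (AB : Finset Edge) (c d : ℕ) : Finset Edge :=
  (EIn G A c d \ AB) ∪ (EIn G A c d \ AB).image (snap S c d) ∪ (memF G c d).biUnion (Off S A) ∪ bottom G c d

theorem W_image_le {E : Finset Edge} {g : Edge → Edge} (h : ∀ e ∈ E, G.wt (g e) = G.wt e) :
    G.W (E.image g) ≤ G.W E := by
  classical
  unfold W
  calc ∑ e ∈ E.image g, G.wt e ≤ ∑ e ∈ E, G.wt (g e) :=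
        Finset.sum_image_le_of_nonneg (fun e _ => G.wt_nonneg e)
    _ = _ := Finset.sum_congr rfl h

theorem W_biUnion_le {ι : Type*} {s : Finset ι} {g : ι → Finset Edge} : G.W (s.biUnion g) ≤ ∑ j ∈ s, G.W (g j) := by
  classical
  induction s using Finset.induction_on with
  | empty => simp [W]
  | insert a s ha ih =>
    rw [Finset.biUnion_insert, Finset.sum_insert ha]
    have := G.W_union_le (g a) (s.biUnion g)
    linarith

/-- The factor two originates here: an edge of the network is used at its place and a second time
after projection. -/
theorem W_EAll_le (S : Sol G τ) (AB : Finset Edge) (c d : ℕ) :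
    G.W (EAll S A AB c d) ≤ 2 * G.W (EIn G A c d \ AB) + ∑ j ∈ memF G c d, G.W (Off S A j) +
      G.W (bottom G c d) := by
  classical
  unfold EAll
  have h1 := G.W_union_le ((EIn G A c d \ AB) ∪ (EIn G A c d \ AB).image (snap S c d) ∪ (memF G c d).biUnion (Off S A)) (bottom G c d)
  have h2 := G.W_union_le ((EIn G A c d \ AB) ∪ (EIn G A c d \ AB).image (snap S c d)) ((memF G c d).biUnion (Off S A))
  have h3 := G.W_union_le (EIn G A c d \ AB) ((EIn G A c d \ AB).image (snap S c d))
  have h4 := W_image_le (G := G) (E := EIn G A c d \ AB) (g := snap S c d) fun e _ => wt_snap S c d e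
  have h5 := W_biUnion_le (G := G) (s := memF G c d) (g := Off S A)
  linarith

theorem toCol_row {E : Finset Edge} {c l : ℕ} : ∀ u, c ≤ u → (∀ x, c ≤ x → x < u → (true, x, l) ∈ E) →
    ToCol E c (u, l) := by
  intro u hu
  induction u, hu using Nat.le_induction with
  | base => intro _; exact ⟨l, .refl⟩
  | succ m hm ih =>
    intro h
    exact ToCol.head (q := (m, l)) (Or.inl ⟨rfl, rfl, h m hm (by omega)⟩) (ih fun x h1 h2 => h x h1 (by omega))

/-- The path of the network from the lower left to `j` is clamped coordinatewise to the quadrant to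
the lower left of the node, so that it ends at the node. A step that survives clamping comes from an
edge of the path, kept in place or projected. Edges of F and spare edges are not available, and
`Off` supplies substitutes for them. Once the bottom row is reached, `bottom` leads to column `c`.
-/
theorem toCol_EAll (h : IsNet G A) (hB : Blocks G τ) (S : Sol G τ) {AB : Finset Edge} {c d j : ℕ}
    (hAB : ∀ e ∈ AB, Spare G τ c d e) (hj : G.Mem c d j) (hτ : ¬ (τ j = 2 ∨ τ j = 5)) :
    ToCol (EAll S A AB c d) c (S.X j, S.ρ j) := by
  classical
  have hjn := hj.1.1
  have hjc := hj.2.1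
  have hjd := hj.2.2
  have hc1 : 1 ≤ G.lc j := hj.1.2.1
  have hXj := S.nodes.X_le hB hj
  have hρj := S.nodes.ρ_lt hB hj
  have hoff : ∀ e ∈ Off S A j, e ∈ EAll S A AB c d := fun e he =>
    Finset.mem_union_left _ (Finset.mem_union_right _ (Finset.mem_biUnion.2 ⟨j, mem_memF.2 hj, he⟩))
  have hin : ∀ e ∈ EIn G A c d \ AB, e ∈ EAll S A AB c d := fun e he =>
    Finset.mem_union_left _ (Finset.mem_union_left _ (Finset.mem_union_left _ he))
  have hsn : ∀ e ∈ EIn G A c d \ AB, snap S c d e ∈ EAll S A AB c d := fun e he =>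
    Finset.mem_union_left _ (Finset.mem_union_left _ (Finset.mem_union_right _ (Finset.mem_image_of_mem _ he)))
  have key : ∀ v, RU A (G.lc j - 1, G.π (G.lc j - 1)) v → RU A v (j, G.π j) → c ≤ v.1 → d ≤ v.2 →
      ToCol (EAll S A AB c d) c (min v.1 (S.X j), min v.2 (S.ρ j)) := by
    intro v hv
    induction hv with
    | refl => intro _ h1; simp only; omega
    | @tail v' v hpv hs ih =>
      intro hvj h1 h2
      have hle := RU.le hvj
      simp only at hle
      by_cases h3 : v.1 = c
      · rw [h3, min_eq_left (by omega)]
        exact ⟨_, .refl⟩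
      by_cases h4 : v.2 = d
      · rw [h4, min_eq_left (by omega : d ≤ S.ρ j)]
        refine toCol_row _ (by omega) fun x hx hx' => Finset.mem_union_right _ ?_
        refine Finset.mem_filter.2 ⟨mem_Sreg_h hj.1.nd hjc hjd hx (by omega) le_rfl (by omega), rfl, rfl⟩
      have hv'j : RU A v' (j, G.π j) := Relation.ReflTransGen.head hs hvj
      obtain ⟨x, y⟩ := v'
      obtain ⟨harc, rfl | rfl⟩ := hs
      · simp only at *
        have ih' := ih hv'j (by omega) h2
        rcases Nat.lt_or_ge x (S.X j) with hx | hx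
        swap
        · rwa [min_eq_right (by omega), ← min_eq_right hx]
        refine ToCol.head (q := (min x (S.X j), min y (S.ρ j))) (Or.inl ⟨by simp only; omega, rfl, ?_⟩) ih'
        rw [min_eq_left hx.le]
        have heS : (true, x, y) ∈ Sreg G c d := mem_Sreg_h hj.1.nd hjc hjd (by omega) (by omega) h2 hle.2
        by_cases hF : FH G x y
        -- Above the bottom row and left of `j`, the rows of the rectangle carry edges of F only in
        -- the row of `j`. The path then stays in this row up to `j`, so `j` is entered horizontally
        -- and `Off` contains the shifted edge.
        · have hy : y = G.π j := by
            by_contra hy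
            exact not_FH hjn (by omega) (by omega) (by omega) hF
          have hL : InL G A j := by
            have := hv'j.row (by simp [hy]) (j - 1) (by simp only; omega) (by simp only; omega)
            simp only [hy, show j - 1 + 1 = j by omega] at this
            exact this
          apply hoff
          rw [Off, if_neg hτ, if_pos hL, min_eq_right (by omega)]
          refine Finset.mem_image.2 ⟨x, Finset.mem_filter.2 ⟨Finset.mem_Ico.2 ⟨by omega, hx⟩, by rwa [← hy]⟩, rfl⟩
        by_cases hA : (true, x, y) ∈ AB
        · rcases hAB _ hA with ⟨-, i, s, hic, h5, h6, h7, h8, h9⟩ | ⟨h5, -⟩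
          swap
          · simp at h5
          simp only at h7 h8 h9
          have hi4 := h5.reg
          have hxi : i ≤ j := by omega
          obtain ⟨s', t1, t2, t3⟩ := hB.t1 i hi4 h6
          obtain rfl := h5.unique t1
          -- A path that uses a spare edge next to `i` can only lead to `i` or to its successor; the
          -- latter has type `5` and is excluded, since it shares its node with the third terminal
          -- of the triple.
          have hij : i = j := by
            by_contra hne
            have h10 := h5.le_right hic hj (by omega)
            rcases h10.lt_or_eq with h11 | rfl
            · have := (h5.mem hic).anti hj h11; omega
            · exact hτ (Or.inr t3)
          subst hij
          have hL : ¬ InL G A i := by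
            rw [h.inL_iff hjn hc1, not_not]
            have := hvj.col (by simp only; omega) (G.π i - 1) (by simp only; omega) (by simp only; omega)
            simp only [h7, show G.π i - 1 + 1 = G.π i by omega] at this
            exact this
          apply hoff
          rw [Off, if_neg hτ, if_neg hL, if_pos h6]
          obtain ⟨t, t4, t5, t6⟩ := hB.t2' s h5.reg' t3
          have := S.nodes.next' i s t h5 t4 h6
          have := t4.π_lt
          rw [min_eq_right (by omega)]
          simp only [Finset.mem_union, Finset.mem_singleton]
          right
          rw [← h7]; rfl
        have heI : (true, x, y) ∈ EIn G A c d \ AB := by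
          refine Finset.mem_sdiff.2 ⟨Finset.mem_filter.2 ⟨heS, by simpa [InF] using hF, by simpa [Arrow] using harc⟩, hA⟩
        rcases Nat.lt_or_ge (S.ρ j) y with hy | hy
        · have := hsn _ heI
          rw [snap_h hB S hj hy hle.2] at this
          rwa [min_eq_right hy.le]
        · rw [min_eq_left hy]; exact hin _ heI
      · simp only at *
        have ih' := ih hv'j h1 (by omega)
        rcases Nat.lt_or_ge y (S.ρ j) with hx | hx
        swap
        · rwa [min_eq_right (b := S.ρ j) (by omega), ← min_eq_right (a := y) hx]
        refine ToCol.head (q := (min x (S.X j), min y (S.ρ j))) (Or.inr ⟨rfl, by simp only; omega, ?_⟩) ih'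
        rw [min_eq_left (b := S.ρ j) hx.le]
        have heS : (false, x, y) ∈ Sreg G c d := mem_Sreg_v hj.1.nd hjc hjd h1 hle.1 (by omega) (by omega)
        by_cases hF : FV G x y
        · have hy : x = j := by
            by_contra hy
            exact not_FV hjn (by omega) (by omega) (by omega) hF
          have hL : ¬ InL G A j := by
            rw [h.inL_iff hjn hc1, not_not]
            have := hv'j.col (by simp [hy]) (G.π j - 1) (by simp only; omega) (by simp only; omega)
            simp only [hy, show G.π j - 1 + 1 = G.π j by omega] at this
            exact this
          apply hoff
          rw [Off, if_neg hτ, if_neg hL, min_eq_right (by omega)]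
          refine Finset.mem_union_left _ (Finset.mem_image.2 ⟨y, Finset.mem_filter.2 ⟨Finset.mem_Ico.2 ⟨by omega, hx⟩, by rwa [← hy]⟩, rfl⟩)
        by_cases hA : (false, x, y) ∈ AB
        · rcases hAB _ hA with ⟨h5, -⟩ | ⟨-, s, t, hsc, h5, h6, h7, h8, h9⟩
          · simp at h5
          simp only at h7 h8 h9
          obtain ⟨s', t1, t2, t3⟩ := hB.t3 t h5.reg' h6
          obtain rfl := h5.unique_left t1
          have htc := h5.mem hsc
          have h10 : j < t := chain_mono hj.1.nd htc.1.nd (hj.2.1.trans htc.2.1.symm) (by omega)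
          have h11 := h5.le_left hsc hj h10
          obtain rfl : j = s := by omega
          -- Vertical spare edges could be used only on the way to the middle terminal of the
          -- triple, which is excluded as well.
          exact absurd (Or.inr t3) hτ
        have heI : (false, x, y) ∈ EIn G A c d \ AB := by
          refine Finset.mem_sdiff.2 ⟨Finset.mem_filter.2 ⟨heS, by simpa [InF] using hF, by simpa [Arrow] using harc⟩, hA⟩
        rcases Nat.lt_or_ge (S.X j) x with hy | hy
        · have := hsn _ heI
          rw [snap_v hB S hj hy hle.1] at this
          rwa [min_eq_right (b := S.X j) hy.le]
        · rw [min_eq_left (b := S.X j) hy]; exact hin _ heI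
  have := key (j, G.π j) (h.in_ru hjn hc1) .refl (by simp only; omega) (by simp only; omega)
  rwa [min_eq_right (by simp only; omega), min_eq_right (by simp only; omega)] at this


variable {G : Frame} {A : ℕ × ℕ → ℕ × ℕ → Prop} {τ : ℕ → ℕ}

/-! ### The edges of the optimal trees and what they are charged to -/

/-- The two parts into which an interval is split. -/
inductive Child (S : Sol G τ) : ℕ × ℕ → ℕ × ℕ → Prop
  | left (a b : ℕ) (h : a < b) : Child S (a, b) (a, S.sp a b)
  | right (a b : ℕ) (h : a < b) : Child S (a, b) (S.sc (S.sp a b), b)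

/-- The next top interval. -/
def RootStep (S : Sol G τ) (a a' : ℕ) : Prop := G.Nx (S.ar a) a'

/-- `r` is the left end of a top interval. -/
def Root (S : Sol G τ) (r : ℕ) : Prop :=
  ∃ a, G.Reg a ∧ (∀ p, ¬ G.Nx p a) ∧ Relation.ReflTransGen (RootStep S) a r

/-- The intervals of the optimal trees. -/
def Used (S : Sol G τ) (a b : ℕ) : Prop :=
  ∃ r, Root S r ∧ Relation.ReflTransGen (Child S) (r, S.ar r) (a, b)

/-- The edges that join the two parts of an interval. -/
def TE (S : Sol G τ) (a b : ℕ) : Finset Edge :=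
  vseg (S.X a) (S.ρ b) (S.ρ (S.sp a b)) ∪ hseg (S.X a) (S.X (S.sc (S.sp a b))) (S.ρ b)

/-- The edges that join the tree of a top interval to the left boundary. -/
def Exit (S : Sol G τ) (r : ℕ) : Finset Edge := hseg (G.lc r) (S.X r) (S.ρ (S.ar r))

/-- The edges that join terminals to their nodes. -/
def Ex (S : Sol G τ) (j : ℕ) : Finset Edge :=
  if τ j = 3 then hseg (S.pr j) j (G.π j - 1) ∪ vseg (S.pr j) (G.π j - 1) (G.π j)
  else if τ j = 5 then vseg (S.pr j) (G.π j - 1) (G.π j)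
  else if τ j = 6 then hseg (S.pr j) j (G.π j - 1) ∪ (vseg (S.pr j) (G.π j - 1) (G.π j) ∪
    vseg (S.pr (S.pr j)) (G.π j - 1) (G.π j))
  else ∅

/-- The edge for a terminal in the column next to the left boundary. -/
def Spc (G : Frame) (b : ℕ) : Finset Edge :=
  if b = G.lc b + 1 ∧ G.ld b + 2 ≤ G.π b then {(true, G.lc b, G.π b - 1)} else ∅

/-- The edges of the trees, except those that cross the strip below the region. -/
def DE (S : Sol G τ) (e : Edge) : Prop :=
  (∃ a b, Used S a b ∧ a < b ∧ e ∈ TE S a b) ∨ (∃ r, Root S r ∧ e ∈ Exit S r) ∨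
    (∃ j, G.Reg j ∧ e ∈ Ex S j) ∨ ∃ b, G.ND b ∧ e ∈ Spc G b

theorem Sol.split {S : Sol G τ} {c d a b : ℕ} (ha : G.Mem c d a) (hb : G.Mem c d b) (hab : a < b) :
    ∃ s, G.Nx (S.sp a b) s ∧ S.sc (S.sp a b) = s ∧ G.Mem c d (S.sp a b) ∧ G.Mem c d s ∧
      a ≤ S.sp a b ∧ S.sp a b < s ∧ s ≤ b := by
  obtain ⟨h1, h2, h3⟩ := S.sp_mem a b ha.1 (by rwa [ha.2.1, ha.2.2]) hab
  rw [ha.2.1, ha.2.2] at h1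
  obtain ⟨s, hs⟩ := h1.nx_ex hb h3
  exact ⟨s, hs, S.sc_eq _ _ hs, h1, hs.mem h1, h2, hs.lt, hs.le_right h1 hb h3⟩

/-- Pairs of members of one staircase. -/
def PairIn (G : Frame) (c d : ℕ) (p : ℕ × ℕ) : Prop := G.Mem c d p.1 ∧ G.Mem c d p.2 ∧ p.1 ≤ p.2

theorem Child.pairIn {S : Sol G τ} {c d : ℕ} {p q : ℕ × ℕ} (h : Child S p q) (hp : PairIn G c d p) :
    PairIn G c d q := by
  cases h with
  | left a b h =>
    obtain ⟨s, h1, h2, h3, h4, h5, h6, h7⟩ := Sol.split (S := S) hp.1 hp.2.1 h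
    exact ⟨hp.1, h3, h5⟩
  | right a b h =>
    obtain ⟨s, h1, h2, h3, h4, h5, h6, h7⟩ := Sol.split (S := S) hp.1 hp.2.1 h
    rw [h2]
    exact ⟨h4, hp.2.1, h7⟩

theorem pairIn_of_child {S : Sol G τ} {c d : ℕ} {p q : ℕ × ℕ} (h : Relation.ReflTransGen (Child S) p q)
    (hp : PairIn G c d p) : PairIn G c d q := by
  induction h with
  | refl => exact hp
  | tail _ h ih => exact h.pairIn ih

theorem Sol.ar_mem' {S : Sol G τ} {c d a : ℕ} (ha : G.Mem c d a) : PairIn G c d (a, S.ar a) := by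
  have := S.ar_mem a ha.1
  rw [ha.2.1, ha.2.2] at this
  exact ⟨ha, this.1, this.2⟩

theorem W_TE_le (hB : Blocks G τ) (S : Sol G τ) {c d a b : ℕ} (ha : G.Mem c d a) (hb : G.Mem c d b)
    (hab : a < b) : G.W (TE S a b) ≤ (G.ys (S.ρ (S.sp a b)) - G.ys (S.ρ b)) +
      (G.xs (S.X (S.sc (S.sp a b))) - G.xs (S.X a)) := by
  obtain ⟨s, h1, h2, h3, h4, h5, h6, h7⟩ := Sol.split (S := S) ha hb hab
  have h8 := S.nodes.mono hB h3 hb (by omega)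
  have h9 := S.nodes.mono hB ha h4 (by omega)
  refine (G.W_union_le _ _).trans ?_
  rw [W_vseg G h8.2 (S.nodes.ρ_lt hB h3).2.2, h2, W_hseg G h9.1 (S.nodes.X_le hB h4).2.2]

/-- Unfolding the recursion for `M` along the chosen splitting points produces actual edges of at
most this total length. -/
theorem tree_W (hB : Blocks G τ) (S : Sol G τ) {c d : ℕ} (k : ℕ) : ∀ a b, b ≤ a + k → PairIn G c d (a, b) →
    ∃ E, G.W E ≤ S.M a b ∧ ∀ a' b', Relation.ReflTransGen (Child S) (a, b) (a', b') → a' < b' →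
      TE S a' b' ⊆ E := by
  induction k with
  | zero =>
    rintro a b hk ⟨h1, h2, h3⟩
    simp only at h1 h2 h3
    obtain rfl : a = b := by omega
    refine ⟨∅, by simp [W, S.M_self a h1.1], ?_⟩
    intro a' b' h h'
    rcases Relation.ReflTransGen.cases_head h with h | ⟨q, hq, -⟩
    · simp only [Prod.mk.injEq] at h; omega
    · cases hq <;> omega
  | succ k ih =>
    rintro a b hk ⟨h1, h2, h3⟩
    simp only at h1 h2 h3
    rcases h3.lt_or_eq with h3 | rfl
    swap
    · exact ih a a (by omega) ⟨h1, h2, le_rfl⟩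
    classical
    obtain ⟨s, t1, t2, t3, t4, t5, t6, t7⟩ := Sol.split (S := S) h1 h2 h3
    obtain ⟨E1, w1, e1⟩ := ih a (S.sp a b) (by omega) ⟨h1, t3, t5⟩
    obtain ⟨E2, w2, e2⟩ := ih s b (by omega) ⟨t4, h2, t7⟩
    refine ⟨E1 ∪ E2 ∪ TE S a b, ?_, ?_⟩
    · have := S.M_eq a b h1.1 (by rwa [h1.2.1, h1.2.2]) h3
      have h4 := W_TE_le hB S h1 h2 h3
      have h5 := G.W_union_le (E1 ∪ E2) (TE S a b)
      have h6 := G.W_union_le E1 E2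
      rw [t2] at this h4
      linarith
    · intro a' b' h h'
      rcases Relation.ReflTransGen.cases_head h with h | ⟨q, hq, hq'⟩
      · simp only [Prod.mk.injEq] at h
        obtain ⟨rfl, rfl⟩ := h
        exact Finset.subset_union_right
      · cases hq with
        | left _ _ _ => exact (e1 a' b' hq' h').trans (Finset.subset_union_left.trans Finset.subset_union_left)
        | right _ _ _ =>
          rw [t2] at hq'
          exact (e2 a' b' hq' h').trans (Finset.subset_union_right.trans Finset.subset_union_left)

theorem roots_W (hB : Blocks G τ) (S : Sol G τ) {c d : ℕ} (k : ℕ) : ∀ a, G.n ≤ a + k → G.Mem c d a →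
    ∃ E, G.W E ≤ S.f a ∧ ∀ r, Relation.ReflTransGen (RootStep S) a r → Exit S r ⊆ E ∧
      ∀ a' b', Relation.ReflTransGen (Child S) (r, S.ar r) (a', b') → a' < b' → TE S a' b' ⊆ E := by
  induction k with
  | zero => intro a hk ha; have := ha.1.1; omega
  | succ k ih =>
    intro a hk ha
    classical
    have har := Sol.ar_mem' (S := S) ha
    obtain ⟨E1, w1, e1⟩ := tree_W hB S _ a (S.ar a) (Nat.le_add_left _ _) har
    have hX := S.nodes.X_le hB ha
    have hexit : G.W (Exit S a) = G.xs (S.X a) - G.xs (G.lc a) :=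
      W_hseg G (by have := ha.2.1; omega) hX.2.2
    by_cases hs : ∃ s, G.Nx (S.ar a) s
    · obtain ⟨s, hs⟩ := hs
      obtain ⟨E2, w2, e2⟩ := ih s (by have := hs.lt; have := har.2.2; simp only at this; omega) (hs.mem har.2.1)
      refine ⟨E1 ∪ Exit S a ∪ E2, ?_, ?_⟩
      · have := S.f_eq_next a s ha.1 hs
        have h5 := G.W_union_le (E1 ∪ Exit S a) E2
        have h6 := G.W_union_le E1 (Exit S a)
        linarith
      · intro r hr
        rcases Relation.ReflTransGen.cases_head hr with rfl | ⟨q, hq, hq'⟩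
        · refine ⟨Finset.subset_union_right.trans Finset.subset_union_left, fun a' b' h h' => ?_⟩
          exact (e1 a' b' h h').trans (Finset.subset_union_left.trans Finset.subset_union_left)
        · obtain rfl := hs.unique hq
          obtain ⟨h1, h2⟩ := e2 r hq'
          exact ⟨h1.trans Finset.subset_union_right, fun a' b' h h' => (h2 a' b' h h').trans Finset.subset_union_right⟩
    · push Not at hs
      refine ⟨E1 ∪ Exit S a, ?_, ?_⟩
      · have := S.f_eq_last a ha.1 hs
        have h6 := G.W_union_le E1 (Exit S a)
        linarith
      · intro r hr
        rcases Relation.ReflTransGen.cases_head hr with rfl | ⟨q, hq, hq'⟩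
        · refine ⟨Finset.subset_union_right, fun a' b' h h' => (e1 a' b' h h').trans Finset.subset_union_left⟩
        · exact absurd hq (hs q)

/-- The length of the edges of rectangles of consecutive terminals on the row of `j`. -/
noncomputable def rowW (G : Frame) (j : ℕ) : ℝ := G.W (rowF G j j (G.π j))
/-- The length of the edges of rectangles of consecutive terminals on column `j`. -/
noncomputable def colW (G : Frame) (j : ℕ) : ℝ := G.W (colF G j (G.π j) j)
/-- The length of the edge to the left of terminal `j`. -/
noncomputable def gapX (G : Frame) (j : ℕ) : ℝ := G.wt (true, j - 1, G.π j)
/-- The length of the edge below terminal `j`. -/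
noncomputable def gapY (G : Frame) (j : ℕ) : ℝ := G.wt (false, j, G.π j - 1)

open Classical in
/-- A bound for the edges that have to be charged to terminal `j`. -/
noncomputable def cD (G : Frame) (τ : ℕ → ℕ) (A : ℕ × ℕ → ℕ × ℕ → Prop) (j : ℕ) : ℝ :=
  if τ j = 1 then (if InL G A j then rowW G j else colW G j)
  else if τ j = 3 then rowW G j + colW G j
  else if τ j = 4 then (if InL G A j then rowW G j else gapX G j)
  else if τ j = 5 then gapY G j
  else if τ j = 6 then gapY G j + rowW G j + (if InL G A j then gapY G j else colW G j)
  else 0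

theorem W_rowF (j x r : ℕ) : G.W (rowF G j x r) = G.W (rowF G j x (G.π j)) := by
  classical
  unfold rowF W
  rw [Finset.sum_image (by intro a _ b _ h; simpa using h), Finset.sum_image (by intro a _ b _ h; simpa using h)]
  simp [wt]

theorem W_colF (j y x : ℕ) : G.W (colF G j y x) = G.W (colF G j y j) := by
  classical
  unfold colF W
  rw [Finset.sum_image (by intro a _ b _ h; simpa using h), Finset.sum_image (by intro a _ b _ h; simpa using h)]
  simp [wt]

theorem W_rowF_le {j x r : ℕ} (h : x ≤ j) : G.W (rowF G j x r) ≤ rowW G j := by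
  classical
  rw [W_rowF]
  apply G.W_mono
  unfold rowF
  exact Finset.image_subset_image (Finset.filter_subset_filter _ (Finset.Ico_subset_Ico_right h))

theorem W_colF_le {j y x : ℕ} (h : y ≤ G.π j) : G.W (colF G j y x) ≤ colW G j := by
  classical
  rw [W_colF]
  apply G.W_mono
  unfold colF
  exact Finset.image_subset_image (Finset.filter_subset_filter _ (Finset.Ico_subset_Ico_right h))

/-- If the row of `j` consists of edges of F from `p` on, the horizontal segment from `p` to `j`
that joins `j` to a shared node and the shifted edges to the left of `p` fit together into the
length of F in that row. -/
theorem W_rowF_add_le {j p r : ℕ} (hj : j < G.n) (h1 : G.lc j ≤ p) (h2 : p ≤ j)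
    (hF : ∀ u, p ≤ u → u < j → FH G u (G.π j)) :
    G.W (rowF G j p r) + (G.xs j - G.xs p) ≤ rowW G j := by
  classical
  rw [W_rowF, ← W_hseg G (l := G.π j) h2 hj, ← W_union]
  · apply G.W_mono
    intro e he
    rcases Finset.mem_union.1 he with he | he
    · unfold rowF at he ⊢
      exact Finset.image_subset_image (Finset.filter_subset_filter _ (Finset.Ico_subset_Ico_right h2)) he
    · rw [mem_hseg] at he
      obtain ⟨k, u, l⟩ := e
      obtain ⟨h3, h4, h5, h6⟩ := he
      simp only at h3 h4 h5 h6
      subst h3 h6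
      exact Finset.mem_image.2 ⟨u, Finset.mem_filter.2 ⟨Finset.mem_Ico.2 ⟨by omega, h5⟩, hF u h4 h5⟩, rfl⟩
  · rw [Finset.disjoint_left]
    intro e he he'
    rw [mem_hseg] at he'
    obtain ⟨u, hu, rfl⟩ := Finset.mem_image.1 he
    have := (Finset.mem_Ico.1 (Finset.mem_filter.1 hu).1).2
    simp only at he'
    omega

theorem FV_own {j : ℕ} (hj : j < G.n) (h : 1 ≤ G.π j) : FV G j (G.π j - 1) := by
  have := G.π_lt j hj
  exact ⟨hj, by omega, Or.inr (Or.inr (Or.inr (by omega)))⟩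

theorem FH_own {j : ℕ} (hj : j < G.n) (h : 1 ≤ j) : FH G (j - 1) (G.π j) := by
  have := FV_own (G := G.T) (j := G.π j) (G.π_lt j hj) (by simpa only [Frame.T, G.σπ j hj] using h)
  rwa [show G.T.π (G.π j) = j from G.σπ j hj] at this

theorem FH_RT {p j u : ℕ} (hj : j < G.n) (hp : p < G.n) (h : G.π j + 1 = G.π p) (h1 : p ≤ u) (h2 : u < j) :
    FH G u (G.π j) := by
  have h3 := G.π_lt j hj
  have h4 := G.π_lt p hp
  refine ⟨h3, by show u + 1 < G.n; omega, Or.inl ⟨by show G.π j + 1 < G.n; omega, ?_⟩⟩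
  simp only [Frame.T, h, G.σπ j hj, G.σπ p hp, Btw]
  omega

/-- For adjacent rows the segment is a side of the rectangle of the two terminals; for adjacent
columns it is the single edge next to `j`. -/
theorem FH_tight {p j u : ℕ} (hpj : G.Nx p j) (ht : G.π j + 1 = G.π p ∨ j = p + 1)
    (h1 : p ≤ u) (h2 : u < j) : FH G u (G.π j) := by
  rcases ht with ht | ht
  · exact FH_RT hpj.reg'.1 hpj.reg.1 ht h1 h2
  · obtain rfl : u = j - 1 := by omega
    exact FH_own hpj.reg'.1 (by omega)

theorem W_colF_pred_add {j x : ℕ} (hj : j < G.n) (h1 : G.ld j + 1 ≤ G.π j) :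
    G.W (colF G j (G.π j - 1) x) + gapY G j ≤ colW G j := by
  classical
  rw [W_colF]
  have : gapY G j = G.W {(false, j, G.π j - 1)} := by simp [W, gapY]
  rw [this, ← W_union]
  · apply G.W_mono
    intro e he
    rcases Finset.mem_union.1 he with he | he
    · unfold colF at he ⊢
      exact Finset.image_subset_image (Finset.filter_subset_filter _ (Finset.Ico_subset_Ico_right (by omega))) he
    · rw [Finset.mem_singleton] at he
      subst he
      exact Finset.mem_image.2 ⟨_, Finset.mem_filter.2 ⟨Finset.mem_Ico.2 ⟨by omega, by omega⟩, FV_own hj (by omega)⟩, rfl⟩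
  · rw [Finset.disjoint_singleton_right]
    intro he
    obtain ⟨u, hu, h⟩ := Finset.mem_image.1 he
    have := (Finset.mem_Ico.1 (Finset.mem_filter.1 hu).1).2
    simp only [Prod.mk.injEq, true_and] at h
    omega

theorem gapX_le_rowW {j : ℕ} (hj : j < G.n) (h1 : G.lc j + 1 ≤ j) : gapX G j ≤ rowW G j := by
  classical
  have : gapX G j = G.W {(true, j - 1, G.π j)} := by simp [W, gapX]
  rw [this]
  apply G.W_mono
  intro e he
  rw [Finset.mem_singleton] at he
  subst he
  exact Finset.mem_image.2 ⟨_, Finset.mem_filter.2 ⟨Finset.mem_Ico.2 ⟨by omega, by omega⟩, FH_own hj (by omega)⟩, rfl⟩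

theorem W_vseg_pred {x j : ℕ} (hj : j < G.n) (h : 1 ≤ G.π j) :
    G.W (vseg x (G.π j - 1) (G.π j)) = gapY G j := by
  have := G.π_lt j hj
  have h2 : vseg x (G.π j - 1) (G.π j) = {(false, x, G.π j - 1)} := by
    ext ⟨k, u, l⟩
    simp only [mem_vseg, Finset.mem_singleton, Prod.mk.injEq]
    grind
  simp [h2, W, gapY, wt]

/-- The values of `cD` are chosen type by type so that this holds and so that the charges of a frame
and of its transpose add up to the row and the column of the terminal, apart from two gaps at either
end of a triple. -/
theorem charge_le (hB : Blocks G τ) (S : Sol G τ) {c d j : ℕ} (hj : G.Mem c d j) :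
    G.W (Off S A j) + G.W (Ex S j) ≤ cD G τ A j := by
  classical
  have hjn := hj.1.1
  have hc := hj.1.2.2.1
  have hd := hj.1.2.2.2
  have hX := S.nodes.X_le hB hj
  have hρ := S.nodes.ρ_lt hB hj
  have hty := hB.ty j hj.1
  have h0 : G.W ∅ = 0 := by simp [W]
  have hcases : τ j = 1 ∨ τ j = 2 ∨ τ j = 3 ∨ τ j = 4 ∨ τ j = 5 ∨ τ j = 6 := by omega
  rcases hcases with h | h | h | h | h | h
  · simp only [Off, Ex, cD, h]
    norm_num [h0]
    split_ifs
    · exact W_rowF_le hX.1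
    · exact W_colF_le hρ.1.le
  · simp [Off, Ex, cD, h, h0]
  · obtain ⟨p, h1, h2, h3⟩ := hB.p2 j hj.1 h
    have hpc := h1.mem' hj
    have hp1 := hpc.1.2.2.1
    have hp2 := hpc.2.1
    have hj2 := hj.2.1
    have hlt := h1.lt
    have e1 := S.pr_eq p j h1
    have e2 := S.nodes.pred p j h1 (Or.inl h)
    have e3 := S.nodes.last j hj.1 (by omega)
    have w1 := W_rowF_add_le (r := S.ρ j) hjn (by omega) hlt.le (fun u => FH_tight h1 h2)
    have w2 := W_colF_pred_add (x := p) hjn (by omega)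
    have w3 := G.W_union_le (hseg p j (G.π j - 1)) (vseg p (G.π j - 1) (G.π j))
    rw [W_hseg G hlt.le hjn, W_vseg_pred hjn (by omega)] at w3
    have w4 := G.W_nonneg (rowF G j p (S.ρ j))
    have w5 := G.W_nonneg (colF G j (G.π j - 1) p)
    simp only [Off, Ex, cD, h, e1, e2, show S.ρ j = G.π j - 1 by omega] at *
    norm_num [h0]
    split_ifs <;> linarith
  · simp only [Off, Ex, cD, h]
    norm_num [h0]
    have e1 := S.nodes.own j hj.1 (by omega) (by omega)
    split_ifs
    · rw [e1]; exact W_rowF_le le_rfl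
    · obtain ⟨s, h1, h2, h3⟩ := hB.t1 j hj.1 h
      obtain ⟨t, h4, h5, h6⟩ := hB.t2' s h1.reg' h3
      have e2 := S.nodes.next' j s t h1 h4 h
      -- The successor `s` is in the next column, so the rectangle of `j` and `s` reaches down to
      -- row `π s` only, and the node is below that row. No edge of F has to be shifted, and only
      -- the substitute for a spare edge remains.
      have e3 : colF G j (S.ρ j) (S.X j) = ∅ := by
        unfold colF
        rw [Finset.image_eq_empty, Finset.filter_eq_empty_iff]
        intro l hl hF
        rw [Finset.mem_Ico] at hl
        have h8 := h1.π_lt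
        obtain ⟨-, -, ⟨-, h7⟩ | ⟨-, h7⟩ | h7 | h7⟩ := hF
        · rw [← h2] at h7; unfold Btw at h7; omega
        · have := G.lt_π hjn (u := j - 1) (by omega) (by omega)
          unfold Btw at h7; omega
        · omega
        · omega
      rw [e3]
      simp [W, gapX, wt]
  · obtain ⟨p, h1, h2, h3⟩ := hB.t2 j hj.1 h
    simp only [Off, Ex, cD, h]
    norm_num [h0]
    rw [W_vseg_pred hjn (by omega)]
  · obtain ⟨p, h1, h2, h3⟩ := hB.t3 j hj.1 h
    have hpc := h1.mem' hj
    have hp1 := hpc.1.2.2.1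
    have hp2 := hpc.2.1
    have hj2 := hj.2.1
    have hlt := h1.lt
    have e1 := S.pr_eq p j h1
    have e2 := S.nodes.pred p j h1 (Or.inr h)
    have e3 := S.nodes.last j hj.1 (by omega)
    have w1 := W_rowF_add_le (r := S.ρ j) hjn (by omega) hlt.le (fun u => FH_tight h1 (Or.inl h2))
    have w2 := W_colF_pred_add (x := p) hjn (by omega)
    have w3 := G.W_union_le (hseg p j (G.π j - 1)) (vseg p (G.π j - 1) (G.π j) ∪ vseg (S.pr p) (G.π j - 1) (G.π j))
    have w6 := G.W_union_le (vseg p (G.π j - 1) (G.π j)) (vseg (S.pr p) (G.π j - 1) (G.π j))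
    rw [W_hseg G hlt.le hjn] at w3
    rw [W_vseg_pred hjn (by omega), W_vseg_pred hjn (by omega)] at w6
    have w4 := G.W_nonneg (rowF G j p (S.ρ j))
    have w5 := G.W_nonneg (colF G j (G.π j - 1) p)
    simp only [Off, Ex, cD, h, e1, e2, show S.ρ j = G.π j - 1 by omega] at *
    norm_num [h0]
    split_ifs <;> linarith


/-! ### Spare edges of triples, and the bound for one staircase -/

variable {G : Frame} {A : ℕ × ℕ → ℕ × ℕ → Prop} {τ : ℕ → ℕ}

/-- Suppose there is no such edge. Since `i` is entered horizontally, it is left downwards, and the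
leaving path must descend in column `i` beyond row `π s`. The cycle of `i` and `s = i + 1` then runs
in the sense in which `s` is entered along its row from `(i, π s)`. The entering path reaches this
point neither from the left, by assumption, nor from below, where the leaving path uses the edge in
the opposite direction. -/
theorem IsNet.alpha_aux (h : IsNet G A) {i s : ℕ} (his : G.Nx i s) (hs : s = i + 1) (hL : InL G A i) :
    ∃ l, G.π s ≤ l ∧ l < G.π i ∧ HasE A (true, i - 1, l) := by
  by_contra hno
  push Not at hno
  have hin := his.reg.1
  have hsn := his.reg'.1
  have hc := his.reg.2.1
  have hlc := his.lc
  have hi2 := his.reg.2.2.1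
  have hpi := his.π_lt
  have hno1 : ∀ l, G.π s ≤ l → l < G.π i → ¬ A (i - 1, l) (i, l) ∧ ¬ A (i, l) (i - 1, l) := by
    intro l h1 h2
    have := hno l h1 h2
    simp only [HasE, if_true, show i - 1 + 1 = i by omega] at this
    tauto
  have hne : ∀ y, (G.lc i - 1, G.π (G.lc i - 1)) ≠ (i, y) := by
    intro y hy; have := congrArg Prod.fst hy; simp only at this; omega
  have h1 := (h.rev.in_ru hin hc).last
  simp only [hne, false_or] at h1
  have h2 : rA A (i, G.π i - 1) (i, G.π i) ∧ RU (rA A) (G.lc i - 1, G.π (G.lc i - 1)) (i, G.π i - 1) := by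
    rcases h1 with h1 | h1
    · exact absurd h1.2.1 (h.anti _ _ hL)
    · exact h1.2
  -- The leaving path descends row by row: a turn to the left is excluded by assumption.
  have h3 : ∀ k l, l + 1 + k = G.π i → G.π s ≤ l → rA A (i, l) (i, l + 1) ∧
      RU (rA A) (G.lc i - 1, G.π (G.lc i - 1)) (i, l) := by
    intro k
    induction k with
    | zero =>
      intro l hl _
      rw [show G.π i - 1 = l by omega, show G.π i = l + 1 by omega] at h2
      exact h2
    | succ k ih =>
      intro l hl hl'
      have := (ih (l + 1) (by omega) (by omega)).2.last
      simp only [hne, false_or] at this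
      rcases this with h4 | h4
      · exact absurd h4.2.1 (hno1 (l + 1) (by omega) (by omega)).2
      · exact h4.2
  obtain ⟨h4, h5⟩ := h3 (G.π i - G.π s - 1) (G.π s) (by omega) le_rfl
  have h5' := h5.last
  simp only [hne, false_or] at h5'
  have h6 : A (i, G.π s) (i, G.π s - 1) := by
    rcases h5' with h7 | h7
    · exact absurd h7.2.1 (hno1 _ le_rfl hpi).2
    · exact h7.2.1
  subst hs
  rcases h.cycDown hsn hpi with hB | hB
  · exact h.anti _ _ (hB.1 _ le_rfl hpi).1 h4
  · have h7 : InL G A (i + 1) := hB.2.2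
    have h8 := (h.in_ru hsn (by rw [hlc]; exact hc)).last
    have hne' : ∀ y, (G.lc (i + 1) - 1, G.π (G.lc (i + 1) - 1)) ≠ (i, y) := by rw [hlc]; exact hne
    have h9 : RU A (G.lc (i + 1) - 1, G.π (G.lc (i + 1) - 1)) (i, G.π (i + 1)) := by
      rcases h8 with h8 | h8 | h8
      · have := congrArg Prod.fst h8; simp only at this; omega
      · exact h8.2.2
      · exact absurd h8.2.1 ((h.inL_iff hsn (by rw [hlc]; exact hc)).1 h7)
    have h10 := h9.last
    simp only [hne', false_or] at h10
    rcases h10 with h11 | h11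
    · exact (hno1 _ le_rfl hpi).1 h11.2.1
    · exact h.anti _ _ h6 h11.2.1

/-- If `i` is not entered horizontally, it is left horizontally, and the reversed network takes
over. -/
theorem IsNet.alpha (h : IsNet G A) {i s : ℕ} (his : G.Nx i s) (hs : s = i + 1) :
    ∃ l, G.π s ≤ l ∧ l < G.π i ∧ HasE A (true, i - 1, l) := by
  by_cases hL : InL G A i
  · exact h.alpha_aux his hs hL
  · have h1 := (h.rev.inL_iff his.reg.1 his.reg.2.1).2 (h.anti _ _ (by
      rw [h.inL_iff his.reg.1 his.reg.2.1, not_not] at hL; exact hL))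
    obtain ⟨l, h2, h3, h4⟩ := h.rev.alpha_aux his hs h1
    exact ⟨l, h2, h3, hasE_rA.1 h4⟩

theorem IsNet.beta (h : IsNet G A) {s t : ℕ} (hst : G.Nx s t) (ht : G.π t + 1 = G.π s) :
    ∃ u, s ≤ u ∧ u < t ∧ HasE A (false, u, G.π t - 1) := by
  obtain ⟨u, h1, h2, h3⟩ := h.T.alpha hst.T ht.symm
  rw [hasE_tA] at h3
  simp only [Frame.T, G.σπ s hst.reg.1, G.σπ t hst.reg'.1] at h1 h2
  exact ⟨u, h1, h2, h3⟩

/-- The edges of the trees of one staircase. -/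
def DEc (S : Sol G τ) (c d : ℕ) (e : Edge) : Prop :=
  (∃ a b, Used S a b ∧ a < b ∧ G.Mem c d a ∧ e ∈ TE S a b) ∨ (∃ r, Root S r ∧ G.Mem c d r ∧ e ∈ Exit S r) ∨
    (∃ j, G.Mem c d j ∧ e ∈ Ex S j) ∨ ∃ b, G.ND b ∧ G.lc b = c ∧ G.ld b = d ∧ e ∈ Spc G b

open Classical in
/-- The terminals of a staircase whose region is not degenerate. -/
noncomputable def ndF (G : Frame) (c d : ℕ) : Finset ℕ :=
  (Finset.range G.n).filter fun b => G.ND b ∧ G.lc b = c ∧ G.ld b = d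

theorem mem_ndF {c d b : ℕ} : b ∈ ndF G c d ↔ G.ND b ∧ G.lc b = c ∧ G.ld b = d := by
  simp only [ndF, Finset.mem_filter, Finset.mem_range, and_iff_right_iff_imp]
  exact fun h => h.1.1

open Classical in
/-- The charge of a terminal. -/
noncomputable def cN (G : Frame) (τ : ℕ → ℕ) (A : ℕ × ℕ → ℕ × ℕ → Prop) (b : ℕ) : ℝ :=
  if G.Reg b then cD G τ A b else if b = G.lc b + 1 ∧ G.ld b + 2 ≤ G.π b then rowW G b else 0

theorem rootStep_mem {S : Sol G τ} {c d a r : ℕ} (ha : G.Mem c d a)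
    (h : Relation.ReflTransGen (RootStep S) a r) : G.Mem c d r := by
  induction h with
  | refl => exact ha
  | tail _ h ih => exact Nx.mem h (Sol.ar_mem' ih).2.1

theorem Root.first {S : Sol G τ} {c d r : ℕ} (hr : Root S r) (hc : G.Mem c d r) :
    ∃ a, G.Mem c d a ∧ (∀ p, ¬ G.Nx p a) ∧ Relation.ReflTransGen (RootStep S) a r := by
  obtain ⟨a, h1, h2, h3⟩ := hr
  have h4 := rootStep_mem (c := G.lc a) (d := G.ld a) ⟨h1, rfl, rfl⟩ h3
  exact ⟨a, ⟨h1, h4.2.1.symm.trans hc.2.1, h4.2.2.symm.trans hc.2.2⟩, h2, h3⟩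

theorem Root.reg {S : Sol G τ} {r : ℕ} (hr : Root S r) : G.Reg r := by
  obtain ⟨a, h1, h2, h3⟩ := hr
  exact (rootStep_mem (c := G.lc a) (d := G.ld a) ⟨h1, rfl, rfl⟩ h3).1

theorem Used.pairIn {S : Sol G τ} {a b : ℕ} (h : Used S a b) : PairIn G (G.lc a) (G.ld a) (a, b) := by
  obtain ⟨r, h1, h2⟩ := h
  have h3 := pairIn_of_child h2 (Sol.ar_mem' (c := G.lc r) (d := G.ld r) ⟨h1.reg, rfl, rfl⟩)
  have h4 := h3.1
  simp only at h4
  rw [h4.2.1, h4.2.2]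
  exact h3

theorem DE.chain {S : Sol G τ} {e : Edge} (h : DE S e) : ∃ c d, DEc S c d e := by
  rcases h with ⟨a, b, h1, h2, h3⟩ | ⟨r, h1, h2⟩ | ⟨j, h1, h2⟩ | ⟨b, h1, h2⟩
  · exact ⟨_, _, Or.inl ⟨a, b, h1, h2, h1.pairIn.1, h3⟩⟩
  · exact ⟨_, _, Or.inr (Or.inl ⟨r, h1, ⟨h1.reg, rfl, rfl⟩, h2⟩)⟩
  · exact ⟨_, _, Or.inr (Or.inr (Or.inl ⟨j, ⟨h1, rfl, rfl⟩, h2⟩))⟩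
  · exact ⟨_, _, Or.inr (Or.inr (Or.inr ⟨b, h1, rfl, rfl, h2⟩))⟩

/-- The trees cost at most `f` of the first terminal, which `Sol.f_le_W` bounds by the length of
`EAll`; the connections of terminals to nodes are charged by `charge_le`. Terminals of types `2` and
`5` need no path of their own, because their nodes coincide with those of their successors. -/
theorem chain_D (h : IsNet G A) (hB : Blocks G τ) (S : Sol G τ) {AB : Finset Edge} (c d : ℕ)
    (hAB : ∀ e ∈ AB, Spare G τ c d e) : ∃ E, (∀ e, DEc S c d e → e ∈ E) ∧
      G.W E ≤ 2 * G.W (EIn G A c d \ AB) + G.W (bottom G c d) + ∑ b ∈ ndF G c d, cN G τ A b := by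
  classical
  have hmem : memF G c d = (ndF G c d).filter G.Reg := by
    ext b
    simp only [mem_memF, Finset.mem_filter, mem_ndF, Mem]
    constructor
    · rintro ⟨h1, h2, h3⟩; exact ⟨⟨h1.nd, h2, h3⟩, h1⟩
    · rintro ⟨⟨h1, h2, h3⟩, h4⟩; exact ⟨h4, h2, h3⟩
  obtain ⟨E1, w1, e1⟩ : ∃ E1, G.W E1 ≤ 2 * G.W (EIn G A c d \ AB) + G.W (bottom G c d) +
      ∑ j ∈ memF G c d, G.W (Off S A j) ∧
      (∀ a b, Used S a b → a < b → G.Mem c d a → TE S a b ⊆ E1) ∧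
      ∀ r, Root S r → G.Mem c d r → Exit S r ⊆ E1 := by
    by_cases hne : ∃ a, G.Mem c d a
    · obtain ⟨a0, ha0, hmin⟩ : ∃ a, G.Mem c d a ∧ ∀ b, G.Mem c d b → a ≤ b :=
        ⟨Nat.find hne, Nat.find_spec hne, fun b hb => Nat.find_min' hne hb⟩
      obtain ⟨E1, w1, e1⟩ := roots_W hB S G.n a0 (by omega) ha0
      have hroot : ∀ r, Root S r → G.Mem c d r → Relation.ReflTransGen (RootStep S) a0 r := by
        intro r hr hrc
        obtain ⟨a, h1, h2, h3⟩ := hr.first hrc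
        rcases (hmin a h1).lt_or_eq with h4 | rfl
        · obtain ⟨p, hp⟩ := ha0.nx_ex' h1 h4
          exact absurd hp (h2 p)
        · exact h3
      refine ⟨E1, ?_, ?_, fun r hr hrc => (e1 r (hroot r hr hrc)).1⟩
      · have h1 := S.f_le_W hB (E := EAll S A AB c d) ha0 (by
          intro b hb
          by_cases hτ : τ b = 2 ∨ τ b = 5
          · have hty := hτ
            rcases hτ with hτ | hτ
            · obtain ⟨s, h2, -, h3⟩ := hB.p1 b hb.1 hτ
              have := toCol_EAll h hB S hAB (h2.mem hb) (by omega)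
              rwa [S.nodes.pred b s h2 (by omega), ← S.nodes.own b hb.1 (by omega) (by omega),
                show S.ρ s = S.ρ b by
                  have := S.nodes.next b s h2 hty; have := S.nodes.last s h2.reg' (by omega); omega] at this
            · obtain ⟨s, h2, -, h3⟩ := hB.t2' b hb.1 hτ
              have := toCol_EAll h hB S hAB (h2.mem hb) (by omega)
              rwa [S.nodes.pred b s h2 (by omega), ← S.nodes.own b hb.1 (by omega) (by omega),
                show S.ρ s = S.ρ b by
                  have := S.nodes.next b s h2 hty; have := S.nodes.last s h2.reg' (by omega); omega] at this
          · exact toCol_EAll h hB S hAB hb hτ)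
        have h2 := W_EAll_le (A := A) S AB c d
        linarith
      · rintro a b ⟨r, h1, h2⟩ hab hac
        have h3 := pairIn_of_child h2 (Sol.ar_mem' (c := G.lc r) (d := G.ld r) ⟨h1.reg, rfl, rfl⟩)
        have h4 := h3.1
        simp only at h4
        have hrc : G.Mem c d r := ⟨h1.reg, h4.2.1.symm.trans hac.2.1, h4.2.2.symm.trans hac.2.2⟩
        exact (e1 r (hroot r h1 hrc)).2 a b h2 hab
    · push Not at hne
      refine ⟨∅, ?_, fun a b _ _ h => absurd h (hne a), fun r _ h => absurd h (hne r)⟩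
      have h1 := G.W_nonneg (EIn G A c d \ AB)
      have h2 := G.W_nonneg (bottom G c d)
      have h3 : ∑ j ∈ memF G c d, G.W (Off S A j) ≥ 0 := Finset.sum_nonneg fun j _ => G.W_nonneg _
      have h4 : G.W ∅ = 0 := by simp [W]
      linarith
  refine ⟨E1 ∪ (memF G c d).biUnion (Ex S) ∪ (ndF G c d).biUnion (Spc G), ?_, ?_⟩
  · rintro e (⟨a, b, h1, h2, h3, h4⟩ | ⟨r, h1, h2, h3⟩ | ⟨j, h1, h2⟩ | ⟨b, h1, h2, h3, h4⟩)
    · exact Finset.mem_union_left _ (Finset.mem_union_left _ (e1.1 a b h1 h2 h3 h4))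
    · exact Finset.mem_union_left _ (Finset.mem_union_left _ (e1.2 r h1 h2 h3))
    · exact Finset.mem_union_left _ (Finset.mem_union_right _ (Finset.mem_biUnion.2 ⟨j, mem_memF.2 h1, h2⟩))
    · exact Finset.mem_union_right _ (Finset.mem_biUnion.2 ⟨b, mem_ndF.2 ⟨h1, h2, h3⟩, h4⟩)
  · have h1 := G.W_union_le (E1 ∪ (memF G c d).biUnion (Ex S)) ((ndF G c d).biUnion (Spc G))
    have h2 := G.W_union_le E1 ((memF G c d).biUnion (Ex S))
    have h3 := W_biUnion_le (G := G) (s := memF G c d) (g := Ex S)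
    have h4 := W_biUnion_le (G := G) (s := ndF G c d) (g := Spc G)
    have h5 : ∑ j ∈ memF G c d, G.W (Off S A j) + ∑ j ∈ memF G c d, G.W (Ex S j) ≤ ∑ j ∈ memF G c d, cD G τ A j := by
      rw [← Finset.sum_add_distrib]
      exact Finset.sum_le_sum fun j hj => charge_le hB S (mem_memF.1 hj)
    have h6 : ∑ j ∈ memF G c d, cD G τ A j + ∑ b ∈ ndF G c d, G.W (Spc G b) ≤ ∑ b ∈ ndF G c d, cN G τ A b := by
      rw [hmem, Finset.sum_filter, ← Finset.sum_add_distrib]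
      refine Finset.sum_le_sum fun b hb => ?_
      obtain ⟨hb, -, -⟩ := mem_ndF.1 hb
      have hb3 := hb.2.2
      have hg := gapX_le_rowW hb.1 hb.2.2.1
      unfold cN Spc
      by_cases h7 : b = G.lc b + 1 ∧ G.ld b + 2 ≤ G.π b
      · have h8 : ¬ G.Reg b := fun h => by have := h.2.2; omega
        have h9 : G.W {(true, G.lc b, G.π b - 1)} = gapX G b := by
          simp only [W, gapX, wt, Finset.sum_singleton, if_true]
          rw [show b - 1 = G.lc b by omega]
        rw [if_neg h8, if_neg h8, if_pos h7, if_pos h7, h9, zero_add]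
        exact hg
      · rw [if_neg h7, if_neg h7]
        split_ifs <;> simp [W]
    linarith

end Frame

/-! ### Adding up the charges of a frame and its transpose -/

/-- Transposition of edges. -/
def eT (e : Edge) : Edge := (!e.1, e.2.2, e.2.1)

@[simp] theorem eT_eT (e : Edge) : eT (eT e) = e := by obtain ⟨k, u, l⟩ := e; simp [eT]

theorem eT_inj : Function.Injective eT := Function.LeftInverse.injective eT_eT

namespace Frame

variable {G : Frame} {A : ℕ × ℕ → ℕ × ℕ → Prop} {τ : ℕ → ℕ}

theorem wt_eT (G : Frame) (e : Edge) : G.T.wt (eT e) = G.wt e := by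
  obtain ⟨k, u, l⟩ := e; cases k <;> rfl

theorem W_eT (G : Frame) (E : Finset Edge) : G.T.W (E.image eT) = G.W E := by
  unfold W
  rw [Finset.sum_image fun _ _ _ _ h => eT_inj h]
  exact Finset.sum_congr rfl fun e _ => G.wt_eT e

theorem InF_eT {e : Edge} : InF G.T (eT e) ↔ InF G e := by
  obtain ⟨k, u, l⟩ := e; cases k <;> rfl

theorem InRect_eT {b : ℕ} (hb : b < G.n) {e : Edge} : InRect G.T (G.π b) (eT e) ↔ InRect G b e := by
  obtain ⟨k, u, l⟩ := e
  have h : G.T.π (G.π b) = b := G.σπ b hb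
  cases k <;> simp [InRect, eT, lc_T G hb, ld_T G hb, h] <;> tauto

theorem mem_Sreg {c d : ℕ} {e : Edge} : e ∈ Sreg G c d ↔
    e ∈ gridE G.n ∧ ∃ b, G.ND b ∧ G.lc b = c ∧ G.ld b = d ∧ InRect G b e := by
  classical simp [Sreg]

theorem exists_T {P : ℕ → Prop} (h : ∀ r, P r → r < G.n) : (∃ r, P r) ↔ ∃ b, b < G.n ∧ P (G.π b) := by
  constructor
  · rintro ⟨r, hr⟩; exact ⟨G.σ r, G.σ_lt r (h r hr), by rwa [G.πσ r (h r hr)]⟩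
  · rintro ⟨b, -, hb⟩; exact ⟨_, hb⟩

theorem mem_Sreg_eT {c d : ℕ} {e : Edge} : eT e ∈ Sreg G.T d c ↔ e ∈ Sreg G c d := by
  rw [mem_Sreg, mem_Sreg]
  refine and_congr ?_ ?_
  · obtain ⟨k, u, l⟩ := e
    simp only [mem_gridE, eT, Frame.T]
    cases k <;> simp <;> tauto
  · rw [exists_T (G := G) (fun r hr => hr.1.1)]
    refine exists_congr fun b => ?_
    constructor
    · rintro ⟨hb, h1, h2, h3, h4⟩
      rw [ND_T hb] at h1; rw [lc_T G hb] at h2; rw [ld_T G hb] at h3; rw [InRect_eT hb] at h4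
      exact ⟨h1, h3, h2, h4⟩
    · rintro ⟨h1, h3, h2, h4⟩
      have hb := h1.1
      rw [ND_T hb, lc_T G hb, ld_T G hb, InRect_eT hb]
      exact ⟨hb, h1, h2, h3, h4⟩

open Classical in
/-- The edges of the region in rows of the rectangles of consecutive terminals. -/
noncomputable def HF (G : Frame) (c d : ℕ) : Finset Edge :=
  (Sreg G c d).filter fun e => e.1 = true ∧ InF G e

/-- The terminal of row `ld b - 1` is left of column `lc b` and that of row `ld b` is right of `b`,
so the bottom row of the rectangle is part of a side of the rectangle of these two. -/
theorem bottom_F {c d : ℕ} {e : Edge} (h : e ∈ bottom G c d) : InF G e := by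
  classical
  obtain ⟨h1, h2, h3⟩ := Finset.mem_filter.1 h
  obtain ⟨k, u, l⟩ := e
  simp only at h2 h3
  subst h2 h3
  obtain ⟨h4, b, hb, rfl, rfl, h5⟩ := mem_Sreg.1 h1
  simp only [InRect, if_true] at h5
  simp only [mem_gridE, if_true] at h4
  have hd := G.one_le_ld hb.1 hb.2.1
  have h6 := G.σ_ld_lt_lc hb.1 hb.2.1
  have h7 := G.lt_σ hb.1 (l := G.ld b) le_rfl hb.2.2.2
  have h8 := G.π_lt b hb.1
  refine ⟨h4.2.1, h4.2.2, Or.inr (Or.inl ⟨hd, ?_⟩)⟩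
  simp only [Frame.T, Btw]
  omega

/-- The terminals are in distinct rows, all above the bottom row, so no edge of F is counted twice.
-/
theorem HF_bound (c d : ℕ) : G.W (bottom G c d) + ∑ b ∈ ndF G c d, rowW G b ≤ G.W (HF G c d) := by
  classical
  have hrow : ∀ b ∈ ndF G c d, ∀ e ∈ rowF G b b (G.π b), e ∈ HF G c d ∧ e.2.2 = G.π b := by
    intro b hb e he
    obtain ⟨u, hu, rfl⟩ := Finset.mem_image.1 he
    obtain ⟨hu, hF⟩ := Finset.mem_filter.1 hu
    obtain ⟨hb, hc, hd⟩ := mem_ndF.1 hb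
    rw [Finset.mem_Ico] at hu
    have := hb.2.2.2
    exact ⟨Finset.mem_filter.2 ⟨mem_Sreg_h hb hc hd (by omega) (by omega) (by omega) le_rfl, rfl, hF⟩, rfl⟩
  have h1 : ∑ b ∈ ndF G c d, rowW G b = G.W ((ndF G c d).biUnion fun b => rowF G b b (G.π b)) := by
    unfold W
    rw [Finset.sum_biUnion]
    · rfl
    · intro a ha b hb hab
      rw [Function.onFun, Finset.disjoint_left]
      intro e h1 h2
      apply hab
      have h3 := (hrow a ha e h1).2
      have h4 := (hrow b hb e h2).2
      exact G.π_inj (mem_ndF.1 ha).1.1 (mem_ndF.1 hb).1.1 (h3.symm.trans h4)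
  rw [h1, ← W_union]
  · apply G.W_mono
    intro e he
    rcases Finset.mem_union.1 he with he | he
    · obtain ⟨h2, h3, -⟩ := Finset.mem_filter.1 he
      exact Finset.mem_filter.2 ⟨h2, h3, bottom_F he⟩
    · obtain ⟨b, hb, he⟩ := Finset.mem_biUnion.1 he
      exact (hrow b hb e he).1
  · rw [Finset.disjoint_left]
    intro e h1 h2
    obtain ⟨b, hb, he⟩ := Finset.mem_biUnion.1 h2
    have h3 := (hrow b hb e he).2
    have h4 := (Finset.mem_filter.1 h1).2.2
    obtain ⟨hb, hc, hd⟩ := mem_ndF.1 hb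
    have := hb.2.2.2
    omega

theorem rowW_T {b : ℕ} (hb : b < G.n) : rowW G.T (G.π b) = colW G b := by
  classical
  have h : G.T.π (G.π b) = b := G.σπ b hb
  unfold rowW colW
  rw [← W_eT, rowF, colF, lc_T G hb, h, Finset.image_image]
  rfl

theorem colW_T {b : ℕ} (hb : b < G.n) : colW G.T (G.π b) = rowW G b := by
  have := rowW_T (G := G.T) (b := G.π b) (G.π_lt b hb)
  rw [show G.T.π (G.π b) = b from G.σπ b hb] at this
  exact this.symm

theorem gapX_T {b : ℕ} (hb : b < G.n) : gapX G.T (G.π b) = gapY G b := by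
  unfold gapX gapY
  rw [show G.T.π (G.π b) = b from G.σπ b hb, ← wt_eT]
  rfl

theorem gapY_T {b : ℕ} (hb : b < G.n) : gapY G.T (G.π b) = gapX G b := by
  unfold gapX gapY
  rw [show G.T.π (G.π b) = b from G.σπ b hb, ← wt_eT]
  rfl

/-- The types of the blocks in the transposed frame. -/
def tyT (G : Frame) (τ : ℕ → ℕ) (r : ℕ) : ℕ := swapTy (τ (G.σ r))

open Classical in
/-- The length reserved for a terminal. -/
noncomputable def spareW (G : Frame) (τ : ℕ → ℕ) (b : ℕ) : ℝ :=
  if G.Reg b then (if τ b = 4 then gapX G b else if τ b = 6 then gapY G b else 0) else 0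

theorem rowW_nonneg (j : ℕ) : 0 ≤ rowW G j := G.W_nonneg _
theorem colW_nonneg (j : ℕ) : 0 ≤ colW G j := G.W_nonneg _

theorem gapY_le_colW {b : ℕ} (hb : G.ND b) : gapY G b ≤ colW G b := by
  have := gapX_le_rowW (G := G.T) (j := G.π b) (G.π_lt b hb.1) (by
    rw [lc_T G hb.1]; exact hb.2.2.2)
  rwa [gapX_T hb.1, rowW_T hb.1] at this

/-- A single pays with its row in one frame and with its column in the other, by `inL_T`. A terminal
of a pair pays with row and column in the frame where it has type `3` and with nothing in the other.
The middle of a triple pays two gaps. The ends of a triple exceed row and column by two gaps, which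
is the term `spareW`. -/
theorem cN_add_le (h : IsNet G A) (hB : Blocks G τ) {b : ℕ} (hb : G.ND b) :
    cN G τ A b + cN G.T (tyT G τ) (tA A) (G.π b) ≤ rowW G b + colW G b + 2 * spareW G τ b := by
  classical
  have hbn := hb.1
  have hX := gapX_le_rowW hbn hb.2.2.1
  have hY := gapY_le_colW hb
  have h1 := rowW_nonneg (G := G) b
  have h2 := colW_nonneg (G := G) b
  have hL := h.inL_T hbn hb.2.1
  have hπ : G.T.π (G.π b) = b := G.σπ b hbn
  unfold cN spareW
  rw [Reg_T hbn]
  by_cases hr : G.Reg b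
  · have hty := hB.ty b hr
    have h3 : tyT G τ (G.π b) = swapTy (τ b) := by unfold tyT; rw [G.σπ b hbn]
    simp only [hr, if_true, cD, h3, hL, rowW_T hbn, colW_T hbn, gapX_T hbn, gapY_T hbn]
    have hcases : τ b = 1 ∨ τ b = 2 ∨ τ b = 3 ∨ τ b = 4 ∨ τ b = 5 ∨ τ b = 6 := by omega
    rcases hcases with h | h | h | h | h | h <;> simp only [h, swapTy] <;> norm_num <;> (try split_ifs) <;> linarith
  · simp only [hr, if_false, lc_T G hbn, ld_T G hbn, hπ, rowW_T hbn]
    split_ifs <;> linarith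

theorem ndF_T (c d : ℕ) : ndF G.T d c = (ndF G c d).image G.π := by
  ext r
  rw [Finset.mem_image, mem_ndF]
  constructor
  · rintro ⟨h1, h2, h3⟩
    have hr : r < G.n := h1.1
    have hb := G.σ_lt r hr
    refine ⟨G.σ r, ?_, G.πσ r hr⟩
    rw [← G.πσ r hr] at h1 h2 h3
    rw [ND_T hb] at h1; rw [lc_T G hb] at h2; rw [ld_T G hb] at h3
    exact mem_ndF.2 ⟨h1, h3, h2⟩
  · rintro ⟨b, hb, rfl⟩
    obtain ⟨h1, h2, h3⟩ := mem_ndF.1 hb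
    rw [ND_T h1.1, lc_T G h1.1, ld_T G h1.1]
    exact ⟨h1, h3, h2⟩

theorem sum_ndF_T (c d : ℕ) (f : ℕ → ℝ) : ∑ r ∈ ndF G.T d c, f r = ∑ b ∈ ndF G c d, f (G.π b) := by
  classical
  rw [ndF_T, Finset.sum_image]
  intro a ha b hb hab
  exact G.π_inj (mem_ndF.1 ha).1.1 (mem_ndF.1 hb).1.1 hab

open Classical in
/-- The edges of a network outside the rectangles of consecutive terminals, in a region. -/
noncomputable def SN (G : Frame) (A : ℕ × ℕ → ℕ × ℕ → Prop) (c d : ℕ) : Finset Edge :=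
  (Sreg G c d).filter fun e => HasE A e ∧ ¬ InF G e

/-- One edge for each end of a triple, from `alpha` or `beta`, as long as the gap at that end. The
edges are distinct: a horizontal one determines the column of its terminal, a vertical one the row.
They are spare for the transposed blocks as well, so the same set is removed in both frames. -/
theorem exists_spare (h : IsNet G A) (hB : Blocks G τ) (c d : ℕ) : ∃ AB : Finset Edge, AB ⊆ SN G A c d ∧
    (∀ e ∈ AB, Spare G τ c d e ∧ Spare G.T (tyT G τ) d c (eT e)) ∧
    ∑ b ∈ ndF G c d, spareW G τ b = G.W AB := by
  classical
  have ex : ∀ b, ∃ e : Edge, G.Mem c d b → τ b = 4 ∨ τ b = 6 → e ∈ SN G A c d ∧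
      (Spare G τ c d e ∧ Spare G.T (tyT G τ) d c (eT e)) ∧ spareW G τ b = G.wt e ∧
      (if τ b = 4 then e.1 = true ∧ e.2.1 + 1 = b else e.1 = false ∧ e.2.2 + 1 = G.π b) := by
    intro b
    by_cases hb : G.Mem c d b ∧ (τ b = 4 ∨ τ b = 6)
    swap
    · exact ⟨(true, 0, 0), fun h1 h2 => absurd ⟨h1, h2⟩ hb⟩
    obtain ⟨hb, h4 | h6⟩ := hb
    · obtain ⟨s, h1, h2, h3⟩ := hB.t1 b hb.1 h4
      obtain ⟨l, h5, h6, h7⟩ := h.alpha h1 h2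
      have hs := h1.mem hb
      have hs2 := hs.1.2.2
      have hb2 := hb.1.2.2
      have e1 := hb.2
      have e2 := hs.2
      refine ⟨(true, b - 1, l), fun _ _ => ⟨?_, ⟨?_, ?_⟩, ?_, ?_⟩⟩
      · refine Finset.mem_filter.2 ⟨mem_Sreg_h hb.1.nd hb.2.1 hb.2.2 (by omega) (by omega) (by omega) h6.le, h7, ?_⟩
        simp only [InF, if_true]
        exact not_FH hb.1.1 (by omega) h6 (by omega)
      · exact Or.inl ⟨rfl, b, s, hb, h1, h4, by simp only; omega, h5, h6⟩
      · refine Or.inr ⟨rfl, G.π s, G.π b, hs.T', h1.T, by simp [tyT, G.σπ b hb.1.1, h4, swapTy], ?_, h5, h6⟩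
        simp only [eT, Frame.T, G.σπ b hb.1.1]; omega
      · simp [spareW, hb.1, h4, gapX, wt]
      · rw [if_pos h4]; exact ⟨rfl, by simp only; omega⟩
    · obtain ⟨s, h1, h2, h3⟩ := hB.t3 b hb.1 h6
      obtain ⟨u, h4, h5, h7⟩ := h.beta h1 h2
      have hs := h1.mem' hb
      have hs2 := hs.1.2.2
      have hb2 := hb.1.2.2
      have e1 := hb.2
      have e2 := hs.2
      refine ⟨(false, u, G.π b - 1), fun _ _ => ⟨?_, ⟨?_, ?_⟩, ?_, ?_⟩⟩
      · refine Finset.mem_filter.2 ⟨mem_Sreg_v hb.1.nd hb.2.1 hb.2.2 (by omega) h5.le (by omega) (by omega), h7, ?_⟩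
        simp only [InF, Bool.false_eq_true, if_false]
        exact not_FV hb.1.1 (by omega) h5 (by omega)
      · exact Or.inr ⟨rfl, s, b, hs, h1, h6, by simp only; omega, h4, h5⟩
      · refine Or.inl ⟨rfl, G.π b, G.π s, hb.T', h1.T, by simp [tyT, G.σπ b hb.1.1, h6, swapTy], ?_, ?_, ?_⟩
        · simp only [eT]; omega
        · simp only [eT, Frame.T, G.σπ s hs.1.1]; exact h4
        · simp only [eT, Frame.T, G.σπ b hb.1.1]; exact h5
      · simp [spareW, hb.1, h6, gapY, wt]
      · rw [if_neg (by omega)]; exact ⟨rfl, by simp only; omega⟩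
  choose g hg using ex
  have hsub : (ndF G c d).filter (fun b => G.Reg b ∧ (τ b = 4 ∨ τ b = 6)) ⊆ ndF G c d := Finset.filter_subset _ _
  have hm : ∀ b ∈ (ndF G c d).filter (fun b => G.Reg b ∧ (τ b = 4 ∨ τ b = 6)), G.Mem c d b ∧ (τ b = 4 ∨ τ b = 6) := by
    intro b hb
    obtain ⟨h1, h2, h3⟩ := Finset.mem_filter.1 hb
    exact ⟨⟨h2, (mem_ndF.1 h1).2⟩, h3⟩
  refine ⟨((ndF G c d).filter (fun b => G.Reg b ∧ (τ b = 4 ∨ τ b = 6))).image g, ?_, ?_, ?_⟩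
  · intro e he
    obtain ⟨b, hb, rfl⟩ := Finset.mem_image.1 he
    obtain ⟨h1, h2⟩ := hm b hb
    exact (hg b h1 h2).1
  · intro e he
    obtain ⟨b, hb, rfl⟩ := Finset.mem_image.1 he
    obtain ⟨h1, h2⟩ := hm b hb
    exact (hg b h1 h2).2.1
  · rw [← Finset.sum_subset hsub, W, Finset.sum_image]
    · refine Finset.sum_congr rfl fun b hb => ?_
      obtain ⟨h1, h2⟩ := hm b hb
      exact (hg b h1 h2).2.2.1
    · intro a ha b hb hab
      obtain ⟨h1, h2⟩ := hm a ha
      obtain ⟨h3, h4⟩ := hm b hb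
      have h5 := (hg a h1 h2).2.2.2
      have h6 := (hg b h3 h4).2.2.2
      rw [hab] at h5
      split_ifs at h5 h6
      · omega
      · rw [h5.1] at h6; simp at h6
      · rw [h5.1] at h6; simp at h6
      · exact G.π_inj h1.1.1 h3.1.1 (by omega)
    · intro b hb hb'
      simp only [Finset.mem_filter, hb, true_and, not_and] at hb'
      unfold spareW
      split_ifs with h1 h2 h3
      · exact absurd (Or.inl h2) (hb' h1)
      · exact absurd (Or.inr h3) (hb' h1)
      · rfl
      · rfl

/-- An edge of the network is directed to the right or up, or else to the left or down, so it enters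
the lower bound of only one of the two frames. -/
theorem W_EIn_le (h : IsNet G A) {c d : ℕ} {AB : Finset Edge} (hAB : AB ⊆ SN G A c d) :
    G.W (EIn G A c d \ AB) + G.T.W (EIn G.T (tA A) d c \ AB.image eT) + G.W AB ≤ G.W (SN G A c d) := by
  classical
  have h1 : G.T.W (EIn G.T (tA A) d c \ AB.image eT) = G.W ((EIn G.T (tA A) d c \ AB.image eT).image eT) := by
    rw [← W_eT G.T]; rfl
  have h2 : ∀ e, e ∈ (EIn G.T (tA A) d c \ AB.image eT).image eT →
      e ∈ Sreg G c d ∧ ¬ InF G e ∧ Arrow (tA A) (eT e) ∧ e ∉ AB := by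
    intro e he
    obtain ⟨e', he', rfl⟩ := Finset.mem_image.1 he
    obtain ⟨he', h3⟩ := Finset.mem_sdiff.1 he'
    obtain ⟨h4, h5, h6⟩ := Finset.mem_filter.1 he'
    refine ⟨?_, ?_, by rwa [eT_eT], fun h7 => h3 (Finset.mem_image.2 ⟨_, h7, eT_eT e'⟩)⟩
    · rw [← mem_Sreg_eT, eT_eT]; exact h4
    · rw [← InF_eT, eT_eT]; exact h5
  rw [h1, ← W_union, ← W_union]
  · apply G.W_mono
    intro e he
    rcases Finset.mem_union.1 he with he | he
    · rcases Finset.mem_union.1 he with he | he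
      · obtain ⟨h4, h5, h6⟩ := Finset.mem_filter.1 (Finset.mem_sdiff.1 he).1
        refine Finset.mem_filter.2 ⟨h4, ?_, h5⟩
        unfold Arrow at h6; unfold HasE; split_ifs at h6 ⊢ <;> exact Or.inl h6
      · obtain ⟨h4, h5, h6, -⟩ := h2 e he
        refine Finset.mem_filter.2 ⟨h4, ?_, h5⟩
        obtain ⟨k, u, l⟩ := e
        cases k <;> simp [Arrow, eT, tA] at h6 <;> simp [HasE, h6]
    · exact hAB he
  · rw [Finset.disjoint_left]
    intro e he
    rcases Finset.mem_union.1 he with he | he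
    · exact (Finset.mem_sdiff.1 he).2
    · exact (h2 e he).2.2.2
  · rw [Finset.disjoint_left]
    intro e he he'
    obtain ⟨h4, h5, h6⟩ := Finset.mem_filter.1 (Finset.mem_sdiff.1 he).1
    obtain ⟨-, -, h7, -⟩ := h2 e he'
    obtain ⟨k, u, l⟩ := e
    cases k <;> simp [Arrow, eT, tA] at h6 h7 <;> exact h.anti _ _ h6 h7

open Classical in
/-- The edges of the region on the rectangles of consecutive terminals. -/
noncomputable def SF (G : Frame) (c d : ℕ) : Finset Edge := (Sreg G c d).filter (InF G)

/-- The rows of the transposed frame are columns, so the bottom rows and the rows and columns of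
terminals of both frames together use F only once. -/
theorem HF_add (c d : ℕ) : G.W (HF G c d) + G.T.W (HF G.T d c) ≤ G.W (SF G c d) := by
  classical
  rw [show G.T.W (HF G.T d c) = G.W ((HF G.T d c).image eT) by rw [← W_eT G.T]; rfl, ← W_union]
  · apply G.W_mono
    intro e he
    rcases Finset.mem_union.1 he with he | he
    · obtain ⟨h1, -, h2⟩ := Finset.mem_filter.1 he
      exact Finset.mem_filter.2 ⟨h1, h2⟩
    · obtain ⟨e', he', rfl⟩ := Finset.mem_image.1 he
      obtain ⟨h1, -, h2⟩ := Finset.mem_filter.1 he'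
      refine Finset.mem_filter.2 ⟨?_, ?_⟩
      · rw [← mem_Sreg_eT, eT_eT]; exact h1
      · rw [← InF_eT, eT_eT]; exact h2
  · rw [Finset.disjoint_left]
    intro e he he'
    obtain ⟨e', he'', rfl⟩ := Finset.mem_image.1 he'
    have h1 := (Finset.mem_filter.1 he).2.1
    have h2 := (Finset.mem_filter.1 he'').2.1
    simp [eT, h2] at h1

/-- The comparison in one region. -/
theorem chain_bound (h : IsNet G A) (hB : Blocks G τ) (S : Sol G τ) (S' : Sol G.T (tyT G τ)) (c d : ℕ) :
    ∃ E, (∀ e, DEc S c d e → e ∈ E) ∧ (∀ e, DEc S' d c e → eT e ∈ E) ∧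
      G.W E ≤ G.W (SF G c d) + 2 * G.W (SN G A c d) := by
  classical
  obtain ⟨AB, h1, h2, h3⟩ := exists_spare h hB c d
  obtain ⟨E1, e1, w1⟩ := chain_D h hB S c d (fun e he => (h2 e he).1)
  obtain ⟨E2, e2, w2⟩ := chain_D h.T hB.T S' (AB := AB.image eT) d c (by
    intro e he
    obtain ⟨e', he', rfl⟩ := Finset.mem_image.1 he
    exact (h2 e' he').2)
  refine ⟨E1 ∪ E2.image eT, fun e he => Finset.mem_union_left _ (e1 e he),
    fun e he => Finset.mem_union_right _ (Finset.mem_image_of_mem _ (e2 e he)), ?_⟩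
  have h4 := G.W_union_le E1 (E2.image eT)
  rw [show G.W (E2.image eT) = G.T.W E2 from W_eT G.T E2] at h4
  have h5 := W_EIn_le h h1
  have h6 := HF_bound (G := G) c d
  have h7 := HF_bound (G := G.T) d c
  have h8 := HF_add (G := G) c d
  rw [sum_ndF_T] at h7 w2
  have h9 : ∑ b ∈ ndF G c d, rowW G.T (G.π b) = ∑ b ∈ ndF G c d, colW G b :=
    Finset.sum_congr rfl fun b hb => rowW_T (mem_ndF.1 hb).1.1
  have h10 : ∑ b ∈ ndF G c d, cN G τ A b + ∑ b ∈ ndF G c d, cN G.T (tyT G τ) (tA A) (G.π b) ≤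
      ∑ b ∈ ndF G c d, rowW G b + ∑ b ∈ ndF G c d, colW G b + 2 * ∑ b ∈ ndF G c d, spareW G τ b := by
    rw [Finset.mul_sum, ← Finset.sum_add_distrib, ← Finset.sum_add_distrib, ← Finset.sum_add_distrib]
    exact Finset.sum_le_sum fun b hb => cN_add_le h hB (mem_ndF.1 hb).1
  change G.T.W E2 ≤ _ + _ + ∑ b ∈ ndF G c d, cN G.T (tyT G τ) (tA A) (G.π b) at w2
  linarith

end Frame

/-! ### The four directions -/

/-- Reflection of edges in `n` columns. -/
def eX (n : ℕ) (e : Edge) : Edge := if e.1 then (true, n - 2 - e.2.1, e.2.2) else (false, n - 1 - e.2.1, e.2.2)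

/-- Reflection of edges in `n` rows. -/
def eY (n : ℕ) (e : Edge) : Edge := eT (eX n (eT e))

/-- The edge that a reflection moves to `e`. -/
def mE (n : ℕ) (q : Bool × Bool) (e : Edge) : Edge :=
  if q.1 then (if q.2 then eX n (eY n e) else eX n e) else if q.2 then eY n e else e

/-- Reflection of vertices. -/
def vE (n : ℕ) (q : Bool × Bool) (p : ℕ × ℕ) : ℕ × ℕ :=
  (if q.1 then n - 1 - p.1 else p.1, if q.2 then n - 1 - p.2 else p.2)

/-- `p` is an end of `e`. -/
def EndP (e : Edge) (p : ℕ × ℕ) : Prop :=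
  p = e.2 ∨ p = if e.1 then (e.2.1 + 1, e.2.2) else (e.2.1, e.2.2 + 1)

theorem mem_gridE_eT {n : ℕ} {e : Edge} : eT e ∈ Frame.gridE n ↔ e ∈ Frame.gridE n := by
  obtain ⟨k, u, l⟩ := e
  simp only [Frame.mem_gridE, eT]
  cases k <;> simp <;> tauto

theorem eX_grid {n : ℕ} {e : Edge} (h : e ∈ Frame.gridE n) : eX n e ∈ Frame.gridE n := by
  obtain ⟨k, u, l⟩ := e
  rw [Frame.mem_gridE] at h ⊢
  cases k <;> simp [eX] at h ⊢ <;> omega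

theorem eX_eX {n : ℕ} {e : Edge} (h : e ∈ Frame.gridE n) : eX n (eX n e) = e := by
  obtain ⟨k, u, l⟩ := e
  rw [Frame.mem_gridE] at h
  cases k <;> simp [eX] at h ⊢ <;> omega

theorem eY_grid {n : ℕ} {e : Edge} (h : e ∈ Frame.gridE n) : eY n e ∈ Frame.gridE n :=
  mem_gridE_eT.2 (eX_grid (mem_gridE_eT.2 h))

theorem eX_eY {n : ℕ} (e : Edge) : eX n (eY n e) = eY n (eX n e) := by
  obtain ⟨k, u, l⟩ := e
  cases k <;> simp [eX, eY, eT]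

theorem eY_eY {n : ℕ} {e : Edge} (h : e ∈ Frame.gridE n) : eY n (eY n e) = e := by
  unfold eY
  rw [eT_eT, eX_eX (mem_gridE_eT.2 h), eT_eT]

theorem mE_grid {n : ℕ} {q : Bool × Bool} {e : Edge} (h : e ∈ Frame.gridE n) : mE n q e ∈ Frame.gridE n := by
  unfold mE
  split_ifs
  exacts [eX_grid (eY_grid h), eX_grid h, eY_grid h, h]

theorem mE_mE {n : ℕ} {q : Bool × Bool} {e : Edge} (h : e ∈ Frame.gridE n) : mE n q (mE n q e) = e := by
  unfold mE
  split_ifs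
  · rw [← eX_eY, eX_eX (eY_grid (eY_grid h)), eY_eY h]
  · exact eX_eX h
  · exact eY_eY h
  · rfl

theorem vE_vE {n : ℕ} {q : Bool × Bool} {p : ℕ × ℕ} (h : p.1 < n) (h' : p.2 < n) : vE n q (vE n q p) = p := by
  obtain ⟨u, l⟩ := p
  simp only at h h'
  simp only [vE]
  split_ifs <;> ext <;> simp only <;> omega

theorem EndP.mE {n : ℕ} {q : Bool × Bool} {e : Edge} {p : ℕ × ℕ} (h : e ∈ Frame.gridE n) (hp : EndP e p) :
    EndP (mE n q e) (vE n q p) := by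
  obtain ⟨k, u, l⟩ := e
  obtain ⟨a, b⟩ := q
  obtain ⟨x, y⟩ := p
  rw [Frame.mem_gridE] at h
  cases k <;> cases a <;> cases b <;> simp [EndP, BDMMN.mE, eX, eY, eT, vE] at h hp ⊢ <;> omega

namespace Frame

/-- Reflection of a frame. -/
def fl (G : Frame) (q : Bool × Bool) : Frame :=
  if q.1 then (if q.2 then G.flipX.flipY else G.flipX) else if q.2 then G.flipY else G

/-- Reflection of arcs. -/
def qA (n : ℕ) (q : Bool × Bool) (A : ℕ × ℕ → ℕ × ℕ → Prop) : ℕ × ℕ → ℕ × ℕ → Prop :=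
  if q.1 then (if q.2 then yA n (xA n A) else xA n A) else if q.2 then yA n A else A

@[simp] theorem fl_n (G : Frame) (q : Bool × Bool) : (G.fl q).n = G.n := by
  unfold fl; split_ifs <;> rfl

variable {G : Frame} {A : ℕ × ℕ → ℕ × ℕ → Prop} {τ : ℕ → ℕ}

theorem IsNet.fl (h : IsNet G A) (q : Bool × Bool) : IsNet (G.fl q) (qA G.n q A) := by
  unfold Frame.fl qA
  split_ifs
  exacts [h.flipX.flipY, h.flipX, h.flipY, h]

theorem wt_eX {e : Edge} (h : e ∈ gridE G.n) : G.flipX.wt e = G.wt (eX G.n e) := by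
  obtain ⟨k, u, l⟩ := e
  rw [mem_gridE] at h
  cases k <;> simp [wt, eX, flipX] at h ⊢
  rw [show G.n - 2 - u + 1 = G.n - 1 - u by omega, show G.n - 1 - (u + 1) = G.n - 2 - u by omega]
  congr 1; ring

theorem wt_eY {e : Edge} (h : e ∈ gridE G.n) : G.flipY.wt e = G.wt (eY G.n e) := by
  have h1 := wt_eX (G := G.T) (mem_gridE_eT.2 h)
  rw [← wt_eT G.flipY]
  rw [show G.flipY.T = G.T.flipX from rfl, h1, ← wt_eT G.T]
  rfl

theorem wt_mE {q : Bool × Bool} {e : Edge} (h : e ∈ gridE G.n) : (G.fl q).wt e = G.wt (mE G.n q e) := by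
  unfold fl mE
  split_ifs
  · rw [wt_eY (G := G.flipX) h]; exact wt_eX (eY_grid h)
  · exact wt_eX h
  · exact wt_eY h
  · rfl

theorem FV_flipX {u l : ℕ} (hu : u < G.n) : FV G.flipX u l ↔ FV G (G.n - 1 - u) l := by
  unfold FV Btw
  simp only [Frame.flipX]
  rw [show G.n - 1 - (u + 1) = G.n - 1 - u - 1 by omega]
  rcases Nat.eq_zero_or_pos u with rfl | h
  · omega
  · rw [show G.n - 1 - (u - 1) = G.n - 1 - u + 1 by omega]
    omega

theorem FH_flipX {u l : ℕ} (hu : u + 1 < G.n) : FH G.flipX u l ↔ FH G (G.n - 2 - u) l := by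
  unfold FH FV
  simp only [Frame.T, Frame.flipX, Btw]
  by_cases hl : l < G.n
  · have h1 := G.σ_lt l hl
    have h2 : l + 1 < G.n → G.σ (l + 1) < G.n := G.σ_lt _
    have h3 : 1 ≤ l → G.σ (l - 1) < G.n := fun _ => G.σ_lt _ (by omega)
    simp only [hl, true_and]
    constructor <;> rintro ⟨h, h4⟩ <;> refine ⟨by omega, ?_⟩ <;> omega
  · tauto

theorem InF_eX {e : Edge} (h : e ∈ gridE G.n) : InF G.flipX e ↔ InF G (eX G.n e) := by
  obtain ⟨k, u, l⟩ := e
  rw [mem_gridE] at h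
  cases k <;> simp [InF, eX] at h ⊢
  · exact FV_flipX h.1
  · exact FH_flipX (by omega)

theorem InF_eY {e : Edge} (h : e ∈ gridE G.n) : InF G.flipY e ↔ InF G (eY G.n e) := by
  have h1 := InF_eX (G := G.T) (mem_gridE_eT.2 h)
  rw [← InF_eT (G := G.flipY)]
  rw [show G.flipY.T = G.T.flipX from rfl, h1, ← InF_eT (G := G.T)]
  rfl

theorem InF_mE {q : Bool × Bool} {e : Edge} (h : e ∈ gridE G.n) : InF (G.fl q) e ↔ InF G (mE G.n q e) := by
  unfold fl mE
  split_ifs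
  · rw [InF_eY (G := G.flipX) h, ← InF_eX (eY_grid h)]; rfl
  · exact InF_eX h
  · exact InF_eY h
  · rfl

theorem hasE_eX {n : ℕ} {e : Edge} (h : e ∈ gridE n) : HasE (xA n A) e ↔ HasE A (eX n e) := by
  obtain ⟨k, u, l⟩ := e
  rw [mem_gridE] at h
  cases k <;> simp [HasE, xA, eX] at h ⊢
  · simp [h]
  · rw [show n - 2 - u + 1 = n - 1 - u by omega, show n - 1 - (u + 1) = n - 2 - u by omega]
    simp [h]; tauto

theorem hasE_eT {e : Edge} : HasE (tA A) e ↔ HasE A (eT e) := by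
  obtain ⟨k, u, l⟩ := e; exact hasE_tA

theorem hasE_eY {n : ℕ} {e : Edge} (h : e ∈ gridE n) : HasE (yA n A) e ↔ HasE A (eY n e) := by
  unfold yA
  rw [hasE_eT, hasE_eX (mem_gridE_eT.2 h), hasE_eT]
  rfl

theorem hasE_mE {n : ℕ} {q : Bool × Bool} {e : Edge} (h : e ∈ gridE n) : HasE (qA n q A) e ↔ HasE A (mE n q e) := by
  unfold qA mE
  split_ifs
  · rw [hasE_eY h, hasE_eX (eY_grid h)]
  · exact hasE_eX h
  · exact hasE_eY h
  · rfl

/-- A property of the vertices of the rectangles of terminal `b` in one of the four directions. -/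
def Vq (G : Frame) (q : Bool × Bool) (b : ℕ) (p : ℕ × ℕ) : Prop :=
  (if q.1 then b ≤ p.1 else p.1 ≤ b) ∧ (if q.2 then G.π b ≤ p.2 else p.2 ≤ G.π b) ∧
    (p.2 ≠ G.π b → if q.1 then G.σ p.2 < b else b < G.σ p.2) ∧
    (p.1 ≠ b → if q.2 then G.π p.1 < G.π b else G.π b < G.π p.1)

/-- The vertices of a rectangle. -/
def VRect (G : Frame) (b : ℕ) (p : ℕ × ℕ) : Prop := G.lc b ≤ p.1 ∧ p.1 ≤ b ∧ G.ld b ≤ p.2 ∧ p.2 ≤ G.π b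

theorem InRect.vRect {b : ℕ} {e : Edge} (h : InRect G b e) {p : ℕ × ℕ} (hp : EndP e p) : VRect G b p := by
  obtain ⟨k, u, l⟩ := e
  cases k <;> simp [InRect] at h <;> rcases hp with rfl | rfl <;> simp [VRect] <;> omega

/-- Membership in a reflected rectangle is translated into properties of the original grid: the
terminals of the row and of the column through the vertex lie beyond `b`, unless these lines are
those of `b`. In this form the directions can be compared. -/
theorem VRect.vq {q : Bool × Bool} {b : ℕ} {p : ℕ × ℕ} (hb : (G.fl q).ND b) (h : VRect (G.fl q) b p) :
    Vq G q (if q.1 then G.n - 1 - b else b) (vE G.n q p) := by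
  obtain ⟨u, l⟩ := p
  obtain ⟨h1, h2, h3, h4⟩ := h
  have hn : b < G.n := by have := hb.1; simpa using this
  have hl := fun h => (G.fl q).lt_π (u := u) hb.1 h1 h
  have hl' := fun h => (G.fl q).lt_σ (l := l) hb.1 h3 h
  have hπ := (G.fl q).π_lt b hb.1
  have hσ := (G.fl q).σ_lt l (by simp only at h4; omega)
  simp only [fl_n] at hπ hσ
  have hπ2 := (G.fl q).π_lt u (by rw [fl_n]; simp only at h2; omega)
  simp only [fl_n] at hπ2
  obtain ⟨a, c⟩ := q
  have e : G.n - 1 - (G.n - 1 - b) = b := by omega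
  have e2 : u < G.n := by simp only at h2; omega
  clear h1 h3 hb
  have k1 := G.π_lt b hn
  have k2 := G.π_lt (G.n - 1 - b) (by omega)
  have k3 := G.π_lt u e2
  have k4 := G.π_lt (G.n - 1 - u) (by omega)
  cases a <;> cases c <;>
    simp [fl, flipX, flipY, T, Vq, vE] at h2 h4 hl hl' hπ hσ hπ2 ⊢ <;>
    exact ⟨by omega, by omega, fun h => by omega, fun h => by omega⟩

/-- The sides on which the terminals of its row and column lie determine the direction in which a
vertex is seen, except at the terminal itself. -/
theorem Vq.eq_of_ne {q q' : Bool × Bool} (hq : q ≠ q') {b b' : ℕ} (hb : b < G.n) (hb' : b' < G.n) {p : ℕ × ℕ}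
    (h : Vq G q b p) (h' : Vq G q' b' p) (hp : p.1 < G.n) (hp' : p.2 < G.n) : p = (b, G.π b) := by
  obtain ⟨u, l⟩ := p
  obtain ⟨a, c⟩ := q
  obtain ⟨a', c'⟩ := q'
  have e1 := G.σπ b hb
  have e2 := G.σπ b' hb'
  have e3 := G.πσ l hp'
  have e4 : l = G.π b → G.σ l = b := by rintro rfl; exact e1
  have e5 : l = G.π b' → G.σ l = b' := by rintro rfl; exact e2
  have e6 : u = b → G.π u = G.π b := by rintro rfl; rfl
  have e7 : u = b' → G.π u = G.π b' := by rintro rfl; rfl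
  have e8 : b = b' → G.π b = G.π b' := by rintro rfl; rfl
  simp only [Prod.mk.injEq]
  cases a <;> cases c <;> cases a' <;> cases c' <;> simp [Vq] at hq h h' <;> omega


/-! ### Rungs, disjointness of the regions, and the factor two -/

variable {G : Frame} {A : ℕ × ℕ → ℕ × ℕ → Prop} {τ : ℕ → ℕ}

/-- The cycle of the columns `lc b - 1` and `lc b` directs column `lc b` downwards, and the cycle of
`lc b` and `b` must agree on their common edges. Therefore `b` is entered along its row from column
`lc b`. That point cannot be reached from below, against the direction of the column, so the
entering path comes from the left. -/
theorem IsNet.rung_aux (h : IsNet G A) {b : ℕ} (hb : G.ND b) (h1 : b = G.lc b + 1)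
    (hc : CycUp G A (G.lc b - 1)) : HasE A (true, G.lc b - 1, G.π b) := by
  have hbn := hb.1
  have hc1 := hb.2.1
  have h2 := G.π_lc_lt hc1
  have h3 := G.lt_π hbn (u := G.lc b) le_rfl (by omega)
  have e1 : G.lc b - 1 + 1 = G.lc b := by omega
  obtain ⟨h4, -, -⟩ := hc
  rw [e1] at h4
  rcases h.cycDown (u := G.lc b) (by omega) (by rw [← h1]; exact h3) with h5 | h5
  · have := h5.1 (G.π b) (by rw [← h1]) h3
    exact absurd this.1 (h.anti _ _ (h4 (G.π b) (by omega) h3).2)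
  · have h6 : InL G A b := by
      have := h5.2.2
      rw [← h1] at this
      unfold InL
      rw [show b - 1 = G.lc b by omega]
      exact this
    have hne : ∀ x y, G.lc b ≤ x → (G.lc b - 1, G.π (G.lc b - 1)) ≠ (x, y) := by
      intro x y hx hy; have := congrArg Prod.fst hy; simp only at this; omega
    have h7 := (h.in_ru hbn hc1).last
    simp only [hne b _ (by omega), false_or] at h7
    rcases h7 with h7 | h7
    · have h8 := h7.2.2.last
      simp only [hne (b - 1) _ (by omega), false_or] at h8
      rw [show b - 1 = G.lc b by omega] at h8
      rcases h8 with h8 | h8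
      · left; simp only [e1]; exact h8.2.1
      · have := (h4 (G.π b - 1) (by omega) (by omega)).2
        rw [show G.π b - 1 + 1 = G.π b by omega] at this
        exact absurd h8.2.1 (h.anti _ _ this)
    · exact absurd h7.2.1 ((h.inL_iff hbn hc1).1 h6)

theorem IsNet.rung_h (h : IsNet G A) {b : ℕ} (hb : G.ND b) (h1 : b = G.lc b + 1) :
    HasE A (true, G.lc b - 1, G.π b) := by
  have hbn := hb.1
  have hc1 := hb.2.1
  have h2 := G.π_lc_lt hc1
  have h3 := G.lt_π hbn (u := G.lc b) le_rfl (by omega)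
  have e1 : G.lc b - 1 + 1 = G.lc b := by omega
  rcases h.cycUp (u := G.lc b - 1) (by omega) (by rw [e1]; omega) with h4 | h4
  · exact h.rung_aux hb h1 h4
  · exact hasE_rA.1 (h.rev.rung_aux hb h1 h4)

/-- The edges that cross the strips below degenerate rectangles. -/
def Rung (G : Frame) (e : Edge) : Prop := ∃ b, G.ND b ∧ G.π b = G.ld b + 1 ∧ e = (false, b, G.ld b - 1)

theorem IsNet.rung (h : IsNet G A) {e : Edge} (he : Rung G e) : HasE A e := by
  obtain ⟨b, hb, h1, rfl⟩ := he
  have hbn := hb.1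
  have hπ : G.T.π (G.π b) = b := G.σπ b hbn
  have := h.T.rung_h (b := G.π b) ((ND_T hbn).2 hb) (by rw [lc_T G hbn]; exact h1)
  rw [lc_T G hbn, hπ, hasE_tA] at this
  exact this

/-- The ends of an edge are on lines whose terminals are on different sides of it. -/
def Sep (G : Frame) (e : Edge) : Prop :=
  if e.1 then (G.π e.2.1 < e.2.2 ∧ e.2.2 < G.π (e.2.1 + 1)) ∨ (G.π (e.2.1 + 1) < e.2.2 ∧ e.2.2 < G.π e.2.1)
  else (G.σ e.2.2 < e.2.1 ∧ e.2.1 < G.σ (e.2.2 + 1)) ∨ (G.σ (e.2.2 + 1) < e.2.1 ∧ e.2.1 < G.σ e.2.2)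

theorem Sep_eT {e : Edge} : Sep G.T (eT e) ↔ Sep G e := by
  obtain ⟨k, u, l⟩ := e; cases k <;> rfl

theorem Sep_eX {e : Edge} (h : e ∈ gridE G.n) : Sep G.flipX e ↔ Sep G (eX G.n e) := by
  obtain ⟨k, u, l⟩ := e
  rw [mem_gridE] at h
  cases k <;> simp [Sep, eX, flipX] at h ⊢
  · have h1 := G.σ_lt l (by omega)
    have h2 := G.σ_lt (l + 1) (by omega)
    omega
  · rw [show G.n - 2 - u + 1 = G.n - 1 - u by omega, show G.n - 1 - (u + 1) = G.n - 2 - u by omega]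
    tauto

theorem Sep_eY {e : Edge} (h : e ∈ gridE G.n) : Sep G.flipY e ↔ Sep G (eY G.n e) := by
  have h1 := Sep_eX (G := G.T) (mem_gridE_eT.2 h)
  rw [← Sep_eT (G := G.flipY)]
  rw [show G.flipY.T = G.T.flipX from rfl, h1, ← Sep_eT (G := G.T)]
  rfl

theorem Sep_mE {q : Bool × Bool} {e : Edge} (h : e ∈ gridE G.n) : Sep (G.fl q) e ↔ Sep G (mE G.n q e) := by
  unfold fl mE
  split_ifs
  · rw [Sep_eY (G := G.flipX) h]; exact Sep_eX (eY_grid h)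
  · exact Sep_eX h
  · exact Sep_eY h
  · rfl

theorem Rung.sep {e : Edge} (h : Rung G e) : Sep G e := by
  obtain ⟨b, hb, h1, rfl⟩ := h
  have h2 := G.one_le_ld hb.1 hb.2.1
  have h3 := G.σ_ld_lt h2
  have h4 := G.lt_σ hb.1 (l := G.ld b) le_rfl (by omega)
  simp only [Sep, Bool.false_eq_true, if_false]
  rw [show G.ld b - 1 + 1 = G.ld b by omega]
  omega

/-- In a region the terminals of the two parallel lines through the ends of an edge lie on one
common side of it, or one of them on it. A rung has them on different sides and so lies outside all
regions. -/
theorem Vq.not_sep {q : Bool × Bool} {b : ℕ} (hb : b < G.n) {e : Edge} (he : e ∈ gridE G.n)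
    (h : ∀ p, EndP e p → Vq G q b p) : ¬ Sep G e := by
  have h1 := h _ (Or.inl rfl)
  have h2 := h _ (Or.inr rfl)
  have e0 := G.σπ b hb
  have e1 : ∀ l, l = G.π b → G.σ l = b := by rintro l rfl; exact e0
  have e2 : ∀ u, u = b → G.π u = G.π b := by rintro u rfl; rfl
  obtain ⟨k, u, l⟩ := e
  obtain ⟨a, c⟩ := q
  have a1 := e1 l
  have a2 := e1 (l + 1)
  have a3 := e2 u
  have a4 := e2 (u + 1)
  cases k <;> cases a <;> cases c <;> simp [Vq, Sep] at h1 h2 ⊢ <;> omega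

/-- If the rectangles share a vertex, then `b'` is the lower terminal, and the nearest lower left
terminals of either one are lower left terminals of the other. This bounds the corners by each
other. -/
theorem VRect.same {b b' : ℕ} {p : ℕ × ℕ} (hb : G.ND b) (hb' : G.ND b') (h : VRect G b p) (h' : VRect G b' p)
    (hlt : b < b') : G.lc b = G.lc b' ∧ G.ld b = G.ld b' := by
  obtain ⟨h1, h2, h3, h4⟩ := h
  obtain ⟨h1', h2', h3', h4'⟩ := h'
  have a1 := G.lt_π hb'.1 (u := b) (by omega) hlt
  have b1 := G.lc_le (b := b)
  have b2 := G.lc_le (b := b')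
  have b3 := G.ld_le (b := b)
  have b4 := G.ld_le (b := b')
  have c1 := hb.2.1
  have c2 := hb'.2.1
  have hn := hb'.1
  have a2 := G.π_lc_lt hb'.2.1
  have a3 := G.lt_lc hb.1 (a := G.lc b' - 1) (by omega) (by omega)
  have a4 := G.π_lc_lt_ld hb.1 hb.2.1
  have a5 := G.lt_lc hb'.1 (a := G.lc b - 1) (by omega) (by omega)
  have e1 : G.lc b = G.lc b' := by omega
  have d1 := G.one_le_ld hb.1 hb.2.1
  have d2 := G.one_le_ld hb'.1 hb'.2.1
  have p1 := G.π_lt b hb.1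
  have f1 := G.σ_ld_lt_lc hb'.1 hb'.2.1
  have f2 := G.σ_ld_lt_lc hb.1 hb.2.1
  have f3 := G.π_lt_ld hb.1 (a := G.σ (G.ld b' - 1)) (by omega) (by rw [G.πσ _ (by omega)]; omega)
  have f4 := G.π_lt_ld hb'.1 (a := G.σ (G.ld b - 1)) (by omega) (by rw [G.πσ _ (by omega)]; omega)
  rw [G.πσ _ (by omega)] at f3 f4
  omega

theorem Sreg_disjoint {c d c' d' : ℕ} {e : Edge} (h : e ∈ Sreg G c d) (h' : e ∈ Sreg G c' d') : c = c' ∧ d = d' := by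
  obtain ⟨-, b, hb, rfl, rfl, h1⟩ := mem_Sreg.1 h
  obtain ⟨-, b', hb', rfl, rfl, h1'⟩ := mem_Sreg.1 h'
  have h2 := h1.vRect (Or.inl rfl)
  have h2' := h1'.vRect (Or.inl rfl)
  rcases lt_trichotomy b b' with h | rfl | h
  · exact h2.same hb hb' h2' h
  · exact ⟨rfl, rfl⟩
  · have := h2'.same hb' hb h2 h
    exact ⟨this.1.symm, this.2.symm⟩

theorem Sreg_vq {q : Bool × Bool} {c d : ℕ} {e : Edge} (he : e ∈ gridE G.n) (h : mE G.n q e ∈ Sreg (G.fl q) c d) :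
    ∃ b, b < G.n ∧ ∀ p, EndP e p → Vq G q b p := by
  obtain ⟨-, b, hb, rfl, rfl, h1⟩ := mem_Sreg.1 h
  have hbn : b < G.n := by simpa using hb.1
  refine ⟨if q.1 then G.n - 1 - b else b, by split_ifs <;> omega, fun p hp => ?_⟩
  have h2 := (h1.vRect (hp.mE he)).vq hb
  have hp' : p.1 < G.n ∧ p.2 < G.n := by
    obtain ⟨k, u, l⟩ := e
    rw [mem_gridE] at he
    cases k <;> rcases hp with rfl | rfl <;> simp at he ⊢ <;> omega
  rwa [vE_vE hp'.1 hp'.2] at h2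

/-- Rectangles of different directions have at most a terminal in common, while an edge has two
ends. -/
theorem Sreg_disjoint_fl {q q' : Bool × Bool} {c d c' d' : ℕ} {e : Edge} (he : e ∈ gridE G.n)
    (h : mE G.n q e ∈ Sreg (G.fl q) c d) (h' : mE G.n q' e ∈ Sreg (G.fl q') c' d') : q = q' ∧ c = c' ∧ d = d' := by
  by_cases hq : q = q'
  · subst hq; exact ⟨rfl, Sreg_disjoint h h'⟩
  · exfalso
    obtain ⟨b, hb, h1⟩ := Sreg_vq he h
    obtain ⟨b', hb', h1'⟩ := Sreg_vq he h'
    have key : ∀ p, EndP e p → p = (b, G.π b) := by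
      intro p hp
      refine (h1 p hp).eq_of_ne hq hb hb' (h1' p hp) ?_ ?_ <;>
      · obtain ⟨k, u, l⟩ := e
        rw [mem_gridE] at he
        cases k <;> rcases hp with rfl | rfl <;> simp at he ⊢ <;> omega
    have k1 := key _ (Or.inl rfl)
    have k2 := key _ (Or.inr rfl)
    rw [← k1] at k2
    split_ifs at k2
    · have := congrArg Prod.fst k2; simp at this
    · have := congrArg Prod.snd k2; simp at this

/-- The edges that are chosen in one of the four directions. -/
def AlgQ {τ : ℕ → ℕ} (S : Sol G τ) (S' : Sol G.T (tyT G τ)) (e : Edge) : Prop :=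
  (DE S e ∨ Rung G e) ∨ DE S' (eT e) ∨ Rung G.T (eT e)

open Classical in
/-- The edges of a network. -/
noncomputable def NE (G : Frame) (A : ℕ × ℕ → ℕ × ℕ → Prop) : Finset Edge := (gridE G.n).filter (HasE A)

open Classical in
/-- The edges of the approximate network. -/
noncomputable def AlgE (G : Frame) {τ : Bool × Bool → ℕ → ℕ} (S : ∀ q, Sol (G.fl q) (τ q))
    (S' : ∀ q, Sol (G.fl q).T (tyT (G.fl q) (τ q))) : Finset Edge :=
  (gridE G.n).filter fun e => InF G e ∨ ∃ q, AlgQ (S q) (S' q) (mE G.n q e)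

theorem W_mE_image {q : Bool × Bool} {E : Finset Edge} (hE : E ⊆ gridE G.n) :
    G.W (E.image (mE G.n q)) = (G.fl q).W E := by
  classical
  unfold W
  rw [Finset.sum_image]
  · exact Finset.sum_congr rfl fun e he => (wt_mE (hE he)).symm
  · intro a ha b hb hab
    rw [← mE_mE (q := q) (hE ha), hab, mE_mE (hE hb)]

theorem Sreg_grid {c d : ℕ} : Sreg G c d ⊆ gridE G.n := fun _ he => (mem_Sreg.1 he).1

open Classical in
theorem chain_bound_fl (h : IsNet G A) {q : Bool × Bool} (hB : Blocks (G.fl q) τ) (S : Sol (G.fl q) τ)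
    (S' : Sol (G.fl q).T (tyT (G.fl q) τ)) (c d : ℕ) : ∃ E : Finset Edge,
      (∀ e ∈ gridE G.n, DEc S c d (mE G.n q e) ∨ DEc S' d c (eT (mE G.n q e)) → e ∈ E) ∧
      G.W E ≤ G.W (((Sreg (G.fl q) c d).image (mE G.n q)).filter (InF G)) +
        2 * G.W (((Sreg (G.fl q) c d).image (mE G.n q)).filter fun e => HasE A e ∧ ¬ InF G e) := by
  classical
  obtain ⟨E, h1, h2, h3⟩ := chain_bound (h.fl q) hB S S' c d
  have hg : Sreg (G.fl q) c d ⊆ gridE G.n := by simpa using Sreg_grid (G := G.fl q) (c := c) (d := d)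
  have e1 : ((Sreg (G.fl q) c d).image (mE G.n q)).filter (InF G) = (SF (G.fl q) c d).image (mE G.n q) := by
    unfold SF
    rw [Finset.filter_image]
    congr 1
    exact Finset.filter_congr fun e he => (InF_mE (hg he)).symm
  have e2 : (((Sreg (G.fl q) c d).image (mE G.n q)).filter fun e => HasE A e ∧ ¬ InF G e) =
      (SN (G.fl q) (qA G.n q A) c d).image (mE G.n q) := by
    unfold SN
    rw [Finset.filter_image]
    congr 1
    exact Finset.filter_congr fun e he => by rw [InF_mE (hg he), hasE_mE (hg he)]
  refine ⟨(E.filter (· ∈ gridE G.n)).image (mE G.n q), ?_, ?_⟩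
  · intro e he hor
    refine Finset.mem_image.2 ⟨mE G.n q e, Finset.mem_filter.2 ⟨?_, mE_grid he⟩, mE_mE he⟩
    rcases hor with hor | hor
    · exact h1 _ hor
    · have := h2 _ hor
      rwa [eT_eT] at this
  · rw [e1, e2, W_mE_image (fun e he => (Finset.mem_filter.1 he).2), W_mE_image (E := SF _ c d) ((Finset.filter_subset _ _).trans hg),
      W_mE_image (E := SN _ _ c d) ((Finset.filter_subset _ _).trans hg)]
    exact ((G.fl q).W_mono (Finset.filter_subset _ _)).trans h3

theorem DEc.lt {S : Sol G τ} {c d : ℕ} {e : Edge} (h : DEc S c d e) : c < G.n ∧ d < G.n := by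
  have key : ∀ b, b < G.n → G.lc b = c → G.ld b = d → c < G.n ∧ d < G.n := by
    rintro b hb rfl rfl
    have := G.lc_le (b := b)
    have := G.ld_le (b := b)
    have := G.π_lt b hb
    omega
  rcases h with ⟨a, b, h1, h2, h3, h4⟩ | ⟨r, h1, h2, h3⟩ | ⟨j, h1, h2⟩ | ⟨b, h1, h2, h3, h4⟩
  · exact key a h3.1.1 h3.2.1 h3.2.2
  · exact key r h2.1.1 h2.2.1 h2.2.2
  · exact key j h1.1.1 h1.2.1 h1.2.2
  · exact key b h1.1 h2 h3

/-- The approximate network is at most twice as long as every network. -/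
theorem W_AlgE_le (h : IsNet G A) {τ : Bool × Bool → ℕ → ℕ} (hB : ∀ q, Blocks (G.fl q) (τ q))
    (S : ∀ q, Sol (G.fl q) (τ q)) (S' : ∀ q, Sol (G.fl q).T (tyT (G.fl q) (τ q))) :
    G.W (AlgE G S S') ≤ 2 * G.W (NE G A) := by
  classical
  choose E hE hW using fun i : (Bool × Bool) × ℕ × ℕ => chain_bound_fl h (hB i.1) (S i.1) (S' i.1) i.2.1 i.2.2
  set I : Finset ((Bool × Bool) × ℕ × ℕ) := Finset.univ ×ˢ Finset.range G.n ×ˢ Finset.range G.n with hI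
  set R : (Bool × Bool) × ℕ × ℕ → Finset Edge := fun i => (Sreg (G.fl i.1) i.2.1 i.2.2).image (mE G.n i.1) with hR
  have hRg : ∀ i, ∀ e ∈ R i, e ∈ gridE G.n ∧ mE G.n i.1 e ∈ Sreg (G.fl i.1) i.2.1 i.2.2 := by
    intro i e he
    obtain ⟨e', he', rfl⟩ := Finset.mem_image.1 he
    have h1 : e' ∈ gridE G.n := by simpa using Sreg_grid he'
    exact ⟨mE_grid h1, by rwa [mE_mE h1]⟩
  have hRd : ∀ i j e, e ∈ R i → e ∈ R j → i = j := by
    rintro ⟨q, c, d⟩ ⟨q', c', d'⟩ e hi hj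
    obtain ⟨h1, h2⟩ := hRg _ e hi
    obtain ⟨-, h3⟩ := hRg _ e hj
    obtain ⟨h4, h5, h6⟩ := Sreg_disjoint_fl h1 h2 h3
    simp only at h4 h5 h6
    rw [h4, h5, h6]
  set F := (gridE G.n).filter (InF G) with hF
  set Q := (gridE G.n).filter (fun e => ¬ InF G e ∧ ∃ q, Rung (G.fl q) (mE G.n q e) ∨ Rung (G.fl q).T (eT (mE G.n q e))) with hQ
  have hsub : AlgE G S S' ⊆ (F ∪ Q) ∪ I.biUnion E := by
    intro e he
    obtain ⟨h1, h2⟩ := Finset.mem_filter.1 he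
    by_cases hf : InF G e
    · exact Finset.mem_union_left _ (Finset.mem_union_left _ (Finset.mem_filter.2 ⟨h1, hf⟩))
    obtain ⟨q, h2⟩ := h2.resolve_left hf
    rcases h2 with (h2 | h2) | h2 | h2
    · obtain ⟨c, d, h3⟩ := h2.chain
      have := h3.lt
      rw [fl_n] at this
      refine Finset.mem_union_right _ (Finset.mem_biUnion.2 ⟨(q, c, d), ?_, hE (q, c, d) e h1 (Or.inl h3)⟩)
      simp [hI, this]
    · exact Finset.mem_union_left _ (Finset.mem_union_right _ (Finset.mem_filter.2 ⟨h1, hf, q, Or.inl h2⟩))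
    · obtain ⟨d, c, h3⟩ := h2.chain
      have : d < (G.fl q).n ∧ c < (G.fl q).n := h3.lt
      rw [fl_n] at this
      refine Finset.mem_union_right _ (Finset.mem_biUnion.2 ⟨(q, c, d), ?_, hE (q, c, d) e h1 (Or.inr h3)⟩)
      simp [hI, this]
    · exact Finset.mem_union_left _ (Finset.mem_union_right _ (Finset.mem_filter.2 ⟨h1, hf, q, Or.inr h2⟩))
  have w1 := (G.W_mono hsub).trans (G.W_union_le _ _)
  have w2 := G.W_union_le F Q
  have w3 : G.W (I.biUnion E) ≤ ∑ i ∈ I, G.W (E i) := W_biUnion_le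
  have w4 : ∑ i ∈ I, G.W (E i) ≤ ∑ i ∈ I, G.W ((R i).filter (InF G)) +
      2 * ∑ i ∈ I, G.W ((R i).filter fun e => HasE A e ∧ ¬ InF G e) := by
    rw [Finset.mul_sum, ← Finset.sum_add_distrib]
    exact Finset.sum_le_sum fun i _ => hW i
  have w5 : ∀ (P : Edge → Prop) [DecidablePred P], ∑ i ∈ I, G.W ((R i).filter P) = G.W (I.biUnion fun i => (R i).filter P) := by
    intro P _
    unfold W
    rw [Finset.sum_biUnion]
    intro i _ j _ hij
    rw [Function.onFun, Finset.disjoint_left]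
    intro e h1 h2
    exact hij (hRd i j e (Finset.mem_filter.1 h1).1 (Finset.mem_filter.1 h2).1)
  have w6 : G.W (I.biUnion fun i => (R i).filter (InF G)) ≤ G.W F := by
    apply G.W_mono
    intro e he
    obtain ⟨i, -, hi⟩ := Finset.mem_biUnion.1 he
    obtain ⟨h1, h2⟩ := Finset.mem_filter.1 hi
    exact Finset.mem_filter.2 ⟨(hRg i e h1).1, h2⟩
  have hQs : ∀ e ∈ Q, Sep G e ∧ HasE A e := by
    intro e he
    obtain ⟨h1, h2, q, h3⟩ := Finset.mem_filter.1 he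
    have h4 : mE G.n q e ∈ gridE (G.fl q).n := by rw [fl_n]; exact mE_grid h1
    have h5 : mE G.n q (mE G.n q e) = e := mE_mE h1
    rw [fl_n] at h4
    rcases h3 with h3 | h3
    · have h6 := (Sep_mE h4).1 h3.sep
      have h7 := (hasE_mE h4).1 ((h.fl q).rung h3)
      rw [h5] at h6 h7
      exact ⟨h6, h7⟩
    · have h6 := (Sep_mE h4).1 (Sep_eT.1 h3.sep)
      have h7 := (h.fl q).T.rung h3
      rw [hasE_eT, eT_eT, hasE_mE h4] at h7
      rw [h5] at h6 h7
      exact ⟨h6, h7⟩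
  -- F, the edges of the network in regions outside F, and the rungs outside F are disjoint parts of
  -- every network.
  have w7 : G.W F + (G.W (I.biUnion fun i => (R i).filter fun e => HasE A e ∧ ¬ InF G e) + G.W Q) ≤ G.W (NE G A) := by
    rw [← W_union, ← W_union]
    · apply G.W_mono
      intro e he
      rcases Finset.mem_union.1 he with he | he
      · obtain ⟨h1, h2⟩ := Finset.mem_filter.1 he
        refine Finset.mem_filter.2 ⟨h1, ?_⟩
        obtain ⟨k, u, l⟩ := e
        cases k
        · exact h.fv h2
        · exact h.fh h2
      rcases Finset.mem_union.1 he with he | he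
      · obtain ⟨i, -, hi⟩ := Finset.mem_biUnion.1 he
        obtain ⟨h1, h2, -⟩ := Finset.mem_filter.1 hi
        exact Finset.mem_filter.2 ⟨(hRg i e h1).1, h2⟩
      · exact Finset.mem_filter.2 ⟨(Finset.mem_filter.1 he).1, (hQs e he).2⟩
    · rw [Finset.disjoint_left]
      intro e h1 h2
      have h1 := (Finset.mem_filter.1 h1).2
      rcases Finset.mem_union.1 h2 with h2 | h2
      · obtain ⟨i, -, hi⟩ := Finset.mem_biUnion.1 h2
        exact (Finset.mem_filter.1 hi).2.2 h1
      · exact (Finset.mem_filter.1 h2).2.1 h1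
    · rw [Finset.disjoint_left]
      intro e h1 h2
      obtain ⟨i, -, hi⟩ := Finset.mem_biUnion.1 h1
      obtain ⟨h3, h4⟩ := hRg i e (Finset.mem_filter.1 hi).1
      obtain ⟨b, hb, h5⟩ := Sreg_vq h3 h4
      exact Vq.not_sep hb h3 h5 (hQs e h2).1
  have w8 := G.W_nonneg Q
  -- F is counted once for itself and once as payment for the trees, the edges in regions outside F
  -- twice, and the rungs once.
  rw [w5 (InF G), w5 (fun e => HasE A e ∧ ¬ InF G e)] at w4
  linarith


/-! ### The orientation of the chosen edges -/

variable {G : Frame} {A : ℕ × ℕ → ℕ × ℕ → Prop} {τ τ' : ℕ → ℕ}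

theorem Nodes.ρ_last {X ρ : ℕ → ℕ} (hB : Blocks G τ) (hX : Nodes G τ X ρ) {c d b : ℕ} (hb : G.Mem c d b) :
    ∃ e, G.Mem c d e ∧ b ≤ e ∧ ρ b + 1 = G.π e ∧ (τ e = 1 ∨ τ e = 3 ∨ τ e = 6) := by
  rcases hX.ρ_cases hB hb with ⟨h1, h2⟩ | ⟨s, h1, h2, h3, h4⟩ | ⟨s, t, h1, h2, h3, h4, h5, h6⟩
  · exact ⟨b, hb, le_rfl, h2, h1⟩
  · exact ⟨s, h1.mem hb, h1.lt.le, h4, by omega⟩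
  · exact ⟨t, h2.mem (h1.mem hb), by have := h1.lt; have := h2.lt; omega, h6, by omega⟩

theorem Nodes.X_first {X ρ : ℕ → ℕ} (hB : Blocks G τ) (hX : Nodes G τ X ρ) {c d b : ℕ} (hb : G.Mem c d b) :
    G.Mem c d (X b) ∧ X b ≤ b ∧ (τ (X b) = 1 ∨ τ (X b) = 2 ∨ τ (X b) = 4 ∨ τ (X b) = 5) := by
  have hty := hB.ty b hb.1
  rcases hX.X_cases hB hb with ⟨h1, h2, h3⟩ | ⟨p, h1, h2, h3⟩
  · rw [h1]; exact ⟨hb, le_rfl, by omega⟩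
  · rw [h2]
    refine ⟨h1.mem' hb, h1.lt.le, ?_⟩
    rcases h3 with h3 | h3
    · obtain ⟨q, h4, -, h5⟩ := hB.p2 b hb.1 h3
      rw [h1.unique_left h4, h5]; omega
    · obtain ⟨q, h4, -, h5⟩ := hB.t3 b hb.1 h3
      rw [h1.unique_left h4, h5]; omega

/-- Horizontal tree edges lie just below the row of the last terminal of a block, apart from those
of `Spc`, which start at the left boundary. This separates them from F and from the trees of the
transposed frame. -/
theorem DE.h_cases (hB : Blocks G τ) {S : Sol G τ} {u l : ℕ} (h : DE S (true, u, l)) :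
    ∃ e, G.ND e ∧ G.lc e ≤ u ∧ u < e ∧ l + 1 = G.π e ∧ G.ld e + 1 ≤ l ∧
      ((G.Reg e ∧ (τ e = 1 ∨ τ e = 3 ∨ τ e = 6)) ∨ u = G.lc e) := by
  rcases h with ⟨a, b, h1, h2, h3⟩ | ⟨r, h1, h2⟩ | ⟨j, h1, h2⟩ | ⟨b, h1, h2⟩
  · obtain ⟨ha, hb, -⟩ := h1.pairIn
    simp only at ha hb
    obtain ⟨s, t1, t2, t3, t4, t5, t6, t7⟩ := Sol.split (S := S) ha hb h2
    simp only [TE, Finset.mem_union, mem_vseg, mem_hseg, t2] at h3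
    simp at h3
    obtain ⟨h3, h4, rfl⟩ := h3
    obtain ⟨e, h5, h6, h7, h8⟩ := S.nodes.ρ_last hB hb
    have h9 := S.nodes.X_le hB ha
    have h10 := S.nodes.X_le hB t4
    have h11 := h5.1.2.2.2
    have h12 := h5.2
    exact ⟨e, h5.1.nd, by omega, by omega, h7, by omega, Or.inl ⟨h5.1, h8⟩⟩
  · have hr : G.Mem (G.lc r) (G.ld r) r := ⟨h1.reg, rfl, rfl⟩
    obtain ⟨-, ha, hle⟩ := Sol.ar_mem' (S := S) hr
    simp only at ha hle
    simp [Exit] at h2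
    obtain ⟨h3, h4, rfl⟩ := h2
    obtain ⟨e, h5, h6, h7, h8⟩ := S.nodes.ρ_last hB ha
    have h9 := S.nodes.X_le hB hr
    have h11 := h5.1.2.2.2
    have h12 := h5.2
    exact ⟨e, h5.1.nd, by omega, by omega, h7, by omega, Or.inl ⟨h5.1, h8⟩⟩
  · have hj : G.Mem (G.lc j) (G.ld j) j := ⟨h1, rfl, rfl⟩
    have h11 := h1.2.2.2
    have key : ∀ p, G.Nx p j → τ j = 3 ∨ τ j = 6 → p ≤ u → u < j → l = G.π j - 1 → ∃ e, G.ND e ∧ G.lc e ≤ u ∧ u < e ∧ l + 1 = G.π e ∧ G.ld e + 1 ≤ l ∧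
      ((G.Reg e ∧ (τ e = 1 ∨ τ e = 3 ∨ τ e = 6)) ∨ u = G.lc e) := by
      intro p hp hτ h3 h4 h5
      have := hp.reg.2.2.1
      have := hp.lc
      exact ⟨j, h1.nd, by omega, h4, by omega, by omega, Or.inl ⟨h1, by omega⟩⟩
    unfold Ex at h2
    split_ifs at h2 with h3 h4 h5
    · obtain ⟨p, h6, -⟩ := hB.p2 j h1 h3
      simp [S.pr_eq p j h6] at h2
      exact key p h6 (Or.inl h3) h2.1 h2.2.1 h2.2.2
    · simp at h2
    · obtain ⟨p, h6, -⟩ := hB.t3 j h1 h5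
      simp [S.pr_eq p j h6] at h2
      exact key p h6 (Or.inr h5) h2.1 h2.2.1 h2.2.2
    · simp at h2
  · unfold Spc at h2
    split_ifs at h2 with h3
    · simp at h2
      exact ⟨b, h1, by omega, by omega, by omega, by omega, Or.inr h2.1⟩
    · simp at h2

/-- Vertical tree edges lie below the terminal of their column, and this terminal is not the last
one of a pair or triple. -/
theorem DE.v_cases (hB : Blocks G τ) {S : Sol G τ} {u l : ℕ} (h : DE S (false, u, l)) :
    G.Reg u ∧ (τ u = 1 ∨ τ u = 2 ∨ τ u = 4 ∨ τ u = 5) ∧ G.ld u + 1 ≤ l ∧ l < G.π u := by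
  rcases h with ⟨a, b, h1, h2, h3⟩ | ⟨r, h1, h2⟩ | ⟨j, h1, h2⟩ | ⟨b, h1, h2⟩
  · obtain ⟨ha, hb, -⟩ := h1.pairIn
    simp only at ha hb
    obtain ⟨s, t1, t2, t3, t4, t5, t6, t7⟩ := Sol.split (S := S) ha hb h2
    simp only [TE, Finset.mem_union, mem_vseg, mem_hseg] at h3
    simp at h3
    obtain ⟨h3, h4, rfl⟩ := h3
    obtain ⟨h5, h6, h7⟩ := S.nodes.X_first hB ha
    have h8 := S.nodes.ρ_lt hB hb
    have h9 := S.nodes.ρ_lt hB t3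
    have h10 : G.π (S.sp a b) ≤ G.π (S.X a) := by
      rcases (h6.trans t5).lt_or_eq with h | h
      · exact (h5.anti t3 h).le
      · rw [h]
    refine ⟨h5.1, h7, ?_, by omega⟩
    rw [h5.2.2]; omega
  · simp [Exit] at h2
  · have hj : G.Mem (G.lc j) (G.ld j) j := ⟨h1, rfl, rfl⟩
    have h11 := h1.2.2.2
    unfold Ex at h2
    split_ifs at h2 with h3 h4 h5
    · obtain ⟨p, h6, -, h7⟩ := hB.p2 j h1 h3
      simp [S.pr_eq p j h6] at h2
      obtain ⟨h8, h9, rfl⟩ := h2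
      have := h6.π_lt
      have := h6.ld
      exact ⟨h6.reg, by omega, by omega, by omega⟩
    · obtain ⟨p, h6, -, h7⟩ := hB.t2 j h1 h4
      simp [S.pr_eq p j h6] at h2
      obtain ⟨h8, h9, rfl⟩ := h2
      have := h6.π_lt
      have := h6.ld
      exact ⟨h6.reg, by omega, by omega, by omega⟩
    · obtain ⟨p, h6, -, h7⟩ := hB.t3 j h1 h5
      obtain ⟨q, h10, -, h12⟩ := hB.t2 p h6.reg h7
      simp [S.pr_eq p j h6, S.pr_eq q p h10] at h2
      have := h6.π_lt
      have := h6.ld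
      have := h10.π_lt
      have := h10.ld
      rcases h2 with ⟨h8, h9, rfl⟩ | ⟨h8, h9, rfl⟩
      · exact ⟨h6.reg, by omega, by omega, by omega⟩
      · exact ⟨h10.reg, by omega, by omega, by omega⟩
    · simp at h2
  · unfold Spc at h2
    split_ifs at h2 with h3 <;> simp at h2

theorem DE.mem_Sreg (hB : Blocks G τ) {S : Sol G τ} {e : Edge} (h : DE S e) : ∃ c d, e ∈ Sreg G c d := by
  obtain ⟨k, u, l⟩ := e
  cases k
  · obtain ⟨h1, h2, h3, h4⟩ := h.v_cases hB
    have := h1.2.2.1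
    exact ⟨_, _, mem_Sreg_v h1.nd rfl rfl (by omega) le_rfl (by omega) h4⟩
  · obtain ⟨e, h1, h2, h3, h4, h5, h6⟩ := h.h_cases hB
    exact ⟨_, _, mem_Sreg_h h1 rfl rfl h2 h3 (by omega) (by omega)⟩

/-- Only horizontal tree edges are turned against the standard orientation, so only these must avoid
F. -/
theorem DE.not_F (hB : Blocks G τ) {S : Sol G τ} {e : Edge} (h : DE S e) (he : e.1 = true) : ¬ InF G e := by
  obtain ⟨k, u, l⟩ := e
  simp only at he
  subst he
  obtain ⟨e, h1, h2, h3, h4, h5, h6⟩ := h.h_cases hB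
  simp only [InF, if_true]
  exact not_FH h1.1 (by omega) (by omega) h3

/-- The trees of a frame and of the transposed frame do not orient an edge in two ways. -/
theorem DE.no_conflict (hB : Blocks G τ) (hB' : Blocks G.T τ') (hτ : ∀ b, b < G.n → τ' (G.π b) = swapTy (τ b))
    {S : Sol G τ} {S' : Sol G.T τ'} {e : Edge} (h : DE S e) (he : e.1 = true) (h' : DE S' (eT e)) : False := by
  obtain ⟨k, u, l⟩ := e
  simp only at he
  subst he
  obtain ⟨e, h1, h2, h3, h4, h5, h6⟩ := h.h_cases hB
  obtain ⟨h7, h8, h9, h10⟩ := DE.v_cases hB' h'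
  have hl : l < G.n := h7.1
  obtain ⟨x, hx, rfl⟩ : ∃ x, x < G.n ∧ l = G.π x := ⟨G.σ l, G.σ_lt l hl, (G.πσ l hl).symm⟩
  rw [Reg_T hx] at h7
  rw [hτ x hx] at h8
  rw [ld_T G hx] at h9
  rw [show G.T.π (G.π x) = x from G.σπ x hx] at h10
  have h9 : G.lc x + 1 ≤ u := h9
  have h10 : u < x := h10
  have hty := hB.ty x h7
  have h8' : τ x = 1 ∨ τ x = 3 ∨ τ x = 6 ∨ τ x = 5 := by
    unfold swapTy at h8; split_ifs at h8 <;> omega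
  have m1 := mem_Sreg_h h1 rfl rfl h2 h3 (by omega) (by omega : G.π x ≤ G.π e)
  have m2 := mem_Sreg_h h7.nd rfl rfl (by omega) h10 (by have := h7.2.2.2; omega) (le_refl (G.π x))
  obtain ⟨e1, e2⟩ := Sreg_disjoint m1 m2
  rcases h6 with ⟨h6, h11⟩ | h6
  · have hlt : e < x := chain_mono h1 h7.nd e1 (by omega)
    have hx' : G.Mem (G.lc e) (G.ld e) x := ⟨h7, e1.symm, e2.symm⟩
    -- Terminal `x` is in the row just below `e`, hence it is the successor of `e`. As `e` ends a
    -- block, `x` begins one. Among the types left for `x` this allows only a single, and a single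
    -- is never in the row just below its predecessor.
    have hnx : G.Nx e x := by
      refine ⟨h6, hx', hlt, fun t ht het => ?_⟩
      by_contra hlt'
      have a1 := chain_anti h1 ht.1.nd ht.2.1.symm het
      have a2 := ht.anti hx' (by omega)
      omega
    rcases h8' with h8 | h8 | h8 | h8
    · exact hB.single' x h7 h8 e hnx h4
    · obtain ⟨p, h12, -, h13⟩ := hB.p2 x h7 h8
      rw [hnx.unique_left h12] at h11; omega
    · obtain ⟨p, h12, -, h13⟩ := hB.t3 x h7 h8
      rw [hnx.unique_left h12] at h11; omega
    · obtain ⟨p, h12, -, h13⟩ := hB.t2 x h7 h8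
      rw [hnx.unique_left h12] at h11; omega
  · omega

/-- In the standard orientation the edge is oriented to the right or up: rows are oriented away from
their terminals, columns towards them. -/
def Opos (G : Frame) (e : Edge) : Prop := if e.1 then G.σ e.2.2 ≤ e.2.1 else e.2.2 < G.π e.2.1

/-- `A` contains the edge in its standard orientation. -/
def ArrO (G : Frame) (A : ℕ × ℕ → ℕ × ℕ → Prop) (e : Edge) : Prop :=
  (Opos G e → Arrow A e) ∧ (¬ Opos G e → Arrow (rA A) e)

/-- Transposition exchanges rows and columns and the reversal exchanges towards and away, so the
standard orientation is invariant. Reflections preserve it too, so all frames share one orientation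
of the grid. -/
theorem ArrO_eT {e : Edge} (h : e ∈ gridE G.n) : ArrO G.T (tA A) e ↔ ArrO G A (eT e) := by
  obtain ⟨k, u, l⟩ := e
  cases k <;> simp [ArrO, Opos, Arrow, rA, tA, eT, Frame.T] <;> tauto

theorem ArrO_eX {e : Edge} (h : e ∈ gridE G.n) : ArrO G.flipX (xA G.n A) e ↔ ArrO G A (eX G.n e) := by
  obtain ⟨k, u, l⟩ := e
  rw [mem_gridE] at h
  cases k <;> simp [ArrO, Opos, Arrow, rA, xA, eX, Frame.flipX] at h ⊢
  · simp [h]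
  · have := G.σ_lt l (by omega)
    rw [show G.n - 2 - u + 1 = G.n - 1 - u by omega, show G.n - 1 - (u + 1) = G.n - 2 - u by omega]
    simp only [show u < G.n by omega, show u + 1 < G.n by omega, and_self, true_and]
    constructor <;> rintro ⟨h1, h2⟩ <;> exact ⟨fun h => h2 (by omega), fun h => h1 (by omega)⟩

theorem ArrO_eY {e : Edge} (h : e ∈ gridE G.n) : ArrO G.flipY (yA G.n A) e ↔ ArrO G A (eY G.n e) := by
  have h1 := ArrO_eX (G := G.T) (A := tA A) (mem_gridE_eT.2 h)
  have h2 := ArrO_eT (G := G.T.flipX) (A := xA G.n (tA A)) (e := e) h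
  have h3 := ArrO_eT (G := G) (A := A) (e := eX G.n (eT e)) (eX_grid (mem_gridE_eT.2 h))
  exact h2.trans (h1.trans h3)

theorem ArrO_mE {q : Bool × Bool} {e : Edge} (h : e ∈ gridE G.n) :
    ArrO (G.fl q) (qA G.n q A) e ↔ ArrO G A (mE G.n q e) := by
  unfold fl qA mE
  split_ifs
  · exact (ArrO_eY (G := G.flipX) h).trans (ArrO_eX (eY_grid h))
  · exact ArrO_eX h
  · exact ArrO_eY h
  · rfl

theorem rA_qA {n : ℕ} {q : Bool × Bool} : qA n q (rA A) = rA (qA n q A) := by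
  unfold qA
  split_ifs <;> funext p p' <;> simp only [rA, yA, xA, tA, and_comm]

theorem ArrO.up {u l : ℕ} (h : ArrO G A (false, u, l)) (h' : l < G.π u) : A (u, l) (u, l + 1) :=
  h.1 (by simpa [Opos] using h')
theorem ArrO.down {u l : ℕ} (h : ArrO G A (false, u, l)) (h' : G.π u ≤ l) : A (u, l + 1) (u, l) :=
  h.2 (by simpa [Opos] using h')

/-- The orientations that are needed for the paths in one of the directions. -/
structure Good (G : Frame) (A : ℕ × ℕ → ℕ × ℕ → Prop) {τ : ℕ → ℕ} (S : Sol G τ) : Prop where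
  F : ∀ e ∈ gridE G.n, InF G e → ArrO G A e
  h : ∀ u l, DE S (true, u, l) → A (u, l) (u + 1, l)
  v : ∀ u l, DE S (false, u, l) → A (u, l) (u, l + 1)
  rung : ∀ u l, Rung G (false, u, l) → A (u, l) (u, l + 1)

/-- The edges against the standard orientation that are chosen in one of the four directions. -/
def FlQ (S : Sol G τ) (S' : Sol G.T τ') (e : Edge) : Prop :=
  (DE S e ∧ e.1 = true) ∨ (DE S' (eT e) ∧ (eT e).1 = true)

section

variable {τ : Bool × Bool → ℕ → ℕ} (S : ∀ q, Sol (G.fl q) (τ q)) (S' : ∀ q, Sol (G.fl q).T (tyT (G.fl q) (τ q)))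

/-- The edges against the standard orientation. -/
def FlE (e : Edge) : Prop := ∃ q, FlQ (S q) (S' q) (mE G.n q e)

open Classical in
/-- The arcs of the approximate network. -/
def AlgA (p p' : ℕ × ℕ) : Prop := ∃ e ∈ AlgE G S S', if (Opos G e ↔ ¬ FlE S S' e) then
  p = e.2 ∧ p' = (if e.1 then (e.2.1 + 1, e.2.2) else (e.2.1, e.2.2 + 1)) else
  p' = e.2 ∧ p = (if e.1 then (e.2.1 + 1, e.2.2) else (e.2.1, e.2.2 + 1))

variable {S S'}

theorem AlgA_O {e : Edge} (he : e ∈ AlgE G S S') (h : ¬ FlE S S' e) : ArrO G (AlgA S S') e := by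
  constructor
  · intro hO
    have : AlgA S S' e.2 (if e.1 then (e.2.1 + 1, e.2.2) else (e.2.1, e.2.2 + 1)) := ⟨e, he, by simp [hO, h]⟩
    unfold Arrow; split_ifs at this ⊢ <;> exact this
  · intro hO
    have : AlgA S S' (if e.1 then (e.2.1 + 1, e.2.2) else (e.2.1, e.2.2 + 1)) e.2 := ⟨e, he, by simp [hO, h]⟩
    unfold Arrow rA; split_ifs at this ⊢ <;> exact this

theorem AlgA_Fl {e : Edge} (he : e ∈ AlgE G S S') (h : FlE S S' e) : ArrO G (rA (AlgA S S')) e := by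
  constructor
  · intro hO
    have : AlgA S S' (if e.1 then (e.2.1 + 1, e.2.2) else (e.2.1, e.2.2 + 1)) e.2 := ⟨e, he, by simp [hO, h]⟩
    unfold Arrow rA; split_ifs at this ⊢ <;> exact this
  · intro hO
    have : AlgA S S' e.2 (if e.1 then (e.2.1 + 1, e.2.2) else (e.2.1, e.2.2 + 1)) := ⟨e, he, by simp [hO, h]⟩
    unfold Arrow rA; split_ifs at this ⊢ <;> exact this

theorem swapTy_swapTy (k : ℕ) : swapTy (swapTy k) = k := by unfold swapTy; split_ifs <;> omega

theorem DE.grid (hB : Blocks G τ') {S : Sol G τ'} {e : Edge} (h : DE S e) : e ∈ gridE G.n := by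
  obtain ⟨c, d, h⟩ := h.mem_Sreg hB; exact Sreg_grid h

theorem Rung.grid {e : Edge} (h : Rung G e) : e ∈ gridE G.n := by
  obtain ⟨b, hb, h1, rfl⟩ := h
  have := hb.1
  have := G.π_lt b hb.1
  rw [mem_gridE]
  exact ⟨hb.1, by simp only; omega, by simp only [Bool.false_eq_true, if_false]; omega⟩

/-- Every edge chosen in some direction lies in a region of this direction. -/
theorem FlQ.mem_Sreg (hB : ∀ q, Blocks (G.fl q) (τ q)) {q : Bool × Bool} {e : Edge}
    (h : DE (S q) e ∨ DE (S' q) (eT e)) : ∃ c d, e ∈ Sreg (G.fl q) c d := by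
  rcases h with h | h
  · exact h.mem_Sreg (hB q)
  · obtain ⟨c, d, h1⟩ := h.mem_Sreg (hB q).T
    exact ⟨d, c, mem_Sreg_eT.1 h1⟩

theorem tyT_eq (τ : ℕ → ℕ) {b : ℕ} (hb : b < G.n) : tyT G τ (G.π b) = swapTy (τ b) := by
  unfold tyT; rw [G.σπ b hb]

theorem not_FlE_of_F (hB : ∀ q, Blocks (G.fl q) (τ q)) {e : Edge} (he : e ∈ gridE G.n) (hF : InF G e) :
    ¬ FlE S S' e := by
  rintro ⟨q, ⟨h1, h2⟩ | ⟨h1, h2⟩⟩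
  · apply h1.not_F (hB q) h2
    rw [InF_mE (mE_grid he), mE_mE he]; exact hF
  · apply h1.not_F (hB q).T h2
    rw [InF_eT, InF_mE (mE_grid he), mE_mE he]; exact hF

theorem not_FlE_of_Sep (hB : ∀ q, Blocks (G.fl q) (τ q)) {e : Edge} (he : e ∈ gridE G.n) (hF : Sep G e) :
    ¬ FlE S S' e := by
  rintro ⟨q, h⟩
  obtain ⟨c, d, h1⟩ := FlQ.mem_Sreg (S := S) (S' := S') hB (h.imp And.left And.left)
  obtain ⟨b, hb, h2⟩ := Sreg_vq he h1
  exact Vq.not_sep hb he h2 hF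

/-- A tree edge lies in a region of one direction only, so no other direction can ask for it to be
turned. -/
theorem FlE.unique (hB : ∀ q, Blocks (G.fl q) (τ q)) {q : Bool × Bool} {e : Edge} (he : e ∈ gridE G.n)
    (h : DE (S q) (mE G.n q e) ∨ DE (S' q) (eT (mE G.n q e))) (hf : FlE S S' e) : FlQ (S q) (S' q) (mE G.n q e) := by
  obtain ⟨q', hf⟩ := hf
  obtain ⟨c, d, h1⟩ := FlQ.mem_Sreg (S := S) (S' := S') hB h
  obtain ⟨c', d', h2⟩ := FlQ.mem_Sreg (S := S) (S' := S') hB (hf.imp And.left And.left)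
  obtain ⟨rfl, -⟩ := Sreg_disjoint_fl he h1 h2
  exact hf

theorem AlgA_good_F (hB : ∀ q, Blocks (G.fl q) (τ q)) (q : Bool × Bool) : ∀ e ∈ gridE G.n,
    InF (G.fl q) e → ArrO (G.fl q) (qA G.n q (AlgA S S')) e := by
  intro e he hF
  rw [ArrO_mE he]
  have h1 : InF G (mE G.n q e) := (InF_mE he).1 hF
  classical
  exact AlgA_O (Finset.mem_filter.2 ⟨mE_grid he, Or.inl h1⟩) (not_FlE_of_F hB (mE_grid he) h1)

theorem AlgA_good_rung (hB : ∀ q, Blocks (G.fl q) (τ q)) (q : Bool × Bool) {e : Edge} (he : e ∈ gridE G.n)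
    (h : Rung (G.fl q) e ∨ Rung (G.fl q).T (eT e)) : ArrO (G.fl q) (qA G.n q (AlgA S S')) e := by
  rw [ArrO_mE he]
  have h1 : Sep (G.fl q) e := by
    rcases h with h | h
    · exact h.sep
    · exact Sep_eT.1 h.sep
  classical
  refine AlgA_O (Finset.mem_filter.2 ⟨mE_grid he, Or.inr ⟨q, ?_⟩⟩) (not_FlE_of_Sep hB (mE_grid he) ((Sep_mE he).1 h1))
  rw [mE_mE he]
  unfold AlgQ; tauto

theorem AlgA_good_DE (hB : ∀ q, Blocks (G.fl q) (τ q)) (q : Bool × Bool) {e : Edge} (he : e ∈ gridE G.n)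
    (h : DE (S q) e ∨ DE (S' q) (eT e)) :
    (FlQ (S q) (S' q) e → ArrO (G.fl q) (rA (qA G.n q (AlgA S S'))) e) ∧
    (¬ FlQ (S q) (S' q) e → ArrO (G.fl q) (qA G.n q (AlgA S S')) e) := by
  classical
  have h1 : mE G.n q e ∈ AlgE G S S' := by
    refine Finset.mem_filter.2 ⟨mE_grid he, Or.inr ⟨q, ?_⟩⟩
    rw [mE_mE he]; unfold AlgQ; tauto
  rw [← rA_qA, ArrO_mE he, ArrO_mE he]
  constructor
  · intro hf
    exact AlgA_Fl h1 ⟨q, by rwa [mE_mE he]⟩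
  · intro hf
    refine AlgA_O h1 fun hf' => hf ?_
    have := hf'.unique (q := q) hB (mE_grid he) (by rwa [mE_mE he])
    rwa [mE_mE he] at this

theorem DE.not_Opos (hB : Blocks G τ') {S : Sol G τ'} {e : Edge} (h : DE S e) (he : e.1 = true) : ¬ Opos G e := by
  obtain ⟨k, u, l⟩ := e
  simp only at he
  subst he
  obtain ⟨e, h1, h2, h3, h4, h5, h6⟩ := h.h_cases hB
  have := G.lt_σ h1.1 (l := l) (by omega) (by omega)
  simp only [Opos, if_true]
  omega

theorem AlgA_good (hB : ∀ q, Blocks (G.fl q) (τ q)) (q : Bool × Bool) : Good (G.fl q) (qA G.n q (AlgA S S')) (S q) where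
  F := by rw [fl_n]; exact AlgA_good_F hB q
  h := by
    intro u l h
    have hg := h.grid (hB q)
    rw [fl_n] at hg
    have h1 := (AlgA_good_DE (S := S) (S' := S') hB q hg (Or.inl h)).1 (Or.inl ⟨h, rfl⟩)
    exact h1.2 (h.not_Opos (hB q) rfl)
  v := by
    intro u l h
    have hg := h.grid (hB q)
    rw [fl_n] at hg
    obtain ⟨-, -, -, h2⟩ := h.v_cases (hB q)
    refine ((AlgA_good_DE (S := S) (S' := S') hB q hg (Or.inl h)).2 ?_).up h2
    rintro (⟨-, h3⟩ | ⟨h3, h4⟩)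
    · simp at h3
    -- The edge would also be a horizontal tree edge of the transposed frame; the argument is that
    -- of `DE.no_conflict` with the two frames exchanged.
    · refine DE.no_conflict (hB q).T (hB q) ?_ h3 h4 h
      intro b hb
      have hb' := (G.fl q).σ_lt b hb
      have := tyT_eq (G := G.fl q) (τ q) hb'
      rw [(G.fl q).πσ b hb] at this
      change _ = swapTy (tyT (G.fl q) (τ q) b)
      rw [this, swapTy_swapTy]
      rfl
  rung := by
    intro u l h
    have hg := h.grid
    rw [fl_n] at hg
    refine (AlgA_good_rung hB q hg (Or.inl h)).up ?_
    obtain ⟨b, hb, h1, h2⟩ := h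
    simp only [Prod.mk.injEq, true_and] at h2
    obtain ⟨rfl, rfl⟩ := h2
    omega

theorem AlgA_good_T (hB : ∀ q, Blocks (G.fl q) (τ q)) (q : Bool × Bool) :
    Good (G.fl q).T (tA (qA G.n q (AlgA S S'))) (S' q) where
  F := by
    intro e he hF
    have he' : e ∈ gridE (G.fl q).n := he
    rw [ArrO_eT he']
    rw [fl_n] at he'
    exact AlgA_good_F hB q (eT e) (mem_gridE_eT.2 he') (by rw [← InF_eT, eT_eT]; exact hF)
  h := by
    intro u l h
    have hg : (true, u, l) ∈ gridE (G.fl q).n := h.grid (hB q).T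
    have hg' := hg
    rw [fl_n, ← mem_gridE_eT] at hg
    have h1 := (AlgA_good_DE (S := S) (S' := S') hB q hg (Or.inr (by rwa [eT_eT]))).1 (Or.inr ⟨by rwa [eT_eT], by rw [eT_eT]⟩)
    have h2 := (ArrO_eT (G := G.fl q) hg').2 h1
    exact h2.2 (h.not_Opos (hB q).T rfl)
  v := by
    intro u l h
    have hg : (false, u, l) ∈ gridE (G.fl q).n := h.grid (hB q).T
    have hg' := hg
    rw [fl_n, ← mem_gridE_eT] at hg
    obtain ⟨-, -, -, h2⟩ := h.v_cases (hB q).T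
    refine ((ArrO_eT (G := G.fl q) hg').2 ((AlgA_good_DE (S := S) (S' := S') hB q hg (Or.inr (by rwa [eT_eT]))).2 ?_)).up h2
    rintro (⟨h3, h4⟩ | ⟨-, h3⟩)
    · refine DE.no_conflict (hB q) (hB q).T (fun b hb => tyT_eq (τ q) hb) h3 h4 (by rwa [eT_eT])
    · simp [eT] at h3
  rung := by
    intro u l h
    have hg : (false, u, l) ∈ gridE (G.fl q).n := h.grid
    have hg' := hg
    rw [fl_n, ← mem_gridE_eT] at hg
    refine ((ArrO_eT (G := G.fl q) hg').2 (AlgA_good_rung hB q hg (Or.inr (by rwa [eT_eT])))).up ?_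
    obtain ⟨b, hb, h1, h2⟩ := h
    simp only [Prod.mk.injEq, true_and] at h2
    obtain ⟨rfl, rfl⟩ := h2
    omega

end


/-! ### Directed paths in the constructed network -/

variable {G : Frame} {A : ℕ × ℕ → ℕ × ℕ → Prop} {τ : ℕ → ℕ}

theorem RU.up {u a b : ℕ} (hab : a ≤ b) (h : ∀ l, a ≤ l → l < b → A (u, l) (u, l + 1)) : RU A (u, a) (u, b) := by
  induction b, hab using Nat.le_induction with
  | base => exact .refl
  | succ m hm ih => exact (ih fun l h1 h2 => h l h1 (by omega)).tail ⟨h m hm (by omega), Or.inr rfl⟩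

theorem RU.right {l a b : ℕ} (hab : a ≤ b) (h : ∀ u, a ≤ u → u < b → A (u, l) (u + 1, l)) : RU A (a, l) (b, l) := by
  induction b, hab using Nat.le_induction with
  | base => exact .refl
  | succ m hm ih => exact (ih fun l h1 h2 => h l h1 (by omega)).tail ⟨h m hm (by omega), Or.inl rfl⟩

theorem RU.trans {p q r : ℕ × ℕ} (h : RU A p q) (h' : RU A q r) : RU A p r := Relation.ReflTransGen.trans h h'

/-- The edges on the rectangles of consecutive terminals are in standard orientation. -/
def FOri (G : Frame) (A : ℕ × ℕ → ℕ × ℕ → Prop) : Prop := ∀ e ∈ gridE G.n, InF G e → ArrO G A e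

theorem FOri.up (h : FOri G A) {u l : ℕ} (hF : FV G u l) (hl : l < G.π u) : A (u, l) (u, l + 1) := by
  refine (h (false, u, l) ?_ hF).up hl
  rw [mem_gridE]
  have := hF.1
  have := hF.2.1
  exact ⟨by simp only; omega, by simp only; omega, by simp only [Bool.false_eq_true, if_false]; omega⟩

theorem FOri.down (h : FOri G A) {u l : ℕ} (hF : FV G u l) (hl : G.π u ≤ l) : A (u, l + 1) (u, l) := by
  refine (h (false, u, l) ?_ hF).down hl
  rw [mem_gridE]
  have := hF.1
  have := hF.2.1
  exact ⟨by simp only; omega, by simp only; omega, by simp only [Bool.false_eq_true, if_false]; omega⟩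

theorem FOri.T (h : FOri G A) : FOri G.T (tA A) := by
  intro e he hF
  have he' : e ∈ gridE G.n := he
  rw [ArrO_eT he']
  exact h _ (mem_gridE_eT.2 he') (by rw [← InF_eT, eT_eT]; exact hF)

theorem FOri.right (h : FOri G A) {u l : ℕ} (hF : FH G u l) (hl : G.σ l ≤ u) : A (u, l) (u + 1, l) :=
  h.T.down hF hl

theorem FOri.left (h : FOri G A) {u l : ℕ} (hF : FH G u l) (hl : u < G.σ l) : A (u + 1, l) (u, l) :=
  h.T.up hF hl

section

variable {S : Sol G τ}

/-- Column `lc b` bounds the rectangle of the terminals of columns `lc b - 1` and `lc b`, of which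
the first is below the region and the second at or above `b`. So the edges used are in F and
directed upwards to the terminal of their column. -/
theorem leftCol (h : FOri G A) {b : ℕ} (hb : b < G.n) (hc : 1 ≤ G.lc b) {y z : ℕ} (h0 : G.ld b - 1 ≤ z) (h1 : z ≤ y)
    (h2 : y ≤ G.π b) : RU A (G.lc b, z) (G.lc b, y) := by
  have h3 := G.π_lc_lt_ld hb hc
  have h4 := G.lc_le (b := b)
  have h5 := G.π_lt b hb
  have h6 : G.π b ≤ G.π (G.lc b) := by
    rcases h4.lt_or_eq with h | h
    · exact (G.lt_π hb le_rfl h).le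
    · rw [h]
  refine RU.up h1 fun l hl hl' => h.up ⟨by omega, by omega, Or.inr (Or.inl ⟨hc, ?_⟩)⟩ (by omega)
  unfold Btw
  omega

/-- Row `ld b - 1` has its terminal to the left of column `lc b`, and rows are directed away from
their terminals. -/
theorem bottomRow (h : FOri G A) {b : ℕ} (hb : b < G.n) (hc : 1 ≤ G.lc b) {x : ℕ} (h1 : G.lc b ≤ x) (h2 : x ≤ b) :
    RU A (G.lc b, G.ld b - 1) (x, G.ld b - 1) := by
  have hd := G.one_le_ld hb hc
  have h3 := G.σ_ld_lt_lc hb hc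
  have h4 := G.ld_le (b := b)
  have h5 := G.π_lt b hb
  have h6 : b ≤ G.σ (G.ld b) := by
    rcases h4.lt_or_eq with h | h
    · exact (G.lt_σ hb le_rfl h).le
    · rw [h, G.σπ b hb]
  refine RU.right h1 fun u hl hl' => h.right ⟨by show G.ld b - 1 < G.n; omega, by show u + 1 < G.n; omega, Or.inl ⟨?_, ?_⟩⟩ (by omega)
  · show G.ld b - 1 + 1 < G.n; omega
  · simp only [Frame.T, Btw, show G.ld b - 1 + 1 = G.ld b by omega]
    omega

theorem ownUp (h : FOri G A) {b : ℕ} (hb : b < G.n) (h1 : 1 ≤ G.π b) : RU A (b, G.π b - 1) (b, G.π b) := by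
  refine RU.up (by omega) fun l hl hl' => ?_
  obtain rfl : l = G.π b - 1 := by omega
  exact h.up (FV_own hb h1) (by omega)

/-- The path follows the left boundary and the exit edge to the root of a top interval and then
descends in the tree. A left part `[a, m]` is reached by going up in column `X a`, a right part `[s,
b]` by going right in row `ρ b`. -/
theorem Good.corner (h : Good G A S) (hB : Blocks G τ) {a b : ℕ} (hu : Used S a b) :
    RU A (G.lc a, G.ld a - 1) (S.X a, S.ρ b) := by
  obtain ⟨r, hr, hab⟩ := hu
  have key : ∀ q : ℕ × ℕ, Relation.ReflTransGen (Child S) (r, S.ar r) q →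
      RU A (G.lc r, G.ld r - 1) (S.X q.1, S.ρ q.2) := by
    intro q hq
    have hrm : G.Mem (G.lc r) (G.ld r) r := ⟨hr.reg, rfl, rfl⟩
    have h0 := Sol.ar_mem' (S := S) hrm
    induction hq with
    | refl =>
      have h1 := S.nodes.X_le hB hrm
      have h2 := S.nodes.ρ_lt hB h0.2.1
      have h3 := S.nodes.mono hB hrm h0.2.1 h0.2.2
      have h4 := S.nodes.ρ_lt hB hrm
      simp only at h2 h3
      refine (leftCol h.F hr.reg.1 hr.reg.2.1 le_rfl (by omega : G.ld r - 1 ≤ S.ρ (S.ar r)) (by omega)).trans ?_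
      refine RU.right (by show G.lc r ≤ S.X r; omega) fun u hu hu' => h.h u _ (Or.inr (Or.inl ⟨r, hr, ?_⟩))
      simp [Exit, hu, hu']
    | @tail q q' hq hc ih =>
      have hp := pairIn_of_child hq h0
      cases hc with
      | left a b hab =>
        obtain ⟨s, t1, t2, t3, t4, t5, t6, t7⟩ := Sol.split (S := S) hp.1 hp.2.1 hab
        refine ih.trans (RU.up (S.nodes.mono hB t3 hp.2.1 (t6.le.trans t7)).2 fun l hl hl' => ?_)
        exact h.v _ _ (Or.inl ⟨a, b, ⟨r, hr, hq⟩, hab, by simp [TE, hl, hl']⟩)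
      | right a b hab =>
        obtain ⟨s, t1, t2, t3, t4, t5, t6, t7⟩ := Sol.split (S := S) hp.1 hp.2.1 hab
        rw [t2]
        refine ih.trans (RU.right (S.nodes.mono hB hp.1 t4 (t5.trans t6.le)).1 fun u hl hl' => ?_)
        exact h.h _ _ (Or.inl ⟨a, b, ⟨r, hr, hq⟩, hab, by simp only at hl hl'; simp [TE, t2, hl, hl']⟩)
  have h1 := key _ hab
  have h2 := (pairIn_of_child hab (Sol.ar_mem' (c := G.lc r) (d := G.ld r) ⟨hr.reg, rfl, rfl⟩)).1
  simp only at h2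
  rw [h2.2.1, h2.2.2]
  exact h1

theorem exists_root {c d j : ℕ} (hj : G.Mem c d j) : ∃ r, Root S r ∧ G.Mem c d r ∧ r ≤ j ∧ j ≤ S.ar r := by
  classical
  have hex : ∃ a, G.Mem c d a := ⟨j, hj⟩
  have h0 : Root S (Nat.find hex) := by
    refine ⟨_, (Nat.find_spec hex).1, fun p hp => ?_, .refl⟩
    have := Nat.find_min' hex (hp.mem' (Nat.find_spec hex))
    have := hp.lt
    omega
  have key : ∀ k r, Root S r → G.Mem c d r → r ≤ j → j ≤ r + k → ∃ r, Root S r ∧ G.Mem c d r ∧ r ≤ j ∧ j ≤ S.ar r := by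
    intro k
    induction k with
    | zero => intro r hr hm h1 h2; exact ⟨r, hr, hm, h1, by have := (S.ar_mem r hm.1).2; omega⟩
    | succ k ih =>
      intro r hr hm h1 h2
      by_cases h3 : j ≤ S.ar r
      · exact ⟨r, hr, hm, h1, h3⟩
      · have h4 := Sol.ar_mem' (S := S) hm
        obtain ⟨s, hs⟩ := Mem.nx_ex h4.2.1 hj (by simp only; omega)
        have h5 := hs.le_right h4.2.1 hj (by simp only; omega)
        have h6 := hs.lt
        have h7 := h4.2.2
        simp only at h6 h7
        obtain ⟨a, h8, h9, h10⟩ := hr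
        exact ih s ⟨a, h8, h9, h10.tail hs⟩ (hs.mem h4.2.1) h5 (by omega)
  exact key j _ h0 (Nat.find_spec hex) (Nat.find_min' hex hj) (by omega)

/-- The top intervals exhaust the staircase and each split leaves every terminal in one of the two
parts, so the splitting ends in single terminals. -/
theorem used_self {j : ℕ} (hj : G.Reg j) : Used S j j := by
  have hm : G.Mem (G.lc j) (G.ld j) j := ⟨hj, rfl, rfl⟩
  obtain ⟨r, hr, hrm, h1, h2⟩ := exists_root (S := S) hm
  have key : ∀ k a b, b ≤ a + k → PairIn G (G.lc j) (G.ld j) (a, b) → Used S a b → a ≤ j → j ≤ b → Used S j j := by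
    intro k
    induction k with
    | zero =>
      intro a b hk _ hu h1 h2
      obtain rfl : a = j := by omega
      obtain rfl : b = a := by omega
      exact hu
    | succ k ih =>
      intro a b hk hp hu h1 h2
      rcases hp.2.2.lt_or_eq with h3 | h3
      swap
      · simp only at h3
        exact ih a b (by omega) hp hu h1 h2
      simp only at h3
      obtain ⟨s, t1, t2, t3, t4, t5, t6, t7⟩ := Sol.split (S := S) hp.1 hp.2.1 h3
      simp only at t1 t2 t3 t4 t5 t6 t7
      obtain ⟨r, hr, hc⟩ := hu
      by_cases h4 : j ≤ S.sp a b
      · have := Child.left (S := S) a b h3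
        exact ih a (S.sp a b) (by omega) (this.pairIn hp) ⟨r, hr, hc.tail this⟩ h1 h4
      · have := Child.right (S := S) a b h3
        have h5 := t1.le_right t3 hm (by omega)
        have h6 := this.pairIn hp
        have h7 : Used S (S.sc (S.sp a b)) b := ⟨r, hr, hc.tail this⟩
        rw [t2] at h6 h7
        exact ih s b (by omega) h6 h7 h5 h2
  exact key _ r (S.ar r) (Nat.le_add_left _ _) (Sol.ar_mem' hrm) ⟨r, hr, .refl⟩ h1 h2

theorem Good.tight (h : Good G A S) {b s : ℕ} (hs : G.Nx b s) (ht : G.π s + 1 = G.π b ∨ s = b + 1) :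
    RU A (b, G.π s) (b, G.π b) := by
  have h1 := hs.π_lt
  have h2 := G.π_lt b hs.reg.1
  have h3 := hs.reg'.1
  refine RU.up h1.le fun l hl hl' => FOri.up h.F ⟨hs.reg.1, by omega, ?_⟩ hl'
  rcases ht with ht | ht
  · exact Or.inr (Or.inr (Or.inr (by omega)))
  · refine Or.inl ⟨by omega, ?_⟩
    rw [← ht]; unfold Btw; omega

/-- The last terminal of a block is reached along the row below it and its own lower edge. Earlier
members climb the vertical edges of `Ex` to the row of their successor and continue in F, where
`tight` applies. -/
theorem Good.node (h : Good G A S) (hB : Blocks G τ) {b : ℕ} (hb : G.Reg b) :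
    RU A (S.X b, S.ρ b) (b, G.π b) := by
  have hm : G.Mem (G.lc b) (G.ld b) b := ⟨hb, rfl, rfl⟩
  have hπ := hb.2.2.2
  have hex : ∀ j, G.Reg j → ∀ l x, (false, x, l) ∈ Ex S j → A (x, l) (x, l + 1) := fun j hj l x he =>
    h.v _ _ (Or.inr (Or.inr (Or.inl ⟨j, hj, he⟩)))
  have hown := ownUp h.F hb.1 (by omega)
  have one : ∀ x y, 1 ≤ y → A (x, y - 1) (x, y) → RU A (x, y - 1) (x, y) := fun x y hy ha =>
    Relation.ReflTransGen.single ⟨ha, Or.inr (by ext <;> simp only; omega)⟩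
  have hty := hB.ty b hb
  have hcases : τ b = 1 ∨ (τ b = 3 ∨ τ b = 6) ∨ τ b = 2 ∨ τ b = 4 ∨ τ b = 5 := by omega
  rcases hcases with h1 | h1 | h1 | h1 | h1
  · rw [S.nodes.own b hb (by omega) (by omega), show S.ρ b = G.π b - 1 by have := S.nodes.last b hb (by omega); omega]
    exact hown
  · have h2 : ∃ p, G.Nx p b := by
      rcases h1 with h1 | h1
      · obtain ⟨p, hp, -⟩ := hB.p2 b hb h1; exact ⟨p, hp⟩
      · obtain ⟨p, hp, -⟩ := hB.t3 b hb h1; exact ⟨p, hp⟩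
    obtain ⟨p, hp⟩ := h2
    rw [S.nodes.pred p b hp h1, show S.ρ b = G.π b - 1 by have := S.nodes.last b hb (by omega); omega]
    refine RU.trans (RU.right hp.lt.le fun u hu hu' => h.h _ _ (Or.inr (Or.inr (Or.inl ⟨b, hb, ?_⟩)))) hown
    unfold Ex
    rw [S.pr_eq p b hp]
    rcases h1 with h1 | h1 <;> simp [h1, hu, hu']
  · obtain ⟨s, h2, h3, h4⟩ := hB.p1 b hb h1
    have h5 := S.nodes.next b s h2 (Or.inl h1)
    rw [S.nodes.own b hb (by omega) (by omega), show S.ρ b = G.π s - 1 by omega]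
    refine (one _ _ (by omega) ?_).trans (h.tight h2 h3)
    have := hex s h2.reg' (G.π s - 1) b (by unfold Ex; rw [S.pr_eq b s h2]; simp [h4]; omega)
    rwa [show G.π s - 1 + 1 = G.π s by omega] at this
  · obtain ⟨s, h2, h3, h4⟩ := hB.t1 b hb h1
    obtain ⟨t, h5, h6, h7⟩ := hB.t2' s h2.reg' h4
    have h8 := S.nodes.next' b s t h2 h5 h1
    rw [S.nodes.own b hb (by omega) (by omega), show S.ρ b = G.π t - 1 by omega]
    have e1 := hex t h5.reg' (G.π t - 1) b (by
      unfold Ex; rw [S.pr_eq s t h5, S.pr_eq b s h2]; simp [h7]; omega)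
    have e2 := hex s h2.reg' (G.π s - 1) b (by unfold Ex; rw [S.pr_eq b s h2]; simp [h4]; omega)
    rw [show G.π t - 1 + 1 = G.π t by omega] at e1
    rw [show G.π s - 1 + 1 = G.π s by omega] at e2
    refine ((one _ _ (by omega) e1).trans ?_).trans (h.tight h2 (Or.inr h3))
    rw [show G.π t = G.π s - 1 by omega]
    exact one _ _ (by omega) e2
  · obtain ⟨t, h5, h6, h7⟩ := hB.t2' b hb h1
    have h8 := S.nodes.next b t h5 (Or.inr h1)
    rw [S.nodes.own b hb (by omega) (by omega), show S.ρ b = G.π t - 1 by omega]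
    have e1 := hex t h5.reg' (G.π t - 1) b (by
      unfold Ex; rw [S.pr_eq b t h5]; simp [h7]; omega)
    rw [show G.π t - 1 + 1 = G.π t by omega] at e1
    exact (one _ _ (by omega) e1).trans (h.tight h5 (Or.inl h6))

/-- Every terminal is reached from the lower left corner of its region. -/
theorem Good.hub (h : Good G A S) (hB : Blocks G τ) {b : ℕ} (hb : b < G.n) (hc : 1 ≤ G.lc b) :
    RU A (G.lc b, G.ld b - 1) (b, G.π b) := by
  have h1 := G.lc_le (b := b)
  have h2 := G.ld_le (b := b)
  have hd := G.one_le_ld hb hc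
  rcases h1.lt_or_eq with h3 | h3
  swap
  · have := leftCol h.F hb hc le_rfl (by omega : G.ld b - 1 ≤ G.π b) le_rfl
    rwa [h3] at this ⊢
  rcases h2.lt_or_eq with h4 | h4
  swap
  · refine (bottomRow h.F hb hc h3.le le_rfl).trans ?_
    rw [h4]; exact ownUp h.F hb (by omega)
  have hN : G.ND b := ⟨hb, hc, h3, h4⟩
  by_cases h5 : G.π b = G.ld b + 1
  · refine (bottomRow h.F hb hc h3.le le_rfl).trans ?_
    have := h.rung b (G.ld b - 1) ⟨b, hN, h5, rfl⟩
    refine Relation.ReflTransGen.head ⟨this, Or.inr rfl⟩ ?_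
    rw [show G.ld b - 1 + 1 = G.π b - 1 by omega]
    exact ownUp h.F hb (by omega)
  by_cases h6 : b = G.lc b + 1
  · refine (leftCol h.F hb hc le_rfl (by omega : G.ld b - 1 ≤ G.π b - 1) (by omega)).trans ?_
    have := h.h (G.lc b) (G.π b - 1) (Or.inr (Or.inr (Or.inr ⟨b, hN, by
      unfold Spc; rw [if_pos ⟨h6, by omega⟩]; simp⟩)))
    refine Relation.ReflTransGen.head ⟨this, Or.inl rfl⟩ ?_
    rw [← h6]
    exact ownUp h.F hb (by omega)
  have hr : G.Reg b := ⟨hb, hc, by omega, by omega⟩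
  exact (h.corner hB (used_self hr)).trans (h.node hB hr)

end

theorem RU.of_tA {p q : ℕ × ℕ} (h : RU (tA A) p q) : RU (rA A) p.swap q.swap := by
  unfold RU at h ⊢
  refine h.lift Prod.swap ?_
  rintro ⟨a, b⟩ ⟨c, d⟩ ⟨h1, h2⟩
  refine ⟨h1, ?_⟩
  simp only [Prod.mk.injEq, Prod.swap] at h2 ⊢
  omega

/-- The paths between terminals and the corners of their regions. -/
def Hub (G : Frame) (A : ℕ × ℕ → ℕ × ℕ → Prop) : Prop := FOri G A ∧ ∀ b, b < G.n → 1 ≤ G.lc b →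
  RU A (G.lc b, G.ld b - 1) (b, G.π b) ∧ RU (rA A) (G.lc b - 1, G.ld b) (b, G.π b)

/-- The second path, which leaves the terminal, is the entering path of the transposed and reversed
frame. -/
theorem hub_of_good {S : Sol G τ} {S' : Sol G.T (tyT G τ)} (hB : Blocks G τ) (h : Good G A S) (h' : Good G.T (tA A) S') :
    Hub G A := by
  refine ⟨h.F, fun b hb hc => ⟨h.hub hB hb hc, ?_⟩⟩
  have hd := G.one_le_ld hb hc
  have := (h'.hub hB.T (G.π_lt b hb) (by rwa [lc_T G hb])).of_tA
  rw [lc_T G hb, ld_T G hb, show G.T.π (G.π b) = b from G.σπ b hb] at this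
  exact this

/-- `G'` is obtained from `G` by a half turn. -/
structure Rot (G G' : Frame) (A A' : ℕ × ℕ → ℕ × ℕ → Prop) : Prop where
  n : G'.n = G.n
  π : ∀ i, i < G.n → G'.π i = G.n - 1 - G.π (G.n - 1 - i)
  σ : ∀ i, i < G.n → G'.σ i = G.n - 1 - G.σ (G.n - 1 - i)
  A : ∀ p q, p.1 < G.n → p.2 < G.n → q.1 < G.n → q.2 < G.n → A' p q →
    A (G.n - 1 - p.1, G.n - 1 - p.2) (G.n - 1 - q.1, G.n - 1 - q.2)

/-- A half turn reverses both axes, so the image of a path to the right and up becomes one when it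
is traversed from its other end. -/
theorem Rot.ru {G' : Frame} {A' : ℕ × ℕ → ℕ × ℕ → Prop} (h : Rot G G' A A') {p q : ℕ × ℕ} (hr : RU A' p q)
    (h1 : q.1 < G.n) (h2 : q.2 < G.n) :
    RU (rA A) (G.n - 1 - q.1, G.n - 1 - q.2) (G.n - 1 - p.1, G.n - 1 - p.2) := by
  induction hr with
  | refl => exact .refl
  | @tail b c hpb hbc ih =>
    obtain ⟨h3, h4⟩ := hbc
    have h5 : b.1 ≤ c.1 ∧ b.2 ≤ c.2 := by rcases h4 with rfl | rfl <;> simp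
    refine Relation.ReflTransGen.head ⟨h.A b c (by omega) (by omega) h1 h2 h3, ?_⟩ (ih (by omega) (by omega))
    rcases h4 with rfl | rfl
    · left; simp only at h1 ⊢; ext <;> simp only; omega
    · right; simp only at h2 ⊢; ext <;> simp only; omega

theorem Rot.rev {G' : Frame} {A' : ℕ × ℕ → ℕ × ℕ → Prop} (h : Rot G G' A A') : Rot G G' (rA A) (rA A') :=
  ⟨h.n, h.π, h.σ, fun p q h1 h2 h3 h4 h5 => h.A q p h3 h4 h1 h2 h5⟩

/-- Paths between two terminals without other terminals in their rectangle. -/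
theorem Hub.link {G' : Frame} {A' : ℕ × ℕ → ℕ × ℕ → Prop} (hr : Rot G G' A A') (h : Hub G A) (h' : Hub G' A')
    {a b : ℕ} (hb : b < G.n) (hab : a < b) (hp : G.π a < G.π b)
    (he : ∀ k, a < k → k < b → ¬ (G.π a < G.π k ∧ G.π k < G.π b)) :
    RU A (a, G.π a) (b, G.π b) ∧ RU (rA A) (a, G.π a) (b, G.π b) := by
  have hn := hr.n
  have ha : a < G.n := by omega
  have pa := G.π_lt a ha
  have pb := G.π_lt b hb
  have hca := G.lt_lc hb hab hp
  have hda := G.π_lt_ld hb hab hp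
  obtain ⟨b1, b2⟩ := h.2 b hb (by omega)
  have lb := G.lc_le (b := b)
  have db := G.ld_le (b := b)
  set a' := G.n - 1 - a with ha'
  have e1 : G.n - 1 - a' = a := by omega
  have e2 : G'.π a' = G.n - 1 - G.π a := by rw [hr.π a' (by omega), e1]
  have e3 : G'.π (G.n - 1 - b) = G.n - 1 - G.π b := by rw [hr.π _ (by omega), show G.n - 1 - (G.n - 1 - b) = b by omega]
  have ha'n : a' < G'.n := by omega
  have hca' := G'.lt_lc (a := G.n - 1 - b) ha'n (by omega) (by omega)
  have hda' := G'.π_lt_ld (a := G.n - 1 - b) ha'n (by omega) (by omega)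
  obtain ⟨a1, a2⟩ := h'.2 a' ha'n (by omega)
  have la := G'.lc_le (b := a')
  have da := G'.ld_le (b := a')
  have qa1 := G'.π_lc_lt (b := a') (by omega)
  have qa2 := G'.π_lt (G'.lc a') (by omega)
  have qd1 := G'.σ_ld_lt (b := a') (by omega)
  -- the upper right corner of the region of `a`
  obtain ⟨x, hx⟩ : ∃ x, x = G.n - 1 - G'.lc a' := ⟨_, rfl⟩
  obtain ⟨y, hy⟩ : ∃ y, y = G.n - 1 - G'.ld a' := ⟨_, rfl⟩
  have f1 := hr.ru a1 (by simp only; omega) (by simp only; omega)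
  have f2 := hr.rev.ru a2 (by simp only; omega) (by simp only; omega)
  simp only [e1, e2, show G.n - 1 - (G.n - 1 - G.π a) = G.π a by omega, ← hx, ← hy,
    show G.n - 1 - (G'.ld a' - 1) = y + 1 by omega, show G.n - 1 - (G'.lc a' - 1) = x + 1 by omega] at f1 f2
  -- positions
  have hx1 : x + 1 ≤ b := by omega
  have hxa : a ≤ x := by omega
  have hya : G.π a ≤ y := by omega
  have g1 : G.π a < G.π (x + 1) := by
    rw [hr.π (G'.lc a' - 1) (by omega), show G.n - 1 - (G'.lc a' - 1) = x + 1 by omega] at qa1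
    have := G.π_lt (x + 1) (by omega)
    omega
  have g2 : G.π x ≤ G.π a := by
    rcases hxa.lt_or_eq with h3 | h3
    · have := G'.lt_π (b := a') (u := G'.lc a') ha'n le_rfl (by omega)
      rw [hr.π (G'.lc a') (by omega), ← hx] at this
      have := G.π_lt x (by omega)
      omega
    · rw [h3]
  have g3 : G.π b ≤ G.π (x + 1) := by
    rcases hx1.lt_or_eq with h3 | h3
    · have := he (x + 1) (by omega) h3; omega
    · rw [h3]
  have k1 := G.π_lc_lt (b := b) (by omega)
  have g4 : G.π (G.lc b - 1) ≤ G.π a := by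
    rcases (show a ≤ G.lc b - 1 by omega).lt_or_eq with h3 | h3
    · have := he (G.lc b - 1) h3 (by omega); omega
    · rw [← h3]
  -- Column `x` has its terminal not above `a`, whereas the columns from `lc b` to `b` have theirs
  -- above `b`, so `x` is left of column `lc b`.
  have g5 : x + 1 ≤ G.lc b := by
    by_contra h3
    have h4 : G.π a < G.π x ∨ x = a := by
      by_contra h5
      have := G.lt_π hb (u := x) (by omega) (by omega)
      omega
    omega
  have y1 : y < G.π b := by omega
  have g6 : a < G.σ (y + 1) := by
    rw [hr.σ (G'.ld a' - 1) (by omega), show G.n - 1 - (G'.ld a' - 1) = y + 1 by omega] at qd1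
    have := G.σ_lt (y + 1) (by omega)
    omega
  have g7 : G.σ y ≤ a := by
    rcases hya.lt_or_eq with h3 | h3
    · have := G'.lt_σ (b := a') (l := G'.ld a') ha'n le_rfl (by omega)
      rw [hr.σ (G'.ld a') (by omega), ← hy] at this
      have := G.σ_lt y (by omega)
      omega
    · rw [← h3, G.σπ a ha]
  have k2 := G.σ_ld_lt (b := b) (by omega)
  have g8 : G.σ (G.ld b - 1) ≤ a := by
    by_contra h3
    have h4 := he (G.σ (G.ld b - 1)) (by omega) k2
    rw [G.πσ _ (by omega)] at h4
    have h5 : G.ld b - 1 ≠ G.π a := by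
      intro h5; rw [h5, G.σπ a ha] at h3; omega
    omega
  have g9 : b ≤ G.σ (G.ld b) := by
    rcases db.lt_or_eq with h | h
    · exact (G.lt_σ hb le_rfl h).le
    · rw [h, G.σπ b hb]
  have g10 : y + 1 ≤ G.ld b := by
    by_contra h3
    have := G.lt_σ hb (l := y) (by omega) y1
    omega
  have hF := h.1
  -- First to the upper right corner of the region of `a`, then along F to the lower left corner of
  -- the region of `b`, and on to `b`. One direction uses column `x + 1` and row `ld b - 1`, the
  -- other column `x` and row `ld b`.
  constructor
  · refine f2.trans (RU.trans (q := (x + 1, G.ld b - 1)) ?_ (RU.trans (q := (G.lc b, G.ld b - 1)) ?_ b1))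
    · refine RU.up (by omega) fun l h3 h4 => hF.up ⟨by omega, by omega, Or.inr (Or.inl ⟨by omega, ?_⟩)⟩ (by omega)
      simp only [Btw, Nat.add_sub_cancel]; omega
    · refine RU.right (by omega) fun u h3 h4 => hF.right ⟨by show G.ld b - 1 < G.n; omega, by show u + 1 < G.n; omega, Or.inl ⟨?_, ?_⟩⟩ (by omega)
      · show G.ld b - 1 + 1 < G.n; omega
      · simp only [Frame.T, Btw, show G.ld b - 1 + 1 = G.ld b by omega]; omega
  · refine f1.trans (RU.trans (q := (x, G.ld b)) ?_ (RU.trans (q := (G.lc b - 1, G.ld b)) ?_ b2))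
    · refine RU.up (by omega) fun l h3 h4 => hF.down ⟨by omega, by omega, Or.inl ⟨by omega, ?_⟩⟩ (by omega)
      unfold Btw; omega
    · refine RU.right (by omega) fun u h3 h4 => hF.left ⟨by show G.ld b < G.n; omega, by show u + 1 < G.n; omega, Or.inr (Or.inl ⟨by omega, ?_⟩)⟩ (by omega)
      simp only [Frame.T, Btw]; omega

/-- A terminal inside the rectangle splits the task into two smaller ones, until the rectangle is
empty. -/
theorem Hub.paths {G' : Frame} {A' : ℕ × ℕ → ℕ × ℕ → Prop} (hr : Rot G G' A A') (h : Hub G A) (h' : Hub G' A')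
    (k : ℕ) : ∀ a b, b < G.n → a < b → G.π a < G.π b → b ≤ a + k →
    RU A (a, G.π a) (b, G.π b) ∧ RU (rA A) (a, G.π a) (b, G.π b) := by
  induction k with
  | zero => intro a b _ h1 _ h2; omega
  | succ k ih =>
    intro a b hb hab hp hk
    by_cases he : ∀ k, a < k → k < b → ¬ (G.π a < G.π k ∧ G.π k < G.π b)
    · exact h.link hr h' hb hab hp he
    · push Not at he
      obtain ⟨m, h1, h2, h3, h4⟩ := he
      have i1 := ih a m (by omega) h1 h3 (by omega)
      have i2 := ih m b hb h2 h4 (by omega)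
      exact ⟨i1.1.trans i2.1, i1.2.trans i2.2⟩

theorem RU.bstep {p q : ℕ × ℕ} (h : RU A p q) : Relation.ReflTransGen (BStep A p q) p q := by
  have key : ∀ v, RU A v q → RU A p v → Relation.ReflTransGen (BStep A p q) v q := by
    intro v hv
    induction hv using Relation.ReflTransGen.head_induction_on with
    | refl => intro _; exact .refl
    | @head v w hvw hwq ih =>
      intro hpv
      have h1 := RU.le hpv
      have h2 := RU.le hwq
      have h3 : (w.1 = v.1 + 1 ∧ w.2 = v.2) ∨ (w.1 = v.1 ∧ w.2 = v.2 + 1) := by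
        rcases hvw.2 with h | h <;> simp [h]
      refine Relation.ReflTransGen.head ⟨hvw.1, ?_, ?_⟩ (ih (Relation.ReflTransGen.tail hpv hvw))
      · unfold nd; clear ih; omega
      · unfold nd; clear ih; omega
  exact key p h .refl

theorem bstep_flipX {n : ℕ} {p q : ℕ × ℕ} (hp : p.1 < n) (hq : q.1 < n) (h : Relation.ReflTransGen (BStep (xA n A) p q) p q) :
    Relation.ReflTransGen (BStep A (n - 1 - p.1, p.2) (n - 1 - q.1, q.2)) (n - 1 - p.1, p.2) (n - 1 - q.1, q.2) := by
  refine h.lift (fun v : ℕ × ℕ => (n - 1 - v.1, v.2)) ?_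
  rintro ⟨a, b⟩ ⟨c, d⟩ ⟨h1, h2, h3⟩
  obtain ⟨⟨h4, h5⟩, h6⟩ := h1
  simp only at h4 h5
  refine ⟨h6, ?_, ?_⟩
  · rw [nd_flip hp h4, nd_flip hp h5]; exact h2
  · rw [nd_flip h4 hq, nd_flip h5 hq]; exact h3


/-! ### The constructed edges form a network -/

variable {G : Frame} {τ : Bool × Bool → ℕ → ℕ} {S : ∀ q, Sol (G.fl q) (τ q)}
  {S' : ∀ q, Sol (G.fl q).T (tyT (G.fl q) (τ q))}

theorem AlgA_hub (hB : ∀ q, Blocks (G.fl q) (τ q)) (q : Bool × Bool) : Hub (G.fl q) (qA G.n q (AlgA S S')) :=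
  hub_of_good (hB q) (AlgA_good hB q) (AlgA_good_T hB q)

theorem rot_tt (A : ℕ × ℕ → ℕ × ℕ → Prop) : Rot (G.fl (false, false)) (G.fl (true, true))
    (qA G.n (false, false) A) (qA G.n (true, true) A) where
  n := by simp
  π := by intro i hi; simp [fl, flipX, flipY, T]
  σ := by intro i hi; simp [fl, flipX, flipY, T]
  A := by
    rintro ⟨a, b⟩ ⟨c, d⟩ h1 h2 h3 h4 h
    simp only [qA, if_true, yA_iff] at h
    simpa [qA, fl, xA] using h.2.2

theorem rot_ft (A : ℕ × ℕ → ℕ × ℕ → Prop) : Rot (G.fl (true, false)) (G.fl (false, true))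
    (qA G.n (true, false) A) (qA G.n (false, true) A) where
  n := by simp
  π := by
    intro i hi
    simp [fl, flipX, flipY, T] at hi ⊢
    rw [show G.n - 1 - (G.n - 1 - i) = i by omega]
  σ := by
    intro i hi
    simp [fl, flipX, flipY, T] at hi ⊢
    have := G.σ_lt (G.n - 1 - i) (by omega)
    omega
  A := by
    rintro ⟨a, b⟩ ⟨c, d⟩ h1 h2 h3 h4 h
    simp [fl, flipX] at h1 h2 h3 h4
    simp [qA, yA_iff] at h
    simp only [qA, fl, flipX, if_true]
    simp
    unfold xA
    simp only
    rw [show G.n - 1 - (G.n - 1 - a) = a by omega, show G.n - 1 - (G.n - 1 - c) = c by omega]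
    exact ⟨by omega, h.2⟩

theorem gridE_end {n : ℕ} {e : Edge} (he : e ∈ gridE n) : (e.2.1 < n ∧ e.2.2 < n) ∧
    (if e.1 then (e.2.1 + 1, e.2.2) else (e.2.1, e.2.2 + 1)).1 < n ∧
    (if e.1 then (e.2.1 + 1, e.2.2) else (e.2.1, e.2.2 + 1)).2 < n := by
  rw [mem_gridE] at he
  refine ⟨⟨he.1, he.2.1⟩, ?_⟩
  split_ifs at he ⊢ <;> simp only <;> omega

/-- The second end of an edge. -/
def end2 (e : Edge) : ℕ × ℕ := if e.1 then (e.2.1 + 1, e.2.2) else (e.2.1, e.2.2 + 1)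

theorem AlgA_cases {p p' : ℕ × ℕ} : AlgA S S' p p' ↔ ∃ e ∈ AlgE G S S',
    ((Opos G e ↔ ¬ FlE S S' e) ∧ p = e.2 ∧ p' = end2 e) ∨ (¬ (Opos G e ↔ ¬ FlE S S' e) ∧ p' = e.2 ∧ p = end2 e) := by
  refine exists_congr fun e => and_congr_right fun _ => ?_
  by_cases h : Opos G e ↔ ¬ FlE S S' e
  · rw [if_pos h]; unfold end2; tauto
  · rw [if_neg h]; unfold end2; tauto

/-- The approximate network is a bidirected Manhattan network. -/
theorem AlgA_isNet (hB : ∀ q, Blocks (G.fl q) (τ q)) : IsNet G (AlgA S S') where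
  lt := by
    classical
    intro p p' hp
    obtain ⟨e, he, ⟨-, h⟩ | ⟨-, h⟩⟩ := AlgA_cases.1 hp
    · rw [h.1, h.2]; exact gridE_end (Finset.mem_filter.1 he).1
    · rw [h.1, h.2]; exact (gridE_end (Finset.mem_filter.1 he).1).symm
  unit := by
    classical
    intro p p' hp
    obtain ⟨e, he, ⟨-, h⟩ | ⟨-, h⟩⟩ := AlgA_cases.1 hp <;>
      (rw [h.1, h.2]; unfold nd end2; split_ifs <;> simp only <;> omega)
  anti := by
    intro p p' hp hp'
    have key : ∀ a b : Edge, a.2 = b.2 → end2 a = end2 b → a = b := by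
      rintro ⟨k, u, l⟩ ⟨k', u', l'⟩ h1 h2
      simp only [Prod.mk.injEq] at h1
      obtain ⟨rfl, rfl⟩ := h1
      cases k <;> cases k' <;> simp [end2] at h2 ⊢
    have key2 : ∀ a b : Edge, a.2 = end2 b → end2 a = b.2 → False := by
      rintro ⟨k, u, l⟩ ⟨k', u', l'⟩ h1 h2
      cases k <;> cases k' <;> simp [end2, Prod.ext_iff] at h1 h2 <;> omega
    obtain ⟨e, he, ⟨h1, h⟩ | ⟨h1, h⟩⟩ := AlgA_cases.1 hp <;>
      obtain ⟨e', he', ⟨h2, h'⟩ | ⟨h2, h'⟩⟩ := AlgA_cases.1 hp'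
    · exact key2 e e' (h.1.symm.trans h'.2) (h.2.symm.trans h'.1)
    · obtain rfl := key e e' (h.1.symm.trans h'.1) (h.2.symm.trans h'.2)
      exact h2 h1
    · obtain rfl := key e e' (h.1.symm.trans h'.1) (h.2.symm.trans h'.2)
      exact h1 h2
    · exact key2 e e' (h.1.symm.trans h'.2) (h.2.symm.trans h'.1)
  path := by
    -- An ascending pair uses the unreflected frame and its half turn; a descending pair uses the
    -- two frames with a single reflection, which are half turns of each other.
    have main : ∀ i j, i < j → j < G.n →
        Relation.ReflTransGen (BStep (AlgA S S') (i, G.π i) (j, G.π j)) (i, G.π i) (j, G.π j) ∧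
        Relation.ReflTransGen (BStep (AlgA S S') (j, G.π j) (i, G.π i)) (j, G.π j) (i, G.π i) := by
      intro i j hij hj
      have hne : G.π i ≠ G.π j := fun h => by have := G.π_inj (by omega) hj h; omega
      rcases lt_or_gt_of_ne hne with hp | hp
      · have := Hub.paths (rot_tt (AlgA S S')) (AlgA_hub hB (false, false)) (AlgA_hub hB (true, true)) j i j
          (by simpa using hj) hij hp (by omega)
        exact ⟨this.1.bstep, path_rev this.2.bstep⟩
      · have := Hub.paths (rot_ft (AlgA S S')) (AlgA_hub hB (true, false)) (AlgA_hub hB (false, true)) G.n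
          (G.n - 1 - j) (G.n - 1 - i) (by rw [fl_n]; omega) (by omega) (by
            simp [fl, flipX]
            rwa [show G.n - 1 - (G.n - 1 - i) = i by omega, show G.n - 1 - (G.n - 1 - j) = j by omega]) (by omega)
        obtain ⟨h1, h2⟩ := this
        have e1 : (G.fl (true, false)).π (G.n - 1 - j) = G.π j := by
          simp [fl, flipX]; rw [show G.n - 1 - (G.n - 1 - j) = j by omega]
        have e2 : (G.fl (true, false)).π (G.n - 1 - i) = G.π i := by
          simp [fl, flipX]; rw [show G.n - 1 - (G.n - 1 - i) = i by omega]
        rw [e1, e2] at h1 h2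
        have h3 := bstep_flipX (by simp only; omega) (by simp only; omega) h1.bstep
        have h4 := path_rev h2.bstep
        have h5 := bstep_flipX (by simp only; omega) (by simp only; omega) h4
        simp only [show G.n - 1 - (G.n - 1 - i) = i by omega, show G.n - 1 - (G.n - 1 - j) = j by omega] at h3 h5
        exact ⟨h5, h3⟩
    intro i j hi hj
    rcases lt_trichotomy i j with h | rfl | h
    · exact (main i j h hj).1
    · exact .refl
    · exact (main j i h hi).2

theorem NE_AlgA : NE G (AlgA S S') = AlgE G S S' := by
  classical
  ext e
  constructor
  · intro h
    obtain ⟨h1, h2⟩ := Finset.mem_filter.1 h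
    have key : ∀ k u l (e' : Edge), EndP e' (u, l) → EndP e' (if k then (u + 1, l) else (u, l + 1)) → e' = (k, u, l) := by
      rintro k u l ⟨k', u', l'⟩ h1 h2
      cases k <;> cases k' <;> simp [EndP] at h1 h2 ⊢ <;> omega
    have key2 : ∀ p p', AlgA S S' p p' → ∃ e' ∈ AlgE G S S', EndP e' p ∧ EndP e' p' := by
      intro p p' hp
      obtain ⟨e', he', h⟩ := AlgA_cases.1 hp
      refine ⟨e', he', ?_⟩
      unfold EndP
      change (p = _ ∨ p = end2 e') ∧ (p' = _ ∨ p' = end2 e')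
      tauto
    obtain ⟨k, u, l⟩ := e
    have : ∃ e' ∈ AlgE G S S', EndP e' (u, l) ∧ EndP e' (if k then (u + 1, l) else (u, l + 1)) := by
      unfold HasE at h2
      split_ifs at h2 ⊢ with hk <;> simp only at h2 <;> rcases h2 with h2 | h2
      · exact key2 _ _ h2
      · obtain ⟨e', h3, h4, h5⟩ := key2 _ _ h2; exact ⟨e', h3, h5, h4⟩
      · exact key2 _ _ h2
      · obtain ⟨e', h3, h4, h5⟩ := key2 _ _ h2; exact ⟨e', h3, h5, h4⟩
    obtain ⟨e', h3, h4, h5⟩ := this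
    rw [← key k u l e' h4 h5]; exact h3
  · intro h
    refine Finset.mem_filter.2 ⟨(Finset.mem_filter.1 h).1, ?_⟩
    have key : ∀ B : ℕ × ℕ → ℕ × ℕ → Prop, Arrow B e ∨ Arrow (rA B) e → HasE B e := by
      intro B h; unfold HasE; unfold Arrow rA at h; split_ifs at h ⊢ <;> exact h
    by_cases hf : FlE S S' e
    · rw [← hasE_rA]
      have h1 := AlgA_Fl h hf
      by_cases hO : Opos G e
      · exact key _ (Or.inl (h1.1 hO))
      · exact key _ (Or.inr (h1.2 hO))
    · have h1 := AlgA_O h hf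
      by_cases hO : Opos G e
      · exact key _ (Or.inl (h1.1 hO))
      · exact key _ (Or.inr (h1.2 hO))


/-! ### From indices to the plane -/

/-- The position of a vertex. -/
def pt (G : Frame) (a : ℕ × ℕ) : Point := (G.xs a.1, G.ys a.2)

/-- The vertices of the grid. -/
def Val (G : Frame) (a : ℕ × ℕ) : Prop := a.1 < G.n ∧ a.2 < G.n

/-- The set of terminals. -/
def terms (G : Frame) : Set Point := {p | ∃ i, i < G.n ∧ p = G.pt (i, G.π i)}

/-- The arcs of `N` are those of `A`. -/
def Arcs (G : Frame) (N : Finset Arc) (A : ℕ × ℕ → ℕ × ℕ → Prop) : Prop :=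
  ∀ p q, (p, q) ∈ N ↔ ∃ a b, A a b ∧ p = G.pt a ∧ q = G.pt b

variable {G : Frame} {N : Finset Arc} {A : ℕ × ℕ → ℕ × ℕ → Prop}

theorem xs_lt_iff {i j : ℕ} (hi : i < G.n) (hj : j < G.n) : G.xs i < G.xs j ↔ i < j := by
  rcases lt_trichotomy i j with h | rfl | h
  · exact iff_of_true (G.xs_lt _ _ h hj) h
  · simp
  · exact iff_of_false (G.xs_lt _ _ h hi).le.not_gt h.le.not_gt

theorem xs_inj {i j : ℕ} (hi : i < G.n) (hj : j < G.n) (h : G.xs i = G.xs j) : i = j := by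
  have h1 := xs_lt_iff hi hj
  have h2 := xs_lt_iff hj hi
  simp only [h, lt_irrefl, false_iff] at h1 h2
  omega

theorem ys_lt_iff {i j : ℕ} (hi : i < G.n) (hj : j < G.n) : G.ys i < G.ys j ↔ i < j := xs_lt_iff (G := G.T) hi hj

theorem ys_inj {i j : ℕ} (hi : i < G.n) (hj : j < G.n) (h : G.ys i = G.ys j) : i = j := xs_inj (G := G.T) hi hj h

theorem pt_inj {a b : ℕ × ℕ} (ha : G.Val a) (hb : G.Val b) (h : G.pt a = G.pt b) : a = b :=
  Prod.ext (xs_inj ha.1 hb.1 (congrArg Prod.fst h)) (ys_inj ha.2 hb.2 (congrArg Prod.snd h))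

theorem isGridVertex_iff {p : Point} : IsGridVertex G.terms p ↔ ∃ a, G.Val a ∧ p = G.pt a := by
  constructor
  · rintro ⟨⟨s, ⟨i, hi, rfl⟩, h1⟩, s, ⟨j, hj, rfl⟩, h2⟩
    exact ⟨(i, G.π j), ⟨hi, G.π_lt j hj⟩, Prod.ext h1.symm h2.symm⟩
  · rintro ⟨a, ha, rfl⟩
    refine ⟨⟨_, ⟨a.1, ha.1, rfl⟩, rfl⟩, _, ⟨G.σ a.2, G.σ_lt _ ha.2, rfl⟩, ?_⟩
    simp only [pt, G.πσ _ ha.2]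

theorem between_iff {f : ℕ → ℝ} {n i j k : ℕ} (hf : ∀ i j, i < n → j < n → (f i < f j ↔ i < j)) (hi : i < n) (hj : j < n)
    (hk : k < n) : (min (f i) (f j) < f k ∧ f k < max (f i) (f j)) ↔ min i j < k ∧ k < max i j := by
  simp only [min_lt_iff, lt_max_iff, hf _ _ hi hk, hf _ _ hj hk, hf _ _ hk hi, hf _ _ hk hj]

theorem isGridEdge_iff {p q : Point} : IsGridEdge G.terms p q ↔
    ∃ a b, G.Val a ∧ G.Val b ∧ nd a b = 1 ∧ p = G.pt a ∧ q = G.pt b := by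
  constructor
  · rintro ⟨h1, h2, h3, h4⟩
    obtain ⟨⟨a, a'⟩, ha, rfl⟩ := isGridVertex_iff.1 h1
    obtain ⟨⟨b, b'⟩, hb, rfl⟩ := isGridVertex_iff.1 h2
    refine ⟨(a, a'), (b, b'), ha, hb, ?_, rfl, rfl⟩
    simp only [Val] at ha hb
    have h5 : ¬ (a = b ∧ a' = b') := by rintro ⟨rfl, rfl⟩; exact h3 rfl
    unfold nd
    simp only
    rcases h4 with ⟨h4, h6⟩ | ⟨h4, h6⟩
    · have h7 := xs_inj ha.1 hb.1 h4
      have key : ∀ k, k < G.n → ¬ (min a' b' < k ∧ k < max a' b') := fun k hk h8 => by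
        refine h6 _ ⟨G.σ k, G.σ_lt k hk, rfl⟩ ?_
        simp only [pt, G.πσ k hk]
        exact (between_iff (fun _ _ => ys_lt_iff) ha.2 hb.2 hk).2 h8
      -- If the two rows were not consecutive, `min + 1` would be an index strictly between them.
      have := key (min a' b' + 1)
      omega
    · have h7 := ys_inj ha.2 hb.2 h4
      have key : ∀ k, k < G.n → ¬ (min a b < k ∧ k < max a b) := fun k hk h8 =>
        h6 _ ⟨k, hk, rfl⟩ ((between_iff (fun _ _ => xs_lt_iff) ha.1 hb.1 hk).2 h8)
      have := key (min a b + 1)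
      omega
  · rintro ⟨⟨a, a'⟩, ⟨b, b'⟩, ha, hb, h, rfl, rfl⟩
    refine ⟨isGridVertex_iff.2 ⟨_, ha, rfl⟩, isGridVertex_iff.2 ⟨_, hb, rfl⟩, fun h' => ?_, ?_⟩
    · have := pt_inj ha hb h'
      simp only [Prod.mk.injEq] at this
      obtain ⟨rfl, rfl⟩ := this
      simp [nd] at h
    · simp only [nd] at h
      simp only [Val] at ha hb
      by_cases h1 : a = b
      · subst h1
        refine Or.inl ⟨rfl, ?_⟩
        rintro _ ⟨i, hi, rfl⟩ h2
        have := (between_iff (fun _ _ => ys_lt_iff) ha.2 hb.2 (G.π_lt i hi)).1 h2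
        omega
      · refine Or.inr ⟨congrArg G.ys (show a' = b' by omega), ?_⟩
        rintro _ ⟨i, hi, rfl⟩ h2
        have := (between_iff (fun _ _ => xs_lt_iff) ha.1 hb.1 hi).1 h2
        omega

theorem abs_mid_iff {f : ℕ → ℝ} {n i j k : ℕ} (hf : ∀ i j, i < n → j < n → (f i < f j ↔ i < j)) (hi : i < n) (hj : j < n)
    (hk : k < n) : |f i - f j| + |f j - f k| = |f i - f k| ↔
      (i - j) + (j - i) + ((j - k) + (k - j)) = (i - k) + (k - i) := by
  have h1 : (|f i - f j| + |f j - f k| = |f i - f k|) ↔ (f i ≤ f j ∧ f j ≤ f k) ∨ (f k ≤ f j ∧ f j ≤ f i) := by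
    constructor
    · intro h
      rcases le_total (f i) (f j) with h1 | h1 <;> rcases le_total (f j) (f k) with h2 | h2 <;>
        rcases abs_cases (f i - f j) with h3 | h3 <;> rcases abs_cases (f j - f k) with h4 | h4 <;>
        rcases abs_cases (f i - f k) with h5 | h5 <;>
        first
        | exact Or.inl ⟨by linarith, by linarith⟩
        | exact Or.inr ⟨by linarith, by linarith⟩
    · rintro (⟨h1, h2⟩ | ⟨h1, h2⟩)
      · rw [abs_of_nonpos (by linarith), abs_of_nonpos (by linarith), abs_of_nonpos (by linarith)]; ring
      · rw [abs_of_nonneg (by linarith), abs_of_nonneg (by linarith), abs_of_nonneg (by linarith)]; ring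
  rw [h1]
  simp only [← not_lt, hf _ _ hi hj, hf _ _ hj hi, hf _ _ hj hk, hf _ _ hk hj]
  omega

theorem l1_triangle (p q r : Point) : l1 p r ≤ l1 p q + l1 q r := by
  unfold l1
  have := abs_sub_le p.1 q.1 r.1
  have := abs_sub_le p.2 q.2 r.2
  linarith

/-- Equality in the triangle inequality splits into the two coordinates, where it only says that one
number is between two others. Hence Manhattan paths can be recognized by counting edges. -/
theorem l1_mid_iff {a b c : ℕ × ℕ} (ha : G.Val a) (hb : G.Val b) (hc : G.Val c) :
    l1 (G.pt a) (G.pt b) + l1 (G.pt b) (G.pt c) = l1 (G.pt a) (G.pt c) ↔ nd a b + nd b c = nd a c := by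
  have h1 := abs_mid_iff (fun _ _ => xs_lt_iff (G := G)) ha.1 hb.1 hc.1
  have h2 := abs_mid_iff (fun _ _ => ys_lt_iff (G := G)) ha.2 hb.2 hc.2
  have h3 := abs_sub_le (G.xs a.1) (G.xs b.1) (G.xs c.1)
  have h4 := abs_sub_le (G.ys a.2) (G.ys b.2) (G.ys c.2)
  simp only [l1, pt, nd]
  constructor
  · intro h
    have := h1.1 (by linarith)
    have := h2.1 (by linarith)
    omega
  · intro h
    have := h1.2 (by omega)
    have := h2.2 (by omega)
    linarith

theorem HasPath.le {p q : Point} {ℓ : ℝ} (h : HasPath N p q ℓ) : l1 p q ≤ ℓ := by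
  induction h with
  | nil p => simp [l1]
  | @cons p q r ℓ h hp ih => linarith [l1_triangle p q r]

/-- Networks in the plane are networks in terms of indices. -/
theorem isNet_of {N : Finset Arc} (h : IsBidirectedManhattan G.terms N) :
    IsNet G (fun a b => G.Val a ∧ G.Val b ∧ (G.pt a, G.pt b) ∈ N) ∧
      G.Arcs N (fun a b => G.Val a ∧ G.Val b ∧ (G.pt a, G.pt b) ∈ N) := by
  have edge : ∀ p q, (p, q) ∈ N → ∃ a b, G.Val a ∧ G.Val b ∧ nd a b = 1 ∧ p = G.pt a ∧ q = G.pt b :=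
    fun p q hpq => isGridEdge_iff.1 (h.1.1 _ hpq)
  have path : ∀ p q ℓ, HasPath N p q ℓ → ∀ s a t, G.Val s → G.Val a → G.Val t → p = G.pt a → q = G.pt t →
      l1 (G.pt s) p + ℓ = l1 (G.pt s) q →
      Relation.ReflTransGen (BStep (fun a b => G.Val a ∧ G.Val b ∧ (G.pt a, G.pt b) ∈ N) s t) a t := by
    intro p q ℓ hp
    induction hp with
    | nil p =>
      rintro s a t hs ha ht rfl h1 -
      rw [pt_inj ha ht h1]
    | @cons p q r ℓ hpq hq ih =>
      rintro s a t hs ha ht rfl rfl h1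
      obtain ⟨a', b, ha', hb, h2, h3, rfl⟩ := edge _ _ hpq
      obtain rfl := pt_inj ha ha' h3
      have h4 := HasPath.le hq
      have h5 := l1_triangle (G.pt s) (G.pt b) (G.pt t)
      have h6 := l1_triangle (G.pt s) (G.pt a) (G.pt b)
      have h7 := l1_triangle (G.pt a) (G.pt b) (G.pt t)
      have h8 := l1_triangle (G.pt s) (G.pt a) (G.pt t)
      -- The path is as short as the distance permits, which forces equality in all these triangle
      -- inequalities.
      have h9 := (l1_mid_iff hs ha hb).1 (by linarith)
      have h10 := (l1_mid_iff ha hb ht).1 (by linarith)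
      exact .head ⟨⟨ha, hb, hpq⟩, by omega, by omega⟩ (ih s b t hs hb ht rfl rfl (by linarith))
  refine ⟨⟨fun p q hpq => ⟨hpq.1, hpq.2.1⟩, fun p q ⟨h1, h2, h3⟩ => ?_, fun p q h1 h2 => h.1.2 _ _ h1.2.2 h2.2.2,
    fun i j hi hj => ?_⟩, fun p q => ⟨fun hpq => ?_, ?_⟩⟩
  · obtain ⟨a, b, h4, h5, h6, h7, h8⟩ := edge _ _ h3
    rwa [pt_inj h1 h4 h7, pt_inj h2 h5 h8]
  · refine path _ _ _ (h.2 _ ⟨i, hi, rfl⟩ _ ⟨j, hj, rfl⟩) _ _ _ ⟨hi, G.π_lt i hi⟩ ⟨hi, G.π_lt i hi⟩ ⟨hj, G.π_lt j hj⟩ rfl rfl ?_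
    simp [l1]
  · obtain ⟨a, b, h1, h2, -, rfl, rfl⟩ := edge _ _ hpq
    exact ⟨a, b, ⟨h1, h2, hpq⟩, rfl, rfl⟩
  · rintro ⟨a, b, ⟨-, -, h1⟩, rfl, rfl⟩
    exact h1

/-- Networks in terms of indices are networks in the plane. -/
theorem IsNet.manhattan (h : IsNet G A) (hN : G.Arcs N A) : IsBidirectedManhattan G.terms N := by
  refine ⟨⟨fun e he => ?_, fun p q h1 h2 => ?_⟩, ?_⟩
  · obtain ⟨a, b, h1, h2, h3⟩ := (hN _ _).1 he
    obtain ⟨h4, h5⟩ := h.lt _ _ h1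
    exact isGridEdge_iff.2 ⟨a, b, h4, h5, h.unit _ _ h1, h2, h3⟩
  · obtain ⟨a, b, h3, rfl, rfl⟩ := (hN _ _).1 h1
    obtain ⟨a', b', h4, h5, h6⟩ := (hN _ _).1 h2
    rw [pt_inj (h.lt _ _ h3).2 (h.lt _ _ h4).1 h5, pt_inj (h.lt _ _ h3).1 (h.lt _ _ h4).2 h6] at h3
    exact h.anti _ _ h4 h3
  · rintro _ ⟨i, hi, rfl⟩ _ ⟨j, hj, rfl⟩
    unfold HasManhattanPath
    have hp := h.path i j hi hj
    generalize hs : BStep A (i, G.π i) (j, G.π j) = B at hp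
    generalize (i, G.π i) = p at hp
    induction hp using Relation.ReflTransGen.head_induction_on with
    | refl => simpa [l1] using HasPath.nil (N := N) (G.pt (j, G.π j))
    | @head a b hab _ ih =>
      rw [← hs] at hab
      obtain ⟨h1, h2⟩ := h.lt _ _ hab.1
      have h3 := h.unit _ _ hab.1
      rw [← (l1_mid_iff h1 h2 ⟨hj, G.π_lt j hj⟩).2 (by rw [h3, hab.2.2, add_comm])]
      exact .cons ((hN _ _).2 ⟨a, b, hab.1, rfl, rfl⟩) ih

theorem wt_eq {e : Edge} : G.wt e = l1 (G.pt e.2) (G.pt (end2 e)) := by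
  unfold wt end2 l1 pt
  split_ifs
  · simp [abs_sub_comm]
  · simp [abs_sub_comm]

/-- Each edge of the network has exactly one orientation, so edges and arcs correspond one to one.
-/
theorem length_eq (h : IsNet G A) (hN : G.Arcs N A) : length N = G.W (NE G A) := by
  classical
  have hasE : ∀ e, HasE A e ↔ A e.2 (end2 e) ∨ A (end2 e) e.2 := fun e => by
    unfold HasE end2; split_ifs <;> rfl
  symm
  refine Finset.sum_bij (fun e _ => if A e.2 (end2 e) then (G.pt e.2, G.pt (end2 e)) else (G.pt (end2 e), G.pt e.2)) ?_ ?_ ?_ ?_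
  · intro e he
    have h1 := (hasE e).1 (Finset.mem_filter.1 he).2
    split_ifs with h2
    · exact (hN _ _).2 ⟨_, _, h2, rfl, rfl⟩
    · exact (hN _ _).2 ⟨_, _, h1.resolve_left h2, rfl, rfl⟩
  · intro e he e' he' heq
    have h1 : G.Val e.2 ∧ G.Val (end2 e) := gridE_end (Finset.mem_filter.1 he).1
    have h2 : G.Val e'.2 ∧ G.Val (end2 e') := gridE_end (Finset.mem_filter.1 he').1
    have key : (e.2 = e'.2 ∧ end2 e = end2 e') ∨ (e.2 = end2 e' ∧ end2 e = e'.2) := by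
      split_ifs at heq <;> simp only [Prod.mk.injEq] at heq
      · exact Or.inl ⟨pt_inj h1.1 h2.1 heq.1, pt_inj h1.2 h2.2 heq.2⟩
      · exact Or.inr ⟨pt_inj h1.1 h2.2 heq.1, pt_inj h1.2 h2.1 heq.2⟩
      · exact Or.inr ⟨pt_inj h1.1 h2.2 heq.2, pt_inj h1.2 h2.1 heq.1⟩
      · exact Or.inl ⟨pt_inj h1.1 h2.1 heq.2, pt_inj h1.2 h2.2 heq.1⟩
    obtain ⟨k, u, l⟩ := e
    obtain ⟨k', u', l'⟩ := e'
    cases k <;> cases k' <;> simp [end2] at key ⊢ <;> omega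
  · rintro ⟨p, q⟩ hpq
    obtain ⟨⟨a, a'⟩, ⟨b, b'⟩, h1, rfl, rfl⟩ := (hN _ _).1 hpq
    obtain ⟨h2, h3⟩ := h.lt _ _ h1
    have h4 := h.unit _ _ h1
    have key : ∃ e ∈ gridE G.n, (e.2 = (a, a') ∧ end2 e = (b, b')) ∨ (e.2 = (b, b') ∧ end2 e = (a, a')) := by
      simp only [nd] at h4 h2 h3
      by_cases h5 : a' = b'
      · refine ⟨(true, min a b, a'), mem_gridE.2 ?_, ?_⟩ <;> simp [end2] <;> omega
      · refine ⟨(false, a, min a' b'), mem_gridE.2 ?_, ?_⟩ <;> simp [end2] <;> omega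
    obtain ⟨e, he, h5 | h5⟩ := key
    · refine ⟨e, Finset.mem_filter.2 ⟨he, (hasE e).2 (Or.inl ?_)⟩, ?_⟩
      · rwa [h5.1, h5.2]
      · rw [h5.1, h5.2, if_pos h1]
    · refine ⟨e, Finset.mem_filter.2 ⟨he, (hasE e).2 (Or.inr ?_)⟩, ?_⟩
      · rwa [h5.1, h5.2]
      · rw [h5.1, h5.2, if_neg (h.anti _ _ h1)]
  · intro e he
    rw [wt_eq]
    split_ifs
    · rfl
    · unfold l1; rw [abs_sub_comm, abs_sub_comm (G.pt e.2).2]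

variable {τ : Bool × Bool → ℕ → ℕ} {S : ∀ q, Sol (G.fl q) (τ q)} {S' : ∀ q, Sol (G.fl q).T (tyT (G.fl q) (τ q))}

/-- The approximate network, as a set of arcs in the plane. -/
theorem approximation (hB : ∀ q, Blocks (G.fl q) (τ q)) (hN : G.Arcs N (AlgA S S')) :
    IsBidirectedManhattan G.terms N ∧ (∃ M, IsOptimal G.terms M) ∧
      ∀ M, IsOptimal G.terms M → length N ≤ 2 * length M := by
  classical
  have hA : IsNet G (AlgA S S') := AlgA_isNet hB
  have h1 := hA.manhattan hN
  refine ⟨h1, ?_, fun M hM => ?_⟩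
  -- There are finitely many grid vertices, hence finitely many networks, and at least one network
  -- exists; so a shortest one does too.
  · set V : Finset Point := (Finset.range G.n ×ˢ Finset.range G.n).image G.pt
    have hfin : {M | IsBidirectedManhattan G.terms M}.Finite := by
      refine ((V ×ˢ V).powerset.finite_toSet).subset fun M hM => Finset.mem_coe.2 (Finset.mem_powerset.2 fun e he => ?_)
      obtain ⟨a, b, h2, h3, -, h4, h5⟩ := isGridEdge_iff.1 (hM.1.1 e he)
      refine Finset.mem_product.2 ⟨Finset.mem_image.2 ⟨a, ?_, h4.symm⟩, Finset.mem_image.2 ⟨b, ?_, h5.symm⟩⟩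
      · simpa [Val] using h2
      · simpa [Val] using h3
    obtain ⟨M, h2, h3⟩ := hfin.exists_minimalFor length _ ⟨N, h1⟩
    exact ⟨M, h2, fun M' hM' => (le_total (length M) (length M')).elim id fun h => h3 hM' h⟩
  · obtain ⟨h2, h3⟩ := isNet_of hM.1
    rw [length_eq hA hN, length_eq h2 h3, NE_AlgA]
    exact W_AlgE_le h2 hB S S'

end Frame

/-! ### Step counts and straight-line code -/

/-- `P` runs from `s` to `s'` in at most `c` steps. -/
def Run (P : Prog) (s s' : State) (c : ℕ) : Prop := ∃ k, Exec P s s' k ∧ k ≤ c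

namespace Run

variable {P Q : Prog} {s s' s'' : State} {c c' : ℕ}

theorem mono (h : Run P s s' c) (hc : c ≤ c') : Run P s s' c' := by
  obtain ⟨k, h1, h2⟩ := h; exact ⟨k, h1, h2.trans hc⟩

theorem seq (h : Run P s s' c) (h' : Run Q s' s'' c') : Run (.seq P Q) s s'' (c + c') := by
  obtain ⟨k, h1, h2⟩ := h
  obtain ⟨l, h3, h4⟩ := h'
  exact ⟨_, .seq h1 h3, by omega⟩

theorem ifN_true {a b : ℕ} (h : s.nreg a < s.nreg b) (hP : Run P s s' c) : Run (.ifN a b P Q) s s' (c + 1) := by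
  obtain ⟨k, h1, h2⟩ := hP; exact ⟨_, .ifN_true h h1, by omega⟩

theorem ifN_false {a b : ℕ} (h : ¬ s.nreg a < s.nreg b) (hQ : Run Q s s' c) : Run (.ifN a b P Q) s s' (c + 1) := by
  obtain ⟨k, h1, h2⟩ := hQ; exact ⟨_, .ifN_false h h1, by omega⟩

theorem ifR_true {a b : ℕ} (h : s.rreg a < s.rreg b) (hP : Run P s s' c) : Run (.ifR a b P Q) s s' (c + 1) := by
  obtain ⟨k, h1, h2⟩ := hP; exact ⟨_, .ifR_true h h1, by omega⟩

theorem ifR_false {a b : ℕ} (h : ¬ s.rreg a < s.rreg b) (hQ : Run Q s s' c) : Run (.ifR a b P Q) s s' (c + 1) := by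
  obtain ⟨k, h1, h2⟩ := hQ; exact ⟨_, .ifR_false h h1, by omega⟩

theorem skip : Run .skip s s 0 := ⟨0, .skip s, le_rfl⟩

/-- A loop with a counting invariant. -/
theorem loop {a b n : ℕ} (st : ℕ → State → Prop)
    (hb : ∀ i, i < n → ∀ s, st i s → s.nreg a < s.nreg b ∧ ∃ s', Run P s s' c ∧ st (i + 1) s')
    (he : ∀ s, st n s → ¬ s.nreg a < s.nreg b) (h0 : st 0 s) :
    ∃ s', Run (.whileN a b P) s s' (n * (c + 1) + 1) ∧ st n s' := by
  have key : ∀ k i s, i + k = n → st i s → ∃ s', Run (.whileN a b P) s s' (k * (c + 1) + 1) ∧ st n s' := by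
    intro k
    induction k with
    | zero =>
      intro i s hi hs
      obtain rfl : i = n := by omega
      exact ⟨s, ⟨1, .while_false (he s hs), by omega⟩, hs⟩
    | succ k ih =>
      intro i s hi hs
      obtain ⟨h1, s', ⟨k1, h2, h2'⟩, h3⟩ := hb i (by omega) s hs
      obtain ⟨s'', ⟨k2, h4, h4'⟩, h5⟩ := ih (i + 1) s' (by omega) h3
      refine ⟨s'', ⟨_, .while_true h1 h2 h4, ?_⟩, h5⟩
      have : (k + 1) * (c + 1) + 1 = k * (c + 1) + 1 + c + 1 := by ring
      omega
  exact key n 0 s (by omega) h0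

end Run

/-- Straight-line code. -/
def Prog.block : List Instr → Prog
  | [] => .skip
  | i :: l => .seq (.instr i) (Prog.block l)

/-- The effect of straight-line code. -/
noncomputable def exec (l : List Instr) (s : State) : State := l.foldl (fun s i => i.run s) s

theorem exec_nil (s : State) : exec [] s = s := rfl

theorem exec_cons (i : Instr) (l : List Instr) (s : State) : exec (i :: l) s = exec l (i.run s) := rfl

theorem exec_append (l l' : List Instr) (s : State) : exec (l ++ l') s = exec l' (exec l s) := List.foldl_append

theorem Run.block (l : List Instr) (s : State) : Run (Prog.block l) s (exec l s) l.length := by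
  induction l generalizing s with
  | nil => exact Run.skip
  | cons i l ih =>
    have := Run.seq ⟨1, Exec.instr i s, le_rfl⟩ (ih (i.run s))
    exact this.mono (by simp; omega)

/-! ### An expression language over tables and its compiler -/

/-- Expressions over two-dimensional tables. Their values are pairs of an integer and a real. -/
inductive E
  | cst (c : ℕ)
  | size
  | var (k : ℕ)
  | get (T : ℕ) (a b : E)
  | add (a b : E)
  | sub (a b : E)
  | ltN (a b x y : E)
  | ltR (a b x y : E)
  | amin (L : ℕ) (g v : E)

/-- Contents of tables. -/
abbrev Tab := ℕ → ℕ → ℕ → ℕ × ℝ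

open Classical in
/-- The least `t < m` at which `v` is minimal among those with `g t ≠ 0`; `n` if there is none. -/
noncomputable def amin (n : ℕ) (g : ℕ → ℕ) (v : ℕ → ℝ) : ℕ → ℕ
  | 0 => n
  | m + 1 => if 0 < g m then (if amin n g v m < n then (if v m < v (amin n g v m) then m else amin n g v m) else m)
      else amin n g v m

open Classical in
/-- The value of an expression. -/
noncomputable def E.ev (n : ℕ) (tab : Tab) : E → (ℕ → ℕ) → ℕ × ℝ
  | .cst c, _ => (c, 0)
  | .size, _ => (n, 0)
  | .var k, V => (V k, 0)
  | .get T a b, V => tab T (a.ev n tab V).1 (b.ev n tab V).1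
  | .add a b, V => ((a.ev n tab V).1 + (b.ev n tab V).1, (a.ev n tab V).2 + (b.ev n tab V).2)
  | .sub a b, V => ((a.ev n tab V).1 - (b.ev n tab V).1, (a.ev n tab V).2 - (b.ev n tab V).2)
  | .ltN a b x y, V => if (a.ev n tab V).1 < (b.ev n tab V).1 then x.ev n tab V else y.ev n tab V
  | .ltR a b x y, V => if (a.ev n tab V).2 < (b.ev n tab V).2 then x.ev n tab V else y.ev n tab V
  | .amin L g v, V =>
    let r := BDMMN.amin n (fun t => (g.ev n tab (Function.update V L t)).1) (fun t => (v.ev n tab (Function.update V L t)).2) n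
    (r, if r < n then (v.ev n tab (Function.update V L r)).2 else 0)

theorem amin_spec {n : ℕ} {g : ℕ → ℕ} {v : ℕ → ℝ} {m : ℕ} (hm : m ≤ n) :
    (amin n g v m = n ∧ ∀ t, t < m → g t = 0) ∨ (amin n g v m < m ∧ 0 < g (amin n g v m) ∧
      (∀ t, t < m → 0 < g t → v (amin n g v m) ≤ v t) ∧
      ∀ t, t < amin n g v m → 0 < g t → v (amin n g v m) < v t) := by
  induction m with
  | zero => left; exact ⟨rfl, by intro t h; omega⟩
  | succ m ih =>
    simp only [amin]
    rcases ih (by omega) with ⟨h1, h2⟩ | ⟨h1, h2, h3, h4⟩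
    · rw [h1]
      split_ifs with h5 h6 h7
      · omega
      · omega
      · right
        refine ⟨by omega, h5, fun t ht hg => ?_, fun t ht hg => ?_⟩
        · rcases Nat.lt_succ_iff_lt_or_eq.1 ht with h | rfl
          · have := h2 t h; omega
          · exact le_rfl
        · have := h2 t ht; omega
      · left
        refine ⟨rfl, fun t ht => ?_⟩
        rcases Nat.lt_succ_iff_lt_or_eq.1 ht with h | rfl
        · exact h2 t h
        · omega
    · right
      rw [if_pos (show amin n g v m < n by omega)]
      split_ifs with h5 h6
      · refine ⟨by omega, h5, fun t ht hg => ?_, fun t ht hg => ?_⟩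
        · rcases Nat.lt_succ_iff_lt_or_eq.1 ht with h | rfl
          · exact h6.le.trans (h3 t h hg)
          · exact le_rfl
        · exact h6.trans_le (h3 t ht hg)
      · refine ⟨by omega, h2, fun t ht hg => ?_, h4⟩
        rcases Nat.lt_succ_iff_lt_or_eq.1 ht with h | rfl
        · exact h3 t h hg
        · exact not_lt.1 h6
      · refine ⟨by omega, h2, fun t ht hg => ?_, h4⟩
        rcases Nat.lt_succ_iff_lt_or_eq.1 ht with h | rfl
        · exact h3 t h hg
        · omega

/-- Doubling a register. -/
def dbl (d : ℕ) : ℕ → List Instr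
  | 0 => []
  | k + 1 => .nadd d d d :: dbl d k

theorem dbl_run (d k : ℕ) (s : State) : exec (dbl d k) s =
    { s with nreg := Function.update s.nreg d (s.nreg d * 2 ^ k) } := by
  induction k generalizing s with
  | zero => simp [dbl, exec_nil]
  | succ k ih =>
    rw [dbl, exec_cons, ih]
    simp only [Instr.run, Function.update_self, Function.update_idem]
    congr 2
    rw [pow_succ]; ring

theorem dbl_length (d k : ℕ) : (dbl d k).length = k := by
  induction k with
  | zero => rfl
  | succ k ih => simp [dbl, ih]

/-- The linear address of an entry of a table whose indices are in registers `a` and `b`, computed in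
register `d`. -/
def addrC (d a b T : ℕ) : List Instr :=
  .nmove d a :: (dbl d 8 ++ ([.nconst (d + 2) 255, .nadd d d (d + 2), .nload d d, .nadd d d b] ++
    (dbl d 8 ++ [.nconst (d + 2) T, .nadd d d (d + 2)])))

/-- The program for an expression. Register `1` holds the size, register `3` the position of the real
tables, register `2 k + 5` the variable `k`. -/
def E.code : E → ℕ → Prog
  | .cst c, d => .block [.nconst d c, .rsub d d d]
  | .size, d => .block [.nmove d 1, .rsub d d d]
  | .var k, d => .block [.nmove d (2 * k + 5), .rsub d d d]
  | .get T a b, d => .seq (a.code d) (.seq (b.code (d + 2))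
      (if T < 255 then (.ifN d 1 (.ifN (d + 2) 1
        (.block (addrC (d + 4) d (d + 2) T ++ [.nload d (d + 4), .nadd (d + 4) (d + 4) 3, .rload d (d + 4)]))
        (.block [.nconst d 0, .rsub d d d])) (.block [.nconst d 0, .rsub d d d]))
        else (.block [.nconst d 0, .rsub d d d])))
  | .add a b, d => .seq (a.code d) (.seq (b.code (d + 2)) (.block [.nadd d d (d + 2), .radd d d (d + 2)]))
  | .sub a b, d => .seq (a.code d) (.seq (b.code (d + 2)) (.block [.nsub d d (d + 2), .rsub d d (d + 2)]))
  | .ltN a b x y, d => .seq (a.code d) (.seq (b.code (d + 2)) (.ifN d (d + 2) (x.code d) (y.code d)))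
  | .ltR a b x y, d => .seq (a.code d) (.seq (b.code (d + 2)) (.ifR d (d + 2) (x.code d) (y.code d)))
  | .amin L g v, d => .seq (.block [.nmove (d + 2) (2 * L + 5), .nconst (2 * L + 5) 0, .nmove d 1, .rsub d d d])
      (.seq (.whileN (2 * L + 5) 1 (.seq (g.code (d + 4)) (.seq (.block [.nconst (d + 6) 0])
        (.seq (.ifN (d + 6) (d + 4) (.seq (v.code (d + 4)) (.ifN d 1
          (.ifR (d + 4) d (.block [.rmove d (d + 4), .nmove d (2 * L + 5)]) .skip)
          (.block [.rmove d (d + 4), .nmove d (2 * L + 5)]))) .skip)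
        (.block [.nconst (d + 6) 1, .nadd (2 * L + 5) (2 * L + 5) (d + 6)])))))
      (.block [.nmove (2 * L + 5) (d + 2)]))

/-- A bound for the number of steps. -/
def E.cost (n : ℕ) : E → ℕ
  | .cst _ => 2
  | .size => 2
  | .var _ => 2
  | .get _ a b => a.cost n + b.cost n + 40
  | .add a b => a.cost n + b.cost n + 2
  | .sub a b => a.cost n + b.cost n + 2
  | .ltN a b x y => a.cost n + b.cost n + x.cost n + y.cost n + 1
  | .ltR a b x y => a.cost n + b.cost n + x.cost n + y.cost n + 1
  | .amin _ g v => n * (g.cost n + v.cost n + 20) + 20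

/-- The registers below `d` and the registers with odd numbers agree, and so do the memories. -/
structure Same (d : ℕ) (s s' : State) : Prop where
  nmem : s'.nmem = s.nmem
  rmem : s'.rmem = s.rmem
  nreg : ∀ r, r < d ∨ r % 2 = 1 → s'.nreg r = s.nreg r
  rreg : ∀ r, r < d → s'.rreg r = s.rreg r

theorem Same.trans {d d' : ℕ} {s s' s'' : State} (h : Same d s s') (h' : Same d' s' s'') (hd : d ≤ d') : Same d s s'' where
  nmem := h'.nmem.trans h.nmem
  rmem := h'.rmem.trans h.rmem
  nreg r hr := (h'.nreg r (by omega)).trans (h.nreg r hr)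
  rreg r hr := (h'.rreg r (by omega)).trans (h.rreg r hr)

/-- The organization of the memory. -/
structure Ok (n : ℕ) (s : State) : Prop where
  size : s.nreg 1 = n
  row : ∀ i, i < n → s.nmem (256 * i + 255) = i * n

theorem Ok.same {n d : ℕ} {s s' : State} (h : Ok n s) (hs : Same d s s') : Ok n s' :=
  ⟨by rw [hs.nreg 1 (Or.inr rfl), h.size], by rw [hs.nmem]; exact h.row⟩

/-- The tables in the memory. -/
noncomputable def tabOf (n : ℕ) (s : State) : Tab := fun T i j =>
  if i < n ∧ j < n ∧ T < 255 then (s.nmem (256 * (i * n + j) + T), s.rmem (256 * (i * n + j) + T + s.nreg 3)) else (0, 0)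

/-- The variables in the registers. -/
def varOf (s : State) : ℕ → ℕ := fun k => s.nreg (2 * k + 5)

theorem Same.tab {n d : ℕ} {s s' : State} (h : Same d s s') : tabOf n s' = tabOf n s := by
  unfold tabOf; rw [h.nmem, h.rmem, h.nreg 3 (Or.inr rfl)]

theorem Same.var {d : ℕ} {s s' : State} (h : Same d s s') : varOf s' = varOf s := by
  funext k; exact h.nreg _ (Or.inr (by omega))

/-- Without multiplication, the factor `256` is obtained by eight doublings, and the product of the
row index with `n` is read from a precomputed pointer. The pointers occupy slot `255` of the cells,
which is why tables have numbers below `255`. -/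
theorem addrC_run {n : ℕ} {s : State} (h : Ok n s) {d a b T : ℕ} (ha : a ≠ d) (hb : b ≠ d)
    (hb' : b ≠ d + 2) (h1 : s.nreg a < n) : exec (addrC d a b T) s =
    { s with nreg := Function.update (Function.update s.nreg (d + 2) T) d (256 * (s.nreg a * n + s.nreg b) + T) } := by
  have h2 := h.row _ h1
  have e1 : s.nreg a * 256 + 255 = 256 * s.nreg a + 255 := by ring
  simp only [addrC, exec_cons, exec_append, dbl_run, exec_nil, Instr.run]
  congr 1
  funext r
  simp only [Function.update_apply]
  by_cases h3 : r = d
  · subst h3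
    simp [hb, hb', h2, e1]
    ring
  · by_cases h4 : r = d + 2 <;> simp [h3, h4]

/-- The instruction writes only registers that expressions may use from `d` on. -/
def Instr.Lo (d : ℕ) : Instr → Prop
  | .nconst r _ | .nmove r _ | .nadd r _ _ | .nsub r _ _ | .nload r _ => d ≤ r ∧ r % 2 = 0
  | .rmove r _ | .radd r _ _ | .rsub r _ _ | .rload r _ => d ≤ r
  | .nstore _ _ | .rstore _ _ => False

theorem Same.refl (d : ℕ) (s : State) : Same d s s := ⟨rfl, rfl, fun _ _ => rfl, fun _ _ => rfl⟩

theorem Instr.Lo.same {d : ℕ} {i : Instr} (h : i.Lo d) (s : State) : Same d s (i.run s) := by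
  cases i <;> simp only [Instr.Lo] at h <;> constructor <;> simp only [Instr.run] <;>
    intro r hr <;> first | trivial | (apply Function.update_of_ne; omega)

theorem Same.exec {d : ℕ} {l : List Instr} (h : ∀ i ∈ l, i.Lo d) (s : State) : Same d s (exec l s) := by
  induction l generalizing s with
  | nil => exact Same.refl d s
  | cons i l ih =>
    exact ((h i (by simp)).same s).trans (ih (fun j hj => h j (by simp [hj])) _) le_rfl

theorem dbl_lo {d k r : ℕ} (hd : d ≤ r) (hr : r % 2 = 0) : ∀ i ∈ dbl r k, i.Lo d := by
  induction k with
  | zero => simp [dbl]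
  | succ k ih =>
    simp only [dbl, List.mem_cons]
    rintro i (rfl | h)
    · exact ⟨hd, hr⟩
    · exact ih i h

theorem addrC_lo {d r a b T : ℕ} (hd : d ≤ r) (hr : r % 2 = 0) : ∀ i ∈ addrC r a b T, i.Lo d := by
  have := dbl_lo (k := 8) hd hr
  simp only [addrC, List.mem_cons, List.mem_append, List.not_mem_nil]
  rintro i (rfl | h | (rfl | rfl | rfl | rfl | h) | h | rfl | rfl | h)
  all_goals first | exact this i h | exact h.elim | (constructor <;> omega)

/-- The value of an expression has been computed in the registers `d`. -/
def Res (d c : ℕ) (P : Prog) (s : State) (v : ℕ × ℝ) : Prop :=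
  ∃ s', Run P s s' c ∧ Same d s s' ∧ s'.nreg d = v.1 ∧ s'.rreg d = v.2

theorem res_zero {d c : ℕ} {s : State} (hd : d % 2 = 0) (hc : 2 ≤ c) :
    Res d c (.block [.nconst d 0, .rsub d d d]) s (0, 0) := by
  refine ⟨_, (Run.block _ s).mono hc, Same.exec ?_ s, ?_, ?_⟩
  · simp [Instr.Lo, hd]
  · simp [exec_cons, exec_nil, Instr.run]
  · simp [exec_cons, exec_nil, Instr.run]

theorem Res.get {n d T : ℕ} {s : State} (hd : d % 2 = 0) (ho : Ok n s) :
    Res d 40 (if T < 255 then (.ifN d 1 (.ifN (d + 2) 1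
        (.block (addrC (d + 4) d (d + 2) T ++ [.nload d (d + 4), .nadd (d + 4) (d + 4) 3, .rload d (d + 4)]))
        (.block [.nconst d 0, .rsub d d d])) (.block [.nconst d 0, .rsub d d d]))
        else (.block [.nconst d 0, .rsub d d d])) s (tabOf n s T (s.nreg d) (s.nreg (d + 2))) := by
  have h0 := res_zero (c := 37) (s := s) hd (by omega)
  have hn : ∀ {b : Prop} [Decidable b], ¬ b → ∀ x : ℕ × ℝ, (if b then x else (0, 0)) = (0, 0) := fun h x => if_neg h
  unfold tabOf
  by_cases hT : T < 255
  · rw [if_pos hT]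
    by_cases h1 : s.nreg d < n
    · by_cases h2 : s.nreg (d + 2) < n
      · rw [if_pos ⟨h1, h2, hT⟩]
        refine ⟨_, ((Run.ifN_true (by rwa [ho.size]) (Run.ifN_true (by rwa [ho.size]) (Run.block _ s))).mono ?_),
          Same.exec ?_ s, ?_, ?_⟩
        · simp [addrC, dbl_length]
        · simp only [List.mem_append]
          rintro i (h | h)
          · exact addrC_lo (by omega) (by omega) i h
          · fin_cases h <;> simp only [Instr.Lo] <;> omega
        · rw [exec_append, addrC_run ho (by omega) (by omega) (by omega) h1]
          simp [exec_cons, exec_nil, Instr.run, Function.update_apply]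
        · rw [exec_append, addrC_run ho (by omega) (by omega) (by omega) h1]
          simp [exec_cons, exec_nil, Instr.run, Function.update_apply]
          rw [if_neg (by omega)]
      · rw [hn (by tauto)]
        obtain ⟨s', h3, h4⟩ := h0
        exact ⟨s', (Run.ifN_true (by rwa [ho.size]) (Run.ifN_false (by rwa [ho.size]) h3)).mono (by omega), h4⟩
    · rw [hn (by tauto)]
      obtain ⟨s', h3, h4⟩ := h0
      exact ⟨s', (Run.ifN_false (by rwa [ho.size]) h3).mono (by omega), h4⟩
  · rw [if_neg hT, hn (by tauto)]
    exact res_zero hd (by omega)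

/-- Scratch values are in even registers from `d` on, while the size, the position of the real
tables and the variables are in odd ones. An operand computed from register `d + 2` on therefore
leaves the value in register `d` and all variables intact. -/
theorem E.code_run {n : ℕ} (e : E) : ∀ {d : ℕ} {s : State}, d % 2 = 0 → 2 ≤ d → Ok n s →
    Res d (e.cost n) (e.code d) s (e.ev n (tabOf n s) (varOf s)) := by
  induction e with
  | cst c =>
    intro d s hd h2 ho
    refine ⟨_, Run.block _ s, Same.exec ?_ s, ?_, ?_⟩ <;> simp [exec_cons, exec_nil, Instr.run, Instr.Lo, E.ev, hd]
  | size =>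
    intro d s hd h2 ho
    refine ⟨_, Run.block _ s, Same.exec ?_ s, ?_, ?_⟩ <;>
      simp [exec_cons, exec_nil, Instr.run, Instr.Lo, E.ev, hd, ho.size]
  | var k =>
    intro d s hd h2 ho
    refine ⟨_, Run.block _ s, Same.exec ?_ s, ?_, ?_⟩ <;>
      simp [exec_cons, exec_nil, Instr.run, Instr.Lo, E.ev, hd, varOf]
  | get T a b iha ihb =>
    intro d s hd h2 ho
    obtain ⟨s1, r1, m1, n1, -⟩ := iha hd h2 ho
    obtain ⟨s2, r2, m2, n2, -⟩ := ihb (d := d + 2) (s := s1) (by omega) (by omega) (ho.same m1)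
    obtain ⟨s3, r3, m3, n3, x3⟩ := Res.get (T := T) hd ((ho.same m1).same m2)
    refine ⟨s3, (r1.seq (r2.seq r3)).mono (by simp only [E.cost]; omega), (m1.trans m2 (by omega)).trans m3 le_rfl, ?_, ?_⟩
    · rw [n3, m2.tab, m1.tab, n2, m2.nreg d (by omega), n1, m1.tab, m1.var]; rfl
    · rw [x3, m2.tab, m1.tab, n2, m2.nreg d (by omega), n1, m1.tab, m1.var]; rfl
  | add a b iha ihb =>
    intro d s hd h2 ho
    obtain ⟨s1, r1, m1, n1, x1⟩ := iha hd h2 ho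
    obtain ⟨s2, r2, m2, n2, x2⟩ := ihb (d := d + 2) (s := s1) (by omega) (by omega) (ho.same m1)
    rw [m1.tab, m1.var] at n2 x2
    rw [← m2.nreg d (by omega)] at n1
    rw [← m2.rreg d (by omega)] at x1
    refine ⟨_, (r1.seq (r2.seq (Run.block _ s2))).mono (by simp [E.cost]; omega),
      (m1.trans m2 (by omega)).trans (Same.exec ?_ s2) le_rfl, ?_, ?_⟩ <;>
      simp [exec_cons, exec_nil, Instr.run, Instr.Lo, E.ev, hd, n1, n2, x1, x2]
  | sub a b iha ihb =>
    intro d s hd h2 ho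
    obtain ⟨s1, r1, m1, n1, x1⟩ := iha hd h2 ho
    obtain ⟨s2, r2, m2, n2, x2⟩ := ihb (d := d + 2) (s := s1) (by omega) (by omega) (ho.same m1)
    rw [m1.tab, m1.var] at n2 x2
    rw [← m2.nreg d (by omega)] at n1
    rw [← m2.rreg d (by omega)] at x1
    refine ⟨_, (r1.seq (r2.seq (Run.block _ s2))).mono (by simp [E.cost]; omega),
      (m1.trans m2 (by omega)).trans (Same.exec ?_ s2) le_rfl, ?_, ?_⟩ <;>
      simp [exec_cons, exec_nil, Instr.run, Instr.Lo, E.ev, hd, n1, n2, x1, x2]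
  | ltN a b x y iha ihb ihx ihy =>
    intro d s hd h2 ho
    obtain ⟨s1, r1, m1, n1, x1⟩ := iha hd h2 ho
    obtain ⟨s2, r2, m2, n2, x2⟩ := ihb (d := d + 2) (s := s1) (by omega) (by omega) (ho.same m1)
    rw [m1.tab, m1.var] at n2
    rw [← m2.nreg d (by omega)] at n1
    have m := m1.trans m2 (by omega)
    obtain ⟨s3, r3, m3, n3, x3⟩ := ihx hd h2 (ho.same m)
    obtain ⟨s4, r4, m4, n4, x4⟩ := ihy hd h2 (ho.same m)
    rw [m.tab, m.var] at n3 x3 n4 x4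
    by_cases h : s2.nreg d < s2.nreg (d + 2)
    · refine ⟨s3, (r1.seq (r2.seq (Run.ifN_true h r3))).mono (by simp [E.cost]; omega), m.trans m3 le_rfl, ?_⟩
      rw [n1, n2] at h
      simp [E.ev, h, n3, x3]
    · refine ⟨s4, (r1.seq (r2.seq (Run.ifN_false h r4))).mono (by simp [E.cost]; omega), m.trans m4 le_rfl, ?_⟩
      rw [n1, n2] at h
      simp [E.ev, h, n4, x4]
  | ltR a b x y iha ihb ihx ihy =>
    intro d s hd h2 ho
    obtain ⟨s1, r1, m1, n1, x1⟩ := iha hd h2 ho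
    obtain ⟨s2, r2, m2, n2, x2⟩ := ihb (d := d + 2) (s := s1) (by omega) (by omega) (ho.same m1)
    rw [m1.tab, m1.var] at x2
    rw [← m2.rreg d (by omega)] at x1
    have m := m1.trans m2 (by omega)
    obtain ⟨s3, r3, m3, n3, x3⟩ := ihx hd h2 (ho.same m)
    obtain ⟨s4, r4, m4, n4, x4⟩ := ihy hd h2 (ho.same m)
    rw [m.tab, m.var] at n3 x3 n4 x4
    by_cases h : s2.rreg d < s2.rreg (d + 2)
    · refine ⟨s3, (r1.seq (r2.seq (Run.ifR_true h r3))).mono (by simp [E.cost]; omega), m.trans m3 le_rfl, ?_⟩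
      rw [x1, x2] at h
      simp [E.ev, h, n3, x3]
    · refine ⟨s4, (r1.seq (r2.seq (Run.ifR_false h r4))).mono (by simp [E.cost]; omega), m.trans m4 le_rfl, ?_⟩
      rw [x1, x2] at h
      simp [E.ev, h, n4, x4]
  | amin L g v ihg ihv =>
    intro d s hd h2 ho
    set gg : ℕ → ℕ := fun t => (g.ev n (tabOf n s) (Function.update (varOf s) L t)).1
    set vv : ℕ → ℝ := fun t => (v.ev n (tabOf n s) (Function.update (varOf s) L t)).2
    -- The loop runs in the register of variable `L` itself, whose old value is saved in register `d
    -- + 2` and restored at the end; register `d` holds the best index so far and the minimum.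
    let st2 : ℕ → ℕ → ℝ → State → Prop := fun i a x s' => (s'.nmem = s.nmem ∧ s'.rmem = s.rmem ∧
      (∀ r, r < d ∨ r % 2 = 1 → r ≠ 2 * L + 5 → s'.nreg r = s.nreg r) ∧ (∀ r, r < d → s'.rreg r = s.rreg r)) ∧
      s'.nreg (2 * L + 5) = i ∧ s'.nreg (d + 2) = s.nreg (2 * L + 5) ∧ s'.nreg d = a ∧ s'.rreg d = x
    let st : ℕ → State → Prop := fun i => st2 i (BDMMN.amin n gg vv i)
      (if BDMMN.amin n gg vv i < n then vv (BDMMN.amin n gg vv i) else 0)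
    have hmv : ∀ {i a x s' s''}, st2 i a x s' → Same (d + 4) s' s'' → st2 i a x s'' := by
      rintro i a x s' s'' ⟨⟨h3, h4, h5, h6⟩, h7, h8, h9, h10⟩ m
      refine ⟨⟨m.nmem.trans h3, m.rmem.trans h4, fun r hr h => ?_, fun r hr => ?_⟩, ?_, ?_, ?_, ?_⟩
      · rw [m.nreg r (by omega), h5 r hr h]
      · rw [m.rreg r (by omega), h6 r hr]
      · rw [m.nreg _ (by omega), h7]
      · rw [m.nreg _ (by omega), h8]
      · rw [m.nreg _ (by omega), h9]
      · rw [m.rreg _ (by omega), h10]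
    have hinc : ∀ {i a x s'}, st2 i a x s' →
        st2 (i + 1) a x (exec [.nconst (d + 6) 1, .nadd (2 * L + 5) (2 * L + 5) (d + 6)] s') := by
      rintro i a x s' ⟨⟨h3, h4, h5, h6⟩, h7, h8, h9, h10⟩
      refine ⟨⟨h3, h4, fun r hr h => ?_, h6⟩, ?_, ?_, ?_, h10⟩ <;>
        simp only [exec_cons, exec_nil, Instr.run, Function.update_apply]
      · rw [if_neg h, if_neg (by omega), h5 r hr h]
      · simp only [if_true, if_neg (show ¬ 2 * L + 5 = d + 6 by omega), h7]
      · rw [if_neg (by omega), if_neg (by omega), h8]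
      · rw [if_neg (by omega), if_neg (by omega), h9]
    have hset : ∀ {i a x s'}, st2 i a x s' →
        st2 i i (s'.rreg (d + 4)) (exec [.rmove d (d + 4), .nmove d (2 * L + 5)] s') := by
      rintro i a x s' ⟨⟨h3, h4, h5, h6⟩, h7, h8, h9, h10⟩
      refine ⟨⟨h3, h4, fun r hr h => ?_, fun r hr => ?_⟩, ?_, ?_, ?_, ?_⟩ <;>
        simp only [exec_cons, exec_nil, Instr.run, Function.update_apply]
      · rw [if_neg (by omega), h5 r hr h]
      · rw [if_neg (by omega), h6 r hr]
      · rw [if_neg (by omega), h7]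
      · rw [if_neg (by omega), h8]
      · simpa using h7
      · simp
    have hst : ∀ {i a x s'}, st2 i a x s' → Ok n s' ∧ tabOf n s' = tabOf n s ∧ varOf s' = Function.update (varOf s) L i := by
      rintro i a x s' ⟨⟨h3, h4, h5, -⟩, h6, -⟩
      refine ⟨⟨by rw [h5 1 (by omega) (by omega), ho.size], by rw [h3]; exact ho.row⟩, ?_, ?_⟩
      · unfold tabOf; rw [h3, h4, h5 3 (by omega) (by omega)]
      · funext k
        simp only [varOf, Function.update_apply]
        split_ifs with h
        · rw [h, h6]
        · exact h5 _ (by omega) (by omega)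
    have r0 := Run.block [.nmove (d + 2) (2 * L + 5), .nconst (2 * L + 5) 0, .nmove d 1, .rsub d d d] s
    have z0 : st 0 (exec [.nmove (d + 2) (2 * L + 5), .nconst (2 * L + 5) 0, .nmove d 1, .rsub d d d] s) := by
      refine ⟨⟨rfl, rfl, fun r hr hr' => ?_, fun r hr => ?_⟩, ?_, ?_, ?_, ?_⟩
      · simp [exec_cons, exec_nil, Instr.run, Function.update_apply]
        rw [if_neg (by omega), if_neg (by omega), if_neg (by omega)]
      · simp [exec_cons, exec_nil, Instr.run, Function.update_apply]; omega
      · simp [exec_cons, exec_nil, Instr.run, Function.update_apply]; omega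
      · simp [exec_cons, exec_nil, Instr.run, Function.update_apply]; omega
      · simp [exec_cons, exec_nil, Instr.run, BDMMN.amin, ho.size]
      · simp [exec_cons, exec_nil, Instr.run, BDMMN.amin]
    obtain ⟨s2, r2, z2⟩ := Run.loop (a := 2 * L + 5) (b := 1) (n := n) (c := g.cost n + v.cost n + 8) st
      (P := .seq (g.code (d + 4)) (.seq (.block [.nconst (d + 6) 0])
        (.seq (.ifN (d + 6) (d + 4) (.seq (v.code (d + 4)) (.ifN d 1
          (.ifR (d + 4) d (.block [.rmove d (d + 4), .nmove d (2 * L + 5)]) .skip)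
          (.block [.rmove d (d + 4), .nmove d (2 * L + 5)]))) .skip)
        (.block [.nconst (d + 6) 1, .nadd (2 * L + 5) (2 * L + 5) (d + 6)])))) (by
        intro i hi s1 z1
        obtain ⟨o1, t1, v1⟩ := hst z1
        refine ⟨by rw [z1.2.1, o1.size]; exact hi, ?_⟩
        obtain ⟨s2, r2, m2, n2, -⟩ := ihg (d := d + 4) (by omega) (by omega) o1
        rw [t1, v1] at n2
        have r3 := Run.block [.nconst (d + 6) 0] s2
        have m3 : Same (d + 4) s1 (exec [.nconst (d + 6) 0] s2) :=
          m2.trans (Same.exec (by simp [Instr.Lo]; omega) s2) le_rfl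
        set s3 := exec [.nconst (d + 6) 0] s2 with hs3
        have n3 : s3.nreg (d + 6) = 0 := by simp [hs3, exec_cons, exec_nil, Instr.run]
        have n3' : s3.nreg (d + 4) = gg i := by
          rw [← show s2.nreg (d + 4) = gg i from n2]; simp [hs3, exec_cons, exec_nil, Instr.run]
        have z3 := hmv z1 m3
        obtain ⟨o3, t3, v3⟩ := hst z3
        have fin : ∀ {P s5}, Run P s3 s5 (v.cost n + 5) → st2 i (BDMMN.amin n gg vv (i + 1))
            (if BDMMN.amin n gg vv (i + 1) < n then vv (BDMMN.amin n gg vv (i + 1)) else 0) s5 →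
            ∃ s', Run (.seq (g.code (d + 4)) (.seq (.block [.nconst (d + 6) 0]) (.seq P
              (.block [.nconst (d + 6) 1, .nadd (2 * L + 5) (2 * L + 5) (d + 6)])))) s1 s'
              (g.cost n + v.cost n + 8) ∧ st (i + 1) s' := fun r5 z5 =>
          ⟨_, (r2.seq (r3.seq (r5.seq (Run.block _ _)))).mono (by simp; omega), hinc z5⟩
        by_cases hg : 0 < gg i
        · obtain ⟨s4, r4, m4, -, x4⟩ := ihv (d := d + 4) (s := s3) (by omega) (by omega) o3
          rw [t3, v3] at x4
          have z4 := hmv z3 m4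
          have x4' : s4.rreg (d + 4) = vv i := x4
          have o4 := (hst z4).1
          have z5 := hset z4
          rw [x4'] at z5
          by_cases h5 : BDMMN.amin n gg vv i < n
          · by_cases h6 : vv i < vv (BDMMN.amin n gg vv i)
            · refine fin ((Run.ifN_true (by rw [n3, n3']; exact hg) (r4.seq (Run.ifN_true
                (by rw [z4.2.2.2.1, o4.size]; exact h5) (Run.ifR_true (by rw [z4.2.2.2.2, if_pos h5, x4']; exact h6)
                (Run.block _ s4))))).mono (by simp)) ?_
              simpa [BDMMN.amin, hg, h5, h6, hi] using z5
            · refine fin ((Run.ifN_true (by rw [n3, n3']; exact hg) (r4.seq (Run.ifN_true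
                (by rw [z4.2.2.2.1, o4.size]; exact h5) (Run.ifR_false (by rw [z4.2.2.2.2, if_pos h5, x4']; exact h6)
                Run.skip)))).mono (by simp)) ?_
              simpa [BDMMN.amin, hg, h5, h6, hi] using z4
          · refine fin ((Run.ifN_true (by rw [n3, n3']; exact hg) (r4.seq (Run.ifN_false
              (by rw [z4.2.2.2.1, o4.size]; exact h5) (Run.block _ s4)))).mono (by simp)) ?_
            simpa [BDMMN.amin, hg, h5, hi] using z5
        · refine fin ((Run.ifN_false (by rw [n3, n3']; exact hg) Run.skip).mono (by simp)) ?_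
          simpa [BDMMN.amin, hg] using z3) (by
        intro s1 z1; rw [z1.2.1, (hst z1).1.size]; omega) z0
    refine ⟨_, (r0.seq (r2.seq (Run.block _ s2))).mono ?_, ?_, ?_, ?_⟩
    · simp [E.cost]
      have : n * (g.cost n + v.cost n + 8 + 1) ≤ n * (g.cost n + v.cost n + 20) := Nat.mul_le_mul_left _ (by omega)
      omega
    · refine ⟨z2.1.1, z2.1.2.1, fun r hr => ?_, z2.1.2.2.2⟩
      simp only [exec_cons, exec_nil, Instr.run, Function.update_apply]
      split_ifs with h
      · rw [h, z2.2.2.1]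
      · exact z2.1.2.2.1 r hr h
    · simp only [exec_cons, exec_nil, Instr.run, Function.update_apply]
      rw [if_neg (by omega), z2.2.2.2.1]; rfl
    · simp only [exec_cons, exec_nil, Instr.run]
      rw [z2.2.2.2.2]; rfl


/-! ### Filling tables one after the other -/

/-- The order in which the entries of a table are computed. -/
def Bef (a b i j : ℕ) : Prop := a < i ∨ a = i ∧ b < j

/-- The values of the variables in the entry `(i, j)` of a table. -/
def V2 (i j : ℕ) : ℕ → ℕ := fun k => if k = 0 then i else if k = 1 then j else 0

/-- The state of the machine while it computes the entry `(i, j)` of a table. -/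
structure Rdy (n i j : ℕ) (s : State) : Prop where
  ok : Ok n s
  var : varOf s = V2 i j
  big : 8 * (n * n) ≤ s.nreg 3

theorem Rdy.same {n i j d : ℕ} {s s' : State} (h : Rdy n i j s) (hs : Same d s s') : Rdy n i j s' :=
  ⟨h.ok.same hs, hs.var.trans h.var, by rw [hs.nreg 3 (Or.inr rfl)]; exact h.big⟩

/-- The table `T` has been computed from `body` up to the entry `(i, j)`. -/
structure Cells (n T : ℕ) (body : E) (t₀ : Tab) (i j : ℕ) (t : Tab) : Prop where
  other : ∀ T', T' ≠ T → t T' = t₀ T'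
  val : ∀ a b, a < n → b < n → Bef a b i j → ∃ t', t T a b = body.ev n t' (V2 a b) ∧
    (∀ T', T' ≠ T → t' T' = t₀ T') ∧ ∀ c d, Bef c d a b → t' T c d = t T c d

/-- One entry of a table. -/
def cell (T : ℕ) (body : E) : Prog :=
  .seq (body.code 2) (.block (addrC 4 5 7 T ++ [.nstore 4 2, .nadd 4 4 3, .rstore 4 2]))

theorem addr_inj {n T T' i i' j j' : ℕ} (hT : T < 255) (hT' : T' < 256) (hj : j < n) (hj' : j' < n)
    (h : 256 * (i * n + j) + T = 256 * (i' * n + j') + T') : T = T' ∧ i = i' ∧ j = j' := by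
  have h1 : T = T' := by omega
  have h2 : i * n + j = i' * n + j' := by omega
  have e : ∀ a b, b < n → (a * n + b) / n = a := fun a b hb => by
    rw [mul_comm, Nat.mul_add_div (by omega), Nat.div_eq_of_lt hb, add_zero]
  have h3 : i = i' := by rw [← e i j hj, h2, e i' j' hj']
  subst h3
  exact ⟨h1, rfl, by omega⟩

theorem cell_run {n T i j : ℕ} {body : E} {s : State} (hT : T < 255) (hi : i < n) (hj : j < n)
    (h : Rdy n i j s) : ∃ s', Run (cell T body) s s' (body.cost n + 30) ∧ Rdy n i j s' ∧ tabOf n s' =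
      fun T' i' j' => if T' = T ∧ i' = i ∧ j' = j then body.ev n (tabOf n s) (V2 i j) else tabOf n s T' i' j' := by
  obtain ⟨s1, r1, m1, n1, x1⟩ := body.code_run (d := 2) rfl le_rfl h.ok
  rw [h.var] at n1 x1
  have z1 := h.same m1
  have v0 : s1.nreg 5 = i := congrFun z1.var 0
  have v1 : s1.nreg 7 = j := congrFun z1.var 1
  refine ⟨_, (r1.seq (Run.block _ s1)).mono (by simp [addrC, dbl_length]), ?_⟩
  rw [exec_append, addrC_run z1.ok (by omega) (by omega) (by omega) (by rw [v0]; exact hi), v0, v1, ← m1.tab]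
  rw [← m1.tab] at n1 x1
  set a := 256 * (i * n + j) + T
  simp only [exec_cons, exec_nil, Instr.run]
  refine ⟨⟨⟨?_, fun r hr => ?_⟩, ?_, ?_⟩, ?_⟩
  · simpa using z1.ok.size
  · simp only [Function.update_apply]
    rw [if_neg, z1.ok.row r hr]
    simp; omega
  · rw [← z1.var]
    funext k
    simp only [varOf, Function.update_apply]
    rw [if_neg (by omega), if_neg (by omega), if_neg (by omega)]
  · simpa using z1.big
  · funext T' i' j'
    by_cases hb : i' < n ∧ j' < n ∧ T' < 255
    · by_cases hc : T' = T ∧ i' = i ∧ j' = j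
      · rw [if_pos hc]
        obtain ⟨rfl, rfl, rfl⟩ := hc
        simp [tabOf, hb, a, n1, x1]
      · have ne : 256 * (i' * n + j') + T' ≠ a := fun hh => hc (addr_inj hb.2.2 (by omega) hb.2.1 hj hh)
        rw [if_neg hc]
        simp [tabOf, hb, ne]
    · have hc : ¬ (T' = T ∧ i' = i ∧ j' = j) := by rintro ⟨rfl, rfl, rfl⟩; exact hb ⟨hi, hj, hT⟩
      rw [if_neg hc]
      simp only [tabOf, if_neg hb]

/-- The witness `t'` is the memory at the moment when an entry is computed: earlier entries of the
same table already have their final values then, and they are never overwritten. -/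
theorem Cells.step {n T i j : ℕ} {body : E} {t₀ t : Tab} (h : Cells n T body t₀ i j t) : Cells n T body t₀ i (j + 1)
    (fun T' i' j' => if T' = T ∧ i' = i ∧ j' = j then body.ev n t (V2 i j) else t T' i' j') where
  other T' hT' := by
    funext a b
    rw [if_neg (by tauto), h.other T' hT']
  val a b ha hb hab := by
    by_cases hc : a = i ∧ b = j
    · obtain ⟨rfl, rfl⟩ := hc
      refine ⟨t, by simp, h.other, fun c d hcd => ?_⟩
      rw [if_neg]
      unfold Bef at hcd; omega
    · obtain ⟨t', h1, h2, h3⟩ := h.val a b ha hb (by unfold Bef at hab ⊢; omega)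
      refine ⟨t', by simpa [hc] using h1, h2, fun c d hcd => ?_⟩
      rw [if_neg, h3 c d hcd]
      unfold Bef at hcd hab; omega

theorem Cells.next_row {n T i : ℕ} {body : E} {t₀ t : Tab} (h : Cells n T body t₀ i n t) :
    Cells n T body t₀ (i + 1) 0 t :=
  ⟨h.other, fun a b ha hb hab => h.val a b ha hb (by unfold Bef at hab ⊢; omega)⟩

/-- The states differ in the first variables and in auxiliary registers only. -/
structure Adj (s s' : State) : Prop where
  nmem : s'.nmem = s.nmem
  rmem : s'.rmem = s.rmem
  nreg : ∀ r, r < 5 → s'.nreg r = s.nreg r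

theorem Adj.tab {n : ℕ} {s s' : State} (h : Adj s s') : tabOf n s' = tabOf n s := by
  unfold tabOf; rw [h.nmem, h.rmem, h.nreg 3 (by omega)]

theorem Adj.rdy {n i j i' j' : ℕ} {s s' : State} (h : Adj s s') (hs : Rdy n i j s) (hv : varOf s' = V2 i' j') :
    Rdy n i' j' s' :=
  ⟨⟨by rw [h.nreg 1 (by omega), hs.ok.size], by rw [h.nmem]; exact hs.ok.row⟩, hv,
    by rw [h.nreg 3 (by omega)]; exact hs.big⟩

/-- Increments a variable register. -/
def inc (r : ℕ) : Prog := .block [.nconst 6 1, .nadd r r 6]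

theorem adj_inc {n i j r : ℕ} {s : State} (h : Rdy n i j s) (hr : r = 5 ∨ r = 7) : ∃ s', Run (inc r) s s' 2 ∧
    Rdy n (if r = 5 then i + 1 else i) (if r = 7 then j + 1 else j) s' ∧ Adj s s' := by
  have ha : Adj s (exec [.nconst 6 1, .nadd r r 6] s) := by
    refine ⟨rfl, rfl, fun k hk => ?_⟩
    simp only [exec_cons, exec_nil, Instr.run, Function.update_apply]
    rw [if_neg (by omega), if_neg (by omega)]
  refine ⟨_, Run.block _ s, ha.rdy h ?_, ha⟩
  funext k
  have := congrFun h.var k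
  simp only [varOf, V2, exec_cons, exec_nil, Instr.run, Function.update_apply] at this ⊢
  by_cases hk : 2 * k + 5 = r
  · rw [if_pos hk, ← hk, if_neg (by omega), this]
    simp only [if_true]
    split_ifs <;> omega
  · rw [if_neg hk, if_neg (by omega), this]
    split_ifs <;> omega

theorem adj_zero {n i j r : ℕ} {s : State} (h : Rdy n i j s) (hr : r = 5 ∨ r = 7) :
    ∃ s', Run (.block [.nconst r 0]) s s' 1 ∧ Rdy n (if r = 5 then 0 else i) (if r = 7 then 0 else j) s' ∧ Adj s s' := by
  have ha : Adj s (exec [.nconst r 0] s) := by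
    refine ⟨rfl, rfl, fun k hk => ?_⟩
    simp only [exec_cons, exec_nil, Instr.run, Function.update_apply]
    rw [if_neg (by omega)]
  refine ⟨_, Run.block _ s, ha.rdy h ?_, ha⟩
  funext k
  have := congrFun h.var k
  simp only [varOf, V2, exec_cons, exec_nil, Instr.run, Function.update_apply] at this ⊢
  by_cases hk : 2 * k + 5 = r
  · rw [if_pos hk]
    split_ifs <;> omega
  · rw [if_neg hk, this]
    split_ifs <;> omega

/-- Runs `P` for all entries of a table. -/
def sweep (P : Prog) : Prog :=
  .seq (.whileN 5 1 (.seq (.whileN 7 1 (.seq P (inc 7))) (.seq (.block [.nconst 7 0]) (inc 5)))) (.block [.nconst 5 0])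

theorem sweep_run {n c : ℕ} {P : Prog} (K : ℕ → ℕ → State → Prop)
    (hK : ∀ i j s s', Adj s s' → K i j s → K i j s') (hrow : ∀ i s, K i n s → K (i + 1) 0 s)
    (hP : ∀ i j s, i < n → j < n → Rdy n i j s → K i j s → ∃ s', Run P s s' c ∧ Rdy n i j s' ∧ K i (j + 1) s')
    {s : State} (h0 : Rdy n 0 0 s) (hK0 : K 0 0 s) :
    ∃ s', Run (sweep P) s s' (n * (n * (c + 3) + 5) + 2) ∧ Rdy n 0 0 s' ∧ K n 0 s' := by
  have v0 : ∀ {i j s}, Rdy n i j s → s.nreg 5 = i := fun h => congrFun h.var 0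
  have v1 : ∀ {i j s}, Rdy n i j s → s.nreg 7 = j := fun h => congrFun h.var 1
  obtain ⟨s1, r1, h1, k1⟩ := Run.loop (a := 5) (b := 1) (n := n) (c := n * (c + 3) + 4)
    (P := .seq (.whileN 7 1 (.seq P (inc 7))) (.seq (.block [.nconst 7 0]) (inc 5)))
    (fun i s => Rdy n i 0 s ∧ K i 0 s) (by
      rintro i hi s ⟨h, k⟩
      refine ⟨by rw [v0 h, h.ok.size]; exact hi, ?_⟩
      obtain ⟨s1, r1, h1, k1⟩ := Run.loop (a := 7) (b := 1) (n := n) (c := c + 2) (P := .seq P (inc 7))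
        (fun j s => Rdy n i j s ∧ K i j s) (by
          rintro j hj s ⟨h, k⟩
          refine ⟨by rw [v1 h, h.ok.size]; exact hj, ?_⟩
          obtain ⟨s1, r1, h1, k1⟩ := hP i j s hi hj h k
          obtain ⟨s2, r2, h2, a2⟩ := adj_inc h1 (r := 7) (by omega)
          exact ⟨s2, r1.seq r2, h2, hK _ _ _ _ a2 k1⟩) (by
          rintro s ⟨h, k⟩
          rw [v1 h, h.ok.size]; omega) ⟨h, k⟩
      obtain ⟨s2, r2, h2, a2⟩ := adj_zero h1 (r := 7) (by omega)
      obtain ⟨s3, r3, h3, a3⟩ := adj_inc h2 (r := 5) (by omega)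
      exact ⟨s3, (r1.seq (r2.seq r3)).mono (le_of_eq (by ring)), h3, hK _ _ _ _ a3 (hK _ _ _ _ a2 (hrow i _ k1))⟩) (by
      rintro s ⟨h, k⟩
      rw [v0 h, h.ok.size]; omega) ⟨h0, hK0⟩
  obtain ⟨s2, r2, h2, a2⟩ := adj_zero h1 (r := 5) (by omega)
  exact ⟨s2, (r1.seq r2).mono (le_of_eq (by ring)), h2, hK _ _ _ _ a2 k1⟩

/-- The entries of the table `T` have been computed from `body`. -/
def Sat (n : ℕ) (F : Tab) (T : ℕ) (body : E) : Prop := ∀ i j, i < n → j < n →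
  ∃ t, F T i j = body.ev n t (V2 i j) ∧ (∀ T', T' < T → t T' = F T') ∧ ∀ a b, Bef a b i j → t T a b = F T a b

theorem fill_run {n T : ℕ} {body : E} {s : State} (hT : T < 255) (h : Rdy n 0 0 s) :
    ∃ s', Run (sweep (cell T body)) s s' (n * (n * (body.cost n + 33) + 5) + 2) ∧ Rdy n 0 0 s' ∧
      (∀ T', T' ≠ T → tabOf n s' T' = tabOf n s T') ∧ Sat n (tabOf n s') T body := by
  obtain ⟨s1, r1, h1, k1⟩ := sweep_run (n := n) (P := cell T body) (c := body.cost n + 30)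
    (fun i j s' => Cells n T body (tabOf n s) i j (tabOf n s'))
    (fun i j s s' ha k => by rw [ha.tab]; exact k) (fun i s k => k.next_row)
    (fun i j s1 hi hj h1 k => by
      obtain ⟨s2, r2, h2, t2⟩ := cell_run hT hi hj h1
      exact ⟨s2, r2, h2, by rw [t2]; exact k.step⟩) h ⟨fun _ _ => rfl, fun a b _ _ hab => by unfold Bef at hab; omega⟩
  refine ⟨s1, r1.mono (le_of_eq (by ring)), h1, k1.other, fun i j hi hj => ?_⟩
  obtain ⟨t, h2, h3, h4⟩ := k1.val i j hi hj (Or.inl hi)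
  exact ⟨t, h2, fun T' hT' => by rw [h3 T' (by omega), k1.other T' (by omega)], h4⟩

/-- Computes the tables from `k` on. -/
def fillAll : ℕ → List E → Prog
  | _, [] => .skip
  | k, e :: l => .seq (sweep (cell k e)) (fillAll (k + 1) l)

/-- A bound for the number of steps. -/
def costAll (n : ℕ) : List E → ℕ
  | [] => 0
  | e :: l => n * (n * (e.cost n + 33) + 5) + 2 + costAll n l

theorem Sat.congr {n : ℕ} {F F' : Tab} {T : ℕ} {body : E} (h : Sat n F T body) (hF : ∀ T', T' ≤ T → F' T' = F T') :
    Sat n F' T body := by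
  intro i j hi hj
  obtain ⟨t, h1, h2, h3⟩ := h i j hi hj
  rw [hF T le_rfl]
  exact ⟨t, h1, fun T' hT' => by rw [h2 T' hT', hF T' hT'.le], h3⟩

theorem fillAll_run {n : ℕ} (l : List E) : ∀ {k : ℕ} {s : State}, k + l.length ≤ 255 → Rdy n 0 0 s →
    ∃ s', Run (fillAll k l) s s' (costAll n l) ∧ Rdy n 0 0 s' ∧ (∀ T, T < k → tabOf n s' T = tabOf n s T) ∧
      ∀ m e, l[m]? = some e → Sat n (tabOf n s') (k + m) e := by
  induction l with
  | nil => intro k s _ h; exact ⟨s, Run.skip, h, fun _ _ => rfl, by simp⟩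
  | cons e l ih =>
    intro k s hk h
    simp only [List.length_cons] at hk
    obtain ⟨s1, r1, h1, o1, z1⟩ := fill_run (T := k) (body := e) (by omega) h
    obtain ⟨s2, r2, h2, o2, z2⟩ := ih (k := k + 1) (by omega) h1
    refine ⟨s2, r1.seq r2, h2, fun T hT => by rw [o2 T (by omega), o1 T (by omega)], fun m e' he => ?_⟩
    cases m with
    | zero =>
      simp only [List.getElem?_cons_zero, Option.some.injEq] at he
      subst he
      exact z1.congr fun T' hT' => o2 T' (by omega)
    | succ m =>
      have := z2 m e' (by simpa using he)
      rwa [show k + 1 + m = k + (m + 1) by omega] at this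

/-- Expressions without loops. -/
def E.flat : E → Bool
  | .cst _ | .size | .var _ => true
  | .get _ a b | .add a b | .sub a b => a.flat && b.flat
  | .ltN a b x y | .ltR a b x y => a.flat && b.flat && x.flat && y.flat
  | .amin _ _ _ => false

/-- Expressions without nested loops. -/
def E.lin : E → Bool
  | .cst _ | .size | .var _ => true
  | .get _ a b | .add a b | .sub a b => a.lin && b.lin
  | .ltN a b x y | .ltR a b x y => a.lin && b.lin && x.lin && y.lin
  | .amin _ g v => g.flat && v.flat

theorem E.cost_flat {e : E} (h : e.flat = true) (n : ℕ) : e.cost n = e.cost 0 := by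
  induction e with
  | cst | size | var => rfl
  | get T a b iha ihb | add a b iha ihb | sub a b iha ihb =>
    simp only [E.flat, Bool.and_eq_true] at h
    simp only [E.cost, iha h.1, ihb h.2]
  | ltN a b x y iha ihb ihx ihy | ltR a b x y iha ihb ihx ihy =>
    simp only [E.flat, Bool.and_eq_true] at h
    simp only [E.cost, iha h.1.1.1, ihb h.1.1.2, ihx h.1.2, ihy h.2]
  | amin => simp [E.flat] at h

/-- A loop over expressions without loops takes linear time. There are quadratically many entries in
a table, which gives the cubic bound. -/
theorem E.cost_lin {e : E} (h : e.lin = true) : ∃ C, ∀ n, e.cost n ≤ C * (n + 1) := by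
  induction e with
  | cst | size | var => exact ⟨2, fun n => by simp only [E.cost]; omega⟩
  | get T a b iha ihb | add a b iha ihb | sub a b iha ihb =>
    simp only [E.lin, Bool.and_eq_true] at h
    obtain ⟨A, hA⟩ := iha h.1
    obtain ⟨B, hB⟩ := ihb h.2
    refine ⟨A + B + 40, fun n => ?_⟩
    have h1 := hA n
    have h2 := hB n
    simp only [E.cost]; rw [add_mul, add_mul]; omega
  | ltN a b x y iha ihb ihx ihy | ltR a b x y iha ihb ihx ihy =>
    simp only [E.lin, Bool.and_eq_true] at h
    obtain ⟨A, hA⟩ := iha h.1.1.1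
    obtain ⟨B, hB⟩ := ihb h.1.1.2
    obtain ⟨X, hX⟩ := ihx h.1.2
    obtain ⟨Y, hY⟩ := ihy h.2
    refine ⟨A + B + X + Y + 1, fun n => ?_⟩
    have h1 := hA n
    have h2 := hB n
    have h3 := hX n
    have h4 := hY n
    simp only [E.cost]; rw [add_mul, add_mul, add_mul, add_mul]; omega
  | amin L g v _ _ =>
    simp only [E.lin, Bool.and_eq_true] at h
    refine ⟨g.cost 0 + v.cost 0 + 20, fun n => ?_⟩
    simp only [E.cost, E.cost_flat h.1 n, E.cost_flat h.2 n]
    nlinarith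

theorem costAll_le {l : List E} (h : ∀ e ∈ l, e.lin = true) : ∃ C, ∀ n, costAll n l ≤ C * (n + 1) ^ 3 := by
  induction l with
  | nil => exact ⟨0, fun n => by simp [costAll]⟩
  | cons e l ih =>
    obtain ⟨A, hA⟩ := ih fun e he => h e (by simp [he])
    obtain ⟨B, hB⟩ := E.cost_lin (h e (by simp))
    refine ⟨A + B + 100, fun n => ?_⟩
    simp only [costAll]
    have h1 : n * (n * (e.cost n + 33) + 5) + 2 ≤ n * (n * (B * (n + 1) + 33) + 5) + 2 := by
      gcongr; exact hB n
    have h2 := hA n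
    have h3 : n * (n * (B * (n + 1) + 33) + 5) + 2 ≤ (B + 100) * (n + 1) ^ 3 := by
      -- The slack of the inequality, written out with natural coefficients, so that it only has to
      -- be dropped.
      have e1 : (B + 100) * (n + 1) ^ 3 = n * (n * (B * (n + 1) + 33) + 5) + 2 +
        (B * (n + 1) * (2 * n + 1) + 100 * n ^ 3 + 267 * n ^ 2 + 295 * n + 98) := by ring
      omega
    rw [show A + B + 100 = (B + 100) + A by ring, add_mul]
    omega


/-! ### Input, output and the complete machine -/

/-- Sets up the row pointers. -/
def rowPtrs : List Instr :=
  .nmove 6 5 :: (dbl 6 8 ++ [.nconst 8 255, .nadd 6 6 8, .nstore 6 4, .nadd 4 4 1, .nconst 8 1, .nadd 5 5 8])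

/-- Copies the coordinates of one terminal to the tables `0` and `1`. -/
def copyIn : List Instr :=
  .nadd 6 5 5 :: .nmove 8 5 :: (dbl 8 8 ++ [.nadd 8 8 3, .rload 2 6, .rstore 8 2, .nconst 10 1, .nadd 6 6 10,
    .nadd 8 8 10, .rload 2 6, .rstore 8 2, .nadd 5 5 10])

/-- Prepares the memory. -/
def initP : Prog :=
  .seq (.block [.nmove 1 0]) (.seq (.whileN 5 1 (.block rowPtrs)) (.seq (.block (.nmove 3 4 :: (dbl 3 3 ++ [.nconst 5 0])))
    (.seq (.whileN 5 1 (.block copyIn)) (.block [.nconst 5 0]))))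

theorem initP_run {n : ℕ} {s : State} (h0 : s.nreg 0 = n) (h1 : ∀ r, r ≠ 0 → s.nreg r = 0) :
    ∃ s', Run initP s s' (n * 50 + 50) ∧ Rdy n 0 0 s' ∧ ∀ i, i < n →
      (tabOf n s' 0 0 i).2 = s.rmem (2 * i) ∧ (tabOf n s' 1 0 i).2 = s.rmem (2 * i + 1) := by
  obtain ⟨s1, r1, a1, a2, a3, a4, a5, a6⟩ := Run.loop (a := 5) (b := 1) (n := n) (c := 20) (P := .block rowPtrs)
    (s := exec [.nmove 1 0] s) (fun i s' => s'.nreg 1 = n ∧ s'.nreg 4 = i * n ∧ s'.nreg 5 = i ∧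
      (∀ r, 7 ≤ r → r % 2 = 1 → s'.nreg r = 0) ∧ s'.rmem = s.rmem ∧ ∀ k, k < i → s'.nmem (256 * k + 255) = k * n) (by
      rintro i hi s2 ⟨b1, b2, b3, b4, b5, b6⟩
      refine ⟨by omega, _, (Run.block _ s2).mono (by simp [rowPtrs, dbl_length]), ?_⟩
      simp only [rowPtrs, exec_cons, exec_append, dbl_run, exec_nil, Instr.run]
      refine ⟨?_, ?_, ?_, fun r hr hr' => ?_, b5, fun k hk => ?_⟩
      · simp [b1]
      · simp [b1, b2]; ring
      · simp [b3]
      · simp only [Function.update_apply]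
        rw [if_neg (by omega), if_neg (by omega), if_neg (by omega), if_neg (by omega), if_neg (by omega),
          if_neg (by omega), if_neg (by omega), b4 r hr hr']
      · simp only [Function.update_apply]
        simp [b2, b3]
        by_cases hk' : k = i
        · rw [if_pos (by omega), hk']
        · rw [if_neg (by omega), b6 k (by omega)]) (by
      rintro s2 ⟨b1, b2, b3, -⟩; omega)
    ⟨by simp [exec_cons, exec_nil, Instr.run, h0], by simp [exec_cons, exec_nil, Instr.run, h1],
      by simp [exec_cons, exec_nil, Instr.run, h1], fun r hr _ => by
        simp only [exec_cons, exec_nil, Instr.run, Function.update_apply]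
        rw [if_neg (by omega), h1 r (by omega)], rfl, by omega⟩
  obtain ⟨s3, r3, c1, c2, c3, c4, c5, c6, c7⟩ := Run.loop (a := 5) (b := 1) (n := n) (c := 20) (P := .block copyIn)
    (s := exec (.nmove 3 4 :: (dbl 3 3 ++ [.nconst 5 0])) s1) (fun i s' => s'.nreg 1 = n ∧ s'.nreg 3 = 8 * (n * n) ∧
      s'.nreg 5 = i ∧ (∀ r, 7 ≤ r → r % 2 = 1 → s'.nreg r = 0) ∧ (∀ k, k < 8 * (n * n) → s'.rmem k = s.rmem k) ∧
      (∀ k, k < n → s'.nmem (256 * k + 255) = k * n) ∧ ∀ k, k < i → s'.rmem (256 * k + 8 * (n * n)) = s.rmem (2 * k) ∧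
      s'.rmem (256 * k + 8 * (n * n) + 1) = s.rmem (2 * k + 1)) (by
      rintro i hi s2 ⟨b1, b2, b3, b4, b5, b6, b7⟩
      refine ⟨by omega, _, (Run.block _ s2).mono (by simp [copyIn, dbl_length]), ?_⟩
      -- The input lies below the real tables, so copying does not overwrite coordinates that are
      -- still to be read.
      have hin : 2 * i + 1 < 8 * (n * n) := by nlinarith
      obtain ⟨A, hA⟩ : ∃ A, A = 256 * i + 8 * (n * n) := ⟨_, rfl⟩
      obtain ⟨D, hD⟩ : ∃ D, D = 2 * i := ⟨_, rfl⟩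
      have e1 : s2.nreg 5 * 256 + s2.nreg 3 = A := by rw [b3, b2, hA]; ring
      have e2 : s2.nreg 5 + s2.nreg 5 = D := by omega
      have hm : ∀ r, (exec copyIn s2).rmem r =
          if r = A + 1 then s.rmem (2 * i + 1) else if r = A then s.rmem (2 * i) else s2.rmem r := by
        intro r
        simp only [copyIn, exec_cons, exec_append, dbl_run, exec_nil, Instr.run]
        rw [← b5 _ hin, ← b5 (2 * i) (by omega), ← hD]
        simp [Function.update_apply, e1, e2, show ¬ D + 1 = A by omega]
      have hn : ∀ r, (exec copyIn s2).nreg r =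
          if r = 5 then i + 1 else if r = 1 ∨ r = 3 ∨ r % 2 = 1 then s2.nreg r else (exec copyIn s2).nreg r := by
        intro r
        split_ifs with h3 h4
        · subst h3; simp [copyIn, exec_cons, exec_append, dbl_run, exec_nil, Instr.run, Function.update_apply, b3]
        · simp only [copyIn, exec_cons, exec_append, dbl_run, exec_nil, Instr.run, Function.update_apply]
          simp only [if_neg (show ¬ r = 8 by omega), if_neg (show ¬ r = 6 by omega), if_neg (show ¬ r = 10 by omega),
            if_neg h3]
        · rfl
      refine ⟨by rw [hn]; simp [b1], by rw [hn]; simp [b2], by rw [hn]; simp, fun r hr hr' => ?_, fun k hk => ?_, ?_,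
        fun k hk => ?_⟩
      · rw [hn, if_neg (by omega), if_pos (by omega), b4 r hr hr']
      · rw [hm, if_neg (by omega), if_neg (by omega), b5 k hk]
      · simpa [copyIn, exec_cons, exec_append, dbl_run, exec_nil, Instr.run] using b6
      · rw [hm, hm]
        by_cases hk' : k = i
        · rw [if_neg (by omega), if_pos (by omega), if_pos (by omega), hk']
          exact ⟨rfl, rfl⟩
        · rw [if_neg (by omega), if_neg (by omega), if_neg (by omega), if_neg (by omega)]
          exact b7 k (by omega)) (by
      rintro s2 ⟨b1, b2, b3, -⟩; omega) (by
      simp only [exec_cons, exec_append, dbl_run, exec_nil, Instr.run]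
      simp only [Function.update_apply]
      simp [a1, a2, a5]
      refine ⟨by ring, fun r hr hr' => ?_, a6⟩
      rw [a4 r hr hr', if_neg (by omega)]; simp; omega)
  have hb := Run.block [.nconst 5 0] s3
  refine ⟨_, ((Run.block _ s).seq (r1.seq ((Run.block _ s1).seq (r3.seq hb)))).mono (by simp [dbl_length]; omega),
    ⟨⟨?_, c6⟩, ?_, ?_⟩, fun i hi => ?_⟩
  · simpa [exec_cons, exec_nil, Instr.run] using c1
  · funext k
    simp only [varOf, V2, exec_cons, exec_nil, Instr.run, Function.update_apply]
    split_ifs <;> first | rfl | omega | (rw [c4 _ (by omega) (by omega)])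
  · simp [exec_cons, exec_nil, Instr.run, c2]
  · have := c7 i hi
    have e3 : (exec [.nconst 5 0] s3).nreg 3 = 8 * (n * n) := by simp [exec_cons, exec_nil, Instr.run, c2]
    simp only [tabOf]
    rw [if_pos ⟨by omega, hi, by omega⟩, if_pos ⟨by omega, hi, by omega⟩, e3, ← this.1, ← this.2]
    refine ⟨?_, ?_⟩ <;> (change s3.rmem _ = _; congr 1; omega)

/-- Writes the values of expressions to the real memory from the position in register `2` on. -/
def emitL : List E → Prog
  | [] => .skip
  | e :: l => .seq (e.code 4) (.seq (.block [.rstore 2 4, .nconst 6 1, .nadd 2 2 6]) (emitL l))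

/-- A bound for the number of steps. -/
def costL (n : ℕ) : List E → ℕ
  | [] => 0
  | e :: l => e.cost n + (3 + costL n l)

/-- The output stays below cell `8 * (n * n)`, where the real tables begin at the earliest, so the
tables survive while results are written. -/
theorem emitL_run {n i j : ℕ} (l : List E) : ∀ {s : State}, Rdy n i j s → s.nreg 2 + l.length ≤ 8 * (n * n) →
    ∃ s', Run (emitL l) s s' (costL n l) ∧ Rdy n i j s' ∧ tabOf n s' = tabOf n s ∧ s'.nreg 2 = s.nreg 2 + l.length ∧
      s'.nreg 0 = s.nreg 0 ∧ (∀ a, a < s.nreg 2 → s'.rmem a = s.rmem a) ∧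
      ∀ k e, l[k]? = some e → s'.rmem (s.nreg 2 + k) = (e.ev n (tabOf n s) (V2 i j)).2 := by
  induction l with
  | nil => intro s h _; exact ⟨s, Run.skip, h, rfl, rfl, rfl, fun _ _ => rfl, by simp⟩
  | cons e l ih =>
    intro s h hl
    simp only [List.length_cons] at hl
    obtain ⟨s1, r1, m1, -, x1⟩ := e.code_run (d := 4) rfl (by omega) h.ok
    have z1 := h.same m1
    have hb := Run.block [.rstore 2 4, .nconst 6 1, .nadd 2 2 6] s1
    have e2 : s1.nreg 2 = s.nreg 2 := m1.nreg 2 (by omega)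
    set s2 := exec [.rstore 2 4, .nconst 6 1, .nadd 2 2 6] s1 with hs2
    have hn : ∀ r, s2.nreg r = if r = 2 then s.nreg 2 + 1 else if r = 6 then 1 else s1.nreg r := by
      intro r
      simp [hs2, exec_cons, exec_nil, Instr.run, Function.update_apply, e2]
    have hm : ∀ r, s2.rmem r = if r = s.nreg 2 then s1.rreg 4 else s1.rmem r := by
      intro r
      simp [hs2, exec_cons, exec_nil, Instr.run, Function.update_apply, e2]
    have z2 : Rdy n i j s2 := by
      refine ⟨⟨by rw [hn]; exact z1.ok.size, z1.ok.row⟩, ?_, by rw [hn]; exact z1.big⟩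
      rw [← z1.var]
      funext k
      simp only [varOf, hn]
      rw [if_neg (by omega), if_neg (by omega)]
    have t2 : tabOf n s2 = tabOf n s := by
      rw [← m1.tab]
      have e3 : s2.nreg 3 = s1.nreg 3 := by rw [hn]; simp
      have h3 := z1.big
      have h4 : ∀ c, s2.rmem (c + s1.nreg 3) = s1.rmem (c + s1.nreg 3) := fun c => by rw [hm, if_neg (by omega)]
      unfold tabOf
      simp only [e3, h4]
      rfl
    obtain ⟨s3, r3, z3, t3, n3, n3', m3, v3⟩ := ih z2 (by rw [hn]; simp; omega)
    rw [hn 2, if_pos rfl] at n3 m3 v3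
    refine ⟨s3, r1.seq (hb.seq r3), z3, t3.trans t2, by simp [n3]; omega, ?_, fun a ha => ?_, fun k e' he => ?_⟩
    · rw [n3', hn 0, if_neg (by omega), if_neg (by omega), m1.nreg 0 (by omega)]
    · rw [m3 a (by omega), hm, if_neg (by omega), m1.rmem]
    · cases k with
      | zero =>
        simp only [List.getElem?_cons_zero, Option.some.injEq] at he
        subst he
        rw [m3 _ (by omega), hm, if_pos (by omega), x1, h.var]
      | succ k =>
        rw [show s.nreg 2 + (k + 1) = s.nreg 2 + 1 + k by omega, v3 k e' (by simpa using he), t2]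

/-- Writes the result. -/
def emitP (es : List E) : Prog :=
  .seq (.block [.nconst 2 0, .nconst 0 0]) (.seq (sweep (.seq (emitL es) (.block [.nconst 6 2, .nadd 0 0 6])))
    (.seq (.block [.nconst 6 1]) (.ifN 6 1 .skip (.block [.nconst 0 0]))))

theorem emitP_run {n : ℕ} {es : List E} (hes : es.length = 8) {s : State} (h : Rdy n 0 0 s) :
    ∃ s', Run (emitP es) s s' (n * (n * (costL n es + 5) + 5) + 10) ∧
      s'.nreg 0 = (if 1 < n then 2 * (n * n) else 0) ∧ ∀ i j, i < n → j < n → ∀ k e, es[k]? = some e →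
        s'.rmem (8 * (i * n + j) + k) = (e.ev n (tabOf n s) (V2 i j)).2 := by
  have lex : ∀ {a b i j}, b < n → Bef a b i j → a * n + b < i * n + j := by
    intro a b i j hb hab
    rcases hab with hab | ⟨rfl, hab⟩
    · have : (a + 1) * n ≤ i * n := Nat.mul_le_mul_right _ hab
      rw [add_mul] at this; omega
    · omega
  set s0 := exec [.nconst 2 0, .nconst 0 0] s with hs0
  have z0 : Rdy n 0 0 s0 := by
    refine ⟨⟨?_, h.ok.row⟩, ?_, ?_⟩
    · simpa [hs0, exec_cons, exec_nil, Instr.run] using h.ok.size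
    · rw [← h.var]; funext k
      simp [hs0, varOf, exec_cons, exec_nil, Instr.run]
    · simpa [hs0, exec_cons, exec_nil, Instr.run] using h.big
  have t0 : tabOf n s0 = tabOf n s := by
    unfold tabOf; simp [hs0, exec_cons, exec_nil, Instr.run]
  obtain ⟨s1, r1, z1, t1, -, n1, v1⟩ := sweep_run (n := n) (c := costL n es + 2)
    (P := .seq (emitL es) (.block [.nconst 6 2, .nadd 0 0 6])) (fun i j s' => tabOf n s' = tabOf n s ∧
      s'.nreg 2 = 8 * (i * n + j) ∧ s'.nreg 0 = 2 * (i * n + j) ∧ ∀ a b, a < n → b < n → Bef a b i j →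
        ∀ k e, es[k]? = some e → s'.rmem (8 * (a * n + b) + k) = (e.ev n (tabOf n s) (V2 a b)).2)
    (by
      rintro i j s1 s2 ha ⟨h1, h2, h3, h4⟩
      rw [ha.tab, ha.nreg 2 (by omega), ha.nreg 0 (by omega), ha.rmem]
      exact ⟨h1, h2, h3, h4⟩)
    (by
      rintro i s1 ⟨h1, h2, h3, h4⟩
      refine ⟨h1, by rw [h2]; ring, by rw [h3]; ring, fun a b ha hb hab => h4 a b ha hb ?_⟩
      unfold Bef at hab ⊢; omega)
    (by
      rintro i j s1 hi hj z1 ⟨h1, h2, h3, h4⟩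
      have hb : 8 * (i * n + j) + 8 ≤ 8 * (n * n) := by
        have := lex (i := n) (j := 0) hj (Or.inl hi)
        omega
      obtain ⟨s2, r2, z2, t2, n2, n2', m2, v2⟩ := emitL_run es z1 (by omega)
      refine ⟨_, r2.seq (Run.block _ s2), ⟨⟨?_, z2.ok.row⟩, ?_, ?_⟩, ?_, ?_, ?_, fun a b ha hb hab k e he => ?_⟩
      · simpa [exec_cons, exec_nil, Instr.run] using z2.ok.size
      · rw [← z2.var]; funext k
        simp only [varOf, exec_cons, exec_nil, Instr.run, Function.update_apply]
        rw [if_neg (by omega), if_neg (by omega)]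
      · simpa [exec_cons, exec_nil, Instr.run] using z2.big
      · rw [← h1, ← t2]
        unfold tabOf; simp [exec_cons, exec_nil, Instr.run]
      · simp [exec_cons, exec_nil, Instr.run, n2, h2, hes]; ring
      · simp [exec_cons, exec_nil, Instr.run, n2', h3]; ring
      · change s2.rmem _ = _
        have hk : k < 8 := by
          rw [← hes]; exact (List.getElem?_eq_some_iff.1 he).1
        by_cases hc : a = i ∧ b = j
        · obtain ⟨rfl, rfl⟩ := hc
          rw [← h2, v2 k e he, h1]
        · have hab' : Bef a b i j := by unfold Bef at hab ⊢; omega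
          have := lex hb hab'
          rw [m2 _ (by omega), h4 a b ha hb hab' k e he]) z0
    ⟨t0, by simp [hs0, exec_cons, exec_nil, Instr.run], by simp [hs0, exec_cons, exec_nil, Instr.run],
      fun a b _ _ hab => by unfold Bef at hab; omega⟩
  have hf := Run.block [.nconst 6 1] s1
  set s2 := exec [.nconst 6 1] s1 with hs2
  have e6 : s2.nreg 6 = 1 := by simp [hs2, exec_cons, exec_nil, Instr.run]
  have e1 : s2.nreg 1 = n := by simpa [hs2, exec_cons, exec_nil, Instr.run] using z1.ok.size
  have e0 : s2.nreg 0 = 2 * (n * n) := by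
    simpa [hs2, exec_cons, exec_nil, Instr.run] using n1
  -- With at most one terminal the grid has no edges, and the filler arcs written for absent edges
  -- are discarded by setting their number to zero.
  by_cases hn : 1 < n
  · refine ⟨s2, ((Run.block _ s).seq (r1.seq (hf.seq (Run.ifN_true (by rw [e6, e1]; exact hn) Run.skip)))).mono ?_,
      by rw [if_pos hn, e0], fun i j hi hj k e he => v1 i j hi hj (Or.inl hi) k e he⟩
    simp; ring_nf; omega
  · refine ⟨_, ((Run.block _ s).seq (r1.seq (hf.seq (Run.ifN_false (by rw [e6, e1]; exact hn) (Run.block _ s2))))).mono ?_,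
      by simp [exec_cons, exec_nil, Instr.run, hn], fun i j hi hj k e he => v1 i j hi hj (Or.inl hi) k e he⟩
    simp; ring_nf; omega

/-- A program that computes tables and writes expressions in them for all pairs of indices. -/
def machine (l es : List E) : Prog := .seq initP (.seq (fillAll 2 l) (emitP es))

theorem machine_run {l es : List E} (hl : l.length ≤ 253) (hes : es.length = 8) {n : ℕ} (t : Fin n → Point) :
    ∃ (s : State) (F : Tab), Run (machine l es) (input t) s
        (n * 50 + 50 + (costAll n l + (n * (n * (costL n es + 5) + 5) + 10))) ∧
      (∀ i : Fin n, (F 0 0 i).2 = (t i).1 ∧ (F 1 0 i).2 = (t i).2) ∧ (∀ m e, l[m]? = some e → Sat n F (2 + m) e) ∧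
      s.nreg 0 = (if 1 < n then 2 * (n * n) else 0) ∧ ∀ i j, i < n → j < n → ∀ k e, es[k]? = some e →
        s.rmem (8 * (i * n + j) + k) = (e.ev n F (V2 i j)).2 := by
  obtain ⟨s1, r1, z1, i1⟩ := initP_run (n := n) (s := input t) rfl (fun r hr => if_neg hr)
  obtain ⟨s2, r2, z2, o2, v2⟩ := fillAll_run l (k := 2) (by omega) z1
  obtain ⟨s3, r3, n3, v3⟩ := emitP_run hes z2
  refine ⟨s3, tabOf n s2, r1.seq (r2.seq r3), fun i => ?_, v2, n3, v3⟩
  rw [o2 0 (by omega), o2 1 (by omega), (i1 i i.2).1, (i1 i i.2).2]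
  have hi := i.2
  constructor
  · simp only [input]
    rw [dif_pos (by omega), if_pos (by omega)]
    congr 2; ext; simp
  · simp only [input]
    rw [dif_pos (by omega), if_neg (by omega)]
    congr 2; ext; simp; omega

theorem costL_le {l : List E} (h : ∀ e ∈ l, e.lin = true) : ∃ C, ∀ n, costL n l ≤ C * (n + 1) := by
  induction l with
  | nil => exact ⟨0, fun n => by simp [costL]⟩
  | cons e l ih =>
    obtain ⟨A, hA⟩ := ih fun e he => h e (by simp [he])
    obtain ⟨B, hB⟩ := E.cost_lin (h e (by simp))
    refine ⟨A + B + 3, fun n => ?_⟩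
    have h1 := hA n
    have h2 := hB n
    simp only [costL]
    rw [add_mul, add_mul]; omega

theorem machine_cost {l es : List E} (hl : ∀ e ∈ l, e.lin = true) (hes : ∀ e ∈ es, e.lin = true) :
    ∃ C, ∀ n, n * 50 + 50 + (costAll n l + (n * (n * (costL n es + 5) + 5) + 10)) ≤ C * (n + 1) ^ 3 := by
  obtain ⟨A, hA⟩ := costAll_le hl
  obtain ⟨B, hB⟩ := costL_le hes
  refine ⟨A + (B + 100), fun n => ?_⟩
  have h1 := hA n
  have h2 : n * (n * (costL n es + 5) + 5) ≤ n * (n * (B * (n + 1) + 5) + 5) := by gcongr; exact hB n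
  have h3 : n * (n * (B * (n + 1) + 5) + 5) + n * 50 + 60 ≤ (B + 100) * (n + 1) ^ 3 := by
    have e1 : (B + 100) * (n + 1) ^ 3 = n * (n * (B * (n + 1) + 5) + 5) + n * 50 + 60 +
      (B * (n + 1) * (2 * n + 1) + 100 * n ^ 3 + 295 * n ^ 2 + 245 * n + 40) := by ring
    omega
  rw [add_mul A]
  omega


/-! ### Tests as expressions, and the meaning of filled tables -/

namespace E

/-- A test succeeds. -/
def Tr (n : ℕ) (t : Tab) (V : ℕ → ℕ) (e : E) : Prop := 0 < (e.ev n t V).1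

/-- Tests. -/
def lt (a b : E) : E := .ltN a b (.cst 1) (.cst 0)
def le (a b : E) : E := .ltN b a (.cst 0) (.cst 1)
def eq (a b : E) : E := .ltN a b (.cst 0) (.ltN b a (.cst 0) (.cst 1))
def and (a b : E) : E := .ltN (.cst 0) a b (.cst 0)
def or (a b : E) : E := .ltN (.cst 0) a (.cst 1) b
def ite (c x y : E) : E := .ltN (.cst 0) c x y

/-- The least value of the variable `L` for which a test succeeds. -/
def fst (L : ℕ) (c : E) : E := .amin L c (.cst 0)

/-- Some value of the variable `L` passes the test. -/
def ex (L : ℕ) (c : E) : E := .lt (.fst L c) .size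

/-- An entry of the first column of a table. -/
def g (T : ℕ) (a : E) : E := .get T a (.cst 0)

variable {n : ℕ} {t : Tab} {V : ℕ → ℕ} {a b c x y : E}

theorem tr_lt : Tr n t V (lt a b) ↔ (a.ev n t V).1 < (b.ev n t V).1 := by
  simp only [Tr, lt, ev]; split_ifs <;> simp_all

theorem tr_le : Tr n t V (le a b) ↔ (a.ev n t V).1 ≤ (b.ev n t V).1 := by
  simp only [Tr, le, ev]; split_ifs <;> simp_all

theorem tr_eq : Tr n t V (eq a b) ↔ (a.ev n t V).1 = (b.ev n t V).1 := by
  simp only [Tr, eq, ev]; split_ifs <;> simp <;> omega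

theorem tr_and : Tr n t V (and a b) ↔ Tr n t V a ∧ Tr n t V b := by
  simp only [Tr, and, ev]; split_ifs <;> simp_all

theorem tr_or : Tr n t V (or a b) ↔ Tr n t V a ∨ Tr n t V b := by
  simp only [Tr, or, ev]; split_ifs <;> simp_all

open Classical in
theorem ev_ite : (ite c x y).ev n t V = if Tr n t V c then x.ev n t V else y.ev n t V := by
  by_cases h : Tr n t V c
  · rw [if_pos h]; exact if_pos h
  · rw [if_neg h]; exact if_neg h

theorem fst_spec {L : ℕ} : (((fst L c).ev n t V).1 = n ∧ ∀ k, k < n → ¬ Tr n t (Function.update V L k) c) ∨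
    (((fst L c).ev n t V).1 < n ∧ Tr n t (Function.update V L ((fst L c).ev n t V).1) c ∧
      ∀ k, k < ((fst L c).ev n t V).1 → ¬ Tr n t (Function.update V L k) c) := by
  simp only [fst, ev, Tr]
  rcases amin_spec (n := n) (g := fun k => (c.ev n t (Function.update V L k)).1) (v := fun _ => (0 : ℝ)) le_rfl with
    ⟨h1, h2⟩ | ⟨h1, h2, h3, h4⟩
  · left
    exact ⟨h1, fun k hk => by have := h2 k hk; omega⟩
  · right
    exact ⟨h1, h2, fun k hk hk' => lt_irrefl _ (h4 k hk hk')⟩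

theorem tr_ex {L : ℕ} : Tr n t V (ex L c) ↔ ∃ k, k < n ∧ Tr n t (Function.update V L k) c := by
  rw [ex, tr_lt]
  rcases fst_spec (n := n) (t := t) (V := V) (c := c) (L := L) with ⟨h1, h2⟩ | ⟨h1, h2, h3⟩
  · constructor
    · intro h; rw [h1] at h; simp [ev] at h
    · rintro ⟨k, h3, h4⟩; exact absurd h4 (h2 k h3)
  · exact ⟨fun _ => ⟨_, h1, h2⟩, fun _ => h1⟩

/-- The expression uses tables before `T` only. -/
def Bel (T : ℕ) : E → Prop
  | .cst _ | .size | .var _ => True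
  | .get T' a b => T' < T ∧ a.Bel T ∧ b.Bel T
  | .add a b | .sub a b => a.Bel T ∧ b.Bel T
  | .ltN a b x y | .ltR a b x y => (a.Bel T ∧ b.Bel T) ∧ x.Bel T ∧ y.Bel T
  | .amin _ g v => g.Bel T ∧ v.Bel T

theorem ev_congr {T : ℕ} {e : E} (h : e.Bel T) {t' : Tab} (ht : ∀ T', T' < T → t T' = t' T') (V : ℕ → ℕ) :
    e.ev n t V = e.ev n t' V := by
  induction e generalizing V with
  | cst | size | var => rfl
  | get T' a b iha ihb => simp only [ev, iha h.2.1, ihb h.2.2, ht T' h.1]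
  | add a b iha ihb | sub a b iha ihb => simp only [ev, iha h.1, ihb h.2]
  | ltN a b x y iha ihb ihx ihy | ltR a b x y iha ihb ihx ihy =>
    simp only [ev, iha h.1.1, ihb h.1.2, ihx h.2.1, ihy h.2.2]
  | amin L g v ihg ihv => simp only [ev, ihg h.1, ihv h.2]

end E

/-- An expression that does not read its own table has the same value in the final memory as when it
was computed. -/
theorem Sat.eq {n T : ℕ} {F : Tab} {e : E} (h : Sat n F T e) (hb : e.Bel T) {i j : ℕ} (hi : i < n) (hj : j < n) :
    F T i j = e.ev n F (V2 i j) := by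
  obtain ⟨t, h1, h2, -⟩ := h i j hi hj
  rw [h1, E.ev_congr hb h2]

/-- The tables from `k` on have been computed from a list of expressions. -/
def Seg (n : ℕ) (F : Tab) (k : ℕ) (l : List E) : Prop := ∀ m e, l[m]? = some e → Sat n F (k + m) e

theorem Seg.append {n k : ℕ} {F : Tab} {l l' : List E} (h : Seg n F k (l ++ l')) :
    Seg n F k l ∧ Seg n F (k + l.length) l' := by
  refine ⟨fun m e he => h m e ?_, fun m e he => ?_⟩
  · rw [List.getElem?_append_left (List.getElem?_eq_some_iff.1 he).1, he]
  · rw [add_assoc]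
    refine h _ e ?_
    rw [List.getElem?_append_right (by omega), Nat.add_sub_cancel_left, he]

theorem V2_zero (i j : ℕ) : V2 i j 0 = i := rfl
theorem V2_one (i j : ℕ) : V2 i j 1 = j := rfl
theorem up2_zero (i j k : ℕ) : Function.update (V2 i j) 2 k 0 = i := rfl
theorem up2_one (i j k : ℕ) : Function.update (V2 i j) 2 k 1 = j := rfl
theorem up2_two (i j k : ℕ) : Function.update (V2 i j) 2 k 2 = k := rfl

/-! ### Tables for staircases and blocks -/

open E BDMMN.Frame

/-- The tables that hold a frame. -/
structure Ids where
  π : ℕ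
  σ : ℕ
  xs : ℕ
  ys : ℕ

/-- The identifiers of the transposed frame. -/
def Ids.T (d : Ids) : Ids := ⟨d.σ, d.π, d.ys, d.xs⟩

/-- The tables contain the frame. -/
structure Holds (n : ℕ) (F : Tab) (G : Frame) (d : Ids) : Prop where
  n_eq : G.n = n
  π : ∀ i, i < n → (F d.π i 0).1 = G.π i
  σ : ∀ i, i < n → (F d.σ i 0).1 = G.σ i
  xs : ∀ i, i < n → (F d.xs i 0).2 = G.xs i
  ys : ∀ i, i < n → (F d.ys i 0).2 = G.ys i

theorem Holds.T {n : ℕ} {F : Tab} {G : Frame} {d : Ids} (h : Holds n F G d) : Holds n F G.T d.T :=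
  ⟨h.n_eq, h.σ, h.π, h.ys, h.xs⟩

/-- One plus the last index before `bound` at which the table `T` is below `val`. -/
def lowE (T : ℕ) (bound val : E) : E :=
  .sub .size (.fst 2 (.and (.lt (.sub (.sub .size (.cst 1)) (.var 2)) bound)
    (.lt (.g T (.sub (.sub .size (.cst 1)) (.var 2))) val)))

/-- The expressions for the left and lower boundaries, regular terminals, and neighbours in staircases. -/
def chainP (d : Ids) (b : ℕ) : List E :=
  [lowE d.π (.var 0) (.g d.π (.var 0)),
   lowE d.σ (.g d.π (.var 0)) (.var 0),
   .and (.le (.cst 1) (.g b (.var 0))) (.and (.le (.add (.g b (.var 0)) (.cst 2)) (.var 0))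
     (.le (.add (.g (b + 1) (.var 0)) (.cst 2)) (.g d.π (.var 0)))),
   .fst 2 (.and (.and (.g (b + 2) (.var 0)) (.g (b + 2) (.var 2))) (.and (.lt (.var 0) (.var 2))
     (.and (.eq (.g b (.var 2)) (.g b (.var 0))) (.eq (.g (b + 1) (.var 2)) (.g (b + 1) (.var 0)))))),
   .fst 2 (.eq (.g (b + 3) (.var 2)) (.var 0))]

/-- The tables computed by `chainP`. -/
structure Chains (n : ℕ) (F : Tab) (G : Frame) (b : ℕ) : Prop where
  lc : ∀ i, i < n → (F b i 0).1 = G.lc i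
  ld : ∀ i, i < n → (F (b + 1) i 0).1 = G.ld i
  reg : ∀ i, i < n → (0 < (F (b + 2) i 0).1 ↔ G.Reg i)
  sc : ∀ i j, G.Nx i j → (F (b + 3) i 0).1 = j
  sc_nx : ∀ i, i < n → (F (b + 3) i 0).1 < n → G.Nx i (F (b + 3) i 0).1
  pr : ∀ i j, G.Nx i j → (F (b + 4) j 0).1 = i
  pr_nx : ∀ j, j < n → (F (b + 4) j 0).1 < n → G.Nx (F (b + 4) j 0).1 j

/-- A search for a least index is turned into one for a greatest index by testing `n - 1 - k`. A
failed search gives `n`, and `n - n = 0` is then the correct value. -/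
theorem lowE_ev {n T : ℕ} {F : Tab} {f : ℕ → ℕ} {bound val : E} {V : ℕ → ℕ} {w v : ℕ}
    (hf : ∀ i, i < n → (F T i 0).1 = f i) (hw : ∀ k, (bound.ev n F (Function.update V 2 k)).1 = w)
    (hv : ∀ k, (val.ev n F (Function.update V 2 k)).1 = v) (hwn : w ≤ n) :
    ((lowE T bound val).ev n F V).1 = low f v w := by
  have key : ∀ k, k < n → (Tr n F (Function.update V 2 k) (.and (.lt (.sub (.sub .size (.cst 1)) (.var 2)) bound)
    (.lt (.g T (.sub (.sub .size (.cst 1)) (.var 2))) val)) ↔ n - 1 - k < w ∧ f (n - 1 - k) < v) := by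
    intro k hk
    rw [tr_and, tr_lt, tr_lt, hw, hv]
    simp only [g, ev, Function.update_self]
    rw [hf _ (by omega)]
  symm
  unfold lowE
  simp only [ev]
  rcases fst_spec (n := n) (t := F) (V := V) (L := 2) (c := .and (.lt (.sub (.sub .size (.cst 1)) (.var 2)) bound)
    (.lt (.g T (.sub (.sub .size (.cst 1)) (.var 2))) val)) with ⟨h1, h2⟩ | ⟨h1, h2, h3⟩
  · rw [h1, Nat.sub_self]
    refine low_eq (by omega) (fun u _ hu => ?_) (by omega)
    have := h2 (n - 1 - u) (by omega)
    rw [key _ (by omega), show n - 1 - (n - 1 - u) = u by omega] at this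
    omega
  · rw [key _ h1] at h2
    set r := ((fst 2 (.and (.lt (.sub (.sub .size (.cst 1)) (.var 2)) bound)
      (.lt (.g T (.sub (.sub .size (.cst 1)) (.var 2))) val))).ev n F V).1
    refine low_eq (by omega) (fun u hu hu' => ?_) (fun _ => ?_)
    · have := h3 (n - 1 - u) (by omega)
      rw [key _ (by omega), show n - 1 - (n - 1 - u) = u by omega] at this
      omega
    · rw [show n - r - 1 = n - 1 - r by omega]; exact h2.2

/-- The value `n` of a failed search stands for a missing successor or predecessor. -/
theorem chainP_spec {n b : ℕ} {F : Tab} {G : Frame} {d : Ids} (h : Holds n F G d) (hπ : d.π < b) (hσ : d.σ < b)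
    (hs : Seg n F b (chainP d b)) : Chains n F G b := by
  have hn := h.n_eq
  have lc : ∀ i, i < n → (F b i 0).1 = G.lc i := by
    intro i hi
    rw [(show Sat n F b _ from hs 0 _ rfl).eq (by simp [Bel, lowE, fst, E.and, E.lt, g]; omega) hi (by omega)]
    refine lowE_ev (w := i) h.π (fun k => rfl) (fun k => ?_) (by omega)
    simp only [g, ev]
    exact h.π i hi
  have ld : ∀ i, i < n → (F (b + 1) i 0).1 = G.ld i := by
    intro i hi
    rw [(hs 1 _ rfl).eq (by simp [Bel, lowE, fst, E.and, E.lt, g]; omega) hi (by omega)]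
    have := G.π_lt i (by omega)
    refine lowE_ev (w := G.π i) (v := i) h.σ (fun k => ?_) (fun k => rfl) (by omega)
    simp only [g, ev]
    exact h.π i hi
  have reg : ∀ i, i < n → (0 < (F (b + 2) i 0).1 ↔ G.Reg i) := by
    intro i hi
    rw [(hs 2 _ rfl).eq (by simp [Bel, E.and, E.le, g]; omega) hi (by omega)]
    change Tr _ _ _ _ ↔ _
    simp only [tr_and, tr_le, g, ev, V2_zero, lc i hi, ld i hi, h.π i hi, Reg, hn, hi, true_and]
  have scs : ∀ i, i < n → ((F (b + 3) i 0).1 = n ∧ ∀ k, ¬ (G.Reg i ∧ G.Mem (G.lc i) (G.ld i) k ∧ i < k)) ∨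
      ((F (b + 3) i 0).1 < n ∧ G.Nx i (F (b + 3) i 0).1) := by
    intro i hi
    rw [(hs 3 _ rfl).eq (by simp [Bel, E.and, E.lt, E.eq, g, fst]) hi (by omega)]
    have key : ∀ k, k < n → (Tr n F (Function.update (V2 i 0) 2 k) (.and (.and (.g (b + 2) (.var 0)) (.g (b + 2) (.var 2)))
        (.and (.lt (.var 0) (.var 2)) (.and (.eq (.g b (.var 2)) (.g b (.var 0)))
        (.eq (.g (b + 1) (.var 2)) (.g (b + 1) (.var 0)))))) ↔ G.Reg i ∧ G.Mem (G.lc i) (G.ld i) k ∧ i < k) := by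
      intro k hk
      simp only [tr_and, tr_lt, tr_eq]
      simp only [Tr, g, ev, up2_zero, up2_two, lc i hi, ld i hi, lc k hk, ld k hk, reg i hi, reg k hk, Mem]
      tauto
    rcases fst_spec (n := n) (t := F) (V := V2 i 0) (L := 2) (c := .and (.and (.g (b + 2) (.var 0)) (.g (b + 2) (.var 2)))
        (.and (.lt (.var 0) (.var 2)) (.and (.eq (.g b (.var 2)) (.g b (.var 0)))
        (.eq (.g (b + 1) (.var 2)) (.g (b + 1) (.var 0)))))) with ⟨h1, h2⟩ | ⟨h1, h2, h3⟩
    · refine Or.inl ⟨h1, fun k hk => ?_⟩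
      have hkn : k < n := by rw [← hn]; exact hk.2.1.1.1
      exact h2 k hkn ((key k hkn).2 hk)
    · rw [key _ h1] at h2
      refine Or.inr ⟨h1, h2.1, h2.2.1, h2.2.2, fun t ht ht' => ?_⟩
      by_contra hc
      have htn : t < n := by rw [← hn]; exact ht.1.1
      exact h3 t (by omega) ((key t htn).2 ⟨h2.1, ht, ht'⟩)
  have sc : ∀ i j, G.Nx i j → (F (b + 3) i 0).1 = j := by
    intro i j hij
    rcases scs i (by rw [← hn]; exact hij.reg.1) with ⟨h1, h2⟩ | ⟨h1, h2⟩
    · exact absurd ⟨hij.1, hij.2.1, hij.2.2.1⟩ (h2 j)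
    · exact h2.unique hij
  have sc_nx : ∀ i, i < n → (F (b + 3) i 0).1 < n → G.Nx i (F (b + 3) i 0).1 := by
    intro i hi hj
    rcases scs i hi with ⟨h1, h2⟩ | ⟨h1, h2⟩
    · omega
    · exact h2
  have prs : ∀ j, j < n → ((F (b + 4) j 0).1 = n ∧ ∀ k, ¬ G.Nx k j) ∨
      ((F (b + 4) j 0).1 < n ∧ G.Nx (F (b + 4) j 0).1 j) := by
    intro j hj
    rw [(hs 4 _ rfl).eq (by simp [Bel, E.eq, g, fst]) hj (by omega)]
    have key : ∀ k, k < n → (Tr n F (Function.update (V2 j 0) 2 k) (.eq (.g (b + 3) (.var 2)) (.var 0)) ↔ G.Nx k j) := by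
      intro k hk
      simp only [tr_eq, g, ev, up2_zero, up2_two]
      exact ⟨fun h => h ▸ sc_nx k hk (by omega), sc k j⟩
    rcases fst_spec (n := n) (t := F) (V := V2 j 0) (L := 2) (c := .eq (.g (b + 3) (.var 2)) (.var 0)) with
      ⟨h1, h2⟩ | ⟨h1, h2, h3⟩
    · refine Or.inl ⟨h1, fun k hk => ?_⟩
      have hkn : k < n := by rw [← hn]; exact hk.reg.1
      exact h2 k hkn ((key k hkn).2 hk)
    · exact Or.inr ⟨h1, (key _ h1).1 h2⟩
  refine ⟨lc, ld, reg, sc, sc_nx, fun i j hij => ?_, fun j hj hj' => ?_⟩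
  · rcases prs j (by rw [← hn]; exact hij.reg'.1) with ⟨h1, h2⟩ | ⟨h1, h2⟩
    · exact absurd hij (h2 i)
    · exact h2.unique_left hij
  · rcases prs j hj with ⟨h1, h2⟩ | ⟨h1, h2⟩
    · omega
    · exact h2

namespace Frame

/-- Consecutive terminals of a staircase are in adjacent rows or columns. -/
def Adjt (G : Frame) (p b : ℕ) : Prop := G.π b + 1 = G.π p ∨ b = p + 1

/-- The greedy partition of staircases into blocks. -/
theorem blocks_of {G : Frame} {par ty : ℕ → ℕ}
    (hpar : ∀ b s, G.Nx b s → G.Adjt b s → par b = 1 - par s)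
    (hpar' : ∀ b, G.Reg b → (∀ s, G.Nx b s → ¬ G.Adjt b s) → par b = 1)
    (hty : ∀ p b, G.Nx p b → G.Adjt p b → ty p = 2 ∨ ty p = 4 ∨ ty p = 5 → ty b = ty p + 1)
    (hty0 : ∀ b, G.Reg b → (∀ p, G.Nx p b → G.Adjt p b → ¬ (ty p = 2 ∨ ty p = 4 ∨ ty p = 5)) → par b < 1 → ty b = 2)
    (hty1 : ∀ b, G.Reg b → (∀ p, G.Nx p b → G.Adjt p b → ¬ (ty p = 2 ∨ ty p = 4 ∨ ty p = 5)) → ¬ par b < 1 →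
      (∀ s, G.Nx b s → s ≠ b + 1) → ty b = 1)
    (hty4 : ∀ b s t, G.Nx b s → s = b + 1 → (∀ p, G.Nx p b → G.Adjt p b → ¬ (ty p = 2 ∨ ty p = 4 ∨ ty p = 5)) →
      ¬ par b < 1 → G.Nx s t → G.π t + 1 = G.π s → ty b = 4)
    (hty2 : ∀ b s, G.Nx b s → s = b + 1 → (∀ p, G.Nx p b → G.Adjt p b → ¬ (ty p = 2 ∨ ty p = 4 ∨ ty p = 5)) →
      ¬ par b < 1 → (∀ t, G.Nx s t → G.π t + 1 ≠ G.π s) → ty b = 2) : Blocks G ty := by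
  -- `par b` is the parity of the number of terminals from `b` to the end of its run of adjacent
  -- terminals. An open block is continued. Otherwise an even rest opens a pair, and an odd rest
  -- opens a single, a triple or a pair, depending on the adjacencies that follow.
  have cases : ∀ b, G.Reg b → (∃ p, G.Nx p b ∧ G.Adjt p b ∧ (ty p = 2 ∨ ty p = 4 ∨ ty p = 5) ∧ ty b = ty p + 1) ∨
      ((∀ p, G.Nx p b → G.Adjt p b → ¬ (ty p = 2 ∨ ty p = 4 ∨ ty p = 5)) ∧
        ((par b = 0 ∧ ty b = 2) ∨ (par b = 1 ∧ ((ty b = 1 ∧ ∀ s, G.Nx b s → s ≠ b + 1) ∨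
          (ty b = 4 ∧ ∃ s t, G.Nx b s ∧ s = b + 1 ∧ G.Nx s t ∧ G.π t + 1 = G.π s) ∨
          (ty b = 2 ∧ ∃ s, G.Nx b s ∧ s = b + 1 ∧ ∀ t, G.Nx s t → G.π t + 1 ≠ G.π s))))) := by
    intro b hb
    by_cases h : ∃ p, G.Nx p b ∧ G.Adjt p b ∧ (ty p = 2 ∨ ty p = 4 ∨ ty p = 5)
    · obtain ⟨p, h1, h2, h3⟩ := h
      exact Or.inl ⟨p, h1, h2, h3, hty p b h1 h2 h3⟩
    · have hA : ∀ p, G.Nx p b → G.Adjt p b → ¬ (ty p = 2 ∨ ty p = 4 ∨ ty p = 5) := fun p h1 h2 h3 => h ⟨p, h1, h2, h3⟩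
      refine Or.inr ⟨hA, ?_⟩
      by_cases h0 : par b < 1
      · exact Or.inl ⟨by omega, hty0 b hb hA h0⟩
      · have hle : par b ≤ 1 := by
          by_cases h1 : ∃ s, G.Nx b s ∧ G.Adjt b s
          · obtain ⟨s, h2, h3⟩ := h1
            rw [hpar b s h2 h3]; omega
          · rw [hpar' b hb fun s h2 h3 => h1 ⟨s, h2, h3⟩]
        refine Or.inr ⟨by omega, ?_⟩
        by_cases h1 : ∃ s, G.Nx b s ∧ s = b + 1
        · obtain ⟨s, h2, h3⟩ := h1
          by_cases h4 : ∃ t, G.Nx s t ∧ G.π t + 1 = G.π s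
          · obtain ⟨t, h5, h6⟩ := h4
            exact Or.inr (Or.inl ⟨hty4 b s t h2 h3 hA h0 h5 h6, s, t, h2, h3, h5, h6⟩)
          · have h5 : ∀ t, G.Nx s t → G.π t + 1 ≠ G.π s := fun t h5 h6 => h4 ⟨t, h5, h6⟩
            exact Or.inr (Or.inr ⟨hty2 b s h2 h3 hA h0 h5, s, h2, h3, h5⟩)
        · have h2 : ∀ s, G.Nx b s → s ≠ b + 1 := fun s h2 h3 => h1 ⟨s, h2, h3⟩
          exact Or.inl ⟨hty1 b hb hA h0 h2, h2⟩
  have up : ∀ b, G.Reg b → ty b = 3 ∨ ty b = 5 ∨ ty b = 6 →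
      ∃ p, G.Nx p b ∧ G.Adjt p b ∧ (ty p = 2 ∨ ty p = 4 ∨ ty p = 5) ∧ ty b = ty p + 1 := by
    intro b hb h
    rcases cases b hb with h1 | ⟨-, h1⟩
    · exact h1
    · omega
  have four : ∀ b, G.Reg b → ty b = 4 → par b = 1 ∧ ∃ s t, G.Nx b s ∧ s = b + 1 ∧ G.Nx s t ∧ G.π t + 1 = G.π s := by
    intro b hb h
    rcases cases b hb with ⟨p, h1, h2, h3, h4⟩ | ⟨-, ⟨-, h1⟩ | ⟨h0, ⟨h1, -⟩ | ⟨-, h1⟩ | ⟨h1, -⟩⟩⟩ <;>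
      first | omega | exact ⟨h0, h1⟩
  have two : ∀ b, G.Reg b → ty b = 2 → ∃ s, G.Nx b s ∧ G.Adjt b s := by
    intro b hb h
    rcases cases b hb with ⟨p, h1, h2, h3, h4⟩ | ⟨-, ⟨h1, -⟩ | ⟨h0, ⟨h1, -⟩ | ⟨h1, -⟩ | ⟨-, s, h1, h2, -⟩⟩⟩
    · omega
    · by_contra hc
      have := hpar' b hb fun s h2 h3 => hc ⟨s, h2, h3⟩
      omega
    · omega
    · omega
    · exact ⟨s, h1, Or.inr h2⟩
  have five : ∀ b, G.Reg b → ty b = 5 → ∃ p, G.Nx p b ∧ b = p + 1 ∧ ty p = 4 ∧ par p = 1 ∧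
      ∃ t, G.Nx b t ∧ G.π t + 1 = G.π b := by
    intro b hb h
    obtain ⟨p, h1, h2, h3, h4⟩ := up b hb (by omega)
    obtain ⟨h5, s, t, h6, h7, h8, h9⟩ := four p h1.reg (by omega)
    obtain rfl := h6.unique h1
    exact ⟨p, h1, h7, by omega, h5, t, h8, h9⟩
  refine ⟨?_, ?_, ?_, ?_, ?_, ?_, ?_, ?_, ?_⟩
  · intro b hb
    rcases cases b hb with ⟨p, h1, h2, h3, h4⟩ | ⟨-, ⟨h1, h2⟩ | ⟨h0, ⟨h1, -⟩ | ⟨h1, -⟩ | ⟨h1, -⟩⟩⟩ <;> omega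
  · intro b hb h
    obtain ⟨s, h1, h2⟩ := two b hb h
    exact ⟨s, h1, h2, by rw [hty b s h1 h2 (by omega)]; omega⟩
  · intro b hb h
    obtain ⟨p, h1, h2, h3, h4⟩ := up b hb (by omega)
    exact ⟨p, h1, h2, by omega⟩
  · intro b hb h
    obtain ⟨h5, s, t, h6, h7, h8, h9⟩ := four b hb h
    exact ⟨s, h6, h7, by rw [hty b s h6 (Or.inr h7) (by omega)]; omega⟩
  · intro b hb h
    obtain ⟨p, h1, h2, h3, -⟩ := five b hb h
    exact ⟨p, h1, h2, h3⟩
  · intro b hb h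
    obtain ⟨p, -, -, -, -, t, h1, h2⟩ := five b hb h
    exact ⟨t, h1, h2, by rw [hty b t h1 (Or.inl h2) (by omega)]; omega⟩
  · intro b hb h
    obtain ⟨s, h1, h2, h3, h4⟩ := up b hb (by omega)
    obtain ⟨p, -, -, -, -, t, h5, h6⟩ := five s h1.reg (by omega)
    obtain rfl := h5.unique h1
    exact ⟨s, h1, h6, by omega⟩
  · intro b hb h
    rcases cases b hb with ⟨p, h1, h2, h3, h4⟩ | ⟨-, ⟨-, h1⟩ | ⟨h0, ⟨-, h1⟩ | ⟨h1, -⟩ | ⟨h1, -⟩⟩⟩ <;>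
      omega
  -- A single `b` has an odd rest, so its predecessor `p` has an even rest and ends a block. A
  -- triple starts at an odd rest and would give `p` an odd one. A pair ending at `p` starts at an
  -- odd rest and is chosen only if the terminal after `p` is not in the row just below.
  · intro b hb h p hpb hπ
    have hadj : G.Adjt p b := Or.inl hπ
    have hpar1 := hpar p b hpb hadj
    rcases cases b hb with ⟨p, h1, h2, h3, h4⟩ | ⟨hA, ⟨-, h1⟩ | ⟨h0, -⟩⟩
    · omega
    · omega
    have hp := hA p hpb hadj
    rcases cases p hpb.reg with ⟨p', h1, h2, h3, h4⟩ | ⟨-, ⟨h1, h2⟩ | ⟨h1, -⟩⟩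
    · have hpar2 := hpar p' p h1 h2
      rcases cases p' h1.reg with ⟨p'', h5, h6, h7, h8⟩ | ⟨-, ⟨h5, -⟩ | ⟨-, ⟨h5, -⟩ | ⟨h5, -⟩ | ⟨-, s, h5, h6, h7⟩⟩⟩
      · have hpar3 := hpar p'' p' h5 h6
        have := (four p'' h5.reg (by omega)).1
        omega
      · omega
      · omega
      · omega
      · obtain rfl := h5.unique h1
        exact h7 b hpb hπ
    · omega
    · omega

end Frame

open E BDMMN.Frame

/-- The index of an entry in the reversed order. -/
def revE : E := .sub (.sub .size (.cst 1)) (.var 0)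

/-- The expressions for the parities and the types of blocks; the tables of `chainP` start at `b`. -/
def typeP (d : Ids) (b c : ℕ) : List E :=
  [.ite (.and (.lt (.g (b + 3) revE) .size) (.or (.eq (.add (.g d.π (.g (b + 3) revE)) (.cst 1)) (.g d.π revE))
      (.eq (.g (b + 3) revE) (.add revE (.cst 1)))))
    (.sub (.cst 1) (.g c (.sub (.sub .size (.cst 1)) (.g (b + 3) revE)))) (.cst 1),
   .ite (.and (.lt (.g (b + 4) (.var 0)) .size) (.and (.or (.eq (.add (.g d.π (.var 0)) (.cst 1)) (.g d.π (.g (b + 4) (.var 0))))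
      (.eq (.var 0) (.add (.g (b + 4) (.var 0)) (.cst 1))))
      (.or (.eq (.g (c + 1) (.g (b + 4) (.var 0))) (.cst 2)) (.or (.eq (.g (c + 1) (.g (b + 4) (.var 0))) (.cst 4))
        (.eq (.g (c + 1) (.g (b + 4) (.var 0))) (.cst 5))))))
    (.add (.g (c + 1) (.g (b + 4) (.var 0))) (.cst 1))
    (.ite (.lt (.g c revE) (.cst 1)) (.cst 2)
      (.ite (.and (.lt (.g (b + 3) (.var 0)) .size) (.eq (.g (b + 3) (.var 0)) (.add (.var 0) (.cst 1))))
        (.ite (.and (.lt (.g (b + 3) (.g (b + 3) (.var 0))) .size)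
          (.eq (.add (.g d.π (.g (b + 3) (.g (b + 3) (.var 0)))) (.cst 1)) (.g d.π (.g (b + 3) (.var 0))))) (.cst 4) (.cst 2))
        (.cst 1)))]

-- Parities depend on the terminals to the right, so their table is indexed backwards: an entry may
-- read only earlier entries of its own table. Types depend on the predecessor and are indexed
-- forwards.
open Classical in
theorem typeP_spec {n b c : ℕ} {F : Tab} {G : Frame} {d : Ids} (h : Holds n F G d) (hc : Chains n F G b)
    (hπ : d.π < c) (hbc : b + 5 ≤ c) (hs : Seg n F c (typeP d b c)) : Blocks G (fun i => (F (c + 1) i 0).1) := by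
  have hn := h.n_eq
  have nx : ∀ {i s}, G.Nx i s → i < n ∧ s < n := fun h => by rw [← hn]; exact ⟨h.reg.1, h.reg'.1⟩
  have par : ∀ i, i < n → (F c (n - 1 - i) 0).1 = if (F (b + 3) i 0).1 < n ∧ G.Adjt i (F (b + 3) i 0).1 then
      1 - (F c (n - 1 - (F (b + 3) i 0).1) 0).1 else 1 := by
    intro i hi
    obtain ⟨t, h1, h2, h3⟩ := hs 0 _ rfl (n - 1 - i) 0 (by omega) (by omega)
    have e1 : n - 1 - (n - 1 - i) = i := by omega
    have e2 := h2 (b + 3) (by omega)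
    have e3 := h2 d.π (by omega)
    rw [add_zero] at h1
    rw [h1, ev_ite]
    simp only [tr_and, tr_or, tr_eq, tr_lt, g, ev, revE, V2_zero, e1, e2, e3, add_zero] at h3 ⊢
    by_cases h4 : (F (b + 3) i 0).1 < n
    · have h5 := hc.sc_nx i hi h4
      rw [h.π i hi, h.π _ h4]
      by_cases h6 : (F (b + 3) i 0).1 < n ∧ G.Adjt i (F (b + 3) i 0).1
      · have h6' : (F (b + 3) i 0).1 < n ∧ (G.π (F (b + 3) i 0).1 + 1 = G.π i ∨ (F (b + 3) i 0).1 = i + 1) := h6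
        rw [if_pos h6, if_pos h6', h3 _ 0 (Or.inl (by have := h5.lt; omega))]
      · have h6' : ¬ ((F (b + 3) i 0).1 < n ∧ (G.π (F (b + 3) i 0).1 + 1 = G.π i ∨ (F (b + 3) i 0).1 = i + 1)) := h6
        rw [if_neg h6, if_neg h6']
    · simp only [h4, false_and, if_false]

  have ty : ∀ i, i < n → (F (c + 1) i 0).1 =
      if (F (b + 4) i 0).1 < n ∧ (G.π i + 1 = G.π (F (b + 4) i 0).1 ∨ i = (F (b + 4) i 0).1 + 1) ∧ ((F (c + 1) (F (b + 4) i 0).1 0).1 = 2 ∨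
        (F (c + 1) (F (b + 4) i 0).1 0).1 = 4 ∨ (F (c + 1) (F (b + 4) i 0).1 0).1 = 5) then
        (F (c + 1) (F (b + 4) i 0).1 0).1 + 1 else if (F c (n - 1 - i) 0).1 < 1 then 2 else
        if (F (b + 3) i 0).1 < n ∧ (F (b + 3) i 0).1 = i + 1 then
          if (F (b + 3) (F (b + 3) i 0).1 0).1 < n ∧
            (F d.π (F (b + 3) (F (b + 3) i 0).1 0).1 0).1 + 1 = (F d.π (F (b + 3) i 0).1 0).1 then 4 else 2 else 1 := by
    intro i hi
    obtain ⟨t, h1, h2, h3⟩ := hs 1 _ rfl i 0 hi (by omega)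
    rw [h1, ev_ite]
    have e2 := h2 (b + 3) (by omega)
    have e3 := h2 d.π (by omega)
    have e4 := h2 (b + 4) (by omega)
    have e5 := h2 c (by omega)
    simp only [tr_and, tr_or, tr_eq, tr_lt, g, ev, revE, V2_zero, e2, e3, e4, e5, ev_ite] at h3 ⊢
    by_cases h4 : (F (b + 4) i 0).1 < n
    · have h5 := hc.pr_nx i hi h4
      rw [h3 _ 0 (Or.inl h5.lt)]
      simp only [h.π i hi, h.π _ h4]
      split_ifs <;> rfl
    · simp only [h4, false_and, if_false]
      split_ifs <;> rfl
  have hA : ∀ {i}, i < n → (∀ p, G.Nx p i → G.Adjt p i → ¬ ((F (c + 1) p 0).1 = 2 ∨ (F (c + 1) p 0).1 = 4 ∨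
      (F (c + 1) p 0).1 = 5)) → ¬ ((F (b + 4) i 0).1 < n ∧ (G.π i + 1 = G.π (F (b + 4) i 0).1 ∨ i = (F (b + 4) i 0).1 + 1) ∧
        ((F (c + 1) (F (b + 4) i 0).1 0).1 = 2 ∨
        (F (c + 1) (F (b + 4) i 0).1 0).1 = 4 ∨ (F (c + 1) (F (b + 4) i 0).1 0).1 = 5)) :=
    fun hi h1 ⟨h2, h3, h4⟩ => h1 _ (hc.pr_nx _ hi h2) h3 h4
  refine blocks_of (par := fun i => (F c (n - 1 - i) 0).1) ?_ ?_ ?_ ?_ ?_ ?_ ?_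
  · intro i s h1 h2
    have h3 := hc.sc i s h1
    have := par i (nx h1).1
    rw [h3, if_pos ⟨(nx h1).2, h2⟩] at this
    exact this
  · intro i hi h1
    have hin : i < n := by rw [← hn]; exact hi.1
    exact (par i hin).trans (if_neg fun h2 => h1 _ (hc.sc_nx i hin h2.1) h2.2)
  · intro p i h1 h2 h3
    have h4 := hc.pr p i h1
    have := ty i (nx h1).2
    rw [h4, if_pos ⟨(nx h1).1, h2, h3⟩] at this
    exact this
  · intro i hi h1 h2
    have hin : i < n := by rw [← hn]; exact hi.1
    exact (ty i hin).trans (by rw [if_neg (hA hin h1), if_pos h2])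
  · intro i hi h1 h2 h3
    have hin : i < n := by rw [← hn]; exact hi.1
    exact (ty i hin).trans (by
      rw [if_neg (hA hin h1), if_neg h2, if_neg fun h4 => h3 _ (hc.sc_nx i hin h4.1) h4.2])
  · intro i s t h1 h2 h3 h4 h5 h6
    have hin := (nx h1).1
    have e1 := hc.sc i s h1
    have e2 := hc.sc s t h5
    exact (ty i hin).trans (by
      rw [if_neg (hA hin h3), if_neg h4, e1, if_pos ⟨(nx h1).2, h2⟩, e2, h.π s (nx h1).2, h.π t (nx h5).2,
        if_pos ⟨(nx h5).2, h6⟩])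
  · intro i s h1 h2 h3 h4 h5
    have hin := (nx h1).1
    have e1 := hc.sc i s h1
    refine (ty i hin).trans ?_
    rw [if_neg (hA hin h3), if_neg h4, e1, if_pos ⟨(nx h1).2, h2⟩, if_neg]
    rintro ⟨h6, h7⟩
    rw [h.π s (nx h1).2, h.π _ h6] at h7
    exact h5 _ (hc.sc_nx s (nx h1).2 h6) h7

/-- Reversal of the order in a block. -/
def swapE (x : E) : E := .ite (.eq x (.cst 2)) (.cst 3) (.ite (.eq x (.cst 3)) (.cst 2)
  (.ite (.eq x (.cst 4)) (.cst 6) (.ite (.eq x (.cst 6)) (.cst 4) x)))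

theorem swapE_ev {n : ℕ} {t : Tab} {V : ℕ → ℕ} {x : E} : ((swapE x).ev n t V).1 = swapTy (x.ev n t V).1 := by
  simp only [swapE, ev_ite, tr_eq, swapTy]
  split_ifs <;> first | rfl | (simp only [ev] at *; contradiction)

/-- The expression for the types of blocks in the transposed frame. -/
def typeTP (d : Ids) (c : ℕ) : E := swapE (.g c (.g d.σ (.var 0)))

theorem typeTP_spec {n T c : ℕ} {F : Tab} {G : Frame} {d : Ids} (h : Holds n F G d) (hσ : d.σ < T) (hc : c < T)
    (hs : Sat n F T (typeTP d c)) {i : ℕ} (hi : i < n) : (F T i 0).1 = tyT G (fun i => (F c i 0).1) i := by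
  rw [hs.eq (by simp [typeTP, swapE, Bel, E.ite, E.eq, g, hσ, hc]) hi (by omega), typeTP, swapE_ev]
  simp only [g, ev, V2_zero, h.σ i hi, tyT]

/-! ### Tables for the dynamic program -/

open E BDMMN.Frame

theorem E.amin_ev {n L : ℕ} {t : Tab} {V : ℕ → ℕ} {c v : E} :
    ((E.amin L c v).ev n t V = (n, 0) ∧ ∀ k, k < n → ¬ Tr n t (Function.update V L k) c) ∨
    (((E.amin L c v).ev n t V).1 < n ∧ Tr n t (Function.update V L ((E.amin L c v).ev n t V).1) c ∧
      ((E.amin L c v).ev n t V).2 = (v.ev n t (Function.update V L ((E.amin L c v).ev n t V).1)).2 ∧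
      ∀ k, k < n → Tr n t (Function.update V L k) c →
        ((E.amin L c v).ev n t V).2 ≤ (v.ev n t (Function.update V L k)).2) := by
  simp only [ev, Tr]
  rcases amin_spec (n := n) (g := fun k => (c.ev n t (Function.update V L k)).1)
    (v := fun k => (v.ev n t (Function.update V L k)).2) le_rfl with ⟨h1, h2⟩ | ⟨h1, h2, h3, -⟩
  · left
    refine ⟨?_, fun k hk => by have := h2 k hk; omega⟩
    rw [h1, if_neg (lt_irrefl n)]
  · right
    rw [if_pos h1]
    exact ⟨h1, h2, rfl, h3⟩

/-- A test whether `y` is a regular terminal in the staircase of `x`. -/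
def memE (b : ℕ) (x y : E) : E := .and (.g (b + 2) y) (.and (.eq (.g b y) (.g b x)) (.eq (.g (b + 1) y) (.g (b + 1) x)))

theorem memE_tr {n b : ℕ} {F t : Tab} {G : Frame} (hc : Chains n F G b) (ht : ∀ T, T < b + 5 → t T = F T) {V : ℕ → ℕ}
    {x y : E} (hx : (x.ev n t V).1 < n) (hy : (y.ev n t V).1 < n) :
    Tr n t V (memE b x y) ↔ G.Mem (G.lc (x.ev n t V).1) (G.ld (x.ev n t V).1) (y.ev n t V).1 := by
  simp only [memE, tr_and, tr_eq]
  simp only [Tr, g, ev, ht b (by omega), ht (b + 1) (by omega), ht (b + 2) (by omega), hc.lc _ hx, hc.ld _ hx,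
    hc.lc _ hy, hc.ld _ hy, hc.reg _ hy, Mem]

/-- The columns of the nodes. -/
def colE (b e : ℕ) : E := .ite (.or (.eq (.g e (.var 0)) (.cst 3)) (.eq (.g e (.var 0)) (.cst 6))) (.g (b + 4) (.var 0)) (.var 0)

/-- The rows of the nodes. -/
def rowE (d : Ids) (b e : ℕ) : E :=
  .sub (.g d.π (.ite (.or (.eq (.g e (.var 0)) (.cst 2)) (.eq (.g e (.var 0)) (.cst 5))) (.g (b + 3) (.var 0))
    (.ite (.eq (.g e (.var 0)) (.cst 4)) (.g (b + 3) (.g (b + 3) (.var 0))) (.var 0)))) (.cst 1)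

/-- The length of a tree that is composed of two trees. -/
def splitE (d : Ids) (b c : ℕ) : E :=
  .add (.add (.add (.get (c + 2) (.var 0) (.var 2)) (.get (c + 2) (.sub (.sub .size (.cst 1)) (.g (b + 3) (.var 2))) (.var 1)))
    (.sub (.g d.ys (.g (c + 1) (.var 2))) (.g d.ys (.g (c + 1) (.var 1)))))
    (.sub (.g d.xs (.g c (.g (b + 3) (.var 2)))) (.g d.xs (.g c revE)))

/-- The best composition. -/
def treeE (d : Ids) (b c : ℕ) : E :=
  .amin 2 (.and (memE b revE (.var 2)) (.and (.le revE (.var 2)) (.lt (.var 2) (.var 1)))) (splitE d b c)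

/-- The length of a tree that is joined to the left boundary, together with its successors. -/
def exitE (d : Ids) (b c : ℕ) : E :=
  .add (.add (.get (c + 2) (.var 0) (.var 2)) (.sub (.g d.xs (.g c revE)) (.g d.xs (.g b revE))))
    (.ite (.lt (.g (b + 3) (.var 2)) .size) (.g (c + 3) (.sub (.sub .size (.cst 1)) (.g (b + 3) (.var 2)))) (.cst 0))

/-- The best first tree. -/
def forestE (d : Ids) (b c : ℕ) : E := .amin 2 (.and (memE b revE (.var 2)) (.le revE (.var 2))) (exitE d b c)

/-- The expressions for the nodes and the optimal trees. -/
def solP (d : Ids) (b e c : ℕ) : List E := [colE b e, rowE d b e, treeE d b c, forestE d b c]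

section

variable {n b e c : ℕ} {F : Tab} {G : Frame} {τ : ℕ → ℕ} {d : Ids} (h : Holds n F G d) (hc : Chains n F G b)
  (hB : Blocks G τ) (hτ : ∀ i, i < n → (F e i 0).1 = τ i) (hπ : d.π < c) (hxs : d.xs < c) (hys : d.ys < c)
  (hbc : b + 5 ≤ c) (hec : e < c) (hs : Seg n F c (solP d b e c))

include h hc hτ hπ hbc hec hs

theorem solP_nodes : Nodes G τ (fun i => (F c i 0).1) (fun i => (F (c + 1) i 0).1) := by
  have hn := h.n_eq
  have nx : ∀ {i s}, G.Nx i s → i < n ∧ s < n := fun h => by rw [← hn]; exact ⟨h.reg.1, h.reg'.1⟩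
  have rg : ∀ {i}, G.Reg i → i < n := fun h => by rw [← hn]; exact h.1
  have e0 : ∀ i, i < n → (F c i 0).1 = ((colE b e).ev n F (V2 i 0)).1 := fun i hi => by
    rw [(show Sat n F c _ from hs 0 _ rfl).eq (by simp [colE, Bel, E.or, E.ite, E.eq, g, hec]; omega) hi (by omega)]
  have e1 : ∀ i, i < n → (F (c + 1) i 0).1 = ((rowE d b e).ev n F (V2 i 0)).1 := fun i hi => by
    rw [(show Sat n F (c + 1) _ from hs 1 _ rfl).eq (by simp [rowE, Bel, E.or, E.ite, E.eq, g]; omega) hi (by omega)]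
  refine ⟨fun i hi h3 h6 => ?_, fun p i hp h36 => ?_, fun i hi h1 => ?_, fun i s h1 h2 => ?_, fun i s t h1 h2 h3 => ?_⟩
  · have hin := rg hi
    rw [e0 i hin]
    simp only [colE, ev_ite, tr_or, tr_eq, g, ev, V2_zero, hτ i hin]
    rw [if_neg (by omega)]
  · have hin := (nx hp).2
    simp only [e0 i hin]
    simp only [colE, ev_ite, tr_or, tr_eq, g, ev, V2_zero, hτ i hin]
    rw [if_pos (by omega), hc.pr p i hp]
  · have hin := rg hi
    simp only [e1 i hin]
    simp only [rowE, ev_ite, tr_or, tr_eq, g, ev, V2_zero, hτ i hin]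
    rw [if_neg (by omega), if_neg (by omega), h.π i hin]
    have := hi.2.2.2
    omega
  · have hin := (nx h1).1
    simp only [e1 i hin]
    simp only [rowE, ev_ite, tr_or, tr_eq, g, ev, V2_zero, hτ i hin]
    rw [if_pos (by omega), hc.sc i s h1, h.π s (nx h1).2]
    have := h1.reg'.2.2.2
    omega
  · have hin := (nx h1).1
    simp only [e1 i hin]
    simp only [rowE, ev_ite, tr_or, tr_eq, g, ev, V2_zero, hτ i hin]
    rw [if_neg (by omega), if_pos (by omega), hc.sc i s h1, hc.sc s t h2, h.π t (nx h2).2]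
    have := h2.reg'.2.2.2
    omega

include hB

theorem solP_lt {i : ℕ} (hi : G.Reg i) : (F c i 0).1 < n ∧ (F (c + 1) i 0).1 < n := by
  have hX := solP_nodes h hc hτ hπ hbc hec hs
  have hm : G.Mem (G.lc i) (G.ld i) i := ⟨hi, rfl, rfl⟩
  have hn := h.n_eq
  have pl : ∀ {i s}, G.Nx i s → i < n ∧ s < n ∧ G.π s < n := fun h => by
    rw [← hn]; exact ⟨h.reg.1, h.reg'.1, G.π_lt _ h.reg'.1⟩
  constructor
  · rcases hX.X_cases hB hm with ⟨h1, -⟩ | ⟨p, h1, h2, -⟩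
    · have := hi.1; omega
    · have := pl h1; omega
  · have := G.π_lt i hi.1
    rcases hX.ρ_cases hB hm with ⟨-, h1⟩ | ⟨s, h1, -, -, h2⟩ | ⟨s, t, -, h1, -, -, -, h2⟩
    · omega
    · have := pl h1; omega
    · have := pl h1; omega

include hxs

-- The left end of an interval is stored in reverse. The part `[i, k]` is then in the same row at an
-- earlier column and the other part in an earlier row, so both are available. The default pair `(n,
-- 0)` of an empty minimum gives length `0` to intervals of one terminal.
include hys in
theorem treeE_spec {i j : ℕ} (hi : G.Reg i) (hj : G.Mem (G.lc i) (G.ld i) j) :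
    ((F (c + 2) (n - 1 - i) j = (n, 0) ∧ ∀ k, G.Mem (G.lc i) (G.ld i) k → i ≤ k → ¬ k < j) ∨
      ∃ m, (F (c + 2) (n - 1 - i) j).1 = m ∧ (G.Mem (G.lc i) (G.ld i) m ∧ i ≤ m ∧ m < j) ∧
        (F (c + 2) (n - 1 - i) j).2 = (F (c + 2) (n - 1 - i) m).2 + (F (c + 2) (n - 1 - (F (b + 3) m 0).1) j).2 +
          (G.ys (F (c + 1) m 0).1 - G.ys (F (c + 1) j 0).1) + (G.xs (F c (F (b + 3) m 0).1 0).1 - G.xs (F c i 0).1) ∧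
        ∀ k, G.Mem (G.lc i) (G.ld i) k → i ≤ k → k < j → (F (c + 2) (n - 1 - i) j).2 ≤
          (F (c + 2) (n - 1 - i) k).2 + (F (c + 2) (n - 1 - (F (b + 3) k 0).1) j).2 +
          (G.ys (F (c + 1) k 0).1 - G.ys (F (c + 1) j 0).1) + (G.xs (F c (F (b + 3) k 0).1 0).1 - G.xs (F c i 0).1)) := by
  have hn := h.n_eq
  have rg : ∀ {i}, G.Reg i → i < n := fun h => by rw [← hn]; exact h.1
  have lt := fun {i} => solP_lt (i := i) h hc hB hτ hπ hbc hec hs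
  have hin := rg hi
  have hjn := rg hj.1
  obtain ⟨t, h1, h2, h3⟩ := hs 2 _ rfl (n - 1 - i) j (by omega) hjn
  have e1 : n - 1 - (n - 1 - i) = i := by omega
  have guard : ∀ k, k < n → (Tr n t (Function.update (V2 (n - 1 - i) j) 2 k)
      (.and (memE b revE (.var 2)) (.and (.le revE (.var 2)) (.lt (.var 2) (.var 1)))) ↔
      G.Mem (G.lc i) (G.ld i) k ∧ i ≤ k ∧ k < j) := by
    intro k hk
    have e2 : (revE.ev n t (Function.update (V2 (n - 1 - i) j) 2 k)).1 = i := by simp only [revE, ev, up2_zero, e1]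
    have e3 : ((E.var 2).ev n t (Function.update (V2 (n - 1 - i) j) 2 k)).1 = k := rfl
    rw [tr_and, tr_and, tr_le, tr_lt, memE_tr hc (fun T hT => h2 T (by omega)) (by rw [e2]; exact hin) (by rw [e3]; exact hk),
      e2, e3]
    rfl
  have val : ∀ k, G.Mem (G.lc i) (G.ld i) k → i ≤ k → k < j →
      ((splitE d b c).ev n t (Function.update (V2 (n - 1 - i) j) 2 k)).2 =
      (F (c + 2) (n - 1 - i) k).2 + (F (c + 2) (n - 1 - (F (b + 3) k 0).1) j).2 +
          (G.ys (F (c + 1) k 0).1 - G.ys (F (c + 1) j 0).1) + (G.xs (F c (F (b + 3) k 0).1 0).1 - G.xs (F c i 0).1) := by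
    intro k hk hik hkj
    obtain ⟨s, hs⟩ := hk.nx_ex hj hkj
    have e2 := hc.sc k s hs
    have := hs.lt
    have hsn := rg hs.reg'
    simp only [splitE, g, ev, up2_zero, up2_one, up2_two, revE, e1, h2 (b + 3) (by omega), h2 d.ys (by omega),
      h2 d.xs (by omega), h2 c (by omega), h2 (c + 1) (by omega), e2]
    rw [h3 _ _ (Or.inr ⟨rfl, hkj⟩), h3 _ _ (Or.inl (by omega)), h.ys _ (lt hk.1).2, h.ys _ (lt hj.1).2,
      h.xs _ (lt hs.reg').1, h.xs _ (lt hi).1]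
  rw [treeE] at h1
  rcases E.amin_ev (n := n) (L := 2) (t := t) (V := V2 (n - 1 - i) j) (c := .and (memE b revE (.var 2))
    (.and (.le revE (.var 2)) (.lt (.var 2) (.var 1)))) (v := splitE d b c) with ⟨h4, h5⟩ | ⟨h4, h5, h6, h7⟩
  · rw [← h1] at h4
    exact Or.inl ⟨h4, fun k hk h6 h7 => h5 k (rg hk.1) ((guard k (rg hk.1)).2 ⟨hk, h6, h7⟩)⟩
  · rw [← h1] at h4 h5 h6 h7
    rw [guard _ h4] at h5
    rw [val _ h5.1 h5.2.1 h5.2.2] at h6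
    refine Or.inr ⟨_, rfl, h5, h6, fun k hk h8 h9 => ?_⟩
    rw [← val k hk h8 h9]
    exact h7 k (rg hk.1) ((guard k (rg hk.1)).2 ⟨hk, h8, h9⟩)

-- The minimum is never empty because `i` itself is admissible; the conditional summand is the value
-- of the rest of the staircase, absent when no successor exists.
open Classical in
theorem forestE_spec {i : ℕ} (hi : G.Reg i) :
    ∃ m, (F (c + 3) (n - 1 - i) 0).1 = m ∧ (G.Mem (G.lc i) (G.ld i) m ∧ i ≤ m) ∧
        (F (c + 3) (n - 1 - i) 0).2 = (F (c + 2) (n - 1 - i) m).2 + (G.xs (F c i 0).1 - G.xs (G.lc i)) +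
          (if (F (b + 3) m 0).1 < n then (F (c + 3) (n - 1 - (F (b + 3) m 0).1) 0).2 else 0) ∧
        ∀ k, G.Mem (G.lc i) (G.ld i) k → i ≤ k → (F (c + 3) (n - 1 - i) 0).2 ≤
          (F (c + 2) (n - 1 - i) k).2 + (G.xs (F c i 0).1 - G.xs (G.lc i)) +
          (if (F (b + 3) k 0).1 < n then (F (c + 3) (n - 1 - (F (b + 3) k 0).1) 0).2 else 0) := by
  have hn := h.n_eq
  have rg : ∀ {i}, G.Reg i → i < n := fun h => by rw [← hn]; exact h.1
  have lt := fun {i} => solP_lt (i := i) h hc hB hτ hπ hbc hec hs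
  have hin := rg hi
  obtain ⟨t, h1, h2, h3⟩ := hs 3 _ rfl (n - 1 - i) 0 (by omega) (by omega)
  have e1 : n - 1 - (n - 1 - i) = i := by omega
  have guard : ∀ k, k < n → (Tr n t (Function.update (V2 (n - 1 - i) 0) 2 k)
      (.and (memE b revE (.var 2)) (.le revE (.var 2))) ↔ G.Mem (G.lc i) (G.ld i) k ∧ i ≤ k) := by
    intro k hk
    have e2 : (revE.ev n t (Function.update (V2 (n - 1 - i) 0) 2 k)).1 = i := by simp only [revE, ev, up2_zero, e1]
    have e3 : ((E.var 2).ev n t (Function.update (V2 (n - 1 - i) 0) 2 k)).1 = k := rfl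
    rw [tr_and, tr_le, memE_tr hc (fun T hT => h2 T (by omega)) (by rw [e2]; exact hin) (by rw [e3]; exact hk), e2, e3]
  have val : ∀ k, G.Mem (G.lc i) (G.ld i) k → i ≤ k →
      ((exitE d b c).ev n t (Function.update (V2 (n - 1 - i) 0) 2 k)).2 =
      (F (c + 2) (n - 1 - i) k).2 + (G.xs (F c i 0).1 - G.xs (G.lc i)) +
          (if (F (b + 3) k 0).1 < n then (F (c + 3) (n - 1 - (F (b + 3) k 0).1) 0).2 else 0) := by
    intro k hk hik
    have hl : G.lc i < n := by have := G.lc_le (b := i); omega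
    simp only [exitE, g, ev, ev_ite, tr_lt, up2_zero, up2_two, revE, e1, h2 (b + 3) (by omega), h2 (c + 2) (by omega),
      h2 d.xs (by omega), h2 c (by omega), h2 b (by omega), hc.lc i hin]
    rw [h.xs _ (lt hi).1, h.xs _ hl]
    by_cases h4 : (F (b + 3) k 0).1 < n
    · have := (hc.sc_nx k (rg hk.1) h4).lt
      rw [if_pos h4, if_pos h4, h3 _ _ (Or.inl (by omega))]
    · rw [if_neg h4, if_neg h4]
  rw [forestE] at h1
  rcases E.amin_ev (n := n) (L := 2) (t := t) (V := V2 (n - 1 - i) 0) (c := .and (memE b revE (.var 2))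
    (.le revE (.var 2))) (v := exitE d b c) with ⟨h4, h5⟩ | ⟨h4, h5, h6, h7⟩
  · exact absurd ((guard i hin).2 ⟨⟨hi, rfl, rfl⟩, le_rfl⟩) (h5 i hin)
  · rw [← h1] at h4 h5 h6 h7
    rw [guard _ h4] at h5
    rw [val _ h5.1 h5.2] at h6
    refine ⟨_, rfl, h5, h6, fun k hk h8 => ?_⟩
    rw [← val k hk h8]
    exact h7 k (rg hk.1) ((guard k (rg hk.1)).2 ⟨hk, h8⟩)

/-- The optimal trees that the tables describe. -/
noncomputable def solOf : Sol G τ where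
  X := fun i => (F c i 0).1
  ρ := fun i => (F (c + 1) i 0).1
  sc := fun i => (F (b + 3) i 0).1
  pr := fun i => (F (b + 4) i 0).1
  M := fun i j => (F (c + 2) (n - 1 - i) j).2
  sp := fun i j => (F (c + 2) (n - 1 - i) j).1
  f := fun i => (F (c + 3) (n - 1 - i) 0).2
  ar := fun i => (F (c + 3) (n - 1 - i) 0).1
  sc_eq := hc.sc
  pr_eq := hc.pr
  nodes := solP_nodes h hc hτ hπ hbc hec hs
  M_self := fun i hi => by
    rcases treeE_spec h hc hB hτ hπ hxs hys hbc hec hs hi ⟨hi, rfl, rfl⟩ with ⟨h1, -⟩ | ⟨m, -, h1, -⟩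
    · rw [h1]
    · omega
  sp_mem := fun i j hi hj hij => by
    rcases treeE_spec h hc hB hτ hπ hxs hys hbc hec hs hi hj with ⟨-, h1⟩ | ⟨m, rfl, h1, -⟩
    · exact absurd hij (h1 i ⟨hi, rfl, rfl⟩ le_rfl)
    · exact h1
  M_eq := fun i j hi hj hij => by
    rcases treeE_spec h hc hB hτ hπ hxs hys hbc hec hs hi hj with ⟨-, h1⟩ | ⟨m, rfl, -, h1, -⟩
    · exact absurd hij (h1 i ⟨hi, rfl, rfl⟩ le_rfl)
    · exact h1
  M_le := fun i m j hi hm hj him hmj => by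
    rcases treeE_spec h hc hB hτ hπ hxs hys hbc hec hs hi hj with ⟨-, h1⟩ | ⟨m', rfl, -, -, h1⟩
    · exact absurd hmj (h1 m hm him)
    · exact h1 m hm him hmj
  ar_mem := fun i hi => by
    obtain ⟨m, rfl, h1, -⟩ := forestE_spec h hc hB hτ hπ hxs hbc hec hs hi
    exact h1
  f_eq_last := fun i hi hl => by
    obtain ⟨m, rfl, h1, h2, -⟩ := forestE_spec h hc hB hτ hπ hxs hbc hec hs hi
    rw [h2, if_neg, add_zero]
    exact fun h3 => hl _ (hc.sc_nx _ (h1.1.1.1.trans_eq h.n_eq) h3)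
  f_eq_next := fun i s hi hn' => by
    obtain ⟨m, rfl, h1, h2, -⟩ := forestE_spec h hc hB hτ hπ hxs hbc hec hs hi
    rw [h2, hc.sc _ s hn', if_pos (by rw [← h.n_eq]; exact hn'.reg'.1)]
  f_le_last := fun i j hi hj hij hl => by
    obtain ⟨m, rfl, -, -, h1⟩ := forestE_spec h hc hB hτ hπ hxs hbc hec hs hi
    have := h1 j hj hij
    rwa [if_neg fun h3 => hl _ (hc.sc_nx _ (hj.1.1.trans_eq h.n_eq) h3), add_zero] at this
  f_le_next := fun i j s hi hj hij hn' => by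
    obtain ⟨m, rfl, -, -, h1⟩ := forestE_spec h hc hB hτ hπ hxs hbc hec hs hi
    have := h1 j hj hij
    rwa [hc.sc _ s hn', if_pos (by rw [← h.n_eq]; exact hn'.reg'.1)] at this

end

/-! ### Tables for the edges of the trees -/

open E BDMMN.Frame

/-- The right end of the interval in the second variable, which is reversed. -/
def revE1 : E := .sub (.sub .size (.cst 1)) (.var 1)

/-- Splitting points of intervals. -/
def spE (c : ℕ) (x y : E) : E := .get (c + 2) (.sub (.sub .size (.cst 1)) x) y

/-- The last terminals of the first trees. -/
def arE (c : ℕ) (x : E) : E := .g (c + 3) (.sub (.sub .size (.cst 1)) x)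

/-- The left ends of the top intervals. -/
def rootE (b c r : ℕ) : E := .and (.g (b + 2) (.var 0)) (.or (.le .size (.g (b + 4) (.var 0)))
  (.ex 2 (.and (.lt (.var 2) (.var 0)) (.and (.g r (.var 2)) (.eq (.g (b + 3) (arE c (.var 2))) (.var 0))))))

/-- The intervals of the optimal trees. -/
def usedE (b c r : ℕ) : E := .or (.and (.g r (.var 0)) (.eq (arE c (.var 0)) revE1))
  (.or (.ex 2 (.and (.and (.lt (.var 0) (.var 2)) (.lt revE1 (.var 2)))
      (.and (.get (r + 1) (.var 0) (.sub (.sub .size (.cst 1)) (.var 2))) (.eq (spE c (.var 0) (.var 2)) revE1))))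
    (.ex 2 (.and (.and (.lt (.var 2) (.var 0)) (.lt (.var 2) revE1))
      (.and (.get (r + 1) (.var 2) (.var 1)) (.eq (.g (b + 3) (spE c (.var 2) revE1)) (.var 0))))))

/-- The horizontal edges of the trees, by right ends of intervals. -/
def covHE (b c r : ℕ) : E := .ex 2 (.and (.lt (.var 2) (.var 0))
  (.and (.get (r + 1) (.var 2) (.sub (.sub .size (.cst 1)) (.var 0)))
    (.and (.le (.g c (.var 2)) (.var 1)) (.lt (.var 1) (.g c (.g (b + 3) (spE c (.var 2) (.var 0))))))))

/-- The vertical edges of the trees, by left ends of intervals. -/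
def covVE (c r : ℕ) : E := .ex 2 (.and (.lt (.var 0) (.var 2))
  (.and (.get (r + 1) (.var 0) (.sub (.sub .size (.cst 1)) (.var 2)))
    (.and (.le (.g (c + 1) (.var 2)) (.var 1)) (.lt (.var 1) (.g (c + 1) (spE c (.var 0) (.var 2)))))))

/-- The terminal in the next row. -/
def upE (d : Ids) : E := .g d.σ (.add (.var 1) (.cst 1))

/-- The horizontal edges. -/
def markHE (d : Ids) (b e c r : ℕ) : E :=
  .or (.ex 2 (.and (.eq (.g (c + 1) (.var 2)) (.var 1)) (.get (r + 2) (.var 2) (.var 0))))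
   (.or (.ex 2 (.and (.g r (.var 2)) (.and (.eq (.g (c + 1) (arE c (.var 2))) (.var 1))
      (.and (.le (.g b (.var 2)) (.var 0)) (.lt (.var 0) (.g c (.var 2)))))))
    (.and (.lt (.add (.var 1) (.cst 1)) .size) (.or
      (.and (.and (.g (b + 2) (upE d)) (.or (.eq (.g e (upE d)) (.cst 3)) (.eq (.g e (upE d)) (.cst 6))))
        (.and (.le (.g (b + 4) (upE d)) (.var 0)) (.lt (.var 0) (upE d))))
      (.and (.and (.eq (upE d) (.add (.var 0) (.cst 1))) (.eq (.g b (upE d)) (.var 0)))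
        (.and (.le (.cst 1) (.g b (upE d))) (.le (.add (.g (b + 1) (upE d)) (.cst 2)) (.g d.π (upE d))))))))

/-- The vertical edges. -/
def markVE (d : Ids) (b e c r : ℕ) : E :=
  .or (.or (.ex 2 (.and (.eq (.g c (.var 2)) (.var 0)) (.get (r + 3) (.var 2) (.var 1))))
    (.and (.lt (.add (.var 1) (.cst 1)) .size) (.and (.g (b + 2) (upE d)) (.or
      (.and (.or (.eq (.g e (upE d)) (.cst 3)) (.or (.eq (.g e (upE d)) (.cst 5)) (.eq (.g e (upE d)) (.cst 6))))
        (.eq (.g (b + 4) (upE d)) (.var 0)))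
      (.and (.eq (.g e (upE d)) (.cst 6)) (.eq (.g (b + 4) (.g (b + 4) (upE d))) (.var 0)))))))
   (.and (.and (.le (.cst 1) (.g b (.var 0))) (.le (.add (.g b (.var 0)) (.cst 1)) (.var 0)))
     (.and (.eq (.g d.π (.var 0)) (.add (.g (b + 1) (.var 0)) (.cst 1)))
       (.eq (.sub (.g (b + 1) (.var 0)) (.cst 1)) (.var 1))))

/-- The expressions for the edges of the optimal trees. -/
def markP (d : Ids) (b e c r : ℕ) : List E :=
  [rootE b c r, usedE b c r, covHE b c r, covVE c r, markHE d b e c r, markVE d b e c r]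

/-- The tables contain optimal trees. -/
structure SolT (F : Tab) (n b c : ℕ) {G : Frame} {τ : ℕ → ℕ} (S : Sol G τ) : Prop where
  X : ∀ i, (F c i 0).1 = S.X i
  ρ : ∀ i, (F (c + 1) i 0).1 = S.ρ i
  sc : ∀ i, (F (b + 3) i 0).1 = S.sc i
  pr : ∀ i, (F (b + 4) i 0).1 = S.pr i
  sp : ∀ i j, (F (c + 2) (n - 1 - i) j).1 = S.sp i j
  ar : ∀ i, (F (c + 3) (n - 1 - i) 0).1 = S.ar i

section

variable {n b e c r : ℕ} {F : Tab} {G : Frame} {τ : ℕ → ℕ} {d : Ids} {S : Sol G τ} (h : Holds n F G d)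
  (hc : Chains n F G b) (hS : SolT F n b c S) (hτ : ∀ i, i < n → (F e i 0).1 = τ i) (hπ : d.π < b) (hσ : d.σ < b)
  (hbc : b + 5 ≤ c) (hec : e < c) (hcr : c + 4 ≤ r) (hs : Seg n F r (markP d b e c r))

include h hc hS hbc hcr hs

theorem rootE_spec {i : ℕ} (hi : i < n) : 0 < (F r i 0).1 ↔ Root S i := by
  have hn := h.n_eq
  have rg : ∀ {i}, G.Reg i → i < n := fun h => by rw [← hn]; exact h.1
  induction i using Nat.strong_induction_on with
  | _ i ih =>
  obtain ⟨t, h1, h2, h3⟩ := (show Sat n F r _ from hs 0 _ rfl) i 0 hi (by omega)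
  rw [h1]
  change Tr _ _ _ _ ↔ _
  simp only [rootE, tr_and, tr_or, tr_le, tr_ex, tr_lt, tr_eq]
  simp only [Tr, g, arE, ev, V2_zero, up2_zero, up2_two, h2 (b + 2) (by omega), h2 (b + 4) (by omega), h2 (b + 3) (by omega),
    h2 (c + 3) (by omega), hc.reg i hi, hS.ar, hS.sc]
  constructor
  · rintro ⟨h4, h5 | ⟨k, hk, h5, h6, h7⟩⟩
    · refine ⟨i, h4, fun p hp => ?_, .refl⟩
      have := rg hp.reg
      have := hc.pr p i hp
      omega
    · rw [h3 _ _ (Or.inl h5)] at h6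
      replace h6 := (ih k h5 hk).1 h6
      obtain ⟨a, h8, h9, h10⟩ := h6
      refine ⟨a, h8, h9, h10.tail ?_⟩
      have hk : G.Reg k := Root.reg ⟨a, h8, h9, h10⟩
      have h11 := hc.sc_nx (S.ar k) (rg (S.ar_mem k hk).1.1) (by rw [hS.sc, h7]; exact hi)
      rw [hS.sc, h7] at h11
      exact h11
  · intro hR
    refine ⟨Root.reg hR, ?_⟩
    obtain ⟨a, h4, h5, h6⟩ := hR
    rcases Relation.ReflTransGen.cases_tail h6 with h7 | ⟨p, h7, h8⟩
    · subst h7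
      left
      by_contra h8
      exact h5 _ (hc.pr_nx _ hi (by omega))
    · right
      have hp : Root S p := ⟨a, h4, h5, h7⟩
      have h9 := (S.ar_mem p (Root.reg hp)).2
      have h8' : G.Nx (S.ar p) i := h8
      have h10 := h8'.lt
      refine ⟨p, by omega, by omega, ?_, S.sc_eq _ _ h8'⟩
      rw [h3 _ _ (Or.inl (by omega))]
      exact (ih p (by omega) (by omega)).2 hp

/-- An interval is recognized from the larger interval of which it is a part. That one has the same
left end and a larger right end, or a smaller left end and the same right end. With right ends
reversed, both precede it in the table. -/
theorem usedE_spec {i j : ℕ} (hi : i < n) (hj : j < n) : 0 < (F (r + 1) i (n - 1 - j)).1 ↔ Used S i j := by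
  have hn := h.n_eq
  have rg : ∀ {i}, G.Reg i → i < n := fun h => by rw [← hn]; exact h.1
  obtain ⟨m, hm⟩ : ∃ m, m = i + (n - j) := ⟨_, rfl⟩
  induction m using Nat.strong_induction_on generalizing i j with
  | _ m ih =>
  obtain ⟨t, h1, h2, h3⟩ := hs 1 _ rfl i (n - 1 - j) hi (by omega)
  have e1 : n - 1 - (n - 1 - j) = j := by omega
  rw [h1]
  change Tr _ _ _ _ ↔ _
  simp only [usedE, tr_and, tr_or, tr_ex, tr_lt, tr_eq]
  simp only [Tr, g, arE, spE, revE1, ev, V2_zero, V2_one, up2_zero, up2_one, up2_two, h2 r (by omega), h2 (b + 3) (by omega),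
    h2 (c + 3) (by omega), h2 (c + 2) (by omega), hS.ar, hS.sc, hS.sp, e1, rootE_spec h hc hS hbc hcr hs hi]
  constructor
  · rintro (⟨h4, h5⟩ | ⟨k, hk, ⟨h4, h5⟩, h6, h7⟩ | ⟨k, hk, ⟨h4, h5⟩, h6, h7⟩)
    · exact ⟨i, h4, by rw [h5]⟩
    · rw [h3 _ _ (Or.inr ⟨rfl, by omega⟩)] at h6
      replace h6 := (ih (i + (n - k)) (by omega) hi hk rfl).1 h6
      obtain ⟨p, h8, h9⟩ := h6
      refine ⟨p, h8, h9.tail ?_⟩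
      rw [← h7]
      exact .left i k h4
    · rw [h3 _ _ (Or.inl h4)] at h6
      replace h6 := (ih (k + (n - j)) (by omega) hk hj rfl).1 h6
      obtain ⟨p, h8, h9⟩ := h6
      refine ⟨p, h8, h9.tail ?_⟩
      rw [← h7]
      exact .right k j h5
  · rintro ⟨p, h4, h5⟩
    rcases Relation.ReflTransGen.cases_tail h5 with h6 | ⟨⟨x, y⟩, h6, h7⟩
    · simp only [Prod.mk.injEq] at h6
      obtain ⟨rfl, h7⟩ := h6
      exact Or.inl ⟨h4, h7.symm⟩
    · have hu : Used S x y := ⟨p, h4, h6⟩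
      obtain ⟨hx, hy, -⟩ := hu.pairIn
      simp only at hx hy
      have hxn := rg hx.1
      have hyn := rg hy.1
      right
      cases h7 with
      | left _ _ hxy =>
        obtain ⟨s, h8, h9, h10, h11, h12, h13, h14⟩ := S.split hx hy hxy
        refine Or.inl ⟨y, hyn, ⟨hxy, by omega⟩, ?_, rfl⟩
        rw [h3 _ _ (Or.inr ⟨rfl, by omega⟩)]
        exact (ih (i + (n - y)) (by omega) hi hyn rfl).2 hu
      | right _ _ hxy =>
        obtain ⟨s, h8, h9, h10, h11, h12, h13, h14⟩ := S.split hx hy hxy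
        refine Or.inr ⟨x, hxn, ⟨by omega, hxy⟩, ?_, rfl⟩
        rw [h3 _ _ (Or.inl (by omega))]
        exact (ih (x + (n - j)) (by omega) hxn hj rfl).2 hu

/-- An intermediate table: its right end already fixes the row of the edges, so the search over both
ends of an interval is divided into two single loops instead of a nested one. -/
theorem covHE_spec {j u : ℕ} (hj : j < n) (hu : u < n) : 0 < (F (r + 2) j u).1 ↔
    ∃ a, Used S a j ∧ a < j ∧ S.X a ≤ u ∧ u < S.X (S.sc (S.sp a j)) := by
  rw [(hs 2 _ rfl).eq (by simp [covHE, spE, Bel, E.ex, E.fst, E.lt, E.le, E.and, g]; omega) hj hu]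
  change Tr _ _ _ _ ↔ _
  simp only [covHE, tr_and, tr_ex, tr_lt, tr_le]
  simp only [Tr, g, spE, ev, up2_zero, up2_one, up2_two, hS.X, hS.sc, hS.sp]
  constructor
  · rintro ⟨a, ha, h1, h2, h3, h4⟩
    exact ⟨a, (usedE_spec h hc hS hbc hcr hs ha hj).1 h2, h1, h3, h4⟩
  · rintro ⟨a, h1, h2, h3, h4⟩
    have ha : a < n := by omega
    exact ⟨a, ha, h2, (usedE_spec h hc hS hbc hcr hs ha hj).2 h1, h3, h4⟩

theorem covVE_spec {i l : ℕ} (hi : i < n) (hl : l < n) : 0 < (F (r + 3) i l).1 ↔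
    ∃ j, Used S i j ∧ i < j ∧ S.ρ j ≤ l ∧ l < S.ρ (S.sp i j) := by
  rw [(hs 3 _ rfl).eq (by simp [covVE, spE, Bel, E.ex, E.fst, E.lt, E.le, E.and, g]; omega) hi hl]
  change Tr _ _ _ _ ↔ _
  simp only [covVE, tr_and, tr_ex, tr_lt, tr_le]
  simp only [Tr, g, spE, ev, up2_zero, up2_one, up2_two, hS.ρ, hS.sp]
  constructor
  · rintro ⟨a, ha, h1, h2, h3, h4⟩
    exact ⟨a, (usedE_spec h hc hS hbc hcr hs hi ha).1 h2, h1, h3, h4⟩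
  · rintro ⟨a, h1, h2, h3, h4⟩
    have ha : a < n := by rw [← h.n_eq]; exact h1.pairIn.2.1.1.1
    exact ⟨a, ha, h2, (usedE_spec h hc hS hbc hcr hs hi ha).2 h1, h3, h4⟩

include hτ hπ hσ hec

theorem markHE_spec {u l : ℕ} (hu : u < n) (hl : l < n) : 0 < (F (r + 4) u l).1 ↔ DE S (true, u, l) := by
  have hn := h.n_eq
  have rg : ∀ {i}, G.Reg i → i < n := fun h => by rw [← hn]; exact h.1
  rw [(hs 4 _ rfl).eq (by simp [markHE, upE, arE, Bel, E.ex, E.fst, E.lt, E.le, E.eq, E.or, E.and, g]; omega) hu hl]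
  change Tr _ _ _ _ ↔ _
  have up : ∀ {b}, b < n → G.π b = l + 1 → (F d.σ (l + 1) 0).1 = b := fun hb hl => by
    rw [h.σ _ (by rw [← hl, ← hn]; exact G.π_lt _ (by omega)), ← hl, G.σπ _ (by omega)]
  simp only [markHE, tr_and, tr_or, tr_ex, tr_lt, tr_le, tr_eq]
  simp only [Tr, g, upE, arE, ev, V2_zero, V2_one, up2_zero, up2_one, up2_two, hS.ρ, hS.ar]
  constructor
  · rintro (⟨k, hk, h1, h2⟩ | ⟨k, hk, h1, h2, h3, h4⟩ | ⟨h1, h2⟩)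
    · obtain ⟨a, h3, h4, h5, h6⟩ := (covHE_spec h hc hS hbc hcr hs hk hu).1 h2
      exact Or.inl ⟨a, k, h3, h4, Finset.mem_union_right _ (mem_hseg.2 ⟨rfl, h5, h6, h1.symm⟩)⟩
    · refine Or.inr (Or.inl ⟨k, (rootE_spec h hc hS hbc hcr hs hk).1 h1, mem_hseg.2 ⟨rfl, ?_, ?_, h2.symm⟩⟩)
      · rw [← hc.lc k hk]; exact h3
      · rw [← hS.X]; exact h4
    · rw [h.σ _ h1] at h2
      have hj : G.σ (l + 1) < n := by rw [← hn]; exact G.σ_lt _ (by omega)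
      have hπj := G.πσ (l + 1) (by omega)
      rw [hτ _ hj, hc.reg _ hj, hS.pr, hc.lc _ hj, hc.ld _ hj, h.π _ hj] at h2
      rcases h2 with ⟨⟨h2, h3⟩, h4, h5⟩ | ⟨⟨h2, h3⟩, h4, h5⟩
      · refine Or.inr (Or.inr (Or.inl ⟨_, h2, ?_⟩))
        unfold Ex
        have hm : (true, u, l) ∈ hseg (S.pr (G.σ (l + 1))) (G.σ (l + 1)) (G.π (G.σ (l + 1)) - 1) :=
          mem_hseg.2 ⟨rfl, h4, h5, by simp [hπj]⟩
        rcases h3 with h3 | h3 <;> simp only [h3]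
        · exact Finset.mem_union_left _ hm
        · exact Finset.mem_union_left _ hm
      · refine Or.inr (Or.inr (Or.inr ⟨G.σ (l + 1), ⟨by omega, h4, by omega, by omega⟩, ?_⟩))
        unfold Spc
        rw [if_pos ⟨by omega, h5⟩, Finset.mem_singleton, h3, hπj]
        rfl
  · rintro (⟨a, k, h1, h2, h3⟩ | ⟨k, h1, h2⟩ | ⟨j, h1, h2⟩ | ⟨j, h1, h2⟩)
    · rcases Finset.mem_union.1 h3 with h4 | h4
      · simp at h4
      · obtain ⟨-, h5, h6, h7⟩ := mem_hseg.1 h4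
        have hk : k < n := rg h1.pairIn.2.1.1
        exact Or.inl ⟨k, hk, h7.symm, (covHE_spec h hc hS hbc hcr hs hk hu).2 ⟨a, h1, h2, h5, h6⟩⟩
    · obtain ⟨-, h5, h6, h7⟩ := mem_hseg.1 h2
      have hk := rg (Root.reg h1)
      refine Or.inr (Or.inl ⟨k, hk, (rootE_spec h hc hS hbc hcr hs hk).2 h1, h7.symm, ?_, ?_⟩)
      · rw [hc.lc k hk]; exact h5
      · rw [hS.X]; exact h6
    · have hj := rg h1
      have h3 : (τ j = 3 ∨ τ j = 6) ∧ S.pr j ≤ u ∧ u < j ∧ l = G.π j - 1 := by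
        unfold Ex at h2
        split_ifs at h2 <;> simp at h2 <;> tauto
      have h4 := h1.2.2.2
      have h5 : G.π j = l + 1 := by omega
      have h6 := G.π_lt j h1.1
      refine Or.inr (Or.inr ⟨by omega, Or.inl ?_⟩)
      rw [up hj h5, hτ j hj, hc.reg j hj, hS.pr]
      exact ⟨⟨h1, h3.1⟩, h3.2.1, h3.2.2.1⟩
    · have hj : j < n := by rw [← hn]; exact h1.1
      unfold Spc at h2
      split_ifs at h2 with h3
      · simp at h2
        have h5 : G.π j = l + 1 := by omega
        have h6 := G.π_lt j h1.1
        refine Or.inr (Or.inr ⟨by omega, Or.inr ?_⟩)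
        rw [up hj h5, hc.lc j hj, hc.ld j hj, h.π j hj]
        exact ⟨⟨by omega, h2.1.symm⟩, h1.2.1, h3.2⟩
      · simp at h2

theorem markVE_spec {u l : ℕ} (hu : u < n) (hl : l < n) :
    0 < (F (r + 5) u l).1 ↔ DE S (false, u, l) ∨ Rung G (false, u, l) := by
  have hn := h.n_eq
  have rg : ∀ {i}, G.Reg i → i < n := fun h => by rw [← hn]; exact h.1
  rw [(hs 5 _ rfl).eq (by simp [markVE, upE, Bel, E.ex, E.fst, E.lt, E.le, E.eq, E.or, E.and, g]; omega) hu hl]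
  change Tr _ _ _ _ ↔ _
  have up : ∀ {b}, b < n → G.π b = l + 1 → (F d.σ (l + 1) 0).1 = b := fun hb hl => by
    rw [h.σ _ (by rw [← hl, ← hn]; exact G.π_lt _ (by omega)), ← hl, G.σπ _ (by omega)]
  simp only [markVE, tr_and, tr_or, tr_ex, tr_lt, tr_le, tr_eq]
  simp only [Tr, g, upE, ev, V2_zero, V2_one, up2_zero, up2_one, up2_two, hS.X, hc.lc u hu, hc.ld u hu, h.π u hu]
  refine or_congr ⟨?_, ?_⟩ ⟨?_, ?_⟩
  · rintro (⟨k, hk, h1, h2⟩ | ⟨h1, h2⟩)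
    · obtain ⟨a, h3, h4, h5, h6⟩ := (covVE_spec h hc hS hbc hcr hs hk hl).1 h2
      exact Or.inl ⟨k, a, h3, h4, Finset.mem_union_left _ (mem_vseg.2 ⟨rfl, h5, h6, h1.symm⟩)⟩
    · rw [h.σ _ h1] at h2
      have hj : G.σ (l + 1) < n := by rw [← hn]; exact G.σ_lt _ (by omega)
      have hπj := G.πσ (l + 1) (by omega)
      rw [hτ _ hj, hc.reg _ hj, hS.pr, hS.pr] at h2
      obtain ⟨h2, h3⟩ := h2
      refine Or.inr (Or.inr (Or.inl ⟨_, h2, ?_⟩))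
      have hm : ∀ p, p = u → (false, u, l) ∈ vseg p (G.π (G.σ (l + 1)) - 1) (G.π (G.σ (l + 1))) := fun p hp =>
        mem_vseg.2 ⟨rfl, by simp [hπj], by simp [hπj], hp.symm⟩
      unfold Ex
      rcases h3 with ⟨h3 | h3 | h3, h4⟩ | ⟨h3, h4⟩ <;> simp only [h3]
      · exact Finset.mem_union_right _ (hm _ h4)
      · exact hm _ h4
      · exact Finset.mem_union_right _ (Finset.mem_union_left _ (hm _ h4))
      · exact Finset.mem_union_right _ (Finset.mem_union_right _ (hm _ h4))
  · rintro (⟨a, k, h1, h2, h3⟩ | ⟨k, h1, h2⟩ | ⟨j, h1, h2⟩ | ⟨j, h1, h2⟩)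
    · rcases Finset.mem_union.1 h3 with h4 | h4
      · obtain ⟨-, h5, h6, h7⟩ := mem_vseg.1 h4
        have ha : a < n := rg h1.pairIn.1.1
        exact Or.inl ⟨a, ha, h7.symm, (covVE_spec h hc hS hbc hcr hs ha hl).2 ⟨k, h1, h2, h5, h6⟩⟩
      · simp at h4
    · simp [Exit] at h2
    · have hj := rg h1
      have h4 := h1.2.2.2
      have h3 : ((τ j = 3 ∨ τ j = 5 ∨ τ j = 6) ∧ S.pr j = u ∨ τ j = 6 ∧ S.pr (S.pr j) = u) ∧ G.π j = l + 1 := by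
        unfold Ex at h2
        split_ifs at h2 with h6 h7 h8 <;> simp at h2 <;> refine ⟨?_, by omega⟩
        · exact Or.inl ⟨Or.inl h6, h2.2.2.symm⟩
        · exact Or.inl ⟨Or.inr (Or.inl h7), h2.2.2.symm⟩
        · rcases h2 with h2 | h2
          · exact Or.inl ⟨Or.inr (Or.inr h8), h2.2.2.symm⟩
          · exact Or.inr ⟨h8, h2.2.2.symm⟩
      have h6 := G.π_lt j h1.1
      refine Or.inr ⟨by omega, ?_⟩
      rw [up hj h3.2, hτ j hj, hc.reg j hj, hS.pr, hS.pr]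
      exact ⟨h1, h3.1⟩
    · unfold Spc at h2
      split_ifs at h2 <;> simp at h2
  · rintro ⟨⟨h1, h2⟩, h3, h4⟩
    exact ⟨u, ⟨by omega, h1, h2, by omega⟩, h3, by rw [h4]⟩
  · rintro ⟨j, h1, h2, h3⟩
    simp only [Prod.mk.injEq, true_and] at h3
    obtain ⟨rfl, rfl⟩ := h3
    exact ⟨⟨h1.2.1, h1.2.2.1⟩, h2, rfl⟩

end

/-! ### Sorting the terminals, and the tables of the reflected frames -/

open E BDMMN.Frame

/-- Sorting of the reals in the first row of the table `R`: the terminal that follows the previous one. -/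
def sortE (R T : ℕ) : E := .amin 2 (.or (.eq (.var 0) (.cst 0))
  (.ltR (.get R (.cst 0) (.g T (.sub (.var 0) (.cst 1)))) (.get R (.cst 0) (.var 2)) (.cst 1) (.cst 0)))
  (.get R (.cst 0) (.var 2))

/-- Entry `i` selects the least coordinate that exceeds the previous one. As the coordinates are
distinct, induction gives the sorted order. -/
theorem sortE_spec {n R T : ℕ} {F : Tab} {x : Fin n → ℝ} (hx : Function.Injective x)
    (hF : ∀ i : Fin n, (F R 0 i).2 = x i) (hRT : R < T) (hs : Sat n F T (sortE R T)) (i : Fin n) :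
    (F T i 0).1 = Tuple.sort x i ∧ (F T i 0).2 = x (Tuple.sort x i) := by
  have hm : StrictMono (x ∘ Tuple.sort x) :=
    (Tuple.monotone_sort x).strictMono_of_injective (hx.comp (Tuple.sort x).injective)
  obtain ⟨i, hi⟩ := i
  induction i using Nat.strong_induction_on with
  | _ i ih =>
  obtain ⟨t, h1, h2, h3⟩ := hs i 0 hi (by omega)
  have key : ∀ k : Fin n, Tr n t (Function.update (V2 i 0) 2 k) (.or (.eq (.var 0) (.cst 0))
      (.ltR (.get R (.cst 0) (.g T (.sub (.var 0) (.cst 1)))) (.get R (.cst 0) (.var 2)) (.cst 1) (.cst 0))) ↔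
      x (Tuple.sort x ⟨i, hi⟩) ≤ x k := by
    intro k
    rw [tr_or, tr_eq]
    simp only [Tr, g, ev, up2_zero, up2_two, h2 R hRT, hF k]
    obtain ⟨m, rfl⟩ := (Tuple.sort x).surjective k
    rw [show (x (Tuple.sort x ⟨i, hi⟩) ≤ x (Tuple.sort x m)) ↔ i ≤ m from hm.le_iff_le]
    by_cases h0 : i = 0
    · simp [h0]
    · have h4 := (ih (i - 1) (by omega) (by omega)).1
      have h5 : (x (Tuple.sort x ⟨i - 1, by omega⟩) < x (Tuple.sort x m)) ↔ i - 1 < m := hm.lt_iff_lt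
      rw [h3 (i - 1) 0 (Or.inl (by omega)), h4, hF]
      simp only [h5]
      split_ifs <;> simp <;> omega
  rw [h1]
  unfold sortE
  have hv := E.amin_ev (n := n) (L := 2) (t := t) (V := V2 i 0) (c := .or (.eq (.var 0) (.cst 0))
      (.ltR (.get R (.cst 0) (.g T (.sub (.var 0) (.cst 1)))) (.get R (.cst 0) (.var 2)) (.cst 1) (.cst 0)))
      (v := .get R (.cst 0) (.var 2))
  generalize E.ev n t (.amin 2 _ _) (V2 i 0) = v at hv ⊢
  obtain ⟨k, r⟩ := v
  rcases hv with ⟨-, h5⟩ | ⟨h4, h5, h6, h7⟩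
  · exact absurd ((key _).2 le_rfl) (h5 _ (Tuple.sort x ⟨i, hi⟩).2)
  · lift k to Fin n using h4
    have h8 := h7 _ (Tuple.sort x ⟨i, hi⟩).2 ((key _).2 le_rfl)
    have h9 := (key k).1 h5
    simp only [ev, up2_two, h2 R hRT, hF] at h6 h8
    rw [h6] at h8
    obtain rfl := hx (le_antisymm h8 h9)
    exact ⟨rfl, h6⟩

/-- The frame of a sequence of terminals. -/
noncomputable def frameOf {n : ℕ} (t : Fin n → Point) (hx : Function.Injective fun i => (t i).1)
    (hy : Function.Injective fun i => (t i).2) : Frame where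
  n := n
  π := fun i => if h : i < n then (Tuple.sort fun i => (t i).2).symm (Tuple.sort (fun i => (t i).1) ⟨i, h⟩) else 0
  σ := fun i => if h : i < n then (Tuple.sort fun i => (t i).1).symm (Tuple.sort (fun i => (t i).2) ⟨i, h⟩) else 0
  xs := fun i => if h : i < n then (t (Tuple.sort (fun i => (t i).1) ⟨i, h⟩)).1 else 0
  ys := fun i => if h : i < n then (t (Tuple.sort (fun i => (t i).2) ⟨i, h⟩)).2 else 0
  π_lt := fun i h => by rw [dif_pos h]; exact Fin.is_lt _
  σ_lt := fun i h => by rw [dif_pos h]; exact Fin.is_lt _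
  σπ := fun i h => by simp [h]
  πσ := fun i h => by simp [h]
  xs_lt := fun i j h h' => by
    rw [dif_pos (h.trans h'), dif_pos h']
    exact ((Tuple.monotone_sort fun i => (t i).1).strictMono_of_injective
      (hx.comp (Equiv.injective _))) (show (⟨i, h.trans h'⟩ : Fin n) < ⟨j, h'⟩ from h)
  ys_lt := fun i j h h' => by
    rw [dif_pos (h.trans h'), dif_pos h']
    exact ((Tuple.monotone_sort fun i => (t i).2).strictMono_of_injective
      (hy.comp (Equiv.injective _))) (show (⟨i, h.trans h'⟩ : Fin n) < ⟨j, h'⟩ from h)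

theorem terms_frameOf {n : ℕ} (t : Fin n → Point) (hx : Function.Injective fun i => (t i).1)
    (hy : Function.Injective fun i => (t i).2) : (frameOf t hx hy).terms = Set.range t := by
  have key : ∀ i (h : i < n), (frameOf t hx hy).pt (i, (frameOf t hx hy).π i) = t (Tuple.sort (fun i => (t i).1) ⟨i, h⟩) := by
    intro i h
    simp [pt, frameOf, h]
  ext p
  constructor
  · rintro ⟨i, hi, rfl⟩
    exact ⟨_, (key i hi).symm⟩
  · rintro ⟨k, rfl⟩
    obtain ⟨⟨i, hi⟩, rfl⟩ := (Tuple.sort fun i => (t i).1).surjective k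
    exact ⟨i, hi, (key i hi).symm⟩

/-- The expressions for the frame of the terminals. -/
def baseP : List E :=
  [sortE 0 2, sortE 1 3, .fst 2 (.eq (.g 3 (.var 2)) (.g 2 (.var 0))), .fst 2 (.eq (.g 2 (.var 2)) (.g 3 (.var 0)))]

theorem fst_inv {n T T' U : ℕ} {F : Tab} {e e' : Equiv.Perm (Fin n)} (he : ∀ i : Fin n, (F T i 0).1 = e i)
    (he' : ∀ i : Fin n, (F T' i 0).1 = e' i) (hT : T < U) (hT' : T' < U)
    (hs : Sat n F U (.fst 2 (.eq (.g T' (.var 2)) (.g T (.var 0))))) (i : Fin n) : (F U i 0).1 = e'.symm (e i) := by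
  rw [hs.eq (by simp [Bel, fst, E.eq, g, hT, hT']) i.2 (by have := i.2; omega)]
  have key : ∀ k : Fin n, Tr n F (Function.update (V2 i 0) 2 k) (.eq (.g T' (.var 2)) (.g T (.var 0))) ↔ k = e'.symm (e i) := by
    intro k
    simp only [tr_eq, g, ev, up2_zero, up2_two, he, he']
    rw [Equiv.eq_symm_apply, Fin.ext_iff]
  rcases fst_spec (n := n) (t := F) (V := V2 i 0) (L := 2) (c := .eq (.g T' (.var 2)) (.g T (.var 0))) with
    ⟨h1, h2⟩ | ⟨h1, h2, -⟩
  · exact absurd ((key _).2 rfl) (h2 _ (Fin.is_lt _))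
  · exact congrArg Fin.val ((key ⟨_, h1⟩).1 h2)

theorem baseP_spec {n : ℕ} {F : Tab} {t : Fin n → Point} (hx : Function.Injective fun i => (t i).1)
    (hy : Function.Injective fun i => (t i).2) (hF : ∀ i : Fin n, (F 0 0 i).2 = (t i).1 ∧ (F 1 0 i).2 = (t i).2)
    (hs : Seg n F 2 baseP) : Holds n F (frameOf t hx hy) ⟨4, 5, 2, 3⟩ := by
  have h1 := sortE_spec hx (fun i => (hF i).1) (by omega) (hs 0 _ rfl)
  have h2 := sortE_spec hy (fun i => (hF i).2) (by omega) (hs 1 _ rfl)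
  have h3 := fst_inv (fun i => (h1 i).1) (fun i => (h2 i).1) (by omega) (by omega) (hs 2 _ rfl)
  have h4 := fst_inv (fun i => (h2 i).1) (fun i => (h1 i).1) (by omega) (by omega) (hs 3 _ rfl)
  refine ⟨rfl, fun i hi => ?_, fun i hi => ?_, fun i hi => ?_, fun i hi => ?_⟩
  · simpa [frameOf, hi] using h3 ⟨i, hi⟩
  · simpa [frameOf, hi] using h4 ⟨i, hi⟩
  · simpa [frameOf, hi] using (h1 ⟨i, hi⟩).2
  · simpa [frameOf, hi] using (h2 ⟨i, hi⟩).2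

/-- Reversal of an index. -/
def mirE (b : Bool) (x : E) : E := if b then .sub (.sub .size (.cst 1)) x else x

/-- Reversal of a sign. -/
def negE (b : Bool) (x : E) : E := if b then .sub (.cst 0) x else x

/-- The expressions for a reflected frame. -/
def flipP (q : Bool × Bool) (d : Ids) : List E :=
  [mirE q.2 (.g d.π (mirE q.1 (.var 0))), mirE q.1 (.g d.σ (mirE q.2 (.var 0))),
    negE q.1 (.g d.xs (mirE q.1 (.var 0))), negE q.2 (.g d.ys (mirE q.2 (.var 0)))]

theorem flipP_spec {n k : ℕ} {F : Tab} {G : Frame} {d : Ids} (q : Bool × Bool) (h : Holds n F G d)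
    (hd : d.π < k ∧ d.σ < k ∧ d.xs < k ∧ d.ys < k) (hs : Seg n F k (flipP q d)) :
    Holds n F (G.fl q) ⟨k, k + 1, k + 2, k + 3⟩ := by
  have hn := h.n_eq
  have h1 := fun i hi => h.π (n - 1 - i) hi
  have h2 := fun i hi => h.σ (n - 1 - i) hi
  have h3 := fun i hi => h.xs (n - 1 - i) hi
  have h4 := fun i hi => h.ys (n - 1 - i) hi
  refine ⟨by rw [fl_n, hn], fun i hi => ?_, fun i hi => ?_, fun i hi => ?_, fun i hi => ?_⟩
  · rw [(show Sat n F k _ from hs 0 _ rfl).eq (by obtain ⟨_ | _, _ | _⟩ := q <;> simp [mirE, Bel, g] <;> omega) hi (by omega)]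
    obtain ⟨_ | _, _ | _⟩ := q <;> simp [mirE, g, ev, V2_zero, fl, flipX, flipY, Frame.T, hn, h.π i hi, h1 i (by omega)]
  · rw [(hs 1 _ rfl).eq (by obtain ⟨_ | _, _ | _⟩ := q <;> simp [mirE, Bel, g] <;> omega) hi (by omega)]
    obtain ⟨_ | _, _ | _⟩ := q <;> simp [mirE, g, ev, V2_zero, fl, flipX, flipY, Frame.T, hn, h.σ i hi, h2 i (by omega)]
  · rw [(hs 2 _ rfl).eq (by obtain ⟨_ | _, _ | _⟩ := q <;> simp [mirE, negE, Bel, g] <;> omega) hi (by omega)]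
    obtain ⟨_ | _, _ | _⟩ := q <;> simp [mirE, negE, g, ev, V2_zero, fl, flipX, flipY, Frame.T, hn, h.xs i hi, h3 i (by omega)]
  · rw [(hs 3 _ rfl).eq (by obtain ⟨_ | _, _ | _⟩ := q <;> simp [mirE, negE, Bel, g] <;> omega) hi (by omega)]
    obtain ⟨_ | _, _ | _⟩ := q <;> simp [mirE, negE, g, ev, V2_zero, fl, flipX, flipY, Frame.T, hn, h.ys i hi, h4 i (by omega)]

/-- The expressions for the trees of one frame; the tables start at `k`, the types of blocks are in the table `e`. -/
def treesP (d : Ids) (b e k : ℕ) : List E := solP d b e k ++ markP d b e k (k + 4)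

theorem treesP_spec {n b e k : ℕ} {F : Tab} {G : Frame} {τ : ℕ → ℕ} {d : Ids} (h : Holds n F G d) (hB : Blocks G τ)
    (hτ : ∀ i, i < n → (F e i 0).1 = τ i) (hd : d.π < b ∧ d.σ < b ∧ d.xs < b ∧ d.ys < b) (hbk : b + 5 ≤ k) (hek : e < k)
    (hc : Chains n F G b) (hs : Seg n F k (treesP d b e k)) : ∃ S : Sol G τ, ∀ u l, u < n → l < n →
      (0 < (F (k + 8) u l).1 ↔ DE S (true, u, l)) ∧
      (0 < (F (k + 9) u l).1 ↔ DE S (false, u, l) ∨ Rung G (false, u, l)) := by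
  obtain ⟨h1, h2⟩ := hs.append
  have hS : SolT F n b k (solOf h hc hB hτ (by omega) (by omega) (by omega) hbk hek h1) :=
    ⟨fun _ => rfl, fun _ => rfl, fun _ => rfl, fun _ => rfl, fun _ _ => rfl, fun _ => rfl⟩
  exact ⟨_, fun u l hu hl => ⟨markHE_spec h hc hS hτ hd.1 hd.2.1 hbk hek le_rfl h2 hu hl,
    markVE_spec h hc hS hτ hd.1 hd.2.1 hbk hek le_rfl h2 hu hl⟩⟩

/-- The expressions for the frame `q` and its transpose; the tables start at `k`. -/
def quadP (q : Bool × Bool) (d : Ids) (k : ℕ) : List E :=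
  let d' : Ids := ⟨k, k + 1, k + 2, k + 3⟩
  flipP q d ++ (chainP d' (k + 4) ++ (typeP d' (k + 4) (k + 9) ++ (treesP d' (k + 4) (k + 10) (k + 11) ++
    (chainP d'.T (k + 21) ++ ([typeTP d' (k + 10)] ++ treesP d'.T (k + 21) (k + 26) (k + 27))))))

/-- The offsets are partial sums of the lengths `4`, `5`, `2`, `10`, `5`, `1`, `10` of the lists;
their total `37` is the stride in `quadT`. -/
theorem quadP_spec {n k : ℕ} {F : Tab} {G : Frame} {d : Ids} (q : Bool × Bool) (h : Holds n F G d)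
    (hd : d.π < k ∧ d.σ < k ∧ d.xs < k ∧ d.ys < k) (hs : Seg n F k (quadP q d k)) :
    ∃ (τ : ℕ → ℕ) (S : Sol (G.fl q) τ) (S' : Sol (G.fl q).T (tyT (G.fl q) τ)), Blocks (G.fl q) τ ∧
      ∀ u l, u < n → l < n → (0 < (F (k + 19) u l).1 ↔ DE S (true, u, l)) ∧
        (0 < (F (k + 20) u l).1 ↔ DE S (false, u, l) ∨ Rung (G.fl q) (false, u, l)) ∧
        (0 < (F (k + 35) u l).1 ↔ DE S' (true, u, l)) ∧
        (0 < (F (k + 36) u l).1 ↔ DE S' (false, u, l) ∨ Rung (G.fl q).T (false, u, l)) := by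
  obtain ⟨s1, hs⟩ := hs.append
  obtain ⟨s2, hs⟩ := hs.append
  obtain ⟨s3, hs⟩ := hs.append
  obtain ⟨s4, hs⟩ := hs.append
  obtain ⟨s5, hs⟩ := hs.append
  obtain ⟨s6, s7⟩ := hs.append
  replace s4 : Seg n F (k + 11) _ := s4
  replace s6 : Seg n F (k + 26) _ := s6
  replace s7 : Seg n F (k + 27) _ := s7
  have h1 := flipP_spec q h hd s1
  have c1 := chainP_spec h1 (b := k + 4) (by simp only; omega) (by simp only; omega) s2
  have hB := typeP_spec h1 c1 (c := k + 9) (by simp only; omega) (by omega) s3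
  obtain ⟨S, hS⟩ := treesP_spec h1 hB (fun _ _ => rfl) (by simp only; omega) (by omega) (by omega) c1 s4
  have c2 := chainP_spec h1.T (b := k + 21) (by simp only [Ids.T]; omega) (by simp only [Ids.T]; omega) s5
  obtain ⟨S', hS'⟩ := treesP_spec h1.T hB.T (e := k + 26) (fun i hi => typeTP_spec h1 (by simp only; omega) (by omega)
    (s6 0 _ rfl) hi) (by simp only [Ids.T]; omega) (by omega) (by omega) c2 s7
  exact ⟨_, S, S', hB, fun u l hu hl => ⟨(hS u l hu hl).1, (hS u l hu hl).2, (hS' u l hu hl).1, (hS' u l hu hl).2⟩⟩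

/-! ### The table of orientations and the output -/

open E BDMMN.Frame

/-- The first table of a reflected frame. -/
def quadT (q : Bool × Bool) : ℕ := 6 + 37 * (2 * q.1.toNat + q.2.toNat)

/-- A test for each reflected frame. -/
def anyE (f : Bool × Bool → E) : E := .or (.or (f (false, false)) (f (false, true))) (.or (f (true, false)) (f (true, true)))

theorem tr_any {n : ℕ} {t : Tab} {V : ℕ → ℕ} {f : Bool × Bool → E} : Tr n t V (anyE f) ↔ ∃ q, Tr n t V (f q) := by
  simp only [anyE, tr_or, Prod.exists, Bool.exists_bool]

/-- The column of a reflected edge. -/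
def colQ (κ : Bool) (q : Bool × Bool) : E := if q.1 then .sub (.sub .size (.cst (if κ then 2 else 1))) (.var 0) else .var 0

/-- The row of a reflected edge. -/
def rowQ (κ : Bool) (q : Bool × Bool) : E := if q.2 then .sub (.sub .size (.cst (if κ then 1 else 2))) (.var 1) else .var 1

/-- A test whether the edge belongs to the trees of a frame. -/
def treeQ (κ : Bool) (q : Bool × Bool) : E := .or (.get (quadT q + (if κ then 19 else 20)) (colQ κ q) (rowQ κ q))
  (.get (quadT q + (if κ then 36 else 35)) (rowQ κ q) (colQ κ q))

/-- A test whether the edge is directed against the standard orientation by a frame. -/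
def flQ (κ : Bool) (q : Bool × Bool) : E := if κ then .get (quadT q + 19) (colQ κ q) (rowQ κ q)
  else .get (quadT q + 35) (rowQ κ q) (colQ κ q)

/-- A test for the edges of the boundaries of rectangles. -/
def fvE (d : Ids) (u l : E) : E :=
  .and (.lt (.add l (.cst 1)) .size) (.or
    (.and (.lt (.add u (.cst 1)) .size) (.and (.or (.le (.g d.π u) l) (.le (.g d.π (.add u (.cst 1))) l))
      (.or (.lt l (.g d.π u)) (.lt l (.g d.π (.add u (.cst 1)))))))
    (.or (.and (.le (.cst 1) u) (.and (.or (.le (.g d.π (.sub u (.cst 1))) l) (.le (.g d.π u) l))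
      (.or (.lt l (.g d.π (.sub u (.cst 1)))) (.lt l (.g d.π u)))))
    (.or (.eq (.g d.π u) l) (.eq (.g d.π u) (.add l (.cst 1))))))

theorem fvE_spec {n : ℕ} {F : Tab} {G : Frame} {d : Ids} (h : Holds n F G d) {V : ℕ → ℕ} {u l : E}
    (hu : (u.ev n F V).1 < n) : Tr n F V (fvE d u l) ↔ FV G (u.ev n F V).1 (l.ev n F V).1 := by
  have hn := h.n_eq
  simp only [fvE, tr_and, tr_or, tr_le, tr_lt, tr_eq, FV, Frame.Btw, min_le_iff, lt_max_iff]
  simp only [g, ev, h.π _ hu, h.π ((u.ev n F V).1 - 1) (by omega), hn, hu, true_and]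
  refine and_congr_right fun _ => or_congr (and_congr_right fun h1 => ?_) Iff.rfl
  rw [h.π _ h1]

/-- A test for the standard orientation. -/
def oposE (κ : Bool) (d : Ids) : E := if κ then .le (.g d.σ (.var 1)) (.var 0) else .lt (.var 1) (.g d.π (.var 0))

/-- The column of the second end of an edge. -/
def endX (κ : Bool) : E := if κ then .add (.var 0) (.cst 1) else .var 0

/-- The row of the second end of an edge. -/
def endY (κ : Bool) : E := if κ then .var 1 else .add (.var 1) (.cst 1)

/-- The orientation of an edge: `0` for edges that are not in the network. -/
def dirE (κ : Bool) (d : Ids) : E :=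
  .ite (.and (.and (.lt (endX κ) .size) (.lt (endY κ) .size))
      (.or (if κ then fvE d.T (.var 1) (.var 0) else fvE d (.var 0) (.var 1)) (anyE (treeQ κ))))
    (.ite (oposE κ d) (.ite (anyE (flQ κ)) (.cst 2) (.cst 1)) (.ite (anyE (flQ κ)) (.cst 1) (.cst 2))) (.cst 0)

/-- The tables of the terminals. -/
def ids : Ids := ⟨4, 5, 2, 3⟩

/-- All tables. -/
def tablesP : List E := baseP ++ (quadP (false, false) ids 6 ++ (quadP (false, true) ids 43 ++
  (quadP (true, false) ids 80 ++ (quadP (true, true) ids 117 ++ [dirE true ids, dirE false ids]))))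

/-- The table of the orientations. -/
def dirT (κ : Bool) : ℕ := if κ then 154 else 155

/-- A choice according to the orientation. -/
def selE (κ : Bool) (a b c : E) : E :=
  .ite (.eq (.get (dirT κ) (.var 0) (.var 1)) (.cst 1)) a (.ite (.eq (.get (dirT κ) (.var 0) (.var 1)) (.cst 2)) b c)

/-- The coordinates of an arc. -/
def arcP (κ : Bool) : List E :=
  [selE κ (.g 2 (.var 0)) (.g 2 (endX κ)) (.g 2 (.cst 0)), selE κ (.g 3 (.var 1)) (.g 3 (endY κ)) (.g 3 (.g 4 (.cst 0))),
   selE κ (.g 2 (endX κ)) (.g 2 (.var 0)) (.g 2 (.cst 1)), selE κ (.g 3 (endY κ)) (.g 3 (.var 1)) (.g 3 (.g 4 (.cst 0)))]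

/-- The program of the approximation algorithm. -/
def approxP : Prog := machine tablesP (arcP true ++ arcP false)

theorem approxP_cost : ∃ C, ∀ n, n * 50 + 50 + (costAll n tablesP +
    (n * (n * (costL n (arcP true ++ arcP false) + 5) + 5) + 10)) ≤ C * (n + 1) ^ 3 := by
  refine machine_cost (fun e he => ?_) (fun e he => ?_)
  · exact List.all_eq_true.1 (show tablesP.all E.lin = true by decide +kernel) e he
  · exact List.all_eq_true.1 (show (arcP true ++ arcP false).all E.lin = true by decide +kernel) e he

theorem dirE_bel (κ : Bool) : (dirE κ ids).Bel (dirT κ) := by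
  cases κ <;> simp [dirE, dirT, E.ite, E.and, E.or, E.eq, E.lt, E.le, E.g, Bel, endX, endY, fvE, anyE, treeQ, flQ, colQ, rowQ,
    quadT, oposE, ids, Ids.T]

theorem colQ_rowQ {n u l : ℕ} {F : Tab} {κ : Bool} {q : Bool × Bool} :
    mE n q (κ, u, l) = (κ, ((colQ κ q).ev n F (V2 u l)).1, ((rowQ κ q).ev n F (V2 u l)).1) := by
  obtain ⟨_ | _, _ | _⟩ := q <;> cases κ <;> simp [mE, eX, eY, eT, colQ, rowQ, ev, V2_zero, V2_one]

section

variable {n : ℕ} {F : Tab} {G : Frame} {τ : Bool × Bool → ℕ → ℕ} {S : ∀ q, Sol (G.fl q) (τ q)}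
  {S' : ∀ q, Sol (G.fl q).T (tyT (G.fl q) (τ q))} (h : Holds n F G ids)
  (hT : ∀ q u l, u < n → l < n → (0 < (F (quadT q + 19) u l).1 ↔ DE (S q) (true, u, l)) ∧
    (0 < (F (quadT q + 20) u l).1 ↔ DE (S q) (false, u, l) ∨ Rung (G.fl q) (false, u, l)) ∧
    (0 < (F (quadT q + 35) u l).1 ↔ DE (S' q) (true, u, l)) ∧
    (0 < (F (quadT q + 36) u l).1 ↔ DE (S' q) (false, u, l) ∨ Rung (G.fl q).T (false, u, l)))

include h hT

theorem treeQ_spec {κ : Bool} {q : Bool × Bool} {u l : ℕ} (he : (κ, u, l) ∈ gridE n) :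
    (Tr n F (V2 u l) (treeQ κ q) ↔ AlgQ (S q) (S' q) (mE G.n q (κ, u, l))) ∧
    (Tr n F (V2 u l) (flQ κ q) ↔ FlQ (S q) (S' q) (mE G.n q (κ, u, l))) := by
  have h1 := mE_grid (q := q) he
  rw [colQ_rowQ (F := F)] at h1
  rw [h.n_eq, colQ_rowQ (F := F)]
  obtain ⟨h2, h3, -⟩ := mem_gridE.1 h1
  simp only at h2 h3
  obtain ⟨a1, a2, -, -⟩ := hT q _ _ h2 h3
  obtain ⟨-, -, a3, a4⟩ := hT q _ _ h3 h2
  have r : ∀ {G : Frame} {u l}, ¬ Rung G (true, u, l) := fun ⟨j, _, _, h⟩ => by simp at h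
  rw [treeQ, tr_or]
  cases κ
  · simp [Tr, ev, flQ, AlgQ, FlQ, eT, a2, a3, r]
  · simp [Tr, ev, flQ, AlgQ, FlQ, eT, a1, a4, r]

theorem dirE_spec {κ : Bool} {u l : ℕ} (hu : u < n) (hl : l < n) (hs : Sat n F (dirT κ) (dirE κ ids)) :
    (((κ, u, l) ∈ AlgE G S S' ∧ (Opos G (κ, u, l) ↔ ¬ FlE S S' (κ, u, l))) ∧ (F (dirT κ) u l).1 = 1) ∨
    (((κ, u, l) ∈ AlgE G S S' ∧ ¬ (Opos G (κ, u, l) ↔ ¬ FlE S S' (κ, u, l))) ∧ (F (dirT κ) u l).1 = 2) ∨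
    ((κ, u, l) ∉ AlgE G S S' ∧ (F (dirT κ) u l).1 = 0) := by
  classical
  have hn := h.n_eq
  rw [hs.eq (dirE_bel κ) hu hl]
  have hg : ((Tr n F (V2 u l) (.lt (endX κ) .size)) ∧ Tr n F (V2 u l) (.lt (endY κ) .size)) ↔ (κ, u, l) ∈ gridE n := by
    rw [mem_gridE, tr_lt, tr_lt]
    cases κ <;> simp [endX, endY, ev, V2_zero, V2_one, hu, hl]
  have ho : Tr n F (V2 u l) (oposE κ ids) ↔ Opos G (κ, u, l) := by
    cases κ
    · simp [oposE, tr_lt, g, ev, V2_zero, V2_one, Opos, h.π u hu]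
    · simp [oposE, tr_le, g, ev, V2_zero, V2_one, Opos, h.σ l hl]
  have hf : Tr n F (V2 u l) (if κ then fvE ids.T (.var 1) (.var 0) else fvE ids (.var 0) (.var 1)) ↔ InF G (κ, u, l) := by
    cases κ
    · exact fvE_spec h hu
    · exact fvE_spec h.T hl
  have ha : Tr n F (V2 u l) (.and (.and (.lt (endX κ) .size) (.lt (endY κ) .size))
      (.or (if κ then fvE ids.T (.var 1) (.var 0) else fvE ids (.var 0) (.var 1)) (anyE (treeQ κ)))) ↔
      (κ, u, l) ∈ AlgE G S S' := by
    rw [tr_and, tr_and, hg, tr_or, hf, tr_any, AlgE, Finset.mem_filter, hn]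
    refine and_congr_right fun he => or_congr Iff.rfl (exists_congr fun q => ?_)
    rw [(treeQ_spec h hT he).1, hn]
  unfold dirE
  rw [ev_ite, if_congr ha rfl rfl]
  by_cases he : (κ, u, l) ∈ AlgE G S S'
  · have hf : Tr n F (V2 u l) (anyE (flQ κ)) ↔ FlE S S' (κ, u, l) := by
      rw [tr_any]
      refine exists_congr fun q => (treeQ_spec h hT ?_).2
      rw [← hn]; exact (Finset.mem_filter.1 he).1
    simp only [ev_ite, ho, hf, he, true_and]
    by_cases h1 : Opos G (κ, u, l) <;> by_cases h2 : FlE S S' (κ, u, l) <;> simp [h1, h2, ev]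
  · exact Or.inr (Or.inr ⟨he, by rw [if_neg he]; rfl⟩)

/-- The arcs that the program writes. -/
theorem arcs_output (hB : ∀ q, Blocks (G.fl q) (τ q)) (hs : ∀ κ, Sat n F (dirT κ) (dirE κ ids)) {s : State}
    (h0 : s.nreg 0 = if 1 < n then 2 * (n * n) else 0)
    (hm : ∀ i j, i < n → j < n → ∀ k e, (arcP true ++ arcP false)[k]? = some e →
      s.rmem (8 * (i * n + j) + k) = (e.ev n F (V2 i j)).2) : G.Arcs (output s) (AlgA S S') := by
  classical
  have hn := h.n_eq
  have grid : ∀ {e}, e ∈ AlgE G S S' → e ∈ gridE n := fun he => by rw [← hn]; exact (Finset.mem_filter.1 he).1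
  have arc : ∀ κ u l, u < n → l < n → 1 < n →
      ∃ a b, ((((s.rmem (4 * (2 * (u * n + l) + (!κ).toNat)), s.rmem (4 * (2 * (u * n + l) + (!κ).toNat) + 1)),
        (s.rmem (4 * (2 * (u * n + l) + (!κ).toNat) + 2), s.rmem (4 * (2 * (u * n + l) + (!κ).toNat) + 3))) : Arc) =
          (G.pt a, G.pt b)) ∧ AlgA S S' a b ∧ ((κ, u, l) ∈ AlgE G S S' →
            ((Opos G (κ, u, l) ↔ ¬ FlE S S' (κ, u, l)) ∧ a = (u, l) ∧ b = end2 (κ, u, l)) ∨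
            (¬ (Opos G (κ, u, l) ↔ ¬ FlE S S' (κ, u, l)) ∧ b = (u, l) ∧ a = end2 (κ, u, l))) := by
    intro κ u l hu hl h1
    have hπ := G.π_lt 0 (by omega)
    have m : ∀ r e, (arcP κ)[r]? = some e → s.rmem (4 * (2 * (u * n + l) + (!κ).toNat) + r) = (e.ev n F (V2 u l)).2 := by
      intro r e he
      have hr := (List.getElem?_eq_some_iff.1 he).1
      have hr4 : r < 4 := hr
      rw [← hm u l hu hl (4 * (!κ).toNat + r) e ?_]
      · congr 1; ring
      · cases κ
        · rw [List.getElem?_append_right (by simp [arcP])]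
          simpa [arcP] using he
        · rw [List.getElem?_append_left (by simpa using hr)]
          simpa using he
    have e2 : (κ, u, l) ∈ gridE n → ((endX κ).ev n F (V2 u l)).1 = (end2 (κ, u, l)).1 ∧
        ((endY κ).ev n F (V2 u l)).1 = (end2 (κ, u, l)).2 ∧ (end2 (κ, u, l)).1 < n ∧ (end2 (κ, u, l)).2 < n := by
      intro he
      have := (gridE_end he).2
      cases κ <;> exact ⟨rfl, rfl, this⟩
    have m0 := m 0 _ rfl
    have m1 := m 1 _ rfl
    have m2 := m 2 _ rfl
    have m3 := m 3 _ rfl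
    rw [add_zero] at m0
    rw [m0, m1, m2, m3]
    simp only [selE, ev_ite, tr_eq]
    simp only [g, ev, V2_zero, V2_one]
    rcases dirE_spec h hT hu hl (hs κ) with ⟨⟨h2, h3⟩, h4⟩ | ⟨⟨h2, h3⟩, h4⟩ | ⟨h2, h4⟩
    · obtain ⟨k1, k2, k3, k4⟩ := e2 (grid h2)
      refine ⟨(u, l), end2 (κ, u, l), ?_, AlgA_cases.2 ⟨_, h2, Or.inl ⟨h3, rfl, rfl⟩⟩, fun _ => Or.inl ⟨h3, rfl, rfl⟩⟩
      simp only [h4, if_true, k1, k2]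
      exact Prod.ext (Prod.ext (h.xs u hu) (h.ys l hl)) (Prod.ext (h.xs _ k3) (h.ys _ k4))
    · obtain ⟨k1, k2, k3, k4⟩ := e2 (grid h2)
      refine ⟨end2 (κ, u, l), (u, l), ?_, AlgA_cases.2 ⟨_, h2, Or.inr ⟨h3, rfl, rfl⟩⟩, fun _ => Or.inr ⟨h3, rfl, rfl⟩⟩
      simp only [h4, if_true, k1, k2, show ¬ (2 = 1) by omega, if_false]
      exact Prod.ext (Prod.ext (h.xs _ k3) (h.ys _ k4)) (Prod.ext (h.xs u hu) (h.ys l hl))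
    -- For an absent edge the program writes the arc that leaves the first terminal to the right. It
    -- belongs to F and hence to the network, so the set of arcs does not change.
    · have hg : (true, 0, G.π 0) ∈ gridE G.n := mem_gridE.2 ⟨by simp only; omega, by simpa using hπ, by simp; omega⟩
      have hF : InF G (true, 0, G.π 0) := ⟨hπ, show 0 + 1 < G.n by omega, Or.inr (Or.inr (Or.inl (G.σπ 0 (by omega))))⟩
      refine ⟨(0, G.π 0), (1, G.π 0), ?_, AlgA_cases.2 ⟨(true, 0, G.π 0), Finset.mem_filter.2 ⟨hg, Or.inl hF⟩,
        Or.inl ⟨?_, rfl, rfl⟩⟩, fun h => absurd h h2⟩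
      · have k1 := h.π 0 (by omega)
        have k2 := h.ys (G.π 0) (by omega)
        simp only [ids] at k1 k2
        simp only [h4, show ¬ (0 = 1) by omega, show ¬ (0 = 2) by omega, if_false, k1, k2]
        exact Prod.ext (Prod.ext (h.xs 0 (by omega)) rfl) (Prod.ext (h.xs 1 h1) rfl)
      · refine iff_of_true ?_ (not_FlE_of_F hB hg hF)
        simp [Opos, G.σπ 0 (show 0 < G.n by omega)]
  intro p q
  simp only [output, Finset.mem_image, Finset.mem_range, h0]
  constructor
  · rintro ⟨k, hk, h1⟩
    split_ifs at hk with h2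
    · have hn0 : 0 < n := by omega
      -- The number of an arc is decoded into its kind, horizontal or vertical, and the column and
      -- row of its edge.
      have d1 := Nat.div_add_mod k 2
      have d2 := Nat.div_add_mod (k / 2) n
      have d3 := Nat.mod_lt (k / 2) hn0
      have d4 : k / 2 / n < n := by
        rw [Nat.div_lt_iff_lt_mul hn0]; omega
      rw [mul_comm] at d2
      have d5 : 2 * (k / 2 / n * n + k / 2 % n) + (!(k % 2 == 0)).toNat = k := by
        rcases Nat.mod_two_eq_zero_or_one k with h3 | h3 <;> simp [h3] <;> omega
      obtain ⟨a, b, h3, h4, -⟩ := arc (k % 2 == 0) (k / 2 / n) (k / 2 % n) d4 d3 h2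
      rw [d5, h1, Prod.mk.injEq] at h3
      exact ⟨a, b, h4, h3⟩
    · omega
  · rintro ⟨a, b, hab, rfl, rfl⟩
    obtain ⟨⟨κ, u, l⟩, he, h1⟩ := AlgA_cases.1 hab
    obtain ⟨k1, k2, k3⟩ := mem_gridE.1 (grid he)
    simp only at k1 k2 k3
    have h2 : 1 < n := by split_ifs at k3 <;> omega
    obtain ⟨a', b', h3, -, h4⟩ := arc κ u l k1 k2 h2
    refine ⟨_, ?_, h3.trans ?_⟩
    · rw [if_pos h2]
      have : (u + 1) * n ≤ n * n := Nat.mul_le_mul_right _ k1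
      rw [add_mul] at this
      cases κ <;> simp <;> omega
    · rcases h1 with ⟨h5, rfl, rfl⟩ | ⟨h5, rfl, rfl⟩ <;> rcases h4 he with ⟨h6, rfl, rfl⟩ | ⟨h6, rfl, rfl⟩
      · rfl
      · exact absurd h5 h6
      · exact absurd h6 h5
      · rfl

end

end BDMMN

theorem mainTheorem1 :
    ∃ (P : BDMMN.Prog) (time : ℕ → ℕ),
      ((fun n : ℕ => (time n : ℝ)) =O[atTop] fun n : ℕ => (n : ℝ) ^ 3) ∧
      ∀ (n : ℕ) (t : Fin n → BDMMN.Point),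
        Function.Injective (fun i => (t i).1) → Function.Injective (fun i => (t i).2) →
        ∃ (s : BDMMN.State) (k : ℕ),
          BDMMN.Exec P (BDMMN.input t) s k ∧ k ≤ time n ∧
          BDMMN.IsBidirectedManhattan (Set.range t) (BDMMN.output s) ∧
          (∃ M, BDMMN.IsOptimal (Set.range t) M) ∧
          ∀ M, BDMMN.IsOptimal (Set.range t) M →
            BDMMN.length (BDMMN.output s) ≤ 2 * BDMMN.length M := by
  obtain ⟨C, hC⟩ := BDMMN.approxP_cost
  refine ⟨BDMMN.approxP, fun n => C * (n + 1) ^ 3, ?_, fun n t hx hy => ?_⟩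
  -- For `n ≥ 1` one has `n + 1 ≤ 2 n`, whence the factor `2 ^ 3 = 8`.
  · refine Asymptotics.IsBigO.of_bound (C * 8) ?_
    filter_upwards [eventually_ge_atTop 1] with n hn
    have h1 : (1 : ℝ) ≤ n := by exact_mod_cast hn
    have h2 : ((n : ℝ) + 1) ^ 3 ≤ (2 * n) ^ 3 := pow_le_pow_left₀ (by linarith) (by linarith) 3
    rw [Real.norm_of_nonneg (by positivity), Real.norm_of_nonneg (by positivity)]
    push_cast
    calc (C : ℝ) * ((n : ℝ) + 1) ^ 3 ≤ C * (2 * (n : ℝ)) ^ 3 := by gcongr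
      _ = C * 8 * (n : ℝ) ^ 3 := by ring
  · obtain ⟨s, F, ⟨k, h1, h2⟩, h3, h4, h5, h6⟩ := BDMMN.machine_run (l := BDMMN.tablesP)
      (es := BDMMN.arcP true ++ BDMMN.arcP false) (by decide +kernel) rfl t
    obtain ⟨a0, a⟩ := BDMMN.Seg.append (show BDMMN.Seg n F 2 BDMMN.tablesP from h4)
    obtain ⟨a1, a⟩ := a.append
    obtain ⟨a2, a⟩ := a.append
    obtain ⟨a3, a⟩ := a.append
    obtain ⟨a4, a5⟩ := a.append
    have hH := BDMMN.baseP_spec hx hy h3 a0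
    -- The four lists of tables start at `6`, `43`, `80` and `117`, as `quadT` says; this holds by
    -- computation.
    have quad : ∀ q, BDMMN.Seg n F (BDMMN.quadT q) (BDMMN.quadP q BDMMN.ids (BDMMN.quadT q)) := by
      rintro ⟨_ | _, _ | _⟩
      exacts [a1, a2, a3, a4]
    choose τ S S' hB hT using fun q => BDMMN.quadP_spec q hH (by simp [BDMMN.quadT]; omega) (quad q)
    have hD : ∀ κ, BDMMN.Sat n F (BDMMN.dirT κ) (BDMMN.dirE κ BDMMN.ids) := by
      rintro (_ | _)
      exacts [a5 1 _ rfl, a5 0 _ rfl]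
    have := BDMMN.Frame.approximation hB (BDMMN.arcs_output hH hT hB hD h5 h6)
    rw [BDMMN.terms_frameOf] at this
    exact ⟨s, k, h1, h2.trans (hC n), this⟩
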